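/- Conventions. A surface is a smooth conformal immersion $F:M\to\mathbb R^3$ of a connected Riemann surface $M$, with unit normal $N$ given by the orientation of $M$. In a conformal chart $z$ its metric is $e^u|dz|^2$, its Hopf differential is $Q\,dz^2$ with $Q=\langle F_{zz},N\rangle$, and its mean curvature $H$ is given by $\langle F_{z\bar z},N\rangle=\tfrac12He^u$. A Bonnet family is a smooth one-parameter family $(F_\tau)_{|\tau|<\epsilon}$ of conformal immersions $M\to\mathbb R^3$ with the same metric and the same non-constant mean curvature function, such that for $\tau\ne0$ the immersion $F_\tau$ is not of the form $A\circ F_0$ with an isometry $A$ of $\mathbb R^3$; $F$ is a Bonnet surface if $F=F_0$ for some Bonnet family. A point $P$ is a critical point of index $-J$ ($J\ge 0$ an integer) if $dH(P)=0$ and, in a conformal chart $z$ with $z(P)=0$, $Q=z^J g$ near $0$ with $g$ continuous at $0$ and $g(0)\neq 0$. For $0<r\le1$ and $H:[0,r^2)\to\mathbb R$ consider the following conditions, where $s=|w|^2$. (1) On $(0,r^2)$ the function $H$ is smooth, $H'<0$, and $$\left(\frac{sH''(s)}{H'(s)}\right)'-H'(s)=\frac{(J+2)^2s^{J+1}}{(1-s^{J+2})^2}\left(2-\frac{H(s)^2}{s\,H'(s)}\right).$$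 (2) $H(s)=H(0)+s^{J+1}B(s)$ on $[0,r^2)$ with $B$ smooth on $[0,r^2)$ and nowhere zero. (3) A conformal immersion of the disc $\{|w|<r\}$ has mean curvature $H(|w|^2)$ and $$Q(w,\bar w)=(J+2)\,\frac{1-\bar w^{J+2}}{1-w^{J+2}}\,\frac{w^J}{1-s^{J+2}},\qquad e^{u(w,\bar w)}=-2(J+2)^2\,\frac{s^J}{(1-s^{J+2})^2H'(s)},$$ the second formula being understood as a limit at $w=0$. Theorem. Let $J\ge0$ be an integer. (a) Let $F:M\to\mathbb R^3$ be a Bonnet surface and $P\in M$ a critical point of index $-J$. Then there are a homothety factor $\rho\in\mathbb R\setminus\{0\}$, a number $r\in(0,1]$, a conformal chart $w$ of $M$ around $P$ with $w(P)=0$ and image $\{|w|<r\}$, and a function $H$ satisfying (1) and (2), such that $\rho F$ in the chart $w$ satisfies (3). (b) Conversely, let $0<r\le1$ and let $H$ satisfy (1) and (2). Then there is a conformal immersion $f$ of the disc $\{|w|<r\}$ into $\mathbb R^3$ with (3), and it is unique up to isometries of $\mathbb R^3$. Every such $f$ is a Bonnet surface, and $w=0$ is a critical point of index $-J$. Its Bonnet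 family is given by the rotations $w\mapsto e^{i\alpha}w$: the immersions $f_\alpha(w)=f(e^{i\alpha}w)$, $|\alpha|<2\pi/(J+2)$, form a Bonnet family, and every conformal immersion of the disc with the same metric and the same mean curvature function as $f$ equals $A\circ f_\alpha$ for some $\alpha\in\mathbb R$ and some isometry $A$ of $\mathbb R^3$. -/

import Mathlib

open Set Filter Topology
open scoped Manifold ContDiff

noncomputable section

/-- Euclidean three-space. -/
abbrev E3 : Type := EuclideanSpace ℝ (Fin 3)

namespace BonnetSurf

/-! ### Local surface theory: maps from (open subsets of) the complex plane, `z = x + i y` -/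

/-- The partial derivative `f_x`. -/
def dX (f : ℂ → E3) (p : ℂ) : E3 := fderiv ℝ f p 1

/-- The partial derivative `f_y`. -/
def dY (f : ℂ → E3) (p : ℂ) : E3 := fderiv ℝ f p Complex.I

/-- `f` is a smooth conformal immersion on the open set `U`. -/
structure IsConformalImmersionOn (f : ℂ → E3) (U : Set ℂ) : Prop where
  smooth : ContDiffOn ℝ ∞ f U
  orthogonal : ∀ p ∈ U, inner ℝ (dX f p) (dY f p) = 0
  norm_eq : ∀ p ∈ U, ‖dX f p‖ = ‖dY f p‖
  ne_zero : ∀ p ∈ U, dX f p ≠ 0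

/-- The conformal factor `e^u` of the metric `e^u |dz|²` induced by a conformal immersion. -/
def conformalFactor (f : ℂ → E3) (p : ℂ) : ℝ := ‖dX f p‖ ^ 2

/-- The vector product in `ℝ³`. -/
def vprod (a b : E3) : E3 := WithLp.toLp 2 (crossProduct (WithLp.ofLp a) (WithLp.ofLp b))

/-- The unit normal `N = f_x × f_y / |f_x × f_y|`. -/
def unitNormal (f : ℂ → E3) (p : ℂ) : E3 :=
  ‖vprod (dX f p) (dY f p)‖⁻¹ • vprod (dX f p) (dY f p)

/-- The coefficient `Q = ⟨f_zz, N⟩` of the Hopf differential `Q dz²`, where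
`f_zz = (f_xx - f_yy - 2 i f_xy) / 4`. -/
def hopf (f : ℂ → E3) (p : ℂ) : ℂ :=
  ((inner ℝ (dX (dX f) p - dY (dY f) p) (unitNormal f p) / 4 : ℝ) : ℂ)
    - ((inner ℝ (dX (dY f) p) (unitNormal f p) / 2 : ℝ) : ℂ) * Complex.I

/-- The mean curvature `H` of a conformal immersion, `⟨f_{z z̄}, N⟩ = H e^u / 2`, where
`f_{z z̄} = (f_xx + f_yy) / 4`. -/
def meanCurv (f : ℂ → E3) (p : ℂ) : ℝ :=
  inner ℝ (dX (dX f) p + dY (dY f) p) (unitNormal f p) / (2 * conformalFactor f p)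

/-! ### Surfaces: conformal immersions of a Riemann surface `M` -/

section Surfaces

variable {M : Type*} [TopologicalSpace M] [ChartedSpace ℂ M]

variable (M) in
/-- The conformal charts of the Riemann surface `M`, i.e. all its holomorphic charts. -/
def conformalCharts : Set (OpenPartialHomeomorph M ℂ) := IsManifold.maximalAtlas 𝓘(ℂ) ω M

/-- The map `F : M → ℝ³` expressed in the chart `z`. -/
def inChart (F : M → E3) (z : OpenPartialHomeomorph M ℂ) : ℂ → E3 := fun x => F (z.symm x)

/-- `F : M → ℝ³` is a smooth conformal immersion. -/
def IsConformalImmersion (F : M → E3) : Prop :=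
  ∀ z ∈ conformalCharts M, IsConformalImmersionOn (inChart F z) z.target

/-- The conformal immersions `F`, `G` induce the same metric on `M`. -/
def SameMetric (F G : M → E3) : Prop :=
  ∀ z ∈ conformalCharts M, ∀ x ∈ z.target,
    conformalFactor (inChart F z) x = conformalFactor (inChart G z) x

/-- The mean curvature function of a conformal immersion (it does not depend on the chart). -/
def meanCurvature (F : M → E3) (P : M) : ℝ :=
  meanCurv (inChart F (chartAt ℂ P)) (chartAt ℂ P P)

/-- `F` and `G` differ by an isometry of the ambient space. -/
def Congruent (F G : M → E3) : Prop := ∃ A : E3 ≃ᵢ E3, ∀ P, G P = A (F P)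

/-- `(F_τ)`, `τ ∈ (-ε, ε)`, is a Bonnet family: a smooth one-parameter family of isometric
conformal immersions with the same non-constant mean curvature function, such that for `τ ≠ 0` the
isometry from `F_0` to `F_τ` is not induced by an isometry of the ambient space. -/
structure IsBonnetFamily (ε : ℝ) (F : ℝ → M → E3) : Prop where
  smooth : ∀ z ∈ conformalCharts M,
    ContDiffOn ℝ ∞ (fun q : ℝ × ℂ => F q.1 (z.symm q.2)) (Ioo (-ε) ε ×ˢ z.target)
  immersion : ∀ τ ∈ Ioo (-ε) ε, IsConformalImmersion (F τ)
  isometric : ∀ τ ∈ Ioo (-ε) ε, SameMetric (F 0) (F τ)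
  meanCurvature_eq : ∀ τ ∈ Ioo (-ε) ε, ∀ P, meanCurvature (F τ) P = meanCurvature (F 0) P
  meanCurvature_nonconst : ¬ ∃ c : ℝ, ∀ P, meanCurvature (F 0) P = c
  nontrivial : ∀ τ ∈ Ioo (-ε) ε, τ ≠ 0 → ¬ Congruent (F 0) (F τ)

/-- `F` is a Bonnet surface: it is the member `τ = 0` of a Bonnet family. -/
def IsBonnetSurface (F : M → E3) : Prop :=
  ∃ ε : ℝ, 0 < ε ∧ ∃ Fam : ℝ → M → E3, Fam 0 = F ∧ IsBonnetFamily ε Fam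

/-- `P` is a critical point of the mean curvature function, of index `-J`: in a conformal chart
`z` centred at `P` the Hopf differential has the form `z ^ J g(z, z̄) dz²`, where `g` does not
vanish near `P`. So `J > 0` at umbilic points, and `J = 0` at non-umbilic critical points. -/
def IsCriticalPointOfIndexNeg (F : M → E3) (P : M) (J : ℕ) : Prop :=
  ∃ z ∈ conformalCharts M, P ∈ z.source ∧ z P = 0 ∧
    fderiv ℝ (fun x => meanCurvature F (z.symm x)) 0 = 0 ∧
    ∃ g : ℂ → ℂ, ContinuousAt g 0 ∧ g 0 ≠ 0 ∧
      ∀ᶠ x in 𝓝 (0 : ℂ), hopf (inChart F z) x = x ^ J * g x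

end Surfaces

/-! ### The Hazzidakis equation at a critical point and the fundamental forms -/

/-- `H` is a smooth solution on `(0, S)`, with `H' < 0`, of
`(s H'' / H')' - H' = (J+2)² s^(J+1) / (1 - s^(J+2))² * (2 - H² / (s H'))`. -/
structure IsHazzidakisSolution (J : ℕ) (S : ℝ) (H : ℝ → ℝ) : Prop where
  smooth : ContDiffOn ℝ ∞ H (Ioo 0 S)
  deriv_neg : ∀ s ∈ Ioo 0 S, deriv H s < 0
  equation : ∀ s ∈ Ioo 0 S,
    deriv (fun t => t * deriv (deriv H) t / deriv H t) s - deriv H s =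
      ((J : ℝ) + 2) ^ 2 * s ^ (J + 1) / (1 - s ^ (J + 2)) ^ 2 *
        (2 - H s ^ 2 / (s * deriv H s))

/-- `H(s) = H(0) + s^(J+1) B(s)` on `[0, S)`, with `B` smooth (up to `s = 0`) and non-vanishing. -/
def HasAsymptotics (J : ℕ) (S : ℝ) (H : ℝ → ℝ) : Prop :=
  ∃ B : ℝ → ℝ, ContDiffOn ℝ ∞ B (Ico 0 S) ∧ (∀ s ∈ Ico 0 S, B s ≠ 0) ∧
    ∀ s ∈ Ico 0 S, H s = H 0 + s ^ (J + 1) * B s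

/-- On the disc `|w| < r`, the fundamental forms of the conformal immersion `f` are
`Q = (J+2) (1 - w̄^(J+2)) / (1 - w^(J+2)) * w^J / (1 - s^(J+2))`,
`e^u = -2 (J+2)² s^J / ((1 - s^(J+2))² H'(s))`, and its mean curvature is `H(s)`; here `s = |w|²`.
At `w = 0` the second formula is to be read as a limit, so it is asked for `w ≠ 0` only. -/
structure HasFundamentalForms (J : ℕ) (H : ℝ → ℝ) (r : ℝ) (f : ℂ → E3) : Prop where
  immersion : IsConformalImmersionOn f (Metric.ball 0 r)
  hopf_eq : ∀ w ∈ Metric.ball (0 : ℂ) r,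
    hopf f w = ((J : ℂ) + 2) *
      ((1 - (starRingEnd ℂ w) ^ (J + 2)) / (1 - w ^ (J + 2))) *
        (w ^ J / (1 - ((‖w‖ ^ 2 : ℝ) : ℂ) ^ (J + 2)))
  factor_eq : ∀ w ∈ Metric.ball (0 : ℂ) r, w ≠ 0 →
    conformalFactor f w =
      -2 * ((J : ℝ) + 2) ^ 2 * ((‖w‖ ^ 2) ^ J /
        ((1 - (‖w‖ ^ 2) ^ (J + 2)) ^ 2 * deriv H (‖w‖ ^ 2)))
  meanCurv_eq : ∀ w ∈ Metric.ball (0 : ℂ) r, meanCurv f w = H (‖w‖ ^ 2)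

/-- The disc `|w| < r`, a Riemann surface. -/
def disc (r : ℝ) : TopologicalSpace.Opens ℂ := ⟨Metric.ball 0 r, Metric.isOpen_ball⟩

end BonnetSurf

end

/-! Local surface theory supplies two tools. The data (metric, H, Q) determine an immersion up to
isometry (`IsConformalImmersionOn.exists_isometry`), and on a disc any smooth data satisfying the
Gauss and Codazzi equations are realised (`exists_immersion`, by integrating a flat skew connection
along rays, `exists_parallel_of_flat`). For two immersions with the same metric and the same H, the
Gauss equation gives equal |Q|, and the Codazzi equation makes the difference of the Hopf
differentials holomorphic (`norm_hopf_eq`, `differentiableOn_hopf_sub`).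

Converse direction. With v = w^(J+2) the model Hopf differential has the form A (1 - v̄) / (1 -
|v|²) with A holomorphic. The Codazzi equation then says that H is a function of s = |w|² with e^u
H' = -2|Q|², and the Gauss equation becomes the Hazzidakis equation (`gauss_iff_hazzidakis`). The
asymptotics of H are what makes the metric smooth and positive at the centre, so a surface exists
(`exists_hasFundamentalForms`). A rotation by κ preserves metric and H and changes Q only through
κ^(J+2). Conversely, if g has the same metric and H, holomorphy of Q_g - Q_f together with |Q_g| =
|Q_f| forces the Hopf differential of a rotated surface (`HasFundamentalForms.exists_rotation`).

Direct direction. A Bonnet family provides holomorphic quadratic differentials q_τ = Q_τ - Q_0 with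
|Q_0 + q_τ| = |Q_0|. Two of them are linearly independent over ℂ (`exists_independent_hopfDiff`): a
real factor of proportionality could only be 0 or 1, and a nonreal one would make Q_0 a constant
multiple of a holomorphic differential, hence H constant. For independent q₁, q₂ the function k =
q₂/(q₂ - q₁) satisfies Q(k̄ - k) = q₁k, is nonreal off P, and so has values in one half plane and
extends over P. A Möbius transformation v of k, normalised by v(P) = 0, yields Q = z^J p (1 - v̄)/(1
- |v|²) with p holomorphic and p(P) ≠ 0 (`exists_cayley_form`).

Put G = z^J p (1 - v). In the coordinate ζ with dζ = (G/v') dz the Codazzi equation says that H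
depends on one real variable only, and the Gauss equation then forces the same for |Q|². This is a
real identity between v and G (`im_eq_zero_of_cayley`). Comparing leading terms at P shows that v
vanishes to order exactly J + 2 (`order_eq_of_order_ge_two`, `order_ne_one`) and that v'² = b v G
with a real constant b ≠ 0 (`exists_real_factor`). In the coordinate w with v = w^(J+2), and after
the homothety by b/(J+2), Q is the model. Radial symmetry, the Hazzidakis equation and the
asymptotics can then be read off (`exists_hazzidakis_of_hopf`); for the last one uses that a smooth
even function of x is a smooth function of x² (`contDiffOn_comp_sqrt`). -/

noncomputable section

namespace BonnetSurf

/-! ### Parallel sections of a flat skew connection on a disc -/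

section Frobenius

variable {E : Type*} [NormedAddCommGroup E] [InnerProductSpace ℝ E] [FiniteDimensional ℝ E]

/-- A linear equation `y' = A(t) y` with skew coefficients has global solutions, of constant
norm. -/
theorem exists_skew_linear_ode {A : ℝ → E →L[ℝ] E} (hA : ContinuousOn A (Icc 0 1))
    (skew : ∀ t ∈ Icc (0 : ℝ) 1, ∀ x, inner ℝ x (A t x) = 0) (y₀ : E) :
    ∃ y : ℝ → E, y 0 = y₀ ∧ (∀ t ∈ Icc (0 : ℝ) 1, HasDerivWithinAt y (A t (y t)) (Icc 0 1) t) ∧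
      ∀ t ∈ Icc (0 : ℝ) 1, ‖y t‖ = ‖y₀‖ := by
  obtain ⟨C, hC⟩ := isCompact_Icc.exists_bound_of_continuousOn hA
  have hC0 : 0 ≤ C := (norm_nonneg _).trans (hC 0 (by simp))
  -- The cut-off makes the field bounded and globally Lipschitz. The truncated field is still
  -- orthogonal to x, so its solutions keep the norm ‖y₀‖ and stay where χ = 1; there they solve the
  -- original equation.
  let χ : ContDiffBump (0 : E) := ⟨‖y₀‖ + 1, ‖y₀‖ + 2, by positivity, by linarith⟩
  have hsm : ContDiff ℝ 1 (fun x : E => χ x • x) := χ.contDiff.smul contDiff_id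
  have hcs : HasCompactSupport (fun x : E => χ x • x) := χ.hasCompactSupport.smul_right
  obtain ⟨K, hK⟩ := hsm.lipschitzWith_of_hasCompactSupport hcs one_ne_zero
  obtain ⟨M, hM⟩ := hcs.exists_bound_of_continuous hsm.continuous
  have hM0 : 0 ≤ M := (norm_nonneg _).trans (hM 0)
  -- The same number C * M serves as bound for the speed and as radius: on an interval of length 1 a
  -- solution cannot leave that ball, so existence holds on all of [0, 1].
  have pl : IsPicardLindelof (fun t x => A t (χ x • x)) (⟨0, by simp⟩ : Icc (0 : ℝ) 1) y₀
      (C * M).toNNReal 0 (C * M).toNNReal (C.toNNReal * K) := by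
    refine ⟨fun t ht => ?_, fun x _ => hA.clm_apply continuousOn_const, fun t ht x _ => ?_, ?_⟩
    · refine LipschitzOnWith.of_dist_le_mul fun x _ y _ => ?_
      rw [dist_eq_norm, ← map_sub, NNReal.coe_mul, Real.coe_toNNReal _ hC0, mul_assoc]
      refine ((A t).le_opNorm _).trans (mul_le_mul (hC t ht) ?_ (norm_nonneg _) hC0)
      rw [← dist_eq_norm]
      exact hK.dist_le_mul x y
    · rw [Real.coe_toNNReal _ (by positivity)]
      exact ((A t).le_opNorm _).trans (mul_le_mul (hC t ht) (hM x) (norm_nonneg _) hC0)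
    · simp
  obtain ⟨y, hy0, hy⟩ := pl.exists_eq_forall_mem_Icc_hasDerivWithinAt₀
  have hy0 : y 0 = y₀ := hy0
  have hn : ∀ t ∈ Icc (0 : ℝ) 1, ‖y t‖ = ‖y₀‖ := by
    have hd : ∀ t ∈ Icc (0 : ℝ) 1,
        HasDerivWithinAt (fun t => inner ℝ (y t) (y t)) 0 (Icc 0 1) t := fun t ht => by
      have := (hy t ht).inner ℝ (hy t ht)
      simpa [real_inner_comm (y t), inner_smul_right, skew t ht] using this
    intro t ht
    have hc := constant_of_derivWithin_zero (fun t ht => (hd t ht).differentiableWithinAt)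
      (fun t ht => (hd t ⟨ht.1, ht.2.le⟩).derivWithin
        (uniqueDiffOn_Icc zero_lt_one t ⟨ht.1, ht.2.le⟩)) t ht
    simp only [real_inner_self_eq_norm_sq, hy0] at hc
    exact (sq_eq_sq₀ (norm_nonneg _) (norm_nonneg _)).1 hc
  refine ⟨y, hy0, fun t ht => ?_, hn⟩
  have h1 : χ (y t) = 1 := χ.one_of_mem_closedBall (by
    rw [mem_closedBall_zero_iff, hn t ht]
    change _ ≤ ‖y₀‖ + 1
    linarith)
  simpa [h1] using hy t ht

theorem exists_bound_fderiv {V W : Type*} [NormedAddCommGroup V] [NormedSpace ℝ V]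
    [NormedAddCommGroup W] [NormedSpace ℝ W] {g : V → W} {U K : Set V}
    (hU : IsOpen U) (hg : ContDiffOn ℝ ∞ g U) (hK : IsCompact K) (hKU : K ⊆ U) :
    ∃ C : ℝ, ∀ x ∈ K, ‖fderiv ℝ g x‖ ≤ C :=
  hK.exists_bound_of_continuousOn
    ((hg.fderiv_of_isOpen (m := 0) hU (by simp)).continuousOn.mono hKU)

/-- Uniform second order Taylor bounds on a compact convex set. -/
theorem exists_taylor_bounds {V W : Type*} [NormedAddCommGroup V] [NormedSpace ℝ V]
    [NormedAddCommGroup W] [NormedSpace ℝ W] {κ : V → W} {U K : Set V}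
    (hU : IsOpen U) (hκ : ContDiffOn ℝ ∞ κ U) (hK : IsCompact K) (hKc : Convex ℝ K)
    (hKU : K ⊆ U) :
    ∃ C : ℝ, 0 ≤ C ∧ ∀ a ∈ K, ‖κ a‖ ≤ C ∧ ∀ b ∈ K, ‖κ b - κ a‖ ≤ C * ‖b - a‖ ∧
      ‖κ b - κ a - fderiv ℝ κ a (b - a)‖ ≤ C * ‖b - a‖ ^ 2 := by
  have h1 : ContDiffOn ℝ ∞ (fderiv ℝ κ) U := hκ.fderiv_of_isOpen hU (by simp)
  obtain ⟨C0, hC0⟩ := hK.exists_bound_of_continuousOn (hκ.continuousOn.mono hKU)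
  obtain ⟨C1, hC1⟩ := hK.exists_bound_of_continuousOn (h1.continuousOn.mono hKU)
  obtain ⟨C2, hC2⟩ := exists_bound_fderiv hU h1 hK hKU
  have hd : ∀ a ∈ K, DifferentiableAt ℝ κ a := fun a ha =>
    (hκ.contDiffAt (hU.mem_nhds (hKU ha))).differentiableAt (by simp)
  have hd1 : ∀ a ∈ K, DifferentiableAt ℝ (fderiv ℝ κ) a := fun a ha =>
    (h1.contDiffAt (hU.mem_nhds (hKU ha))).differentiableAt (by simp)
  set C := max 0 (max C0 (max C1 C2))
  have hle0 : C0 ≤ C := by simp [C]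
  have hle1 : C1 ≤ C := by simp [C]
  have hle2 : C2 ≤ C := by simp [C]
  have hCn : 0 ≤ C := by simp [C]
  refine ⟨C, hCn, fun a ha => ⟨(hC0 a ha).trans hle0, fun b hb => ⟨?_, ?_⟩⟩⟩
  · exact hKc.norm_image_sub_le_of_norm_fderiv_le (fun x hx => hd x hx)
      (fun x hx => (hC1 x hx).trans hle1) ha hb
  · have hseg : segment ℝ a b ⊆ K := hKc.segment_subset ha hb
    have := (convex_segment a b).norm_image_sub_le_of_norm_hasFDerivWithin_le'
      (f := κ) (f' := fderiv ℝ κ) (φ := fderiv ℝ κ a) (C := C * ‖b - a‖)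
      (fun x hx => (hd x (hseg hx)).hasFDerivAt.hasFDerivWithinAt) (fun x hx => ?_)
      (left_mem_segment ℝ a b) (right_mem_segment ℝ a b)
    · calc _ ≤ _ := this
        _ = _ := by ring
    · have h3 := hKc.norm_image_sub_le_of_norm_fderiv_le (fun x hx => hd1 x hx)
        (fun x hx => (hC2 x hx).trans hle2) ha (hseg hx)
      refine h3.trans (mul_le_mul_of_nonneg_left ?_ hCn)
      obtain ⟨θ, hθ, rfl⟩ := (segment_eq_image' ℝ a b ▸ hx)
      simp only [add_sub_cancel_left, norm_smul, Real.norm_eq_abs, abs_of_nonneg hθ.1]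
      exact mul_le_of_le_one_left (norm_nonneg _) hθ.2

/-- **Frobenius theorem** for a flat connection form with skew values on a disc. -/
theorem exists_parallel_of_flat {r : ℝ} {κ : ℂ → ℂ →L[ℝ] E →L[ℝ] E}
    (hκ : ContDiffOn ℝ ∞ κ (Metric.ball 0 r))
    (skew : ∀ p ∈ Metric.ball (0 : ℂ) r, ∀ v x, inner ℝ x (κ p v x) = 0)
    (flat : ∀ p ∈ Metric.ball (0 : ℂ) r, ∀ u v x,
      fderiv ℝ κ p u v x + κ p v (κ p u x) = fderiv ℝ κ p v u x + κ p u (κ p v x)) (y₀ : E) :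
    ∃ y : ℂ → E, y 0 = y₀ ∧
      ∀ p ∈ Metric.ball (0 : ℂ) r, HasFDerivAt y ((κ p).flip (y p)) p := by
  have hmem : ∀ {ρ : ℝ} {p : ℂ}, p ∈ Metric.ball (0 : ℂ) ρ → ∀ t ∈ Icc (0 : ℝ) 1,
      (t • p) ∈ Metric.ball (0 : ℂ) ρ := fun {ρ p} hp t ht => by
    rw [mem_ball_zero_iff] at hp ⊢
    rw [norm_smul, Real.norm_eq_abs, abs_of_nonneg ht.1]
    exact (mul_le_of_le_one_left (norm_nonneg _) ht.2).trans_lt hp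
  -- The section is built ray by ray: `Y p` solves the equation along the segment from 0 to p, and p
  -- ↦ `Y p 1` is the candidate. Flatness is needed only to differentiate it across rays.
  have hray : ∀ p : ℂ, ∃ y : ℝ → E, p ∈ Metric.ball (0 : ℂ) r → y 0 = y₀ ∧
      (∀ t ∈ Icc (0 : ℝ) 1, HasDerivWithinAt y (κ (t • p) p (y t)) (Icc 0 1) t) ∧
      ∀ t ∈ Icc (0 : ℝ) 1, ‖y t‖ = ‖y₀‖ := by
    intro p
    by_cases hp : p ∈ Metric.ball (0 : ℂ) r
    · have hc : ContinuousOn (fun t : ℝ => κ (t • p) p) (Icc 0 1) :=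
        ContinuousOn.clm_apply (hκ.continuousOn.comp (by fun_prop) (hmem hp)) continuousOn_const
      obtain ⟨y, hy⟩ := exists_skew_linear_ode hc
        (fun t ht x => skew _ (hmem hp t ht) p x) y₀
      exact ⟨y, fun _ => hy⟩
    · exact ⟨0, fun h => absurd h hp⟩
  choose Y hY using hray
  by_cases hr : 0 < r
  swap
  · exact ⟨fun _ => y₀, rfl, fun p hp => by simp [Metric.ball_eq_empty.2 (not_lt.1 hr)] at hp⟩
  refine ⟨fun p => Y p 1, ?_, fun p hp => ?_⟩
  · obtain ⟨h0, h1, -⟩ := hY 0 (by simpa using hr)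
    have hc := constant_of_derivWithin_zero (fun t ht => (h1 t ht).differentiableWithinAt)
      (fun t ht => by
        rw [(h1 t ⟨ht.1, ht.2.le⟩).derivWithin (uniqueDiffOn_Icc zero_lt_one t ⟨ht.1, ht.2.le⟩)]
        simp) 1 (by simp)
    exact hc.trans h0
  rw [mem_ball_zero_iff] at hp
  obtain ⟨ρ, hpρ, hρr⟩ := exists_between hp
  have hsub : Metric.closedBall (0 : ℂ) ρ ⊆ Metric.ball 0 r := Metric.closedBall_subset_ball hρr
  obtain ⟨C, hC0, hC⟩ := exists_taylor_bounds Metric.isOpen_ball hκ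
    (isCompact_closedBall (0 : ℂ) ρ) (convex_closedBall 0 ρ) hsub
  obtain ⟨hp0, hp1, hp2⟩ := hY p (by simpa using hp)
  have hρ0 : 0 ≤ ρ := (norm_nonneg p).trans hpρ.le
  -- the main estimate
  set ε : ℝ := (C * ρ + C + C * ρ * C + C * C) * ‖y₀‖ with hε
  have key : ∀ h : ℂ, p + h ∈ Metric.ball (0 : ℂ) ρ →
      ‖Y (p + h) 1 - Y p 1 - κ p h (Y p 1)‖ ≤ gronwallBound 0 (C * ρ) (ε * ‖h‖ ^ 2) 1 := by
    intro h hh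
    have hh' : p + h ∈ Metric.ball (0 : ℂ) r := Metric.ball_subset_closedBall.trans hsub hh
    obtain ⟨hq0, hq1, hq2⟩ := hY (p + h) hh'
    have hpρ' : p ∈ Metric.ball (0 : ℂ) ρ := by simpa using hpρ
    have hκd : ∀ t ∈ Icc (0 : ℝ) 1,
        HasDerivWithinAt (fun t : ℝ => κ (t • p)) (fderiv ℝ κ (t • p) p) (Icc 0 1) t := by
      intro t ht
      have h1 : HasFDerivAt κ (fderiv ℝ κ (t • p)) (t • p) :=
        ((hκ.contDiffAt (Metric.isOpen_ball.mem_nhds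
          (hsub (Metric.ball_subset_closedBall (hmem hpρ' t ht))))).differentiableAt
          (by simp)).hasFDerivAt
      have h2 : HasDerivAt (fun t : ℝ => t • p) p t := by
        simpa using (hasDerivAt_id t).smul_const p
      exact (HasFDerivAt.comp_hasDerivAt (l := κ) t h1 h2).hasDerivWithinAt
    -- `D` compares the solutions on neighbouring rays after subtracting the expected first
    -- variation. It vanishes at t = 0, and a bound O(‖h‖²) for `D 1` is differentiability at p with
    -- the required derivative.
    let D : ℝ → E := fun t => Y (p + h) t - Y p t - t • κ (t • p) h (Y p t)
    let D' : ℝ → E := fun t => κ (t • (p + h)) (p + h) (Y (p + h) t) - κ (t • p) p (Y p t) -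
      (κ (t • p) h (Y p t) + t • (fderiv ℝ κ (t • p) p h (Y p t)
        + κ (t • p) h (κ (t • p) p (Y p t))))
    have hD : ∀ t ∈ Icc (0 : ℝ) 1, HasDerivWithinAt D (D' t) (Icc 0 1) t := by
      intro t ht
      have h3 : HasDerivWithinAt (fun t : ℝ => κ (t • p) h) (fderiv ℝ κ (t • p) p h)
          (Icc 0 1) t := by
        simpa using (hκd t ht).clm_apply (hasDerivWithinAt_const t _ h)
      have h4 := (hasDerivWithinAt_id t (Icc (0 : ℝ) 1)).smul (h3.clm_apply (hp1 t ht))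
      have h5 := ((hq1 t ht).sub (hp1 t ht)).sub h4
      refine (h5.congr_deriv ?_).congr_of_mem (fun _ _ => rfl) ht
      simp only [D', id, one_smul]
      abel
    have hbound : ∀ t ∈ Ico (0 : ℝ) 1, ‖D' t‖ ≤ (C * ρ) * ‖D t‖ + ε * ‖h‖ ^ 2 := by
      intro t ht'
      have ht : t ∈ Icc (0 : ℝ) 1 := ⟨ht'.1, ht'.2.le⟩
      have ha := Metric.ball_subset_closedBall (hmem hpρ' t ht)
      have hb := Metric.ball_subset_closedBall (hmem hh t ht)
      obtain ⟨-, hab⟩ := hC _ ha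
      obtain ⟨hab1, hab2⟩ := hab _ hb
      have hba : t • (p + h) - t • p = t • h := by rw [smul_add]; abel
      rw [hba] at hab1 hab2
      have hth : ‖t • h‖ ≤ ‖h‖ := by
        rw [norm_smul, Real.norm_eq_abs, abs_of_nonneg ht.1]
        exact mul_le_of_le_one_left (norm_nonneg _) ht.2
      have hab1' : ‖κ (t • (p + h)) - κ (t • p)‖ ≤ C * ‖h‖ :=
        hab1.trans (mul_le_mul_of_nonneg_left hth hC0)
      have hab2' : ‖κ (t • (p + h)) - κ (t • p) - fderiv ℝ κ (t • p) (t • h)‖ ≤ C * ‖h‖ ^ 2 :=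
        hab2.trans (mul_le_mul_of_nonneg_left (by gcongr) hC0)
      have hnb : ‖κ (t • (p + h))‖ ≤ C := (hC _ hb).1
      have hna : ‖κ (t • p)‖ ≤ C := (hC _ ha).1
      have hph : ‖p + h‖ ≤ ρ := (mem_ball_zero_iff.1 hh).le
      have hfl := flat (t • p) (hsub ha) p h (Y p t)
      -- Flatness has exchanged p and h in the derivative of κ. Besides the term linear in `D`, only
      -- a second-order Taylor remainder and products of two factors of size O(‖h‖) are left, so
      -- Grönwall's inequality applies.
      have heq : D' t = κ (t • (p + h)) (p + h) (D t)
          + ((κ (t • (p + h)) - κ (t • p) - fderiv ℝ κ (t • p) (t • h)) p (Y p t)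
          + (κ (t • (p + h)) - κ (t • p)) h (Y p t)
          + t • ((κ (t • (p + h)) - κ (t • p)) p (κ (t • p) h (Y p t))
            + κ (t • (p + h)) h (κ (t • p) h (Y p t)))) := by
        simp only [D', D, hfl]
        simp only [map_sub, map_add, map_smul, _root_.sub_apply,
          _root_.add_apply, _root_.smul_apply, smul_add, smul_sub]
        abel
      rw [heq]
      have n1 : ‖κ (t • (p + h)) (p + h) (D t)‖ ≤ C * ρ * ‖D t‖ :=
        ((κ _).le_opNorm₂ _ _).trans (by gcongr)
      have hyn : ‖Y p t‖ = ‖y₀‖ := hp2 t ht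
      have n2 : ‖(κ (t • (p + h)) - κ (t • p) - fderiv ℝ κ (t • p) (t • h)) p (Y p t)‖ ≤
          (C * ‖h‖ ^ 2) * ρ * ‖y₀‖ := by
        refine (ContinuousLinearMap.le_opNorm₂ _ _ _).trans ?_
        rw [hyn]; gcongr
      have n3 : ‖(κ (t • (p + h)) - κ (t • p)) h (Y p t)‖ ≤ (C * ‖h‖) * ‖h‖ * ‖y₀‖ := by
        refine (ContinuousLinearMap.le_opNorm₂ _ _ _).trans ?_
        rw [hyn]; gcongr
      have n4 : ‖κ (t • p) h (Y p t)‖ ≤ C * ‖h‖ * ‖y₀‖ := by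
        refine (ContinuousLinearMap.le_opNorm₂ _ _ _).trans ?_
        rw [hyn]; gcongr
      have n5 : ‖t • ((κ (t • (p + h)) - κ (t • p)) p (κ (t • p) h (Y p t))
            + κ (t • (p + h)) h (κ (t • p) h (Y p t)))‖ ≤ 1 * (C * ‖h‖ * ρ * (C * ‖h‖ * ‖y₀‖)
            + C * ‖h‖ * (C * ‖h‖ * ‖y₀‖)) := by
        rw [norm_smul, Real.norm_eq_abs, abs_of_nonneg ht.1]
        refine mul_le_mul ht.2 ((norm_add_le _ _).trans (add_le_add ?_ ?_)) (norm_nonneg _)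
          zero_le_one
        · refine (ContinuousLinearMap.le_opNorm₂ _ _ _).trans ?_
          gcongr
        · refine (ContinuousLinearMap.le_opNorm₂ _ _ _).trans ?_
          gcongr
      refine (norm_add_le _ _).trans (add_le_add n1 ?_)
      refine (norm_add_le _ _).trans ((add_le_add ((norm_add_le _ _).trans (add_le_add n2 n3))
        n5).trans (le_of_eq ?_))
      rw [hε]; ring
    have hg := norm_le_gronwallBound_of_norm_deriv_right_le (f := D) (f' := D') (δ := 0)
      (fun t ht => (hD t ht).continuousWithinAt)
      (fun t ht => ((hD t ⟨ht.1, ht.2.le⟩).mono_of_mem_nhdsWithin (Icc_mem_nhdsGE_of_mem ht)))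
      (by simp [D, hq0, hp0]) hbound 1 (by simp)
    simpa [D] using hg
  -- With zero initial value the Grönwall bound is linear in the forcing term, so ‖h‖² can be taken
  -- out.
  have hlin : ∀ x : ℝ, gronwallBound 0 (C * ρ) (ε * x) 1 = gronwallBound 0 (C * ρ) ε 1 * x := by
    intro x
    by_cases h0 : C * ρ = 0
    · simp [h0, gronwallBound_K0]
    · simp only [gronwallBound_of_K_ne_0 h0]; ring
  refine HasFDerivAt.of_isLittleO ?_
  refine Asymptotics.IsBigO.trans_isLittleO (g := fun q => ‖q - p‖ ^ 2)
    (Asymptotics.IsBigO.of_bound (gronwallBound 0 (C * ρ) ε 1) ?_) ?_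
  · filter_upwards [Metric.isOpen_ball.mem_nhds (mem_ball_zero_iff.2 hpρ)] with q hq
    have := key (q - p) (by simpa using hq)
    rw [hlin] at this
    simpa using this
  · exact (Asymptotics.isLittleO_norm_pow_id one_lt_two).comp_tendsto
      (by simpa using tendsto_sub_nhds_zero_iff.2 (tendsto_id (x := 𝓝 p)))

end Frobenius

end BonnetSurf

namespace BonnetSurf

/-! ### Partial derivatives -/

section Partial

variable {F : Type*} [NormedAddCommGroup F] [NormedSpace ℝ F] {U : Set ℂ}

/-- The partial derivative in the real direction. -/
def px (g : ℂ → F) (p : ℂ) : F := fderiv ℝ g p 1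

/-- The partial derivative in the imaginary direction. -/
def py (g : ℂ → F) (p : ℂ) : F := fderiv ℝ g p Complex.I

theorem dX_eq_px (f : ℂ → E3) : dX f = px f := rfl

theorem dY_eq_py (f : ℂ → E3) : dY f = py f := rfl

theorem contDiffOn_fderiv_apply (hU : IsOpen U) {g : ℂ → F} (hg : ContDiffOn ℝ ∞ g U) (v : ℂ) :
    ContDiffOn ℝ ∞ (fun p => fderiv ℝ g p v) U :=
  (hg.fderiv_of_isOpen hU (by simp)).clm_apply contDiffOn_const

theorem contDiffOn_px (hU : IsOpen U) {g : ℂ → F} (hg : ContDiffOn ℝ ∞ g U) :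
    ContDiffOn ℝ ∞ (px g) U := contDiffOn_fderiv_apply hU hg 1

theorem contDiffOn_py (hU : IsOpen U) {g : ℂ → F} (hg : ContDiffOn ℝ ∞ g U) :
    ContDiffOn ℝ ∞ (py g) U := contDiffOn_fderiv_apply hU hg Complex.I

theorem _root_.ContDiffOn.differentiableAt_of_isOpen {V : Type*} [NormedAddCommGroup V]
    [NormedSpace ℝ V] {U : Set V} (hU : IsOpen U) {g : V → F}
    (hg : ContDiffOn ℝ ∞ g U) {p : V} (hp : p ∈ U) : DifferentiableAt ℝ g p :=
  (hg.contDiffAt (hU.mem_nhds hp)).differentiableAt (by simp)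

theorem fderiv_fderiv_apply (hU : IsOpen U) {g : ℂ → F} (hg : ContDiffOn ℝ ∞ g U) {p : ℂ}
    (hp : p ∈ U) (u v : ℂ) :
    fderiv ℝ (fun q => fderiv ℝ g q v) p u = fderiv ℝ (fderiv ℝ g) p u v := by
  have h1 : DifferentiableAt ℝ (fderiv ℝ g) p :=
    (hg.fderiv_of_isOpen (m := ∞) hU (by simp)).differentiableAt_of_isOpen hU hp
  rw [fderiv_clm_apply h1 (differentiableAt_const v)]
  simp

theorem fderiv_fderiv_symm (hU : IsOpen U) {g : ℂ → F} (hg : ContDiffOn ℝ ∞ g U) {p : ℂ}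
    (hp : p ∈ U) (u v : ℂ) :
    fderiv ℝ (fderiv ℝ g) p u v = fderiv ℝ (fderiv ℝ g) p v u :=
  ((hg.contDiffAt (hU.mem_nhds hp)).isSymmSndFDerivAt (by simp; norm_cast)).eq u v

theorem px_py_comm (hU : IsOpen U) {g : ℂ → F} (hg : ContDiffOn ℝ ∞ g U) {p : ℂ}
    (hp : p ∈ U) : px (py g) p = py (px g) p := by
  have h1 := fderiv_fderiv_apply hU hg hp 1 Complex.I
  have h2 := fderiv_fderiv_apply hU hg hp Complex.I 1
  have h3 := fderiv_fderiv_symm hU hg hp 1 Complex.I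
  exact h1.trans (h3.trans h2.symm)

theorem fderiv_eq_px_py (g : ℂ → F) (p v : ℂ) :
    fderiv ℝ g p v = v.re • px g p + v.im • py g p := by
  have : v = v.re • (1 : ℂ) + v.im • Complex.I := by simp
  conv_lhs => rw [this]
  rw [map_add, map_smul, map_smul]
  rfl

theorem px_congr {g h : ℂ → F} {p : ℂ} (e : g =ᶠ[𝓝 p] h) : px g p = px h p := by
  unfold px; rw [e.fderiv_eq]

theorem py_congr {g h : ℂ → F} {p : ℂ} (e : g =ᶠ[𝓝 p] h) : py g p = py h p := by
  unfold py; rw [e.fderiv_eq]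

theorem px_const (c : F) (p : ℂ) : px (fun _ => c) p = 0 := by simp [px]

theorem py_const (c : F) (p : ℂ) : py (fun _ => c) p = 0 := by simp [py]

theorem px_inner {E : Type*} [NormedAddCommGroup E] [InnerProductSpace ℝ E] {g h : ℂ → E} {p : ℂ}
    (hg : DifferentiableAt ℝ g p) (hh : DifferentiableAt ℝ h p) :
    px (fun q => inner ℝ (g q) (h q)) p = inner ℝ (px g p) (h p) + inner ℝ (g p) (px h p) := by
  unfold px; rw [fderiv_inner_apply ℝ hg hh, add_comm]

theorem py_inner {E : Type*} [NormedAddCommGroup E] [InnerProductSpace ℝ E] {g h : ℂ → E} {p : ℂ}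
    (hg : DifferentiableAt ℝ g p) (hh : DifferentiableAt ℝ h p) :
    py (fun q => inner ℝ (g q) (h q)) p = inner ℝ (py g p) (h p) + inner ℝ (g p) (py h p) := by
  unfold py; rw [fderiv_inner_apply ℝ hg hh, add_comm]

theorem px_add {g h : ℂ → F} {p : ℂ} (hg : DifferentiableAt ℝ g p)
    (hh : DifferentiableAt ℝ h p) : px (fun q => g q + h q) p = px g p + px h p := by
  unfold px; rw [fderiv_fun_add hg hh]; rfl

theorem px_sub {g h : ℂ → F} {p : ℂ} (hg : DifferentiableAt ℝ g p)
    (hh : DifferentiableAt ℝ h p) : px (fun q => g q - h q) p = px g p - px h p := by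
  unfold px; rw [fderiv_fun_sub hg hh]; rfl

theorem px_mul {A : Type*} [NormedCommRing A] [NormedAlgebra ℝ A] {g h : ℂ → A} {p : ℂ}
    (hg : DifferentiableAt ℝ g p) (hh : DifferentiableAt ℝ h p) :
    px (fun q => g q * h q) p = px g p * h p + g p * px h p := by
  unfold px; rw [fderiv_fun_mul hg hh]; simp; ring

theorem px_smul {g : ℂ → ℝ} {h : ℂ → F} {p : ℂ} (hg : DifferentiableAt ℝ g p)
    (hh : DifferentiableAt ℝ h p) :
    px (fun q => g q • h q) p = px g p • h p + g p • px h p := by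
  unfold px; rw [fderiv_fun_smul hg hh]; simp [add_comm]

theorem px_const_mul {A : Type*} [NormedCommRing A] [NormedAlgebra ℝ A] {h : ℂ → A} {p : ℂ}
    (c : A) (hh : DifferentiableAt ℝ h p) : px (fun q => c * h q) p = c * px h p := by
  rw [px_mul (differentiableAt_const c) hh, px_const]; ring

theorem px_clm {G : Type*} [NormedAddCommGroup G] [NormedSpace ℝ G] {h : ℂ → F} {p : ℂ}
    (L : F →L[ℝ] G) (hh : DifferentiableAt ℝ h p) : px (fun q => L (h q)) p = L (px h p) := by
  unfold px
  have : HasFDerivAt (fun q => L (h q)) _ p := L.hasFDerivAt.comp p hh.hasFDerivAt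
  rw [this.fderiv]; rfl

theorem px_inv {g : ℂ → ℝ} {p : ℂ} (hg : DifferentiableAt ℝ g p) (h0 : g p ≠ 0) :
    px (fun q => (g q)⁻¹) p = - px g p / g p ^ 2 := by
  unfold px
  have := (hasDerivAt_inv h0).comp_hasFDerivAt p hg.hasFDerivAt
  rw [show (fun q => (g q)⁻¹) = (fun x => x⁻¹) ∘ g from rfl, this.fderiv]
  simp [div_eq_inv_mul]

theorem py_add {g h : ℂ → F} {p : ℂ} (hg : DifferentiableAt ℝ g p)
    (hh : DifferentiableAt ℝ h p) : py (fun q => g q + h q) p = py g p + py h p := by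
  unfold py; rw [fderiv_fun_add hg hh]; rfl

theorem py_sub {g h : ℂ → F} {p : ℂ} (hg : DifferentiableAt ℝ g p)
    (hh : DifferentiableAt ℝ h p) : py (fun q => g q - h q) p = py g p - py h p := by
  unfold py; rw [fderiv_fun_sub hg hh]; rfl

theorem py_mul {A : Type*} [NormedCommRing A] [NormedAlgebra ℝ A] {g h : ℂ → A} {p : ℂ}
    (hg : DifferentiableAt ℝ g p) (hh : DifferentiableAt ℝ h p) :
    py (fun q => g q * h q) p = py g p * h p + g p * py h p := by
  unfold py; rw [fderiv_fun_mul hg hh]; simp; ring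

theorem py_smul {g : ℂ → ℝ} {h : ℂ → F} {p : ℂ} (hg : DifferentiableAt ℝ g p)
    (hh : DifferentiableAt ℝ h p) :
    py (fun q => g q • h q) p = py g p • h p + g p • py h p := by
  unfold py; rw [fderiv_fun_smul hg hh]; simp [add_comm]

theorem py_const_mul {A : Type*} [NormedCommRing A] [NormedAlgebra ℝ A] {h : ℂ → A} {p : ℂ}
    (c : A) (hh : DifferentiableAt ℝ h p) : py (fun q => c * h q) p = c * py h p := by
  rw [py_mul (differentiableAt_const c) hh, py_const]; ring

theorem py_clm {G : Type*} [NormedAddCommGroup G] [NormedSpace ℝ G] {h : ℂ → F} {p : ℂ}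
    (L : F →L[ℝ] G) (hh : DifferentiableAt ℝ h p) : py (fun q => L (h q)) p = L (py h p) := by
  unfold py
  have : HasFDerivAt (fun q => L (h q)) _ p := L.hasFDerivAt.comp p hh.hasFDerivAt
  rw [this.fderiv]; rfl

theorem py_inv {g : ℂ → ℝ} {p : ℂ} (hg : DifferentiableAt ℝ g p) (h0 : g p ≠ 0) :
    py (fun q => (g q)⁻¹) p = - py g p / g p ^ 2 := by
  unfold py
  have := (hasDerivAt_inv h0).comp_hasFDerivAt p hg.hasFDerivAt
  rw [show (fun q => (g q)⁻¹) = (fun x => x⁻¹) ∘ g from rfl, this.fderiv]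
  simp [div_eq_inv_mul]

end Partial

/-! ### The vector product -/

theorem inner_eq_sum3 (a b : E3) : inner ℝ a b = a 0 * b 0 + a 1 * b 1 + a 2 * b 2 := by
  simp [PiLp.inner_apply, Fin.sum_univ_three]; ring

theorem vprod_apply (a b : E3) :
    vprod a b 0 = a 1 * b 2 - a 2 * b 1 ∧ vprod a b 1 = a 2 * b 0 - a 0 * b 2 ∧
      vprod a b 2 = a 0 * b 1 - a 1 * b 0 := by
  simp [vprod, cross_apply]

theorem inner_vprod_left (a b : E3) : inner ℝ a (vprod a b) = 0 := by
  obtain ⟨h0, h1, h2⟩ := vprod_apply a b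
  rw [inner_eq_sum3, h0, h1, h2]; ring

theorem inner_vprod_right (a b : E3) : inner ℝ b (vprod a b) = 0 := by
  obtain ⟨h0, h1, h2⟩ := vprod_apply a b
  rw [inner_eq_sum3, h0, h1, h2]; ring

theorem norm_vprod_sq (a b : E3) :
    ‖vprod a b‖ ^ 2 = ‖a‖ ^ 2 * ‖b‖ ^ 2 - inner ℝ a b ^ 2 := by
  obtain ⟨h0, h1, h2⟩ := vprod_apply a b
  simp only [← real_inner_self_eq_norm_sq, inner_eq_sum3, h0, h1, h2]; ring

/-- Parseval's identity for an orthogonal basis of the form `(a, b, n)`. -/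
theorem inner_eq_of_frame {a b n : E3} {E : ℝ} (hE : E ≠ 0) (ha : inner ℝ a a = E)
    (hb : inner ℝ b b = E) (hn : inner ℝ n n = (1 : ℝ)) (hab : inner ℝ a b = (0 : ℝ))
    (han : inner ℝ a n = (0 : ℝ)) (hbn : inner ℝ b n = (0 : ℝ)) (v w : E3) :
    inner ℝ v w = inner ℝ a v * inner ℝ a w / E + inner ℝ b v * inner ℝ b w / E +
      inner ℝ n v * inner ℝ n w := by
  have hE0 : 0 < E := lt_of_le_of_ne (ha ▸ real_inner_self_nonneg) hE.symm
  have hba : inner ℝ b a = (0 : ℝ) := by rw [real_inner_comm, hab]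
  have hna : inner ℝ n a = (0 : ℝ) := by rw [real_inner_comm, han]
  have hnb : inner ℝ n b = (0 : ℝ) := by rw [real_inner_comm, hbn]
  have hs : √E * √E = E := Real.mul_self_sqrt hE0.le
  have hs0 : √E ≠ 0 := (Real.sqrt_pos.2 hE0).ne'
  have ho : Orthonormal ℝ ![(√E)⁻¹ • a, (√E)⁻¹ • b, n] := by
    rw [orthonormal_iff_ite]
    intro i j
    fin_cases i <;> fin_cases j <;>
      simp [-inner_self_eq_norm_sq_to_K, inner_smul_left, inner_smul_right, ha, hb, hn, hab, han,
        hbn, hba, hna, hnb] <;>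
      (field_simp; linarith)
  let B := (basisOfOrthonormalOfCardEqFinrank ho (by simp)).toOrthonormalBasis (by simpa using ho)
  have hB : ∀ i, B i = ![(√E)⁻¹ • a, (√E)⁻¹ • b, n] i := fun i => by simp [B]
  rw [← B.sum_inner_mul_inner v w, Fin.sum_univ_three, hB, hB, hB]
  simp only [Matrix.cons_val_zero, Matrix.cons_val_one, Matrix.cons_val, inner_smul_left,
    inner_smul_right, real_inner_comm a v, real_inner_comm b v, real_inner_comm n v]
  simp only [map_inv₀, conj_trivial]
  field_simp
  rw [show √E ^ 2 = E by rw [sq, hs]]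
  ring

end BonnetSurf

namespace BonnetSurf

/-! ### The fundamental forms of a conformal immersion -/

/-- The coefficient `⟨f_xx, N⟩` of the second fundamental form. -/
def sffL (f : ℂ → E3) (p : ℂ) : ℝ := inner ℝ (dX (dX f) p) (unitNormal f p)

/-- The coefficient `⟨f_xy, N⟩` of the second fundamental form. -/
def sffM (f : ℂ → E3) (p : ℂ) : ℝ := inner ℝ (dX (dY f) p) (unitNormal f p)

/-- The coefficient `⟨f_yy, N⟩` of the second fundamental form. -/
def sffK (f : ℂ → E3) (p : ℂ) : ℝ := inner ℝ (dY (dY f) p) (unitNormal f p)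

theorem hopf_eq_sff (f : ℂ → E3) (p : ℂ) :
    hopf f p = (((sffL f p - sffK f p) / 4 : ℝ) : ℂ) - ((sffM f p / 2 : ℝ) : ℂ) * Complex.I := by
  rw [hopf, inner_sub_left]; rfl

theorem meanCurv_eq_sff (f : ℂ → E3) (p : ℂ) :
    meanCurv f p = (sffL f p + sffK f p) / (2 * conformalFactor f p) := by
  rw [meanCurv, inner_add_left]; rfl

theorem contDiffOn_vprod {V : Type*} [NormedAddCommGroup V] [NormedSpace ℝ V] {U : Set V}
    {g h : V → E3} (hg : ContDiffOn ℝ ∞ g U)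
    (hh : ContDiffOn ℝ ∞ h U) : ContDiffOn ℝ ∞ (fun p => vprod (g p) (h p)) U := by
  have hg' := contDiffOn_euclidean.1 hg
  have hh' := contDiffOn_euclidean.1 hh
  refine contDiffOn_euclidean.2 fun i => ?_
  fin_cases i
  · simpa [(vprod_apply _ _).1] using ((hg' 1).mul (hh' 2)).sub ((hg' 2).mul (hh' 1))
  · simpa [(vprod_apply _ _).2.1] using ((hg' 2).mul (hh' 0)).sub ((hg' 0).mul (hh' 2))
  · simpa [(vprod_apply _ _).2.2] using ((hg' 0).mul (hh' 1)).sub ((hg' 1).mul (hh' 0))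

namespace IsConformalImmersionOn

variable {f g : ℂ → E3} {U : Set ℂ} {p : ℂ}

theorem mono (hf : IsConformalImmersionOn f U) {V : Set ℂ} (h : V ⊆ U) :
    IsConformalImmersionOn f V :=
  ⟨hf.smooth.mono h, fun p hp => hf.orthogonal p (h hp), fun p hp => hf.norm_eq p (h hp),
    fun p hp => hf.ne_zero p (h hp)⟩

theorem inner_dX_dX (f : ℂ → E3) (p : ℂ) :
    inner ℝ (dX f p) (dX f p) = conformalFactor f p := real_inner_self_eq_norm_sq _

theorem inner_dY_dY (hf : IsConformalImmersionOn f U) (hp : p ∈ U) :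
    inner ℝ (dY f p) (dY f p) = conformalFactor f p := by
  rw [real_inner_self_eq_norm_sq, ← hf.norm_eq p hp, conformalFactor]

theorem cf_pos (hf : IsConformalImmersionOn f U) (hp : p ∈ U) : 0 < conformalFactor f p :=
  pow_pos (norm_pos_iff.2 (hf.ne_zero p hp)) 2

theorem norm_vprod (hf : IsConformalImmersionOn f U) (hp : p ∈ U) :
    ‖vprod (dX f p) (dY f p)‖ = conformalFactor f p := by
  have h := norm_vprod_sq (dX f p) (dY f p)
  rw [hf.orthogonal p hp, ← hf.norm_eq p hp] at h
  have : ‖vprod (dX f p) (dY f p)‖ ^ 2 = conformalFactor f p ^ 2 := by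
    rw [h, conformalFactor]; ring
  exact (sq_eq_sq₀ (norm_nonneg _) (hf.cf_pos hp).le).1 this

theorem unitNormal_eq (hf : IsConformalImmersionOn f U) (hp : p ∈ U) :
    unitNormal f p = (conformalFactor f p)⁻¹ • vprod (dX f p) (dY f p) := by
  rw [unitNormal, hf.norm_vprod hp]

theorem inner_dX_normal (f : ℂ → E3) (p : ℂ) : inner ℝ (dX f p) (unitNormal f p) = 0 := by
  rw [unitNormal, inner_smul_right, inner_vprod_left, mul_zero]

theorem inner_dY_normal (f : ℂ → E3) (p : ℂ) : inner ℝ (dY f p) (unitNormal f p) = 0 := by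
  rw [unitNormal, inner_smul_right, inner_vprod_right, mul_zero]

theorem inner_normal_normal (hf : IsConformalImmersionOn f U) (hp : p ∈ U) :
    inner ℝ (unitNormal f p) (unitNormal f p) = 1 := by
  have h0 := (hf.cf_pos hp).ne'
  rw [hf.unitNormal_eq hp, inner_smul_left, inner_smul_right, real_inner_self_eq_norm_sq,
    hf.norm_vprod hp]
  simp only [map_inv₀, conj_trivial]
  field_simp

theorem inner_eq (hf : IsConformalImmersionOn f U) (hp : p ∈ U) (v w : E3) :
    inner ℝ v w = inner ℝ (dX f p) v * inner ℝ (dX f p) w / conformalFactor f p +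
      inner ℝ (dY f p) v * inner ℝ (dY f p) w / conformalFactor f p +
      inner ℝ (unitNormal f p) v * inner ℝ (unitNormal f p) w :=
  inner_eq_of_frame (hf.cf_pos hp).ne' (inner_dX_dX f p) (hf.inner_dY_dY hp)
    (hf.inner_normal_normal hp) (hf.orthogonal p hp) (inner_dX_normal f p) (inner_dY_normal f p)
    v w

/-! ### Smoothness of the fundamental forms -/

section Smooth

variable (hU : IsOpen U) (hf : IsConformalImmersionOn f U)
include hU hf

theorem contDiffOn_dX : ContDiffOn ℝ ∞ (dX f) U := contDiffOn_px hU hf.smooth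

theorem contDiffOn_dY : ContDiffOn ℝ ∞ (dY f) U := contDiffOn_py hU hf.smooth

theorem contDiffOn_cf : ContDiffOn ℝ ∞ (conformalFactor f) U :=
  (hf.contDiffOn_dX hU).norm_sq ℝ

theorem contDiffOn_unitNormal : ContDiffOn ℝ ∞ (unitNormal f) U :=
  (((hf.contDiffOn_cf hU).inv fun _ hp => (hf.cf_pos hp).ne').smul
    (contDiffOn_vprod (hf.contDiffOn_dX hU) (hf.contDiffOn_dY hU))).congr
    fun _ hp => hf.unitNormal_eq hp

theorem contDiffOn_sffL : ContDiffOn ℝ ∞ (sffL f) U :=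
  (contDiffOn_px hU (hf.contDiffOn_dX hU)).inner ℝ (hf.contDiffOn_unitNormal hU)

theorem contDiffOn_sffM : ContDiffOn ℝ ∞ (sffM f) U :=
  (contDiffOn_px hU (hf.contDiffOn_dY hU)).inner ℝ (hf.contDiffOn_unitNormal hU)

theorem contDiffOn_sffK : ContDiffOn ℝ ∞ (sffK f) U :=
  (contDiffOn_py hU (hf.contDiffOn_dY hU)).inner ℝ (hf.contDiffOn_unitNormal hU)

theorem contDiffOn_meanCurv : ContDiffOn ℝ ∞ (meanCurv f) U :=
  (((hf.contDiffOn_sffL hU).add (hf.contDiffOn_sffK hU)).div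
    (contDiffOn_const.mul (hf.contDiffOn_cf hU))
    fun _ hp => mul_ne_zero two_ne_zero (hf.cf_pos hp).ne').congr
    fun _ _ => meanCurv_eq_sff f _

theorem contDiffOn_hopf : ContDiffOn ℝ ∞ (hopf f) U := by
  have h1 : ContDiffOn ℝ ∞ (fun p => (((sffL f p - sffK f p) / 4 : ℝ) : ℂ)) U :=
    Complex.ofRealCLM.contDiff.comp_contDiffOn
      (((hf.contDiffOn_sffL hU).sub (hf.contDiffOn_sffK hU)).div_const 4)
  have h2 : ContDiffOn ℝ ∞ (fun p => ((sffM f p / 2 : ℝ) : ℂ)) U :=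
    Complex.ofRealCLM.contDiff.comp_contDiffOn ((hf.contDiffOn_sffM hU).div_const 2)
  exact (h1.sub (h2.mul contDiffOn_const)).congr fun _ _ => hopf_eq_sff f _

end Smooth

/-! ### Moving-frame relations; the equations of Gauss and Codazzi in real form -/

section Relations

variable (hU : IsOpen U) (hf : IsConformalImmersionOn f U) (hp : p ∈ U)
include hf hp

theorem sffL_add_sffK : sffL f p + sffK f p = 2 * conformalFactor f p * meanCurv f p := by
  have := (hf.cf_pos hp).ne'
  rw [meanCurv_eq_sff]; field_simp

theorem sffL_eq : sffL f p = conformalFactor f p * meanCurv f p + 2 * (hopf f p).re := by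
  have := hf.sffL_add_sffK hp
  rw [hopf_eq_sff]; simp only [Complex.sub_re, Complex.ofReal_re, Complex.mul_re, Complex.I_re,
    Complex.ofReal_im, Complex.I_im]; linarith

theorem sffK_eq : sffK f p = conformalFactor f p * meanCurv f p - 2 * (hopf f p).re := by
  have := hf.sffL_add_sffK hp
  rw [hopf_eq_sff]; simp only [Complex.sub_re, Complex.ofReal_re, Complex.mul_re, Complex.I_re,
    Complex.ofReal_im, Complex.I_im]; linarith

omit hf hp in
theorem sffM_eq (f : ℂ → E3) (p : ℂ) : sffM f p = -2 * (hopf f p).im := by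
  rw [hopf_eq_sff]; simp only [Complex.sub_im, Complex.ofReal_re, Complex.mul_im, Complex.I_re,
    Complex.ofReal_im, Complex.I_im]; ring

include hU

theorem dY_dX : dY (dX f) p = dX (dY f) p := (px_py_comm hU hf.smooth hp).symm

theorem inner_dXX_dX : inner ℝ (dX f p) (dX (dX f) p) = px (conformalFactor f) p / 2 := by
  have hd := (hf.contDiffOn_dX hU).differentiableAt_of_isOpen hU hp
  have := px_inner hd hd
  rw [px_congr (Eventually.of_forall fun q => inner_dX_dX f q), real_inner_comm] at this
  rw [this, ← dX_eq_px]; ring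

theorem inner_dXY_dX : inner ℝ (dX f p) (dX (dY f) p) = py (conformalFactor f) p / 2 := by
  have hd := (hf.contDiffOn_dX hU).differentiableAt_of_isOpen hU hp
  have := py_inner hd hd
  rw [py_congr (Eventually.of_forall fun q => inner_dX_dX f q), real_inner_comm] at this
  rw [this, ← dY_eq_py, hf.dY_dX hU hp]; ring

theorem inner_dXY_dY : inner ℝ (dY f p) (dX (dY f) p) = px (conformalFactor f) p / 2 := by
  have hd := (hf.contDiffOn_dY hU).differentiableAt_of_isOpen hU hp
  have := px_inner hd hd
  rw [px_congr ((hU.eventually_mem hp).mono fun q hq => hf.inner_dY_dY hq), real_inner_comm] at this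
  rw [this, ← dX_eq_px]; ring

theorem inner_dYY_dY : inner ℝ (dY f p) (dY (dY f) p) = py (conformalFactor f) p / 2 := by
  have hd := (hf.contDiffOn_dY hU).differentiableAt_of_isOpen hU hp
  have := py_inner hd hd
  rw [py_congr ((hU.eventually_mem hp).mono fun q hq => hf.inner_dY_dY hq), real_inner_comm] at this
  rw [this, ← dY_eq_py]; ring

/-- Comes from differentiating ⟨f_x, f_y⟩ = 0, the other summand ⟨f_x, f_xy⟩ being half the
y-derivative of ‖f_x‖². -/
theorem inner_dXX_dY : inner ℝ (dY f p) (dX (dX f) p) = - py (conformalFactor f) p / 2 := by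
  have hd := (hf.contDiffOn_dX hU).differentiableAt_of_isOpen hU hp
  have hd' := (hf.contDiffOn_dY hU).differentiableAt_of_isOpen hU hp
  have := px_inner hd hd'
  rw [px_congr ((hU.eventually_mem hp).mono fun q hq => hf.orthogonal q hq), px_const,
    ← dX_eq_px, ← dX_eq_px, hf.inner_dXY_dX hU hp] at this
  rw [real_inner_comm]; linarith

theorem inner_dYY_dX : inner ℝ (dX f p) (dY (dY f) p) = - px (conformalFactor f) p / 2 := by
  have hd := (hf.contDiffOn_dX hU).differentiableAt_of_isOpen hU hp
  have hd' := (hf.contDiffOn_dY hU).differentiableAt_of_isOpen hU hp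
  have := py_inner hd hd'
  rw [py_congr ((hU.eventually_mem hp).mono fun q hq => hf.orthogonal q hq), py_const,
    ← dY_eq_py, ← dY_eq_py, hf.dY_dX hU hp, real_inner_comm, hf.inner_dXY_dY hU hp] at this
  linarith

theorem inner_px_normal_normal : inner ℝ (unitNormal f p) (px (unitNormal f) p) = 0 := by
  have hd := (hf.contDiffOn_unitNormal hU).differentiableAt_of_isOpen hU hp
  have := px_inner hd hd
  rw [px_congr ((hU.eventually_mem hp).mono fun q hq => hf.inner_normal_normal hq), px_const,
    real_inner_comm] at this
  linarith

theorem inner_py_normal_normal : inner ℝ (unitNormal f p) (py (unitNormal f) p) = 0 := by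
  have hd := (hf.contDiffOn_unitNormal hU).differentiableAt_of_isOpen hU hp
  have := py_inner hd hd
  rw [py_congr ((hU.eventually_mem hp).mono fun q hq => hf.inner_normal_normal hq), py_const,
    real_inner_comm] at this
  linarith

/-- Differentiation of ⟨f_x, N⟩ = 0. This and the next three lemmas are the Weingarten equations. -/
theorem inner_px_normal_dX : inner ℝ (dX f p) (px (unitNormal f) p) = - sffL f p := by
  have := px_inner ((hf.contDiffOn_dX hU).differentiableAt_of_isOpen hU hp)
    ((hf.contDiffOn_unitNormal hU).differentiableAt_of_isOpen hU hp)
  rw [px_congr (Eventually.of_forall fun q => inner_dX_normal f q), px_const, ← dX_eq_px] at this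
  unfold sffL; linarith

theorem inner_px_normal_dY : inner ℝ (dY f p) (px (unitNormal f) p) = - sffM f p := by
  have := px_inner ((hf.contDiffOn_dY hU).differentiableAt_of_isOpen hU hp)
    ((hf.contDiffOn_unitNormal hU).differentiableAt_of_isOpen hU hp)
  rw [px_congr (Eventually.of_forall fun q => inner_dY_normal f q), px_const, ← dX_eq_px] at this
  unfold sffM; linarith

theorem inner_py_normal_dX : inner ℝ (dX f p) (py (unitNormal f) p) = - sffM f p := by
  have := py_inner ((hf.contDiffOn_dX hU).differentiableAt_of_isOpen hU hp)
    ((hf.contDiffOn_unitNormal hU).differentiableAt_of_isOpen hU hp)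
  rw [py_congr (Eventually.of_forall fun q => inner_dX_normal f q), py_const, ← dY_eq_py,
    hf.dY_dX hU hp] at this
  unfold sffM; linarith

theorem inner_py_normal_dY : inner ℝ (dY f p) (py (unitNormal f) p) = - sffK f p := by
  have := py_inner ((hf.contDiffOn_dY hU).differentiableAt_of_isOpen hU hp)
    ((hf.contDiffOn_unitNormal hU).differentiableAt_of_isOpen hU hp)
  rw [py_congr (Eventually.of_forall fun q => inner_dY_normal f q), py_const, ← dY_eq_py] at this
  unfold sffK; linarith

/-- The Gauss equation, in terms of the second fundamental form. -/
theorem gauss_sff :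
    conformalFactor f p * (px (px (conformalFactor f)) p + py (py (conformalFactor f)) p) -
      (px (conformalFactor f) p ^ 2 + py (conformalFactor f) p ^ 2) =
      -2 * conformalFactor f p * (sffL f p * sffK f p - sffM f p ^ 2) := by
  have hE := (hf.cf_pos hp).ne'
  have sX := hf.contDiffOn_dX hU
  have sY := hf.contDiffOn_dY hU
  have dXX := (contDiffOn_px hU sX).differentiableAt_of_isOpen hU hp
  have dXY := (contDiffOn_px hU sY).differentiableAt_of_isOpen hU hp
  have dYd := sY.differentiableAt_of_isOpen hU hp
  -- The y-derivative of ⟨f_y, f_xx⟩ and the x-derivative of ⟨f_y, f_xy⟩ contain the same third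
  -- derivative. In the difference it cancels, leaving ⟨f_yy, f_xx⟩ - ‖f_xy‖², which the expansion
  -- in the frame (f_x, f_y, N) evaluates.
  have h1 : py (fun q => inner ℝ (dY f q) (dX (dX f) q)) p = inner ℝ (dY (dY f) p) (dX (dX f) p)
      + inner ℝ (dY f p) (dY (dX (dX f)) p) := py_inner dYd dXX
  have h2 : px (fun q => inner ℝ (dY f q) (dX (dY f) q)) p = inner ℝ (dX (dY f) p) (dX (dY f) p)
      + inner ℝ (dY f p) (dX (dX (dY f)) p) := px_inner dYd dXY
  rw [py_congr ((hU.eventually_mem hp).mono fun q hq => hf.inner_dXX_dY hU hq)] at h1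
  rw [px_congr ((hU.eventually_mem hp).mono fun q hq => hf.inner_dXY_dY hU hq)] at h2
  have h3 : dY (dX (dX f)) p = dX (dX (dY f)) p := by
    refine (px_py_comm hU sX hp).symm.trans ?_
    exact px_congr ((hU.eventually_mem hp).mono fun q hq => hf.dY_dX hU hq)
  have e1 : py (fun q => -py (conformalFactor f) q / 2) p =
      - py (py (conformalFactor f)) p / 2 := by
    have := py_const_mul (-1 / 2 : ℝ) ((contDiffOn_py hU
      (hf.contDiffOn_cf hU)).differentiableAt_of_isOpen hU hp)
    rw [py_congr (Eventually.of_forall fun q => (by ring :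
      -py (conformalFactor f) q / 2 = -1 / 2 * py (conformalFactor f) q)), this]
    ring
  have e2 : px (fun q => px (conformalFactor f) q / 2) p = px (px (conformalFactor f)) p / 2 := by
    have := px_const_mul (1 / 2 : ℝ) ((contDiffOn_px hU
      (hf.contDiffOn_cf hU)).differentiableAt_of_isOpen hU hp)
    rw [px_congr (Eventually.of_forall fun q => (by ring :
      px (conformalFactor f) q / 2 = 1 / 2 * px (conformalFactor f) q)), this]
    ring
  rw [e1, h3] at h1
  rw [e2] at h2
  have p1 := hf.inner_eq hp (dY (dY f) p) (dX (dX f) p)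
  have p2 := hf.inner_eq hp (dX (dY f) p) (dX (dY f) p)
  rw [hf.inner_dYY_dX hU hp, hf.inner_dXX_dX hU hp, hf.inner_dYY_dY hU hp,
    hf.inner_dXX_dY hU hp, real_inner_comm _ (unitNormal f p),
    real_inner_comm _ (unitNormal f p)] at p1
  rw [hf.inner_dXY_dX hU hp, hf.inner_dXY_dY hU hp, real_inner_comm _ (unitNormal f p)] at p2
  rw [p1] at h1
  rw [p2] at h2
  have h4 : py (py (conformalFactor f)) p + px (px (conformalFactor f)) p = _ :=
    (show _ = 2 * (px (px (conformalFactor f)) p / 2 - - py (py (conformalFactor f)) p / 2) by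
      ring).trans (by rw [h1, h2])
  rw [add_comm (px _ p), h4]
  unfold sffL sffM sffK
  field_simp
  ring

/-- The first Codazzi equation. -/
theorem codazzi_sff_y : py (sffL f) p - px (sffM f) p =
    py (conformalFactor f) p * meanCurv f p := by
  have hE := (hf.cf_pos hp).ne'
  have dXX := (contDiffOn_px hU (hf.contDiffOn_dX hU)).differentiableAt_of_isOpen hU hp
  have dXY := (contDiffOn_px hU (hf.contDiffOn_dY hU)).differentiableAt_of_isOpen hU hp
  have dN := (hf.contDiffOn_unitNormal hU).differentiableAt_of_isOpen hU hp
  have h1 : py (sffL f) p = _ := py_inner dXX dN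
  have h2 : px (sffM f) p = _ := px_inner dXY dN
  -- The third derivatives cancel in L_y - M_x. What remains is ⟨f_xx, N_y⟩ - ⟨f_xy, N_x⟩, which the
  -- frame expansion turns into E_y (L + K) / (2E) = E_y H.
  have h3 : py (dX (dX f)) p = px (dX (dY f)) p := by
    refine (px_py_comm hU (hf.contDiffOn_dX hU) hp).symm.trans ?_
    exact px_congr ((hU.eventually_mem hp).mono fun q hq => hf.dY_dX hU hq)
  rw [h1, h2, h3, meanCurv_eq_sff]
  have p1 := hf.inner_eq hp (dX (dX f) p) (py (unitNormal f) p)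
  have p2 := hf.inner_eq hp (dX (dY f) p) (px (unitNormal f) p)
  rw [hf.inner_dXX_dX hU hp, hf.inner_dXX_dY hU hp, hf.inner_py_normal_normal hU hp,
    hf.inner_py_normal_dX hU hp, hf.inner_py_normal_dY hU hp] at p1
  rw [hf.inner_dXY_dX hU hp, hf.inner_dXY_dY hU hp, hf.inner_px_normal_normal hU hp,
    hf.inner_px_normal_dX hU hp, hf.inner_px_normal_dY hU hp] at p2
  rw [p1, p2]
  field_simp
  ring

/-- The second Codazzi equation. -/
theorem codazzi_sff_x : px (sffK f) p - py (sffM f) p =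
    px (conformalFactor f) p * meanCurv f p := by
  have hE := (hf.cf_pos hp).ne'
  have dYY := (contDiffOn_py hU (hf.contDiffOn_dY hU)).differentiableAt_of_isOpen hU hp
  have dXY := (contDiffOn_px hU (hf.contDiffOn_dY hU)).differentiableAt_of_isOpen hU hp
  have dN := (hf.contDiffOn_unitNormal hU).differentiableAt_of_isOpen hU hp
  have h1 : px (sffK f) p = _ := px_inner dYY dN
  have h2 : py (sffM f) p = _ := py_inner dXY dN
  have h3 : px (dY (dY f)) p = py (dX (dY f)) p := px_py_comm hU (hf.contDiffOn_dY hU) hp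
  rw [h1, h2, h3, meanCurv_eq_sff]
  have p1 := hf.inner_eq hp (dY (dY f) p) (px (unitNormal f) p)
  have p2 := hf.inner_eq hp (dX (dY f) p) (py (unitNormal f) p)
  rw [hf.inner_dYY_dX hU hp, hf.inner_dYY_dY hU hp, hf.inner_px_normal_normal hU hp,
    hf.inner_px_normal_dX hU hp, hf.inner_px_normal_dY hU hp] at p1
  rw [hf.inner_dXY_dX hU hp, hf.inner_dXY_dY hU hp, hf.inner_py_normal_normal hU hp,
    hf.inner_py_normal_dX hU hp, hf.inner_py_normal_dY hU hp] at p2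
  rw [p1, p2]
  field_simp
  ring

end Relations

end IsConformalImmersionOn

end BonnetSurf

namespace BonnetSurf

/-! ### The Gauss and Codazzi equations -/

namespace IsConformalImmersionOn

variable {f g : ℂ → E3} {U : Set ℂ} {p : ℂ}

/-- The Gauss equation in terms of the Hopf differential and the mean curvature. -/
theorem gauss (hU : IsOpen U) (hf : IsConformalImmersionOn f U) (hp : p ∈ U) :
    conformalFactor f p * (px (px (conformalFactor f)) p + py (py (conformalFactor f)) p) -
      (px (conformalFactor f) p ^ 2 + py (conformalFactor f) p ^ 2) =
      -2 * conformalFactor f p *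
        (conformalFactor f p ^ 2 * meanCurv f p ^ 2 - 4 * ‖hopf f p‖ ^ 2) := by
  rw [hf.gauss_sff hU hp, hf.sffL_eq hp, hf.sffK_eq hp, sffM_eq, ← Complex.normSq_eq_norm_sq,
    Complex.normSq_apply]
  ring

/-- The Codazzi equation `2 Q_z̄ = H_z e^u`. -/
theorem codazzi (hU : IsOpen U) (hf : IsConformalImmersionOn f U) (hp : p ∈ U) :
    px (hopf f) p + Complex.I * py (hopf f) p =
      (conformalFactor f p / 2 : ℝ) *
        (((px (meanCurv f) p : ℝ) : ℂ) - Complex.I * ((py (meanCurv f) p : ℝ) : ℂ)) := by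
  have dQ := (hf.contDiffOn_hopf hU).differentiableAt_of_isOpen hU hp
  have dE := (hf.contDiffOn_cf hU).differentiableAt_of_isOpen hU hp
  have dH := (hf.contDiffOn_meanCurv hU).differentiableAt_of_isOpen hU hp
  have dre : DifferentiableAt ℝ (fun q => (hopf f q).re) p :=
    Complex.reCLM.differentiableAt.comp p dQ
  have dim : DifferentiableAt ℝ (fun q => (hopf f q).im) p :=
    Complex.imCLM.differentiableAt.comp p dQ
  have hre : px (fun q => (hopf f q).re) p = (px (hopf f) p).re := px_clm Complex.reCLM dQ
  have hre' : py (fun q => (hopf f q).re) p = (py (hopf f) p).re := py_clm Complex.reCLM dQ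
  have him : px (fun q => (hopf f q).im) p = (px (hopf f) p).im := px_clm Complex.imCLM dQ
  have him' : py (fun q => (hopf f q).im) p = (py (hopf f) p).im := py_clm Complex.imCLM dQ
  have hLy : py (sffL f) p = py (conformalFactor f) p * meanCurv f p +
      conformalFactor f p * py (meanCurv f) p + 2 * (py (hopf f) p).re := by
    rw [py_congr ((hU.eventually_mem hp).mono fun q hq => hf.sffL_eq hq),
      py_add (dE.fun_mul dH) (dre.const_mul 2), py_mul dE dH, py_const_mul _ dre, hre']
  have hKx : px (sffK f) p = px (conformalFactor f) p * meanCurv f p +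
      conformalFactor f p * px (meanCurv f) p - 2 * (px (hopf f) p).re := by
    rw [px_congr ((hU.eventually_mem hp).mono fun q hq => hf.sffK_eq hq),
      px_sub (dE.fun_mul dH) (dre.const_mul 2), px_mul dE dH, px_const_mul _ dre, hre]
  have hMx : px (sffM f) p = -2 * (px (hopf f) p).im := by
    rw [px_congr (Eventually.of_forall fun q => sffM_eq f q), px_const_mul _ dim, him]
  have hMy : py (sffM f) p = -2 * (py (hopf f) p).im := by
    rw [py_congr (Eventually.of_forall fun q => sffM_eq f q), py_const_mul _ dim, him']
  have c1 := hf.codazzi_sff_y hU hp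
  have c2 := hf.codazzi_sff_x hU hp
  rw [hLy, hMx] at c1
  rw [hKx, hMy] at c2
  apply Complex.ext
  · simp
    linarith
  · simp
    linarith

/-- Conformal immersions with the same metric and mean curvature have Hopf differentials of the
same absolute value. -/
theorem norm_hopf_eq (hU : IsOpen U) (hf : IsConformalImmersionOn f U)
    (hg : IsConformalImmersionOn g U) (hE : ∀ q ∈ U, conformalFactor g q = conformalFactor f q)
    (hH : ∀ q ∈ U, meanCurv g q = meanCurv f q) (hp : p ∈ U) : ‖hopf g p‖ = ‖hopf f p‖ := by
  -- Every term of the Gauss equation other than |Q|² is determined by the metric and H.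
  have h1 := hf.gauss hU hp
  have h2 := hg.gauss hU hp
  have he : ∀ q ∈ U, conformalFactor g =ᶠ[𝓝 q] conformalFactor f := fun q hq =>
    (hU.eventually_mem hq).mono hE
  rw [px_congr (he p hp), py_congr (he p hp),
    px_congr ((hU.eventually_mem hp).mono fun q hq => px_congr (he q hq)),
    py_congr ((hU.eventually_mem hp).mono fun q hq => py_congr (he q hq)), hE p hp, hH p hp, h1]
    at h2
  have h0 := (hf.cf_pos hp).ne'
  have : ‖hopf g p‖ ^ 2 = ‖hopf f p‖ ^ 2 := by
    have := mul_left_cancel₀ (mul_ne_zero (by norm_num : (-2 : ℝ) ≠ 0) h0) h2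
    linarith
  exact (sq_eq_sq₀ (norm_nonneg _) (norm_nonneg _)).1 this

/-- The difference of the Hopf differentials of conformal immersions with the same metric and mean
curvature is holomorphic. -/
theorem differentiableOn_hopf_sub (hU : IsOpen U) (hf : IsConformalImmersionOn f U)
    (hg : IsConformalImmersionOn g U) (hE : ∀ q ∈ U, conformalFactor g q = conformalFactor f q)
    (hH : ∀ q ∈ U, meanCurv g q = meanCurv f q) :
    DifferentiableOn ℂ (fun q => hopf g q - hopf f q) U := by
  intro p hp
  have dQ := (hf.contDiffOn_hopf hU).differentiableAt_of_isOpen hU hp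
  have dQ' := (hg.contDiffOn_hopf hU).differentiableAt_of_isOpen hU hp
  refine (differentiableAt_complex_iff_differentiableAt_real.2
    ⟨dQ'.fun_sub dQ, ?_⟩).differentiableWithinAt
  -- The two Codazzi equations have the same right-hand side, so the difference of the Hopf
  -- coefficients satisfies the Cauchy–Riemann equation.
  have h1 := hf.codazzi hU hp
  have h2 := hg.codazzi hU hp
  have he : meanCurv g =ᶠ[𝓝 p] meanCurv f := (hU.eventually_mem hp).mono hH
  rw [px_congr he, py_congr he, hE p hp, ← h1] at h2
  have hx := px_sub dQ' dQ
  have hy := py_sub dQ' dQ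
  change py _ p = Complex.I • px _ p
  rw [hx, hy, smul_eq_mul]
  linear_combination -Complex.I * h2 + (py (hopf g) p - py (hopf f) p) * Complex.I_sq

end IsConformalImmersionOn

/-! ### Changes of the parameter -/

theorem conformalFactor_congr {f g : ℂ → E3} {p : ℂ} (h : f =ᶠ[𝓝 p] g) :
    conformalFactor f p = conformalFactor g p := by
  unfold conformalFactor; rw [dX_eq_px, dX_eq_px, px_congr h]

theorem dX_congr {f g : ℂ → E3} {p : ℂ} (h : f =ᶠ[𝓝 p] g) : dX f p = dX g p := px_congr h

theorem dY_congr {f g : ℂ → E3} {p : ℂ} (h : f =ᶠ[𝓝 p] g) : dY f p = dY g p := py_congr h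

theorem dX_eventuallyEq {f g : ℂ → E3} {p : ℂ} (h : f =ᶠ[𝓝 p] g) : dX f =ᶠ[𝓝 p] dX g :=
  h.eventually_nhds.mono fun _ hq => dX_congr hq

theorem dY_eventuallyEq {f g : ℂ → E3} {p : ℂ} (h : f =ᶠ[𝓝 p] g) : dY f =ᶠ[𝓝 p] dY g :=
  h.eventually_nhds.mono fun _ hq => dY_congr hq

theorem unitNormal_congr {f g : ℂ → E3} {p : ℂ} (h : f =ᶠ[𝓝 p] g) :
    unitNormal f p = unitNormal g p := by
  unfold unitNormal; rw [dX_congr h, dY_congr h]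

theorem sffL_congr {f g : ℂ → E3} {p : ℂ} (h : f =ᶠ[𝓝 p] g) : sffL f p = sffL g p := by
  unfold sffL; rw [dX_congr (dX_eventuallyEq h), unitNormal_congr h]

theorem sffM_congr {f g : ℂ → E3} {p : ℂ} (h : f =ᶠ[𝓝 p] g) : sffM f p = sffM g p := by
  unfold sffM; rw [dX_congr (dY_eventuallyEq h), unitNormal_congr h]

theorem sffK_congr {f g : ℂ → E3} {p : ℂ} (h : f =ᶠ[𝓝 p] g) : sffK f p = sffK g p := by
  unfold sffK; rw [dY_congr (dY_eventuallyEq h), unitNormal_congr h]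

theorem hopf_congr {f g : ℂ → E3} {p : ℂ} (h : f =ᶠ[𝓝 p] g) : hopf f p = hopf g p := by
  rw [hopf_eq_sff, hopf_eq_sff, sffL_congr h, sffM_congr h, sffK_congr h]

theorem meanCurv_congr {f g : ℂ → E3} {p : ℂ} (h : f =ᶠ[𝓝 p] g) : meanCurv f p = meanCurv g p := by
  rw [meanCurv_eq_sff, meanCurv_eq_sff, sffL_congr h, sffK_congr h, conformalFactor_congr h]

theorem IsConformalImmersionOn.congr {f g : ℂ → E3} {U : Set ℂ} (hU : IsOpen U)
    (hf : IsConformalImmersionOn f U) (h : ∀ q ∈ U, g q = f q) : IsConformalImmersionOn g U := by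
  have he : ∀ q ∈ U, g =ᶠ[𝓝 q] f := fun q hq => (hU.eventually_mem hq).mono h
  refine ⟨hf.smooth.congr h, fun p hp => ?_, fun p hp => ?_, fun p hp => ?_⟩
  · rw [dX_congr (he p hp), dY_congr (he p hp), hf.orthogonal p hp]
  · rw [dX_congr (he p hp), dY_congr (he p hp), hf.norm_eq p hp]
  · rw [dX_congr (he p hp)]; exact hf.ne_zero p hp

theorem vprod_rotate (a b : ℝ) (v w : E3) :
    vprod (a • v + b • w) (-b • v + a • w) = (a ^ 2 + b ^ 2) • vprod v w := by
  ext i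
  fin_cases i
  · simp [(vprod_apply _ _).1]; ring
  · simp [(vprod_apply _ _).2.1]; ring
  · simp [(vprod_apply _ _).2.2]; ring

/-! ### Precomposition with a holomorphic map -/

section CompHolomorphic

variable {f : ℂ → E3} {φ : ℂ → ℂ} {U V : Set ℂ} {q : ℂ}

theorem fderiv_comp_holomorphic {F : Type*} [NormedAddCommGroup F] [NormedSpace ℝ F] {f : ℂ → F}
    (hf : DifferentiableAt ℝ f (φ q)) (hφ : DifferentiableAt ℂ φ q) (v : ℂ) :
    fderiv ℝ (fun x => f (φ x)) q v = fderiv ℝ f (φ q) (deriv φ q * v) := by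
  have h1 : HasFDerivAt φ _ q := hφ.hasDerivAt.hasFDerivAt.restrictScalars ℝ
  have h2 := hf.hasFDerivAt.comp q h1
  rw [show (fun x => f (φ x)) = f ∘ φ from rfl, h2.fderiv]
  simp [mul_comm]

theorem sff_apply (hU : IsOpen U) (hf : ContDiffOn ℝ ∞ f U) (hp : q ∈ U) (u v : ℂ) :
    inner ℝ (fderiv ℝ (fderiv ℝ f) q u v) (unitNormal f q) =
      u.re * v.re * sffL f q + (u.re * v.im + u.im * v.re) * sffM f q +
        u.im * v.im * sffK f q := by
  have h11 : dX (dX f) q = _ := fderiv_fderiv_apply hU hf hp 1 1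
  have h12 : dX (dY f) q = _ := fderiv_fderiv_apply hU hf hp 1 Complex.I
  have h22 : dY (dY f) q = _ := fderiv_fderiv_apply hU hf hp Complex.I Complex.I
  have h21 := fderiv_fderiv_symm hU hf hp Complex.I 1
  have hu : u = u.re • (1 : ℂ) + u.im • Complex.I := by simp
  have hv : v = v.re • (1 : ℂ) + v.im • Complex.I := by simp
  have : fderiv ℝ (fderiv ℝ f) q u v = (u.re * v.re) • dX (dX f) q +
      (u.re * v.im + u.im * v.re) • dX (dY f) q + (u.im * v.im) • dY (dY f) q := by
    rw [h11, h12, h22]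
    conv_lhs => rw [hu, hv]
    simp only [map_add, map_smul, _root_.add_apply, _root_.smul_apply, h21, smul_add, smul_smul,
      add_smul]
    rw [mul_comm v.re u.re, mul_comm v.im u.re, mul_comm v.re u.im, mul_comm v.im u.im]
    abel
  rw [this, inner_add_left, inner_add_left, inner_smul_left, inner_smul_left, inner_smul_left]
  rfl

variable (hU : IsOpen U) (hV : IsOpen V) (hf : IsConformalImmersionOn f U)
  (hφ : DifferentiableOn ℂ φ V) (hm : MapsTo φ V U) (hq : q ∈ V)
include hU hV hf hφ hm hq

theorem dX_comp_holomorphic : dX (fun x => f (φ x)) q =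
    (deriv φ q).re • dX f (φ q) + (deriv φ q).im • dY f (φ q) := by
  have := fderiv_comp_holomorphic (hf.smooth.differentiableAt_of_isOpen hU (hm hq))
    (hφ.differentiableAt (hV.mem_nhds hq)) 1
  rw [mul_one, fderiv_eq_px_py f] at this
  exact this

theorem dY_comp_holomorphic : dY (fun x => f (φ x)) q =
    -(deriv φ q).im • dX f (φ q) + (deriv φ q).re • dY f (φ q) := by
  have := fderiv_comp_holomorphic (hf.smooth.differentiableAt_of_isOpen hU (hm hq))
    (hφ.differentiableAt (hV.mem_nhds hq)) Complex.I
  rw [fderiv_eq_px_py f, show (deriv φ q * Complex.I).re = -(deriv φ q).im by simp,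
    show (deriv φ q * Complex.I).im = (deriv φ q).re by simp] at this
  exact this

theorem conformalFactor_comp_holomorphic :
    conformalFactor (fun x => f (φ x)) q = ‖deriv φ q‖ ^ 2 * conformalFactor f (φ q) := by
  rw [← IsConformalImmersionOn.inner_dX_dX, dX_comp_holomorphic hU hV hf hφ hm hq]
  simp only [inner_add_left, inner_add_right, inner_smul_left, inner_smul_right,
    IsConformalImmersionOn.inner_dX_dX, hf.inner_dY_dY (hm hq), hf.orthogonal _ (hm hq),
    real_inner_comm (dX f (φ q)) (dY f (φ q)), conj_trivial, ← Complex.normSq_eq_norm_sq,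
    Complex.normSq_apply]
  ring

/-- Multiplication by φ' acts on the tangent plane as a rotation times a positive scaling, so f_x ×
f_y is multiplied by |φ'|² > 0. -/
theorem unitNormal_comp_holomorphic (h0 : deriv φ q ≠ 0) :
    unitNormal (fun x => f (φ x)) q = unitNormal f (φ q) := by
  unfold unitNormal
  rw [dX_comp_holomorphic hU hV hf hφ hm hq, dY_comp_holomorphic hU hV hf hφ hm hq, vprod_rotate]
  have : 0 < (deriv φ q).re ^ 2 + (deriv φ q).im ^ 2 := by
    have := Complex.normSq_pos.2 h0
    rw [Complex.normSq_apply] at this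
    nlinarith
  rw [norm_smul, Real.norm_eq_abs, abs_of_pos this, mul_inv, smul_smul, mul_right_comm,
    inv_mul_cancel₀ this.ne', one_mul]

/-- The chain rule also produces a term with φ'', but that term is tangential and disappears when
paired with the normal. Hence the second fundamental form transforms as a tensor. -/
theorem inner_fderiv_fderiv_comp_holomorphic (h0 : deriv φ q ≠ 0) (u v : ℂ) :
    inner ℝ (fderiv ℝ (fun y => fderiv ℝ (fun x => f (φ x)) y v) q u)
      (unitNormal (fun x => f (φ x)) q) =
    inner ℝ (fderiv ℝ (fderiv ℝ f) (φ q) (deriv φ q * u) (deriv φ q * v))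
      (unitNormal f (φ q)) := by
  have he : (fun y => fderiv ℝ (fun x => f (φ x)) y v) =ᶠ[𝓝 q]
      fun y => fderiv ℝ f (φ y) (deriv φ y * v) :=
    (hV.eventually_mem hq).mono fun y hy =>
      fderiv_comp_holomorphic (hf.smooth.differentiableAt_of_isOpen hU (hm hy))
        (hφ.differentiableAt (hV.mem_nhds hy)) v
  have hφq := hφ.differentiableAt (hV.mem_nhds hq)
  have hφ' : DifferentiableAt ℝ (fun y => deriv φ y * v) q :=
    (((hφ.deriv hV).differentiableAt (hV.mem_nhds hq)).restrictScalars ℝ).mul_const v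
  have hd : DifferentiableAt ℝ (fun y => fderiv ℝ f (φ y)) q := by
    have h1 : DifferentiableAt ℝ (fderiv ℝ f) (φ q) :=
      (hf.smooth.fderiv_of_isOpen (m := ∞) hU (by simp)).differentiableAt_of_isOpen hU (hm hq)
    exact h1.comp q (hφq.restrictScalars ℝ)
  rw [he.fderiv_eq, fderiv_clm_apply hd hφ', unitNormal_comp_holomorphic hU hV hf hφ hm hq h0]
  have h1 : DifferentiableAt ℝ (fderiv ℝ f) (φ q) :=
    (hf.smooth.fderiv_of_isOpen (m := ∞) hU (by simp)).differentiableAt_of_isOpen hU (hm hq)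
  simp only [_root_.add_apply, ContinuousLinearMap.comp_apply, ContinuousLinearMap.flip_apply,
    fderiv_comp_holomorphic h1 hφq, inner_add_left]
  rw [fderiv_eq_px_py f (φ q) ((fderiv ℝ (fun y => deriv φ y * v) q) u), inner_add_left,
    inner_smul_left, inner_smul_left, ← dX_eq_px, ← dY_eq_py,
    IsConformalImmersionOn.inner_dX_normal, IsConformalImmersionOn.inner_dY_normal]
  simp

/-- The factor φ'² is what makes Q dz² independent of the conformal chart; on it rest both the
changes of chart on M and the action of rotations. -/
theorem hopf_comp_holomorphic (h0 : deriv φ q ≠ 0) :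
    hopf (fun x => f (φ x)) q = deriv φ q ^ 2 * hopf f (φ q) := by
  have h11 : sffL (fun x => f (φ x)) q = _ :=
    inner_fderiv_fderiv_comp_holomorphic hU hV hf hφ hm hq h0 1 1
  have h12 : sffM (fun x => f (φ x)) q = _ :=
    inner_fderiv_fderiv_comp_holomorphic hU hV hf hφ hm hq h0 1 Complex.I
  have h22 : sffK (fun x => f (φ x)) q = _ :=
    inner_fderiv_fderiv_comp_holomorphic hU hV hf hφ hm hq h0 Complex.I Complex.I
  rw [sff_apply hU hf.smooth (hm hq)] at h11 h12 h22
  rw [hopf_eq_sff, hopf_eq_sff, h11, h12, h22]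
  apply Complex.ext <;> simp [sq] <;> ring

theorem meanCurv_comp_holomorphic (h0 : deriv φ q ≠ 0) :
    meanCurv (fun x => f (φ x)) q = meanCurv f (φ q) := by
  have h11 : sffL (fun x => f (φ x)) q = _ :=
    inner_fderiv_fderiv_comp_holomorphic hU hV hf hφ hm hq h0 1 1
  have h22 : sffK (fun x => f (φ x)) q = _ :=
    inner_fderiv_fderiv_comp_holomorphic hU hV hf hφ hm hq h0 Complex.I Complex.I
  rw [sff_apply hU hf.smooth (hm hq)] at h11 h22
  have hn : ‖deriv φ q‖ ^ 2 = (deriv φ q).re ^ 2 + (deriv φ q).im ^ 2 := by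
    rw [← Complex.normSq_eq_norm_sq, Complex.normSq_apply]; ring
  have hn0 : (deriv φ q).re ^ 2 + (deriv φ q).im ^ 2 ≠ 0 := by
    rw [← hn]; exact pow_ne_zero 2 (norm_ne_zero_iff.2 h0)
  have hE := (hf.cf_pos (hm hq)).ne'
  rw [meanCurv_eq_sff, meanCurv_eq_sff, h11, h22,
    conformalFactor_comp_holomorphic hU hV hf hφ hm hq, hn]
  simp
  field_simp
  ring

omit hq in
theorem isConformalImmersionOn_comp_holomorphic (h0 : ∀ q ∈ V, deriv φ q ≠ 0) :
    IsConformalImmersionOn (fun x => f (φ x)) V := by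
  have hs : ContDiffOn ℝ ∞ φ V := (hφ.contDiffOn (n := ∞) hV).restrict_scalars ℝ
  refine ⟨hf.smooth.comp hs hm, fun q hq => ?_, fun q hq => ?_, fun q hq h => ?_⟩
  · rw [dX_comp_holomorphic hU hV hf hφ hm hq, dY_comp_holomorphic hU hV hf hφ hm hq]
    simp only [inner_add_left, inner_add_right, inner_smul_left, inner_smul_right,
      IsConformalImmersionOn.inner_dX_dX, hf.inner_dY_dY (hm hq), hf.orthogonal _ (hm hq),
      real_inner_comm (dX f (φ q)) (dY f (φ q)), conj_trivial]
    ring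
  · refine (sq_eq_sq₀ (norm_nonneg _) (norm_nonneg _)).1 ?_
    rw [dX_comp_holomorphic hU hV hf hφ hm hq, dY_comp_holomorphic hU hV hf hφ hm hq,
      ← real_inner_self_eq_norm_sq, ← real_inner_self_eq_norm_sq]
    simp only [inner_add_left, inner_add_right, inner_smul_left, inner_smul_right,
      IsConformalImmersionOn.inner_dX_dX, hf.inner_dY_dY (hm hq), hf.orthogonal _ (hm hq),
      real_inner_comm (dX f (φ q)) (dY f (φ q)), conj_trivial]
    ring
  · have h1 := conformalFactor_comp_holomorphic hU hV hf hφ hm hq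
    rw [conformalFactor, h] at h1
    have := mul_pos (pow_pos (norm_pos_iff.2 (h0 q hq)) 2) (hf.cf_pos (hm hq))
    simp at h1
    rcases h1 with h1 | h1
    · exact h0 q hq h1
    · exact (hf.cf_pos (hm hq)).ne' h1

end CompHolomorphic

end BonnetSurf

namespace BonnetSurf

/-! ### Rigidity -/

namespace IsConformalImmersionOn

variable {f g : ℂ → E3} {U : Set ℂ} {p : ℂ}

/-! ### Gauss–Weingarten formulas, paired with a fixed vector -/

section GaussWeingarten

variable (hU : IsOpen U) (hf : IsConformalImmersionOn f U) (hp : p ∈ U) (v : E3)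
include hU hf hp

theorem differentiableAt_inner_dX : DifferentiableAt ℝ (fun q => inner ℝ (dX f q) v) p :=
  ((hf.contDiffOn_dX hU).differentiableAt_of_isOpen hU hp).inner ℝ (differentiableAt_const v)

theorem differentiableAt_inner_dY : DifferentiableAt ℝ (fun q => inner ℝ (dY f q) v) p :=
  ((hf.contDiffOn_dY hU).differentiableAt_of_isOpen hU hp).inner ℝ (differentiableAt_const v)

theorem differentiableAt_inner_normal :
    DifferentiableAt ℝ (fun q => inner ℝ (unitNormal f q) v) p :=
  ((hf.contDiffOn_unitNormal hU).differentiableAt_of_isOpen hU hp).inner ℝ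
    (differentiableAt_const v)

theorem px_inner_dX : px (fun q => inner ℝ (dX f q) v) p =
    (px (conformalFactor f) p / 2 * inner ℝ (dX f p) v -
      py (conformalFactor f) p / 2 * inner ℝ (dY f p) v) / conformalFactor f p +
      sffL f p * inner ℝ (unitNormal f p) v := by
  rw [px_inner ((hf.contDiffOn_dX hU).differentiableAt_of_isOpen hU hp) (differentiableAt_const v),
    px_const, inner_zero_right, add_zero, hf.inner_eq hp]
  rw [← dX_eq_px, hf.inner_dXX_dX hU hp, hf.inner_dXX_dY hU hp, sffL,
    real_inner_comm (unitNormal f p) (dX (dX f) p)]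
  ring

theorem py_inner_dX : py (fun q => inner ℝ (dX f q) v) p =
    (py (conformalFactor f) p / 2 * inner ℝ (dX f p) v +
      px (conformalFactor f) p / 2 * inner ℝ (dY f p) v) / conformalFactor f p +
      sffM f p * inner ℝ (unitNormal f p) v := by
  rw [py_inner ((hf.contDiffOn_dX hU).differentiableAt_of_isOpen hU hp) (differentiableAt_const v),
    py_const, inner_zero_right, add_zero, hf.inner_eq hp]
  rw [← dY_eq_py, hf.dY_dX hU hp, hf.inner_dXY_dX hU hp, hf.inner_dXY_dY hU hp, sffM,
    real_inner_comm (unitNormal f p) (dX (dY f) p)]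
  ring

theorem px_inner_dY : px (fun q => inner ℝ (dY f q) v) p =
    (py (conformalFactor f) p / 2 * inner ℝ (dX f p) v +
      px (conformalFactor f) p / 2 * inner ℝ (dY f p) v) / conformalFactor f p +
      sffM f p * inner ℝ (unitNormal f p) v := by
  rw [px_inner ((hf.contDiffOn_dY hU).differentiableAt_of_isOpen hU hp) (differentiableAt_const v),
    px_const, inner_zero_right, add_zero, hf.inner_eq hp]
  rw [← dX_eq_px, hf.inner_dXY_dX hU hp, hf.inner_dXY_dY hU hp, sffM,
    real_inner_comm (unitNormal f p) (dX (dY f) p)]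
  ring

theorem py_inner_dY : py (fun q => inner ℝ (dY f q) v) p =
    (-px (conformalFactor f) p / 2 * inner ℝ (dX f p) v +
      py (conformalFactor f) p / 2 * inner ℝ (dY f p) v) / conformalFactor f p +
      sffK f p * inner ℝ (unitNormal f p) v := by
  rw [py_inner ((hf.contDiffOn_dY hU).differentiableAt_of_isOpen hU hp) (differentiableAt_const v),
    py_const, inner_zero_right, add_zero, hf.inner_eq hp]
  rw [← dY_eq_py, hf.inner_dYY_dX hU hp, hf.inner_dYY_dY hU hp, sffK,
    real_inner_comm (unitNormal f p) (dY (dY f) p)]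
  ring

theorem px_inner_unitNormal : px (fun q => inner ℝ (unitNormal f q) v) p =
    -(sffL f p * inner ℝ (dX f p) v + sffM f p * inner ℝ (dY f p) v) / conformalFactor f p := by
  rw [px_inner ((hf.contDiffOn_unitNormal hU).differentiableAt_of_isOpen hU hp)
    (differentiableAt_const v), px_const, inner_zero_right, add_zero, hf.inner_eq hp]
  rw [hf.inner_px_normal_dX hU hp, hf.inner_px_normal_dY hU hp, hf.inner_px_normal_normal hU hp]
  ring

theorem py_inner_unitNormal : py (fun q => inner ℝ (unitNormal f q) v) p =
    -(sffM f p * inner ℝ (dX f p) v + sffK f p * inner ℝ (dY f p) v) / conformalFactor f p := by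
  rw [py_inner ((hf.contDiffOn_unitNormal hU).differentiableAt_of_isOpen hU hp)
    (differentiableAt_const v), py_const, inner_zero_right, add_zero, hf.inner_eq hp]
  rw [hf.inner_py_normal_dX hU hp, hf.inner_py_normal_dY hU hp, hf.inner_py_normal_normal hU hp]
  ring

end GaussWeingarten

end IsConformalImmersionOn

/-- The linear map taking the frame `(f_x, f_y, N)` of `f` to that of `g`. -/
def transfer (f g : ℂ → E3) (p : ℂ) : E3 →ₗ[ℝ] E3 where
  toFun v := (inner ℝ (dX f p) v / conformalFactor f p) • dX g p +
    (inner ℝ (dY f p) v / conformalFactor f p) • dY g p +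
    (inner ℝ (unitNormal f p) v : ℝ) • unitNormal g p
  map_add' v w := by simp only [inner_add_right, add_div, add_smul]; abel
  map_smul' c v := by
    simp only [inner_smul_right, mul_div_assoc, mul_smul, smul_add, RingHom.id_apply]

theorem transfer_apply (f g : ℂ → E3) (p : ℂ) (v : E3) :
    transfer f g p v = (inner ℝ (dX f p) v / conformalFactor f p) • dX g p +
    (inner ℝ (dY f p) v / conformalFactor f p) • dY g p +
    (inner ℝ (unitNormal f p) v : ℝ) • unitNormal g p := rfl

namespace IsConformalImmersionOn

variable {f g : ℂ → E3} {U : Set ℂ} {p : ℂ}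

theorem inner_transfer (f g : ℂ → E3) (p : ℂ) (v w : E3) :
    inner ℝ (transfer f g p v) w =
      (conformalFactor f p)⁻¹ * (inner ℝ (dX f p) v * inner ℝ (dX g p) w +
        inner ℝ (dY f p) v * inner ℝ (dY g p) w) +
      inner ℝ (unitNormal f p) v * inner ℝ (unitNormal g p) w := by
  rw [transfer_apply, inner_add_left, inner_add_left, inner_smul_left, inner_smul_left,
    inner_smul_left]
  simp only [conj_trivial]
  ring

/-! ### Two immersions with equal fundamental forms -/

section SameForms

variable (hU : IsOpen U) (hf : IsConformalImmersionOn f U)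
    (hg : IsConformalImmersionOn g U) (hE : ∀ q ∈ U, conformalFactor g q = conformalFactor f q)
include hf hg hE

/-- Equal conformal factors give the two frames the same Gram matrix, so the change of frame is
orthogonal. -/
theorem norm_transfer (hp : p ∈ U) (v : E3) : ‖transfer f g p v‖ = ‖v‖ := by
  have h0 := (hf.cf_pos hp).ne'
  refine (sq_eq_sq₀ (norm_nonneg _) (norm_nonneg _)).1 ?_
  have hba : inner ℝ (dY g p) (dX g p) = (0 : ℝ) := by
    rw [real_inner_comm, hg.orthogonal p hp]
  have hx : inner ℝ (dX g p) (transfer f g p v) = inner ℝ (dX f p) v := by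
    rw [real_inner_comm (transfer f g p v), inner_transfer, inner_dX_dX, hba,
      real_inner_comm (dX g p) (unitNormal g p), inner_dX_normal, hE p hp]
    field_simp
    ring
  have hy : inner ℝ (dY g p) (transfer f g p v) = inner ℝ (dY f p) v := by
    rw [real_inner_comm (transfer f g p v), inner_transfer, hg.inner_dY_dY hp, hg.orthogonal p hp,
      real_inner_comm (dY g p) (unitNormal g p), inner_dY_normal, hE p hp]
    field_simp
    ring
  have hn : inner ℝ (unitNormal g p) (transfer f g p v) = inner ℝ (unitNormal f p) v := by
    rw [real_inner_comm (transfer f g p v), inner_transfer, hg.inner_normal_normal hp,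
      inner_dX_normal, inner_dY_normal]
    ring
  rw [← real_inner_self_eq_norm_sq, ← real_inner_self_eq_norm_sq, inner_transfer,
    hf.inner_eq hp v v, hx, hy, hn]
  field_simp

omit hg hE in
theorem transfer_dX (hp : p ∈ U) : transfer f g p (dX f p) = dX g p := by
  have h0 := (hf.cf_pos hp).ne'
  rw [transfer_apply, inner_dX_dX, real_inner_comm, hf.orthogonal p hp,
    real_inner_comm (dX f p) (unitNormal f p), inner_dX_normal]
  simp [h0]

omit hg hE in
theorem transfer_dY (hp : p ∈ U) : transfer f g p (dY f p) = dY g p := by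
  have h0 := (hf.cf_pos hp).ne'
  rw [transfer_apply, hf.inner_dY_dY hp, hf.orthogonal p hp,
    real_inner_comm (dY f p) (unitNormal f p), inner_dY_normal]
  simp [h0]

variable (hH : ∀ q ∈ U, meanCurv g q = meanCurv f q) (hQ : ∀ q ∈ U, hopf g q = hopf f q)
include hU hH hQ

/-- The frames of f and g solve the same Gauss–Weingarten system, whose coefficients involve only
the metric, H and Q. Hence each matrix coefficient ⟨T v, w⟩ of the change of frame has zero
derivative. -/
theorem transfer_eq (hUc : IsPreconnected U) {q : ℂ} (hp : p ∈ U) (hq : q ∈ U) :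
    transfer f g p = transfer f g q := by
  ext1 v
  refine ext_inner_right ℝ fun w => ?_
  rw [inner_transfer, inner_transfer]
  have dE : ∀ q ∈ U, DifferentiableAt ℝ (conformalFactor f) q := fun q hq =>
    (hf.contDiffOn_cf hU).differentiableAt_of_isOpen hU hq
  have d1 : ∀ q ∈ U, DifferentiableAt ℝ (fun q => (conformalFactor f q)⁻¹) q := fun q hq =>
    (dE q hq).fun_inv (hf.cf_pos hq).ne'
  have d2 : ∀ q ∈ U, DifferentiableAt ℝ
      (fun q => inner ℝ (dX f q) v * inner ℝ (dX g q) w) q := fun q hq =>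
    (hf.differentiableAt_inner_dX hU hq v).fun_mul (hg.differentiableAt_inner_dX hU hq w)
  have d3 : ∀ q ∈ U, DifferentiableAt ℝ
      (fun q => inner ℝ (dY f q) v * inner ℝ (dY g q) w) q := fun q hq =>
    (hf.differentiableAt_inner_dY hU hq v).fun_mul (hg.differentiableAt_inner_dY hU hq w)
  have d4 : ∀ q ∈ U, DifferentiableAt ℝ
      (fun q => inner ℝ (unitNormal f q) v * inner ℝ (unitNormal g q) w) q := fun q hq =>
    (hf.differentiableAt_inner_normal hU hq v).fun_mul (hg.differentiableAt_inner_normal hU hq w)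
  have d5 : ∀ q ∈ U, DifferentiableAt ℝ (fun q => (conformalFactor f q)⁻¹ *
      (inner ℝ (dX f q) v * inner ℝ (dX g q) w + inner ℝ (dY f q) v * inner ℝ (dY g q) w)) q :=
    fun q hq => (d1 q hq).fun_mul ((d2 q hq).fun_add (d3 q hq))
  have he : ∀ q ∈ U, conformalFactor g =ᶠ[𝓝 q] conformalFactor f := fun q hq =>
    (hU.eventually_mem hq).mono hE
  have hL : ∀ q ∈ U, sffL g q = sffL f q := fun q hq => by
    rw [hg.sffL_eq hq, hf.sffL_eq hq, hE q hq, hH q hq, hQ q hq]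
  have hK : ∀ q ∈ U, sffK g q = sffK f q := fun q hq => by
    rw [hg.sffK_eq hq, hf.sffK_eq hq, hE q hq, hH q hq, hQ q hq]
  have hM : ∀ q ∈ U, sffM g q = sffM f q := fun q hq => by
    rw [sffM_eq, sffM_eq, hQ q hq]
  refine hU.is_const_of_fderiv_eq_zero (𝕜 := ℝ) (f := fun q => (conformalFactor f q)⁻¹ *
      (inner ℝ (dX f q) v * inner ℝ (dX g q) w + inner ℝ (dY f q) v * inner ℝ (dY g q) w) +
      inner ℝ (unitNormal f q) v * inner ℝ (unitNormal g q) w) hUc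
    (fun q hq => ((d5 q hq).fun_add (d4 q hq)).differentiableWithinAt) (fun q hq => ?_) hp hq
  have h0 := (hf.cf_pos hq).ne'
  ext1 z
  rw [fderiv_eq_px_py, px_add (d5 q hq) (d4 q hq), py_add (d5 q hq) (d4 q hq),
    px_mul (d1 q hq) ((d2 q hq).fun_add (d3 q hq)), py_mul (d1 q hq) ((d2 q hq).fun_add (d3 q hq)),
    px_add (d2 q hq) (d3 q hq), py_add (d2 q hq) (d3 q hq), px_inv (dE q hq) h0,
    py_inv (dE q hq) h0,
    px_mul (hf.differentiableAt_inner_dX hU hq v) (hg.differentiableAt_inner_dX hU hq w),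
    py_mul (hf.differentiableAt_inner_dX hU hq v) (hg.differentiableAt_inner_dX hU hq w),
    px_mul (hf.differentiableAt_inner_dY hU hq v) (hg.differentiableAt_inner_dY hU hq w),
    py_mul (hf.differentiableAt_inner_dY hU hq v) (hg.differentiableAt_inner_dY hU hq w),
    px_mul (hf.differentiableAt_inner_normal hU hq v) (hg.differentiableAt_inner_normal hU hq w),
    py_mul (hf.differentiableAt_inner_normal hU hq v) (hg.differentiableAt_inner_normal hU hq w),
    hf.px_inner_dX hU hq, hg.px_inner_dX hU hq, hf.py_inner_dX hU hq, hg.py_inner_dX hU hq,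
    hf.px_inner_dY hU hq, hg.px_inner_dY hU hq, hf.py_inner_dY hU hq, hg.py_inner_dY hU hq,
    hf.px_inner_unitNormal hU hq, hg.px_inner_unitNormal hU hq,
    hf.py_inner_unitNormal hU hq, hg.py_inner_unitNormal hU hq, px_congr (he q hq),
    py_congr (he q hq), hE q hq, hL q hq, hM q hq, hK q hq]
  have hx : ∀ a b : ℝ, a = 0 → b = 0 → z.re • a + z.im • b = 0 := fun a b ha hb => by simp [ha, hb]
  refine hx _ _ ?_ ?_
  · field_simp; ring
  · field_simp; ring

/-- The transfer map carries df to dg at every point, because it does not depend on the point; so g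
- T ∘ f has zero derivative. -/
theorem sub_transfer_eq (hUc : IsPreconnected U) {q : ℂ} (hp : p ∈ U) (hq : q ∈ U) :
    g q - transfer f g p (f q) = g p - transfer f g p (f p) := by
  have hdf : ∀ q ∈ U, DifferentiableAt ℝ f q := fun q hq =>
    hf.smooth.differentiableAt_of_isOpen hU hq
  have hdg : ∀ q ∈ U, DifferentiableAt ℝ g q := fun q hq =>
    hg.smooth.differentiableAt_of_isOpen hU hq
  let C : E3 →L[ℝ] E3 := (transfer f g p).toContinuousLinearMap
  have hC : ∀ q ∈ U, DifferentiableAt ℝ (fun q => C (f q)) q := fun q hq =>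
    C.differentiableAt.comp q (hdf q hq)
  refine hU.is_const_of_fderiv_eq_zero (𝕜 := ℝ) (f := fun q => g q - C (f q)) hUc
    (fun q hq => ((hdg q hq).fun_sub (hC q hq)).differentiableWithinAt) (fun q hq => ?_) hq hp
  ext1 z
  rw [fderiv_eq_px_py, px_sub (hdg q hq) (hC q hq), py_sub (hdg q hq) (hC q hq),
    px_clm C (hdf q hq), py_clm C (hdf q hq)]
  have h1 : C (px f q) = px g q := by
    change transfer f g p (dX f q) = dX g q
    rw [transfer_eq hU hf hg hE hH hQ hUc hp hq, transfer_dX hf hq]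
  have h2 : C (py f q) = py g q := by
    change transfer f g p (dY f q) = dY g q
    rw [transfer_eq hU hf hg hE hH hQ hUc hp hq, transfer_dY hf hq]
  simp [h1, h2]

/-- Conformal immersions with the same fundamental forms differ by an isometry of the ambient
space. -/
theorem exists_isometry (hUc : IsPreconnected U) :
    ∃ A : E3 ≃ᵢ E3, ∀ q ∈ U, g q = A (f q) := by
  rcases U.eq_empty_or_nonempty with rfl | ⟨p, hp⟩
  · exact ⟨IsometryEquiv.refl _, by simp⟩
  let C : E3 →ₗᵢ[ℝ] E3 := ⟨transfer f g p, norm_transfer hf hg hE hp⟩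
  let C' : E3 ≃ₗᵢ[ℝ] E3 := C.toLinearIsometryEquiv rfl
  refine ⟨C'.toIsometryEquiv.trans (IsometryEquiv.addRight (g p - transfer f g p (f p))),
    fun q hq => ?_⟩
  change g q = transfer f g p (f q) + (g p - transfer f g p (f p))
  rw [← sub_transfer_eq hU hf hg hE hH hQ hUc hp hq]
  abel

end SameForms

end IsConformalImmersionOn

/-- Both tangent frames are rotated and scaled in the same way and both normals are unchanged. Thus
the change of frame belongs to the point of M and not to the chart, which allows rigidity to be
proved on a whole surface. -/
theorem transfer_comp_holomorphic {f g : ℂ → E3} {φ : ℂ → ℂ} {U V : Set ℂ} {q : ℂ}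
    (hU : IsOpen U) (hV : IsOpen V) (hf : IsConformalImmersionOn f U)
    (hg : IsConformalImmersionOn g U) (hφ : DifferentiableOn ℂ φ V) (hm : MapsTo φ V U)
    (hq : q ∈ V) (h0 : deriv φ q ≠ 0) :
    transfer (fun x => f (φ x)) (fun x => g (φ x)) q = transfer f g (φ q) := by
  ext1 v
  refine ext_inner_right ℝ fun w => ?_
  have hn : ‖deriv φ q‖ ^ 2 = (deriv φ q).re ^ 2 + (deriv φ q).im ^ 2 := by
    rw [← Complex.normSq_eq_norm_sq, Complex.normSq_apply]; ring
  have hn0 : (deriv φ q).re ^ 2 + (deriv φ q).im ^ 2 ≠ 0 := by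
    rw [← hn]; exact pow_ne_zero 2 (norm_ne_zero_iff.2 h0)
  have hE := (hf.cf_pos (hm hq)).ne'
  rw [IsConformalImmersionOn.inner_transfer, IsConformalImmersionOn.inner_transfer,
    dX_comp_holomorphic hU hV hf hφ hm hq, dY_comp_holomorphic hU hV hf hφ hm hq,
    dX_comp_holomorphic hU hV hg hφ hm hq, dY_comp_holomorphic hU hV hg hφ hm hq,
    unitNormal_comp_holomorphic hU hV hf hφ hm hq h0,
    unitNormal_comp_holomorphic hU hV hg hφ hm hq h0,
    conformalFactor_comp_holomorphic hU hV hf hφ hm hq, hn]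
  simp only [inner_add_left, inner_smul_left, conj_trivial]
  field_simp
  ring

/-! ### Isometries and homotheties of the ambient space -/

/-- The Mazur–Ulam theorem. -/
theorem exists_linear_part (A : E3 ≃ᵢ E3) : ∃ (L : E3 ≃ₗᵢ[ℝ] E3) (c : E3), ∀ x, A x = L x + c := by
  refine ⟨A.toRealAffineIsometryEquiv.linearIsometryEquiv, A 0, fun x => ?_⟩
  have := A.toRealAffineIsometryEquiv.map_vadd 0 x
  simpa using this

section Similarity

variable {f : ℂ → E3} {U : Set ℂ} (hU : IsOpen U) (hf : IsConformalImmersionOn f U)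
include hU hf

omit hU hf in
theorem dX_isometry (L : E3 ≃ₗᵢ[ℝ] E3) (c : E3) {p : ℂ} {h : ℂ → E3}
    (hh : DifferentiableAt ℝ h p) : dX (fun x => L (h x) + c) p = L (dX h p) := by
  have hL : DifferentiableAt ℝ (fun x => L (h x)) p := L.differentiableAt.comp p hh
  have := px_add hL (differentiableAt_const c)
  rw [dX_eq_px, this, px_const, add_zero]
  exact px_clm (L.toContinuousLinearEquiv : E3 →L[ℝ] E3) hh

omit hU hf in
theorem dY_isometry (L : E3 ≃ₗᵢ[ℝ] E3) (c : E3) {p : ℂ} {h : ℂ → E3}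
    (hh : DifferentiableAt ℝ h p) : dY (fun x => L (h x) + c) p = L (dY h p) := by
  have hL : DifferentiableAt ℝ (fun x => L (h x)) p := L.differentiableAt.comp p hh
  have := py_add hL (differentiableAt_const c)
  rw [dY_eq_py, this, py_const, add_zero]
  exact py_clm (L.toContinuousLinearEquiv : E3 →L[ℝ] E3) hh

theorem isConformalImmersionOn_isometry (A : E3 ≃ᵢ E3) :
    IsConformalImmersionOn (fun x => A (f x)) U := by
  obtain ⟨L, c, hA⟩ := exists_linear_part A
  simp only [hA]
  have hd : ∀ p ∈ U, DifferentiableAt ℝ f p := fun p hp =>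
    hf.smooth.differentiableAt_of_isOpen hU hp
  refine ⟨(L.contDiff.comp_contDiffOn hf.smooth).add contDiffOn_const, fun p hp => ?_,
    fun p hp => ?_, fun p hp => ?_⟩
  · rw [dX_isometry L c (hd p hp), dY_isometry L c (hd p hp), L.inner_map_map,
      hf.orthogonal p hp]
  · rw [dX_isometry L c (hd p hp), dY_isometry L c (hd p hp), L.norm_map, L.norm_map,
      hf.norm_eq p hp]
  · rw [dX_isometry L c (hd p hp)]
    simpa using hf.ne_zero p hp

/-- An isometry of the ambient space preserves the second fundamental form up to sign. -/
theorem forms_isometry (A : E3 ≃ᵢ E3) {p : ℂ} (hp : p ∈ U) :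
    (hopf (fun x => A (f x)) p = hopf f p ∧ meanCurv (fun x => A (f x)) p = meanCurv f p) ∨
    (hopf (fun x => A (f x)) p = - hopf f p ∧
      meanCurv (fun x => A (f x)) p = - meanCurv f p) := by
  have hg := isConformalImmersionOn_isometry hU hf A
  obtain ⟨L, c, hA⟩ := exists_linear_part A
  simp only [hA] at hg ⊢
  have hd : ∀ p ∈ U, DifferentiableAt ℝ f p := fun p hp =>
    hf.smooth.differentiableAt_of_isOpen hU hp
  have hX : ∀ p ∈ U, dX (fun x => L (f x) + c) p = L (dX f p) := fun p hp =>
    dX_isometry L c (hd p hp)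
  have hY : ∀ p ∈ U, dY (fun x => L (f x) + c) p = L (dY f p) := fun p hp =>
    dY_isometry L c (hd p hp)
  have hX' : dX (fun x => L (f x) + c) =ᶠ[𝓝 p] fun q => L (dX f q) + 0 :=
    (hU.eventually_mem hp).mono fun q hq => (hX q hq).trans (add_zero _).symm
  have hY' : dY (fun x => L (f x) + c) =ᶠ[𝓝 p] fun q => L (dY f q) + 0 :=
    (hU.eventually_mem hp).mono fun q hq => (hY q hq).trans (add_zero _).symm
  have sX := (hf.contDiffOn_dX hU).differentiableAt_of_isOpen hU hp
  have sY := (hf.contDiffOn_dY hU).differentiableAt_of_isOpen hU hp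
  have hXX := (dX_congr hX').trans (dX_isometry L 0 sX)
  have hXY := (dX_congr hY').trans (dX_isometry L 0 sY)
  have hYY := (dY_congr hY').trans (dY_isometry L 0 sY)
  have hE : conformalFactor (fun x => L (f x) + c) p = conformalFactor f p := by
    rw [conformalFactor, hX p hp, L.norm_map, conformalFactor]
  set g := fun x => L (f x) + c with hgdef
  -- L(N_f) is a unit vector orthogonal to the tangent plane of the image surface, so it is ε times
  -- the normal of that surface with ε = ±1. This sign is the only effect on Q and H.
  set ε : ℝ := inner ℝ (unitNormal g p) (L (unitNormal f p)) with hε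
  have key : ∀ w : E3, inner ℝ (L (unitNormal f p)) w = ε * inner ℝ (unitNormal g p) w := by
    intro w
    rw [hg.inner_eq hp, hX p hp, hY p hp, L.inner_map_map, L.inner_map_map,
      IsConformalImmersionOn.inner_dX_normal, IsConformalImmersionOn.inner_dY_normal]
    simp [hε]
  have hε2 : ε * ε = 1 := by
    have := key (L (unitNormal f p))
    rw [L.inner_map_map, hf.inner_normal_normal hp] at this
    exact this.symm
  have hs : ∀ w : E3, inner ℝ (L w) (unitNormal g p) = ε * inner ℝ w (unitNormal f p) := by
    intro w
    have := key (L w)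
    rw [L.inner_map_map] at this
    rw [real_inner_comm, real_inner_comm (unitNormal f p) w, this, ← mul_assoc, hε2, one_mul]
  have hL : sffL g p = ε * sffL f p := by rw [sffL, hXX, hs]; rfl
  have hM : sffM g p = ε * sffM f p := by rw [sffM, hXY, hs]; rfl
  have hK : sffK g p = ε * sffK f p := by rw [sffK, hYY, hs]; rfl
  have hε' : ε = 1 ∨ ε = -1 := mul_self_eq_one_iff.1 hε2
  rw [hopf_eq_sff, hopf_eq_sff, meanCurv_eq_sff, meanCurv_eq_sff, hL, hM, hK, hE]
  rcases hε' with h | h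
  · left; simp [h]
  · right
    rw [h]
    constructor
    · push_cast; ring
    · ring

variable {ρ : ℝ} (hρ : ρ ≠ 0)
include hρ

omit hρ hU hf in
theorem dX_smul (ρ : ℝ) (f : ℂ → E3) (p : ℂ) : dX (fun x => ρ • f x) p = ρ • dX f p := by
  unfold dX
  rw [show (fun x => ρ • f x) = ρ • f from rfl, fderiv_const_smul_field]; rfl

omit hρ hU hf in
theorem dY_smul (ρ : ℝ) (f : ℂ → E3) (p : ℂ) : dY (fun x => ρ • f x) p = ρ • dY f p := by
  unfold dY
  rw [show (fun x => ρ • f x) = ρ • f from rfl, fderiv_const_smul_field]; rfl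

-- The vector product is multiplied by ρ² > 0, so even a negative homothety factor keeps the normal.
-- Consequently Q is multiplied by ρ with its sign, which is what the normal form needs when the
-- real constant b is negative.
omit hU hf in
theorem unitNormal_smul (f : ℂ → E3) (p : ℂ) :
    unitNormal (fun x => ρ • f x) p = unitNormal f p := by
  have hv : vprod (ρ • dX f p) (ρ • dY f p) = ρ ^ 2 • vprod (dX f p) (dY f p) := by
    ext i
    fin_cases i
    · simp [(vprod_apply _ _).1]; ring
    · simp [(vprod_apply _ _).2.1]; ring
    · simp [(vprod_apply _ _).2.2]; ring
  have h2 : 0 < ρ ^ 2 := by positivity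
  rw [unitNormal, dX_smul, dY_smul, hv, norm_smul, Real.norm_eq_abs, abs_of_pos h2, mul_inv,
    smul_smul, mul_right_comm, inv_mul_cancel₀ h2.ne', one_mul, unitNormal]

omit hU hf in
theorem sff_smul (f : ℂ → E3) (p : ℂ) : sffL (fun x => ρ • f x) p = ρ * sffL f p ∧
    sffM (fun x => ρ • f x) p = ρ * sffM f p ∧ sffK (fun x => ρ • f x) p = ρ * sffK f p := by
  have hX : dX (fun x => ρ • f x) = fun q => ρ • dX f q := funext fun q => dX_smul ρ f q
  have hY : dY (fun x => ρ • f x) = fun q => ρ • dY f q := funext fun q => dY_smul ρ f q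
  unfold sffL sffM sffK
  rw [unitNormal_smul hρ, hX, hY, dX_smul, dX_smul, dY_smul, inner_smul_left, inner_smul_left,
    inner_smul_left]
  exact ⟨rfl, rfl, rfl⟩

omit hU in
theorem isConformalImmersionOn_smul : IsConformalImmersionOn (fun x => ρ • f x) U := by
  refine ⟨(contDiff_const_smul ρ).comp_contDiffOn hf.smooth, fun p hp => ?_, fun p hp => ?_,
    fun p hp => ?_⟩
  · rw [dX_smul, dY_smul, inner_smul_left, inner_smul_right, hf.orthogonal p hp]; simp
  · rw [dX_smul, dY_smul, norm_smul, norm_smul, hf.norm_eq p hp]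
  · rw [dX_smul]; exact smul_ne_zero hρ (hf.ne_zero p hp)

omit hU hf in
theorem hopf_smul (f : ℂ → E3) (p : ℂ) : hopf (fun x => ρ • f x) p = ρ * hopf f p := by
  obtain ⟨h1, h2, h3⟩ := sff_smul hρ f p
  rw [hopf_eq_sff, hopf_eq_sff, h1, h2, h3]
  push_cast; ring

end Similarity

end BonnetSurf

namespace BonnetSurf

/-! ### Existence of a conformal immersion with given fundamental forms -/

/-- The vector product as a continuous bilinear map. -/
def vprodL : E3 →L[ℝ] E3 →L[ℝ] E3 :=
  LinearMap.toContinuousBilinearMap (LinearMap.mk₂ ℝ vprod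
    (fun a b c => by ext i; fin_cases i <;> simp [vprod, cross_apply])
    (fun a b c => by ext i; fin_cases i <;> simp [vprod, cross_apply])
    (fun a b c => by ext i; fin_cases i <;> simp [vprod, cross_apply] <;> ring)
    (fun a b c => by ext i; fin_cases i <;> simp [vprod, cross_apply]))

theorem vprodL_apply (a b : E3) : vprodL a b = vprod a b := rfl

/-- The Jacobi identity: the commutator of two cross-product operators is the cross product with the
product. It reduces flatness of the connection form to a vector equation for its two components. -/
theorem vprod_jacobi (a b c : E3) :
    vprod a (vprod b c) - vprod b (vprod a c) = vprod (vprod a b) c := by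
  ext i
  fin_cases i <;> simp [vprod, cross_apply] <;> ring

/-- Bootstrapping for solutions of a first-order system: if the derivative is as smooth as y itself,
each order of smoothness yields the next. -/
theorem contDiffOn_of_fderiv_eq {V F : Type*} [NormedAddCommGroup V] [NormedSpace ℝ V]
    [NormedAddCommGroup F] [NormedSpace ℝ F] {U : Set V} (hU : IsOpen U) {y : V → F}
    {D : V → V →L[ℝ] F} (hD : ∀ n : ℕ, ContDiffOn ℝ n y U → ContDiffOn ℝ n D U)
    (hy : ∀ p ∈ U, HasFDerivAt y (D p) p) : ContDiffOn ℝ ∞ y U := by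
  refine contDiffOn_infty.2 fun n => ?_
  induction n with
  | zero =>
    exact contDiffOn_zero.2 fun p hp => (hy p hp).continuousAt.continuousWithinAt
  | succ n ih =>
    rw [show ((n + 1 : ℕ) : WithTop ℕ∞) = (n : WithTop ℕ∞) + 1 by simp,
      contDiffOn_succ_iff_fderiv_of_isOpen hU]
    refine ⟨fun p hp => (hy p hp).differentiableAt.differentiableWithinAt, by simp, ?_⟩
    exact (hD n ih).congr fun p hp => (hy p hp).fderiv

/-- The Maurer-Cartan form with the values `Wx`, `Wy` on the coordinate vectors. -/
def connForm (Wx Wy : ℂ → E3) (p : ℂ) : ℂ →L[ℝ] E3 →L[ℝ] E3 :=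
  Complex.reCLM.smulRight (vprodL (Wx p)) + Complex.imCLM.smulRight (vprodL (Wy p))

theorem connForm_apply (Wx Wy : ℂ → E3) (p v : ℂ) (y : E3) :
    connForm Wx Wy p v y = v.re • vprod (Wx p) y + v.im • vprod (Wy p) y := by
  simp [connForm, vprodL_apply]

/-- A frame along a disc with prescribed flat connection form. -/
theorem exists_frame {r : ℝ} (hr : 0 < r) {Wx Wy : ℂ → E3}
    (hx : ContDiffOn ℝ ∞ Wx (Metric.ball 0 r)) (hy : ContDiffOn ℝ ∞ Wy (Metric.ball 0 r))
    (flat : ∀ p ∈ Metric.ball (0 : ℂ) r, py Wx p - px Wy p + vprod (Wx p) (Wy p) = 0) :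
    ∃ e : Fin 3 → ℂ → E3, (∀ i, ContDiffOn ℝ ∞ (e i) (Metric.ball 0 r)) ∧
      (∀ p ∈ Metric.ball (0 : ℂ) r, (∀ i j, inner ℝ (e i p) (e j p) = if i = j then (1 : ℝ) else 0) ∧
        vprod (e 0 p) (e 1 p) = e 2 p ∧
        px (e 0) p = -Wx p 2 • e 1 p + Wx p 1 • e 2 p ∧
        px (e 1) p = Wx p 2 • e 0 p - Wx p 0 • e 2 p ∧
        py (e 0) p = -Wy p 2 • e 1 p + Wy p 1 • e 2 p ∧
        py (e 1) p = Wy p 2 • e 0 p - Wy p 0 • e 2 p) := by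
  have hκ : ContDiffOn ℝ ∞ (connForm Wx Wy) (Metric.ball 0 r) := by
    have h1 : ContDiffOn ℝ ∞ (fun p => vprodL (Wx p)) (Metric.ball 0 r) :=
      vprodL.contDiff.comp_contDiffOn hx
    have h2 : ContDiffOn ℝ ∞ (fun p => vprodL (Wy p)) (Metric.ball 0 r) :=
      vprodL.contDiff.comp_contDiffOn hy
    exact (contDiffOn_const.smulRight h1).add (contDiffOn_const.smulRight h2)
  have hκd : ∀ p ∈ Metric.ball (0 : ℂ) r, ∀ u v y, fderiv ℝ (connForm Wx Wy) p u v y =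
      v.re • vprod (fderiv ℝ Wx p u) y + v.im • vprod (fderiv ℝ Wy p u) y := by
    intro p hp u v y
    have dκ := hκ.differentiableAt_of_isOpen Metric.isOpen_ball hp
    have d1 : DifferentiableAt ℝ (fun q => connForm Wx Wy q v) p :=
      dκ.clm_apply (differentiableAt_const v)
    have e1 : fderiv ℝ (connForm Wx Wy) p u v y =
        fderiv ℝ (fun q => connForm Wx Wy q v y) p u := by
      rw [fderiv_clm_apply d1 (differentiableAt_const y),
        fderiv_clm_apply dκ (differentiableAt_const v)]
      simp
    have dx := hx.differentiableAt_of_isOpen Metric.isOpen_ball hp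
    have dy := hy.differentiableAt_of_isOpen Metric.isOpen_ball hp
    have h1 : HasFDerivAt (fun q => vprod (Wx q) y) ((vprodL.flip y).comp (fderiv ℝ Wx p)) p :=
      (vprodL.flip y).hasFDerivAt.comp p dx.hasFDerivAt
    have h2 : HasFDerivAt (fun q => vprod (Wy q) y) ((vprodL.flip y).comp (fderiv ℝ Wy p)) p :=
      (vprodL.flip y).hasFDerivAt.comp p dy.hasFDerivAt
    have h3 := (h1.fun_const_smul v.re).fun_add (h2.fun_const_smul v.im)
    rw [e1]
    simp only [connForm_apply]
    rw [h3.fderiv]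
    simp [vprodL_apply]
  have hskew : ∀ p ∈ Metric.ball (0 : ℂ) r, ∀ v x, inner ℝ x (connForm Wx Wy p v x) = 0 := by
    intro p _ v x
    rw [connForm_apply, inner_add_right, inner_smul_right, inner_smul_right, inner_vprod_right,
      inner_vprod_right]
    simp
  have hflat : ∀ p ∈ Metric.ball (0 : ℂ) r, ∀ u v x,
      fderiv ℝ (connForm Wx Wy) p u v x + connForm Wx Wy p v (connForm Wx Wy p u x) =
      fderiv ℝ (connForm Wx Wy) p v u x + connForm Wx Wy p u (connForm Wx Wy p v x) := by
    intro p hp u v x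
    have hj := vprod_jacobi (Wx p) (Wy p) x
    have hf := flat p hp
    rw [hκd p hp, hκd p hp, fderiv_eq_px_py Wx p u, fderiv_eq_px_py Wx p v,
      fderiv_eq_px_py Wy p u, fderiv_eq_px_py Wy p v]
    simp only [connForm_apply, ← vprodL_apply] at hj hf ⊢
    have hw : py Wx p = px Wy p - vprodL (Wx p) (Wy p) := by
      rw [← sub_eq_zero, ← hf]; abel
    rw [hw]
    simp only [map_add, map_sub, map_smul, _root_.add_apply, _root_.sub_apply, _root_.smul_apply,
      ← hj]
    module
  choose y hy0 hyd using fun c : Fin 3 => exists_parallel_of_flat hκ hskew hflat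
    (EuclideanSpace.single c (1 : ℝ))
  have hys : ∀ c, ContDiffOn ℝ ∞ (y c) (Metric.ball 0 r) := fun c =>
    contDiffOn_of_fderiv_eq Metric.isOpen_ball (fun n hn => by
      have h1 : ContDiffOn ℝ n (fun p => vprodL (Wx p) (y c p)) (Metric.ball 0 r) :=
        (vprodL.contDiff.comp_contDiffOn (hx.of_le (by exact_mod_cast le_top))).clm_apply hn
      have h2 : ContDiffOn ℝ n (fun p => vprodL (Wy p) (y c p)) (Metric.ball 0 r) :=
        (vprodL.contDiff.comp_contDiffOn (hy.of_le (by exact_mod_cast le_top))).clm_apply hn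
      refine ((contDiffOn_const (c := Complex.reCLM)).smulRight h1).add
        ((contDiffOn_const (c := Complex.imCLM)).smulRight h2) |>.congr fun p _ => ?_
      ext1 v
      simp [connForm_apply, vprodL_apply]) (hyd c)
  have hpx : ∀ c, ∀ p ∈ Metric.ball (0 : ℂ) r, px (y c) p = vprod (Wx p) (y c p) := by
    intro c p hp
    rw [px, (hyd c p hp).fderiv]; simp [connForm_apply]
  have hpy : ∀ c, ∀ p ∈ Metric.ball (0 : ℂ) r, py (y c) p = vprod (Wy p) (y c p) := by
    intro c p hp
    rw [py, (hyd c p hp).fderiv]; simp [connForm_apply]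
  have hmem0 : (0 : ℂ) ∈ Metric.ball (0 : ℂ) r := Metric.mem_ball_self hr
  have hgram : ∀ c d, ∀ p ∈ Metric.ball (0 : ℂ) r,
      inner ℝ (y c p) (y d p) = if c = d then (1 : ℝ) else 0 := by
    intro c d p hp
    have hd : ∀ c, ∀ q ∈ Metric.ball (0 : ℂ) r, DifferentiableAt ℝ (y c) q := fun c q hq =>
      (hyd c q hq).differentiableAt
    have hsk : ∀ w a b : E3, inner ℝ (vprod w a) b + inner ℝ a (vprod w b) = (0 : ℝ) := by
      intro w a b
      simp only [inner_eq_sum3, (vprod_apply _ _).1, (vprod_apply _ _).2.1, (vprod_apply _ _).2.2]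
      ring
    have := Metric.isOpen_ball.is_const_of_fderiv_eq_zero (𝕜 := ℝ)
      (f := fun q => (inner ℝ (y c q) (y d q) : ℝ)) (Metric.isPreconnected_ball (x := (0 : ℂ)) (r := r))
      (fun q hq => ((hd c q hq).inner ℝ (hd d q hq)).differentiableWithinAt) (fun q hq => by
        ext1 z
        rw [fderiv_eq_px_py, px_inner (hd c q hq) (hd d q hq), py_inner (hd c q hq) (hd d q hq),
          hpx c q hq, hpx d q hq, hpy c q hq, hpy d q hq, hsk, hsk]
        simp) hp hmem0
    rw [this, hy0, hy0]
    simp [EuclideanSpace.inner_single_left]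
  -- The `y c` are the rows of the frame matrix and the `e i` its columns. `Wx` and `Wy` hold
  -- components with respect to the moving frame, and it is for the rows that the frame equations
  -- take the form dy = W × y.
  let e : Fin 3 → ℂ → E3 := fun i p => WithLp.toLp 2 fun c => y c p i
  have he : ∀ i p c, e i p c = y c p i := fun i p c => rfl
  have hcoord : ∀ c i, ContDiffOn ℝ ∞ (fun p => y c p i) (Metric.ball 0 r) := fun c i =>
    contDiffOn_euclidean.1 (hys c) i
  have hes : ∀ i, ContDiffOn ℝ ∞ (e i) (Metric.ball 0 r) := fun i =>
    contDiffOn_euclidean.2 fun c => hcoord c i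
  have hor : ∀ p ∈ Metric.ball (0 : ℂ) r, ∀ i j,
      inner ℝ (e i p) (e j p) = if i = j then (1 : ℝ) else 0 := by
    intro p hp i j
    let Y : Matrix (Fin 3) (Fin 3) ℝ := fun c i => y c p i
    have h1 : Y * Y.transpose = 1 := by
      ext c d
      rw [Matrix.mul_apply, Matrix.one_apply, ← hgram c d p hp, inner_eq_sum3, Fin.sum_univ_three]
      rfl
    have h1' : Y.transpose * Y = 1 := mul_eq_one_comm.1 h1
    have h2 := congrArg (fun M => M i j) h1'
    rw [Matrix.mul_apply, Matrix.one_apply, Fin.sum_univ_three] at h2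
    rw [← h2, inner_eq_sum3]
    rfl
  have hclm : ∀ (i c : Fin 3), ∀ p ∈ Metric.ball (0 : ℂ) r,
      px (e i) p c = px (y c) p i ∧ py (e i) p c = py (y c) p i := by
    intro i c p hp
    have d1 := (hes i).differentiableAt_of_isOpen Metric.isOpen_ball hp
    have d2 := (hys c).differentiableAt_of_isOpen Metric.isOpen_ball hp
    exact ⟨(px_clm (EuclideanSpace.proj c : E3 →L[ℝ] ℝ) d1).symm.trans
        (px_clm (EuclideanSpace.proj i : E3 →L[ℝ] ℝ) d2),
      (py_clm (EuclideanSpace.proj c : E3 →L[ℝ] ℝ) d1).symm.trans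
        (py_clm (EuclideanSpace.proj i : E3 →L[ℝ] ℝ) d2)⟩
  refine ⟨e, hes, fun p hp => ⟨hor p hp, ?_, ?_, ?_, ?_, ?_⟩⟩
  -- Orthonormality gives e₀ × e₁ = ±e₂. The sign is continuous on the connected disc and is + at
  -- the centre, where the frame is the standard basis.
  · have key : ∀ p ∈ Metric.ball (0 : ℂ) r, ∀ w : E3, inner ℝ (vprod (e 0 p) (e 1 p)) w =
        inner ℝ (e 2 p) (vprod (e 0 p) (e 1 p)) * inner ℝ (e 2 p) w := by
      intro p hp w
      rw [inner_eq_of_frame (a := e 0 p) (b := e 1 p) (n := e 2 p) one_ne_zero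
        (by simp [-inner_self_eq_norm_sq_to_K, hor p hp])
        (by simp [-inner_self_eq_norm_sq_to_K, hor p hp])
        (by simp [-inner_self_eq_norm_sq_to_K, hor p hp]) (by simp [hor p hp])
        (by simp [hor p hp]) (by simp [hor p hp]), inner_vprod_left, inner_vprod_right]
      ring
    have hsq : ∀ p ∈ Metric.ball (0 : ℂ) r, (inner ℝ (e 2 p) (vprod (e 0 p) (e 1 p)) : ℝ) ^ 2 = 1 := by
      intro p hp
      have h1 := key p hp (vprod (e 0 p) (e 1 p))
      rw [real_inner_self_eq_norm_sq, norm_vprod_sq, ← real_inner_self_eq_norm_sq,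
        ← real_inner_self_eq_norm_sq, hor p hp, hor p hp, hor p hp] at h1
      rw [sq, ← h1]; simp
    have hc : ContinuousOn (fun p => (inner ℝ (e 2 p) (vprod (e 0 p) (e 1 p)) : ℝ))
        (Metric.ball 0 r) :=
      ((hes 2).inner ℝ (contDiffOn_vprod (hes 0) (hes 1))).continuousOn
    have hone : (inner ℝ (e 2 p) (vprod (e 0 p) (e 1 p)) : ℝ) = 1 := by
      rcases (Metric.isPreconnected_ball (x := (0 : ℂ)) (r := r)).eq_or_eq_neg_of_sq_eq hc
        (continuousOn_const (c := (1 : ℝ))) (fun q hq => by simpa using hsq q hq)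
        (fun _ => one_ne_zero) with h | h
      · exact h hp
      · have h0 : (inner ℝ (e 2 0) (vprod (e 0 0) (e 1 0)) : ℝ) = -1 := h hmem0
        have e0 : ∀ i c, e i 0 c = if c = i then (1 : ℝ) else 0 := fun i c => by
          rw [he, hy0]; simp [eq_comm]
        simp only [inner_eq_sum3, (vprod_apply _ _).1, (vprod_apply _ _).2.1,
          (vprod_apply _ _).2.2, e0] at h0
        simp only [show (2 : Fin 3) ≠ 0 by decide, show (2 : Fin 3) ≠ 1 by decide, if_false] at h0
        norm_num at h0
    refine ext_inner_right ℝ fun w => ?_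
    rw [key p hp, hone, one_mul]
  · ext c
    rw [(hclm 0 c p hp).1, hpx c p hp, (vprod_apply _ _).1]
    simp [he]; ring
  · ext c
    rw [(hclm 1 c p hp).1, hpx c p hp, (vprod_apply _ _).2.1]
    simp [he]
  · ext c
    rw [(hclm 0 c p hp).2, hpy c p hp, (vprod_apply _ _).1]
    simp [he]; ring
  · ext c
    rw [(hclm 1 c p hp).2, hpy c p hp, (vprod_apply _ _).2.1]
    simp [he]

/-- **Bonnet's theorem** on a disc: the Gauss and Codazzi equations are sufficient. -/
theorem exists_immersion {r : ℝ} (hr : 0 < r) {E H : ℂ → ℝ} {Q : ℂ → ℂ}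
    (hE : ContDiffOn ℝ ∞ E (Metric.ball 0 r)) (hH : ContDiffOn ℝ ∞ H (Metric.ball 0 r))
    (hQ : ContDiffOn ℝ ∞ Q (Metric.ball 0 r)) (hE0 : ∀ p ∈ Metric.ball (0 : ℂ) r, 0 < E p)
    (gauss : ∀ p ∈ Metric.ball (0 : ℂ) r,
      E p * (px (px E) p + py (py E) p) - (px E p ^ 2 + py E p ^ 2) =
        -2 * E p * (E p ^ 2 * H p ^ 2 - 4 * ‖Q p‖ ^ 2))
    (codazzi : ∀ p ∈ Metric.ball (0 : ℂ) r, px Q p + Complex.I * py Q p =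
      (E p / 2 : ℝ) * (((px H p : ℝ) : ℂ) - Complex.I * ((py H p : ℝ) : ℂ))) :
    ∃ f : ℂ → E3, IsConformalImmersionOn f (Metric.ball 0 r) ∧
      ∀ p ∈ Metric.ball (0 : ℂ) r, conformalFactor f p = E p ∧ hopf f p = Q p ∧
        meanCurv f p = H p := by
  set U := Metric.ball (0 : ℂ) r with hUdef
  have hU : IsOpen U := Metric.isOpen_ball
  -- The frame to be constructed is (f_x/λ, f_y/λ, N) with λ² = E.
  let lam : ℂ → ℝ := fun p => √(E p)
  have hl0 : ∀ p ∈ U, 0 < lam p := fun p hp => Real.sqrt_pos.2 (hE0 p hp)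
  have hl2 : ∀ p ∈ U, E p = lam p * lam p := fun p hp => (Real.mul_self_sqrt (hE0 p hp).le).symm
  have hls : ContDiffOn ℝ ∞ lam U := hE.sqrt fun p hp => (hE0 p hp).ne'
  have hli : ContDiffOn ℝ ∞ (fun p => (lam p)⁻¹) U := hls.inv fun p hp => (hl0 p hp).ne'
  have hlx := contDiffOn_px hU hls
  have hly := contDiffOn_py hU hls
  let q1 : ℂ → ℝ := fun p => (Q p).re
  let q2 : ℂ → ℝ := fun p => (Q p).im
  have hq1 : ContDiffOn ℝ ∞ q1 U := Complex.reCLM.contDiff.comp_contDiffOn hQ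
  have hq2 : ContDiffOn ℝ ∞ q2 U := Complex.imCLM.contDiff.comp_contDiffOn hQ
  -- `a1` and `a2` are the tangential rotation coefficients of the frame, forced by f_xy = f_yx;
  -- `l`, `m`, `k` are the coefficients of the second fundamental form divided by λ.
  let a1 : ℂ → ℝ := fun p => -1 * (py lam p * (lam p)⁻¹)
  let a2 : ℂ → ℝ := fun p => px lam p * (lam p)⁻¹
  let l : ℂ → ℝ := fun p => lam p * H p + 2 * (q1 p * (lam p)⁻¹)
  let m : ℂ → ℝ := fun p => -2 * (q2 p * (lam p)⁻¹)
  let k : ℂ → ℝ := fun p => lam p * H p - 2 * (q1 p * (lam p)⁻¹)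
  have ha1 : ContDiffOn ℝ ∞ a1 U := contDiffOn_const.mul (hly.mul hli)
  have ha2 : ContDiffOn ℝ ∞ a2 U := hlx.mul hli
  have hls' : ContDiffOn ℝ ∞ l U := (hls.mul hH).add (contDiffOn_const.mul (hq1.mul hli))
  have hms : ContDiffOn ℝ ∞ m U := contDiffOn_const.mul (hq2.mul hli)
  have hks : ContDiffOn ℝ ∞ k U := (hls.mul hH).sub (contDiffOn_const.mul (hq1.mul hli))
  let Wx : ℂ → E3 := fun p => !₂[-1 * m p, l p, -1 * a1 p]
  let Wy : ℂ → E3 := fun p => !₂[-1 * k p, m p, -1 * a2 p]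
  have hWx : ContDiffOn ℝ ∞ Wx U := contDiffOn_euclidean.2 fun i => by
    fin_cases i
    exacts [contDiffOn_const.mul hms, hls', contDiffOn_const.mul ha1]
  have hWy : ContDiffOn ℝ ∞ Wy U := contDiffOn_euclidean.2 fun i => by
    fin_cases i
    exacts [contDiffOn_const.mul hks, hms, contDiffOn_const.mul ha2]
  have flat : ∀ p ∈ U, py Wx p - px Wy p + vprod (Wx p) (Wy p) = 0 := by
    intro p hp
    have dl := hls.differentiableAt_of_isOpen hU hp
    have dlx := hlx.differentiableAt_of_isOpen hU hp
    have dly := hly.differentiableAt_of_isOpen hU hp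
    have di := hli.differentiableAt_of_isOpen hU hp
    have d1 := hq1.differentiableAt_of_isOpen hU hp
    have d2 := hq2.differentiableAt_of_isOpen hU hp
    have dH := hH.differentiableAt_of_isOpen hU hp
    have dQ := hQ.differentiableAt_of_isOpen hU hp
    have dm := hms.differentiableAt_of_isOpen hU hp
    have dk := hks.differentiableAt_of_isOpen hU hp
    have da1 := ha1.differentiableAt_of_isOpen hU hp
    have da2 := ha2.differentiableAt_of_isOpen hU hp
    have h0 := (hl0 p hp).ne'
    have hEx : ∀ q ∈ U, px E q = 2 * (lam q * px lam q) := fun q hq => by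
      have dl := hls.differentiableAt_of_isOpen hU hq
      rw [px_congr ((hU.eventually_mem hq).mono hl2), px_mul dl dl]; ring
    have hEy : ∀ q ∈ U, py E q = 2 * (lam q * py lam q) := fun q hq => by
      have dl := hls.differentiableAt_of_isOpen hU hq
      rw [py_congr ((hU.eventually_mem hq).mono hl2), py_mul dl dl]; ring
    have hExx : px (px E) p = 2 * (px lam p * px lam p + lam p * px (px lam) p) := by
      rw [px_congr ((hU.eventually_mem hp).mono hEx), px_const_mul _ (dl.fun_mul dlx),
        px_mul dl dlx]
    have hEyy : py (py E) p = 2 * (py lam p * py lam p + lam p * py (py lam) p) := by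
      rw [py_congr ((hU.eventually_mem hp).mono hEy), py_const_mul _ (dl.fun_mul dly),
        py_mul dl dly]
    have hg := gauss p hp
    have hc := codazzi p hp
    have hq1x : px q1 p = (px Q p).re := px_clm Complex.reCLM dQ
    have hq1y : py q1 p = (py Q p).re := py_clm Complex.reCLM dQ
    have hq2x : px q2 p = (px Q p).im := px_clm Complex.imCLM dQ
    have hq2y : py q2 p = (py Q p).im := py_clm Complex.imCLM dQ
    have c1 := congrArg Complex.re hc
    have c2 := congrArg Complex.im hc
    simp only [Complex.add_re, Complex.mul_re, Complex.I_re, Complex.I_im, Complex.ofReal_re,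
      Complex.ofReal_im, Complex.sub_re, Complex.add_im, Complex.mul_im, Complex.sub_im,
      ← hq1x, ← hq1y, ← hq2x, ← hq2y, hl2 p hp] at c1 c2
    rw [hEx p hp, hEy p hp, hExx, hEyy, ← Complex.normSq_eq_norm_sq, Complex.normSq_apply,
      hl2 p hp] at hg
    change _ = -2 * (lam p * lam p) * ((lam p * lam p) ^ 2 * H p ^ 2 -
      4 * (q1 p * q1 p + q2 p * q2 p)) at hg
    have hix := px_inv dl h0
    have hiy := py_inv dl h0
    have hly' : py l p = py lam p * H p + lam p * py H p +
        2 * (py q1 p * (lam p)⁻¹ + q1 p * (-py lam p / lam p ^ 2)) := by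
      rw [← hiy, py_add (dl.fun_mul dH) ((d1.fun_mul di).const_mul 2), py_mul dl dH,
        py_const_mul _ (d1.fun_mul di), py_mul d1 di]
    have hkx : px k p = px lam p * H p + lam p * px H p -
        2 * (px q1 p * (lam p)⁻¹ + q1 p * (-px lam p / lam p ^ 2)) := by
      rw [← hix, px_sub (dl.fun_mul dH) ((d1.fun_mul di).const_mul 2), px_mul dl dH,
        px_const_mul _ (d1.fun_mul di), px_mul d1 di]
    have hmx : px m p = -2 * (px q2 p * (lam p)⁻¹ + q2 p * (-px lam p / lam p ^ 2)) := by
      rw [← hix, px_const_mul _ (d2.fun_mul di), px_mul d2 di]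
    have hmy : py m p = -2 * (py q2 p * (lam p)⁻¹ + q2 p * (-py lam p / lam p ^ 2)) := by
      rw [← hiy, py_const_mul _ (d2.fun_mul di), py_mul d2 di]
    have ha1y : py a1 p = -1 * (py (py lam) p * (lam p)⁻¹ + py lam p * (-py lam p / lam p ^ 2)) := by
      rw [← hiy, py_const_mul _ (dly.fun_mul di), py_mul dly di]
    have ha2x : px a2 p = px (px lam) p * (lam p)⁻¹ + px lam p * (-px lam p / lam p ^ 2) := by
      rw [← hix, px_mul dlx di]
    have dWx := hWx.differentiableAt_of_isOpen hU hp
    have dWy := hWy.differentiableAt_of_isOpen hU hp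
    have eWx : ∀ i, py Wx p i = py (fun q => Wx q i) p := fun i =>
      (py_clm (EuclideanSpace.proj i : E3 →L[ℝ] ℝ) dWx).symm
    have eWy : ∀ i, px Wy p i = px (fun q => Wy q i) p := fun i =>
      (px_clm (EuclideanSpace.proj i : E3 →L[ℝ] ℝ) dWy).symm
    have s1 : py (fun q => Wx q 0) p = -1 * py m p := py_const_mul _ dm
    have s2 : px (fun q => Wy q 0) p = -1 * px k p := px_const_mul _ dk
    have s3 : py (fun q => Wx q 2) p = -1 * py a1 p := py_const_mul _ da1
    have s4 : px (fun q => Wy q 2) p = -1 * px a2 p := px_const_mul _ da2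
    -- Components 0 and 1 of the flatness condition are the real and imaginary parts of the Codazzi
    -- equation; component 2 is the Gauss equation.
    ext i
    fin_cases i
    · change py Wx p 0 - px Wy p 0 + vprod (Wx p) (Wy p) 0 = 0
      rw [eWx, eWy, (vprod_apply _ _).1, s1, s2]
      change -1 * py m p - -1 * px k p + (l p * (-1 * a2 p) - -1 * a1 p * m p) = 0
      rw [hmy, hkx]
      simp only [l, m, a1, a2]
      field_simp
      linear_combination -2 * lam p * c1
    · change py Wx p 1 - px Wy p 1 + vprod (Wx p) (Wy p) 1 = 0
      rw [eWx, eWy, (vprod_apply _ _).2.1]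
      change py l p - px m p + (-1 * a1 p * (-1 * k p) - -1 * m p * (-1 * a2 p)) = 0
      rw [hly', hmx]
      simp only [m, k, a1, a2]
      field_simp
      linear_combination 2 * lam p * c2
    · change py Wx p 2 - px Wy p 2 + vprod (Wx p) (Wy p) 2 = 0
      rw [eWx, eWy, (vprod_apply _ _).2.2, s3, s4]
      change -1 * py a1 p - -1 * px a2 p + (-1 * m p * m p - l p * (-1 * k p)) = 0
      rw [ha1y, ha2x]
      simp only [m, k, l]
      field_simp
      refine mul_left_cancel₀ (pow_ne_zero 2 h0) ?_
      linarith
  obtain ⟨e, hes, he⟩ := exists_frame hr hWx hWy flat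
  let a : ℂ → E3 := fun p => lam p • e 0 p
  let b : ℂ → E3 := fun p => lam p • e 1 p
  have has : ContDiffOn ℝ ∞ a U := hls.smul (hes 0)
  have hbs : ContDiffOn ℝ ∞ b U := hls.smul (hes 1)
  have dl : ∀ p ∈ U, DifferentiableAt ℝ lam p := fun p hp => hls.differentiableAt_of_isOpen hU hp
  have de : ∀ i, ∀ p ∈ U, DifferentiableAt ℝ (e i) p := fun i p hp =>
    (hes i).differentiableAt_of_isOpen hU hp
  have hax : ∀ p ∈ U, px a p = px lam p • e 0 p + lam p • (a1 p • e 1 p + l p • e 2 p) := by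
    intro p hp
    rw [px_smul (dl p hp) (de 0 p hp), (he p hp).2.2.1]
    simp [Wx]
  have hay : ∀ p ∈ U, py a p = py lam p • e 0 p + lam p • (a2 p • e 1 p + m p • e 2 p) := by
    intro p hp
    rw [py_smul (dl p hp) (de 0 p hp), (he p hp).2.2.2.2.1]
    simp [Wy]
  have hbx : ∀ p ∈ U, px b p = px lam p • e 1 p + lam p • (-a1 p • e 0 p + m p • e 2 p) := by
    intro p hp
    rw [px_smul (dl p hp) (de 1 p hp), (he p hp).2.2.2.1]
    simp [Wx]
  have hby : ∀ p ∈ U, py b p = py lam p • e 1 p + lam p • (-a2 p • e 0 p + k p • e 2 p) := by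
    intro p hp
    rw [py_smul (dl p hp) (de 1 p hp), (he p hp).2.2.2.2.2]
    simp [Wy]
  have hsymm : ∀ p ∈ U, py a p = px b p := by
    intro p hp
    have h0 := (hl0 p hp).ne'
    rw [hay p hp, hbx p hp]
    have e1 : lam p * a1 p = -py lam p := by simp only [a1]; field_simp
    have e2 : lam p * a2 p = px lam p := by simp only [a2]; field_simp
    simp only [smul_add, smul_smul, e2, mul_neg, e1, neg_neg]
    abel
  -- The one-form λe₀ dx + λe₁ dy is closed by `hsymm`; its primitive on the disc is the immersion.
  let θ : ℂ → ℂ →L[ℝ] E3 := fun p => Complex.reCLM.smulRight (a p) + Complex.imCLM.smulRight (b p)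
  have hθ : ContDiffOn ℝ ∞ θ U :=
    (contDiffOn_const.smulRight has).add (contDiffOn_const.smulRight hbs)
  have hθd : ∀ p ∈ U, ∀ u v, fderiv ℝ θ p u v = v.re • fderiv ℝ a p u + v.im • fderiv ℝ b p u := by
    intro p hp u v
    have e1 : fderiv ℝ θ p u v = fderiv ℝ (fun q => θ q v) p u := by
      rw [fderiv_clm_apply (hθ.differentiableAt_of_isOpen hU hp) (differentiableAt_const v)]
      simp
    have h3 := ((has.differentiableAt_of_isOpen hU hp).hasFDerivAt.fun_const_smul v.re).fun_add
      ((hbs.differentiableAt_of_isOpen hU hp).hasFDerivAt.fun_const_smul v.im)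
    have e2 : (fun q => θ q v) = fun q => v.re • a q + v.im • b q := by
      funext q; simp [θ]
    rw [e1, e2, h3.fderiv]
    simp
  obtain ⟨f, hf⟩ := (convex_ball (0 : ℂ) r).exists_forall_hasFDerivAt_of_fderiv_symmetric hU
    (hθ.differentiableOn (by simp)) (fun p hp u v => by
      rw [hθd p hp, hθd p hp, fderiv_eq_px_py a p u, fderiv_eq_px_py a p v, fderiv_eq_px_py b p u,
        fderiv_eq_px_py b p v, hsymm p hp]
      module)
  have hfs : ContDiffOn ℝ ∞ f U := contDiffOn_of_fderiv_eq hU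
    (fun n _ => hθ.of_le (by exact_mod_cast le_top)) hf
  have hX : ∀ p ∈ U, dX f p = a p := fun p hp => by rw [dX, (hf p hp).fderiv]; simp [θ]
  have hY : ∀ p ∈ U, dY f p = b p := fun p hp => by rw [dY, (hf p hp).fderiv]; simp [θ]
  have hnorm : ∀ p ∈ U, ∀ i, ‖e i p‖ = 1 := fun p hp i => by
    have := (he p hp).1 i i
    rw [real_inner_self_eq_norm_sq, if_pos rfl] at this
    exact (pow_eq_one_iff_of_nonneg (norm_nonneg _) two_ne_zero).1 this
  have himm : IsConformalImmersionOn f U := by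
    refine ⟨hfs, fun p hp => ?_, fun p hp => ?_, fun p hp => ?_⟩
    · rw [hX p hp, hY p hp, inner_smul_left, inner_smul_right, (he p hp).1]; simp
    · rw [hX p hp, hY p hp, norm_smul, norm_smul, hnorm p hp, hnorm p hp]
    · rw [hX p hp]
      refine smul_ne_zero (hl0 p hp).ne' ?_
      rw [← norm_ne_zero_iff, hnorm p hp]; exact one_ne_zero
  have hcf : ∀ p ∈ U, conformalFactor f p = E p := fun p hp => by
    rw [conformalFactor, hX p hp, norm_smul, hnorm p hp, mul_one, Real.norm_eq_abs, sq_abs,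
      hl2 p hp, sq]
  refine ⟨f, himm, fun p hp => ⟨hcf p hp, ?_⟩⟩
  have h0 := (hl0 p hp).ne'
  have hN : unitNormal f p = e 2 p := by
    have hv : vprod (a p) (b p) = (lam p * lam p) • e 2 p := by
      rw [← (he p hp).2.1]
      change vprodL (lam p • e 0 p) (lam p • e 1 p) = _ • vprodL _ _
      simp [smul_smul]
    rw [himm.unitNormal_eq hp, hX p hp, hY p hp, hv, smul_smul, hcf p hp, hl2 p hp,
      inv_mul_cancel₀ (mul_ne_zero h0 h0), one_smul]
  have hor := (he p hp).1
  have o02 : inner ℝ (e 0 p) (e 2 p) = (0 : ℝ) := by simp [hor]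
  have o12 : inner ℝ (e 1 p) (e 2 p) = (0 : ℝ) := by simp [hor]
  have o22 : inner ℝ (e 2 p) (e 2 p) = (1 : ℝ) := by rw [hor]; simp
  have hL : sffL f p = lam p * l p := by
    rw [sffL, hN, dX_eq_px (dX f), px_congr ((hU.eventually_mem hp).mono hX), hax p hp]
    simp only [inner_add_left, inner_smul_left, o02, o12, o22, conj_trivial]; ring
  have hM : sffM f p = lam p * m p := by
    rw [sffM, hN, dX_eq_px (dY f), px_congr ((hU.eventually_mem hp).mono hY), hbx p hp]
    simp only [inner_add_left, inner_smul_left, o02, o12, o22, conj_trivial]; ring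
  have hK : sffK f p = lam p * k p := by
    rw [sffK, hN, dY_eq_py (dY f), py_congr ((hU.eventually_mem hp).mono hY), hby p hp]
    simp only [inner_add_left, inner_smul_left, o02, o12, o22, conj_trivial]; ring
  rw [hopf_eq_sff, meanCurv_eq_sff, hL, hM, hK, hcf p hp, hl2 p hp]
  constructor
  · apply Complex.ext
    · simp [l, k]; field_simp; ring
    · simp [m]; field_simp; ring
  · simp only [l, k]; field_simp; ring

end BonnetSurf

namespace BonnetSurf

/-! ### Derivatives of smooth functions of one real variable -/

theorem ContDiffOn.deriv_of_isOpen_infty {k : ℝ → ℝ} {U : Set ℝ} (hU : IsOpen U)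
    (hk : ContDiffOn ℝ ∞ k U) : ContDiffOn ℝ ∞ (deriv k) U :=
  ((contDiffOn_infty_iff_deriv_of_isOpen hU).1 hk).2

theorem ContDiffOn.hasDerivAt_of_isOpen {k : ℝ → ℝ} {U : Set ℝ} (hU : IsOpen U)
    (hk : ContDiffOn ℝ ∞ k U) {x : ℝ} (hx : x ∈ U) : HasDerivAt k (deriv k x) x :=
  ((hk.differentiableOn (by simp)).differentiableAt (hU.mem_nhds hx)).hasDerivAt

/-! ### Averages along segments through the origin -/

/-- The weighted average `∫₀¹ φ^m k(xφ) dφ`. -/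
def radialMean (m : ℕ) (k : ℝ → ℝ) (x : ℝ) : ℝ := ∫ φ in (0 : ℝ)..1, φ ^ m * k (x * φ)

theorem mul_mem_Ioo_of_mem_Icc {r x φ : ℝ} (hx : x ∈ Ioo (-r) r) (hφ : φ ∈ Icc (0 : ℝ) 1) :
    x * φ ∈ Ioo (-r) r := by
  refine abs_lt.1 ?_
  rw [abs_mul, abs_of_nonneg hφ.1]
  exact (mul_le_of_le_one_right (abs_nonneg x) hφ.2).trans_lt (abs_lt.2 hx)

theorem continuousOn_radialMean_integrand {k : ℝ → ℝ} {r : ℝ} (hk : ContinuousOn k (Ioo (-r) r))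
    (m : ℕ) {x : ℝ} (hx : x ∈ Ioo (-r) r) :
    ContinuousOn (fun φ => φ ^ m * k (x * φ)) (Icc 0 1) :=
  (continuous_pow m).continuousOn.mul
    (hk.comp (by fun_prop) fun _ hφ => mul_mem_Ioo_of_mem_Icc hx hφ)

/-- Differentiation under the integral. The inner derivative raises the weight by one, so these
averages are closed under differentiation and their smoothness follows by induction. -/
theorem hasDerivAt_radialMean {k : ℝ → ℝ} {r : ℝ} (hk : ContDiffOn ℝ ∞ k (Ioo (-r) r)) (m : ℕ)
    {x : ℝ} (hx : x ∈ Ioo (-r) r) :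
    HasDerivAt (radialMean m k) (radialMean (m + 1) (deriv k) x) x := by
  have hk' := ContDiffOn.deriv_of_isOpen_infty isOpen_Ioo hk
  obtain ⟨r₁, h1, h2⟩ := exists_between (abs_lt.2 hx)
  have hsub : Icc (-r₁) r₁ ⊆ Ioo (-r) r := fun y hy => ⟨by linarith [hy.1], by linarith [hy.2]⟩
  obtain ⟨C, hC⟩ := isCompact_Icc.exists_bound_of_continuousOn (hk'.continuousOn.mono hsub)
  have hs : Ioo (-r₁) r₁ ∈ 𝓝 x := Ioo_mem_nhds (abs_lt.1 h1).1 (abs_lt.1 h1).2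
  have meas : ∀ (j : ℕ) {g : ℝ → ℝ}, ContinuousOn g (Ioo (-r) r) → ∀ y ∈ Ioo (-r) r,
      IntervalIntegrable (fun φ => φ ^ j * g (y * φ)) MeasureTheory.volume 0 1 := by
    intro j g hg y hy
    refine ContinuousOn.intervalIntegrable ?_
    rw [uIcc_of_le zero_le_one]
    exact continuousOn_radialMean_integrand hg j hy
  have hI : ∀ {φ : ℝ}, φ ∈ uIoc (0:ℝ) 1 → φ ∈ Icc (0:ℝ) 1 := fun h => by
    rw [uIoc_of_le zero_le_one] at h; exact ⟨h.1.le, h.2⟩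
  have key := intervalIntegral.hasDerivAt_integral_of_dominated_loc_of_deriv_le
    (μ := MeasureTheory.volume) (a := 0) (b := 1)
    (F := fun y φ => φ ^ m * k (y * φ)) (F' := fun y φ => φ ^ (m + 1) * deriv k (y * φ))
    (bound := fun _ => C) hs
    ((isOpen_Ioo.eventually_mem hx).mono fun y hy => (meas m hk.continuousOn y hy).def'.1)
    (meas m hk.continuousOn x hx) (meas (m + 1) hk'.continuousOn x hx).def'.1
    (Eventually.of_forall fun φ hφ y hy => ?_) (by simp)
    (Eventually.of_forall fun φ hφ y hy => ?_)
  · exact key.2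
  · have hφ := hI hφ
    have := hC _ (Ioo_subset_Icc_self (mul_mem_Ioo_of_mem_Icc hy hφ))
    rw [norm_mul, norm_pow, Real.norm_of_nonneg hφ.1]
    calc φ ^ (m + 1) * _ ≤ 1 * C := by
          gcongr
          · exact pow_le_one₀ hφ.1 hφ.2
      _ = C := one_mul C
  · have hφ := hI hφ
    have h := ContDiffOn.hasDerivAt_of_isOpen isOpen_Ioo hk
      (hsub (Ioo_subset_Icc_self (mul_mem_Ioo_of_mem_Icc hy hφ)))
    have := (HasDerivAt.comp (h₂ := k) y h ((hasDerivAt_id y).mul_const φ)).const_mul (φ ^ m)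
    exact this.congr_deriv (by ring)

theorem contDiffOn_radialMean {k : ℝ → ℝ} {r : ℝ} (hk : ContDiffOn ℝ ∞ k (Ioo (-r) r)) (m : ℕ) :
    ContDiffOn ℝ ∞ (radialMean m k) (Ioo (-r) r) := by
  rw [contDiffOn_infty]
  intro n
  induction n generalizing k m with
  | zero =>
    rw [Nat.cast_zero, contDiffOn_zero]
    exact fun x hx => (hasDerivAt_radialMean hk m hx).continuousAt.continuousWithinAt
  | succ n ih =>
    rw [Nat.cast_succ, contDiffOn_succ_iff_deriv_of_isOpen isOpen_Ioo]
    refine ⟨fun x hx => (hasDerivAt_radialMean hk m hx).differentiableAt.differentiableWithinAt,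
      by simp, (ih (ContDiffOn.deriv_of_isOpen_infty isOpen_Ioo hk) (m + 1)).congr
        fun x hx => (hasDerivAt_radialMean hk m hx).deriv⟩

theorem radialMean_neg {k : ℝ → ℝ} {r : ℝ} (hk : ∀ x ∈ Ioo (-r) r, k (-x) = k x) (m : ℕ) {x : ℝ}
    (hx : x ∈ Ioo (-r) r) : radialMean m k (-x) = radialMean m k x := by
  refine intervalIntegral.integral_congr fun φ hφ => ?_
  rw [uIcc_of_le zero_le_one] at hφ
  simp only [neg_mul, hk _ (mul_mem_Ioo_of_mem_Icc hx hφ)]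

/-! ### Even functions as functions of the square -/

theorem deriv_neg_of_even {g : ℝ → ℝ} {r : ℝ} (he : ∀ x ∈ Ioo (-r) r, g (-x) = g x) {x : ℝ}
    (hx : x ∈ Ioo (-r) r) : deriv g (-x) = -deriv g x := by
  have h : (fun y => g (-y)) =ᶠ[𝓝 x] g := (isOpen_Ioo.eventually_mem hx).mono he
  have := h.deriv_eq
  rw [deriv_comp_neg] at this
  linarith

theorem deriv_deriv_neg_of_even {g : ℝ → ℝ} {r : ℝ} (he : ∀ x ∈ Ioo (-r) r, g (-x) = g x) {x : ℝ}
    (hx : x ∈ Ioo (-r) r) : deriv (deriv g) (-x) = deriv (deriv g) x := by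
  have h : (fun y => deriv g (-y)) =ᶠ[𝓝 x] fun y => -deriv g y :=
    (isOpen_Ioo.eventually_mem hx).mono fun y hy => deriv_neg_of_even he hy
  have := h.deriv_eq
  rw [deriv_comp_neg, deriv.fun_neg] at this
  linarith

/-- Hadamard's lemma applied to g', which is odd and therefore vanishes at 0. -/
theorem deriv_eq_mul_radialMean {g : ℝ → ℝ} {r : ℝ} (hg : ContDiffOn ℝ ∞ g (Ioo (-r) r))
    (he : ∀ x ∈ Ioo (-r) r, g (-x) = g x) {x : ℝ} (hx : x ∈ Ioo (-r) r) :
    deriv g x = x * radialMean 0 (deriv (deriv g)) x := by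
  have hg' := ContDiffOn.deriv_of_isOpen_infty isOpen_Ioo hg
  have hg'' := ContDiffOn.deriv_of_isOpen_infty isOpen_Ioo hg'
  have h0 : deriv g 0 = 0 := by
    have : (0:ℝ) ∈ Ioo (-r) r := ⟨by linarith [hx.1, hx.2], by linarith [hx.1, hx.2]⟩
    have := deriv_neg_of_even he this
    rw [neg_zero] at this; linarith
  have := intervalIntegral.integral_eq_sub_of_hasDerivAt (a := 0) (b := 1)
    (f := fun φ => deriv g (x * φ)) (f' := fun φ => x * (φ ^ 0 * deriv (deriv g) (x * φ)))
    (fun φ hφ => ?_) (ContinuousOn.intervalIntegrable ?_)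
  · rw [intervalIntegral.integral_const_mul] at this
    rw [radialMean, this]; simp [h0]
  · rw [uIcc_of_le zero_le_one] at hφ
    have h := ContDiffOn.hasDerivAt_of_isOpen isOpen_Ioo hg' (mul_mem_Ioo_of_mem_Icc hx hφ)
    have := HasDerivAt.comp (h₂ := deriv g) φ h ((hasDerivAt_id φ).const_mul x)
    exact this.congr_deriv (by ring)
  · rw [uIcc_of_le zero_le_one]
    exact continuousOn_const.mul (continuousOn_radialMean_integrand hg''.continuousOn 0 hx)

theorem sqrt_mem_Ioo {r s : ℝ} (hr : 0 < r) (hs : s < r ^ 2) : √s ∈ Ioo (-r) r :=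
  ⟨by linarith [Real.sqrt_nonneg s], (Real.sqrt_lt' hr).2 hs⟩

/-- Whitney's theorem on even functions. The derivative of g(√s) is g'(√s)/(2√s), which equals half
the mean of g'' over [0, √s]: again a smooth even function of √s, so induction on the order of
differentiability applies. -/
theorem contDiffOn_comp_sqrt {g : ℝ → ℝ} {r : ℝ} (hr : 0 < r) (hg : ContDiffOn ℝ ∞ g (Ioo (-r) r))
    (he : ∀ x ∈ Ioo (-r) r, g (-x) = g x) : ContDiffOn ℝ ∞ (fun s => g √s) (Ico 0 (r ^ 2)) := by
  rw [contDiffOn_infty]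
  intro n
  have cont : ∀ {h : ℝ → ℝ}, ContDiffOn ℝ ∞ h (Ioo (-r) r) →
      ContinuousOn (fun s => h √s) (Ico 0 (r ^ 2)) := fun hh =>
    hh.continuousOn.comp Real.continuous_sqrt.continuousOn fun s hs => sqrt_mem_Ioo hr hs.2
  have hud : UniqueDiffOn ℝ (Ico 0 (r ^ 2)) := uniqueDiffOn_Ico 0 (r ^ 2)
  induction n generalizing g with
  | zero => rw [Nat.cast_zero, contDiffOn_zero]; exact cont hg
  | succ n ih =>
    set k := deriv (deriv g) with hk
    have hkd : ContDiffOn ℝ ∞ k (Ioo (-r) r) := ContDiffOn.deriv_of_isOpen_infty isOpen_Ioo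
      (ContDiffOn.deriv_of_isOpen_infty isOpen_Ioo hg)
    have hm := contDiffOn_radialMean hkd 0
    set g₁ : ℝ → ℝ := fun x => 1 / 2 * radialMean 0 k x with hg₁
    have hg₁d : ContDiffOn ℝ ∞ g₁ (Ioo (-r) r) := contDiffOn_const.mul hm
    have hpos : ∀ s ∈ Ioo 0 (r ^ 2), HasDerivAt (fun s => g √s) (g₁ √s) s := by
      intro s hs
      have hs' := sqrt_mem_Ioo hr hs.2
      have h := HasDerivAt.comp (h₂ := g) s (ContDiffOn.hasDerivAt_of_isOpen isOpen_Ioo hg hs')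
        (Real.hasDerivAt_sqrt hs.1.ne')
      refine h.congr_deriv ?_
      have : √s ≠ 0 := (Real.sqrt_pos.2 hs.1).ne'
      rw [deriv_eq_mul_radialMean hg he hs', ← hk, hg₁]
      field_simp
    have hall : ∀ s ∈ Ico 0 (r ^ 2), HasDerivWithinAt (fun s => g √s) (g₁ √s) (Ico 0 (r ^ 2)) s := by
      intro s hs
      rcases hs.1.eq_or_lt with h | h
      · subst h
        have hmem : Ioo 0 (r ^ 2) ∈ 𝓝[>] (0:ℝ) := Ioo_mem_nhdsGT (by positivity)
        -- The square root is not differentiable at 0; there the one-sided derivative is obtained as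
        -- the limit of the derivatives from the right.
        refine (hasDerivWithinAt_Ici_of_tendsto_deriv (s := Ioo 0 (r ^ 2))
          (fun s hs => (hpos s hs).differentiableAt.differentiableWithinAt)
          ((cont hg 0 hs).mono Ioo_subset_Ico_self) hmem ?_).mono Ico_subset_Ici_self
        have h1 : Tendsto (fun s => g₁ √s) (𝓝[>] 0) (𝓝 (g₁ √0)) :=
          (cont hg₁d 0 hs).tendsto.mono_left
            (nhdsWithin_le_of_mem (mem_of_superset hmem Ioo_subset_Ico_self))
        exact h1.congr' (by filter_upwards [hmem] with s hs using (hpos s hs).deriv.symm)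
      · exact (hpos s ⟨h, hs.2⟩).hasDerivWithinAt
    rw [Nat.cast_succ, contDiffOn_succ_iff_derivWithin hud]
    exact ⟨fun s hs => (hall s hs).differentiableWithinAt, by simp,
      (ih hg₁d fun x hx => by
        simp only [hg₁, hk, radialMean_neg (fun y hy => deriv_deriv_neg_of_even he hy) 0 hx]).congr
      fun s hs => (hall s hs).derivWithin (hud s hs)⟩

/-- Integrate d/dφ H(sφ²) over [0, 1]. With this substitution √(sφ²) = √s φ, so H(s) - H(0) = 2
s^(J+1) ∫ φ^(2J+1) g(√s φ) dφ. The integral is an even smooth function of √s, and it is negative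
because g is. -/
theorem exists_asymptotic_factor {H g : ℝ → ℝ} {r : ℝ} (hr : 0 < r) (J : ℕ)
    (hg : ContDiffOn ℝ ∞ g (Ioo (-r) r)) (he : ∀ x ∈ Ioo (-r) r, g (-x) = g x)
    (hneg : ∀ x ∈ Ioo (-r) r, g x < 0) (hH : ContinuousOn H (Ico 0 (r ^ 2)))
    (hd : ∀ s ∈ Ioo 0 (r ^ 2), HasDerivAt H (s ^ J * g √s) s) :
    ∃ B : ℝ → ℝ, ContDiffOn ℝ ∞ B (Ico 0 (r ^ 2)) ∧ (∀ s ∈ Ico 0 (r ^ 2), B s ≠ 0) ∧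
      ∀ s ∈ Ico 0 (r ^ 2), H s = H 0 + s ^ (J + 1) * B s := by
  refine ⟨fun s => 2 * radialMean (2 * J + 1) g √s, contDiffOn_const.mul
    (contDiffOn_comp_sqrt hr (contDiffOn_radialMean hg _) fun x hx => radialMean_neg he _ hx),
    fun s hs => ?_, fun s hs => ?_⟩
  · have hx := sqrt_mem_Ioo hr hs.2
    have hc := continuousOn_radialMean_integrand hg.continuousOn (2 * J + 1) hx
    have : 0 < ∫ φ in (0:ℝ)..1, -(φ ^ (2 * J + 1) * g (√s * φ)) := by
      refine intervalIntegral.intervalIntegral_pos_of_pos_on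
        (ContinuousOn.intervalIntegrable ?_) (fun φ hφ => ?_) zero_lt_one
      · rw [uIcc_of_le zero_le_one]; exact hc.neg
      · have := hneg _ (mul_mem_Ioo_of_mem_Icc hx (Ioo_subset_Icc_self hφ))
        have h2 : 0 < φ ^ (2 * J + 1) := pow_pos hφ.1 _
        nlinarith
    rw [intervalIntegral.integral_neg] at this
    simp only [radialMean]
    intro h
    linarith
  · rcases hs.1.eq_or_lt with h | h
    · subst h; simp
    have hx := sqrt_mem_Ioo hr hs.2
    have hxp := Real.sqrt_pos.2 h
    have hsq := Real.sq_sqrt h.le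
    have hc := continuousOn_radialMean_integrand hg.continuousOn (2 * J + 1) hx
    have := intervalIntegral.integral_eq_sub_of_hasDerivAt_of_le (a := 0) (b := 1)
      (f := fun φ => H (s * φ ^ 2))
      (f' := fun φ => 2 * s ^ (J + 1) * (φ ^ (2 * J + 1) * g (√s * φ))) zero_le_one
      (hH.comp (by fun_prop) fun φ hφ => ⟨by have := hφ.1; positivity, ?_⟩)
      (fun φ hφ => ?_) (ContinuousOn.intervalIntegrable ?_)
    · rw [intervalIntegral.integral_const_mul] at this
      simp only [one_pow, mul_one, ne_eq, OfNat.ofNat_ne_zero, not_false_eq_true, zero_pow,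
        mul_zero] at this
      simp only [radialMean]; linarith
    · have : φ ^ 2 ≤ 1 := pow_le_one₀ hφ.1 hφ.2
      nlinarith [hs.2]
    · have h1 : s * φ ^ 2 ∈ Ioo 0 (r ^ 2) := by
        have h1 : φ ^ 2 ≤ 1 := pow_le_one₀ hφ.1.le hφ.2.le
        have h2 : 0 < φ ^ 2 := pow_pos hφ.1 2
        exact ⟨by positivity, by nlinarith [hs.2]⟩
      have h2 : √(s * φ ^ 2) = √s * φ := by rw [Real.sqrt_mul h.le, Real.sqrt_sq hφ.1.le]
      have h3 := HasDerivAt.comp (h₂ := H) φ (hd _ h1)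
        ((hasDerivAt_pow 2 φ).const_mul s)
      refine h3.congr_deriv ?_
      rw [h2]; push_cast; ring
    · rw [uIcc_of_le zero_le_one]
      exact continuousOn_const.mul hc

end BonnetSurf

namespace BonnetSurf

open Complex (I)

/-! ### The operator `∂_x + i ∂_y` -/

/-- The operator `∂_x + i ∂_y = 2 ∂_{z̄}`. -/
def dbar (g : ℂ → ℂ) (p : ℂ) : ℂ := px g p + I * py g p

theorem dbar_congr {g h : ℂ → ℂ} {p : ℂ} (e : g =ᶠ[𝓝 p] h) : dbar g p = dbar h p := by
  rw [dbar, dbar, px_congr e, py_congr e]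

theorem dbar_mul {g h : ℂ → ℂ} {p : ℂ} (hg : DifferentiableAt ℝ g p)
    (hh : DifferentiableAt ℝ h p) :
    dbar (fun q => g q * h q) p = dbar g p * h p + g p * dbar h p := by
  rw [dbar, px_mul hg hh, py_mul hg hh, dbar, dbar]; ring

theorem dbar_sub {g h : ℂ → ℂ} {p : ℂ} (hg : DifferentiableAt ℝ g p)
    (hh : DifferentiableAt ℝ h p) : dbar (fun q => g q - h q) p = dbar g p - dbar h p := by
  rw [dbar, px_sub hg hh, py_sub hg hh, dbar, dbar]; ring

theorem dbar_const (c : ℂ) (p : ℂ) : dbar (fun _ => c) p = 0 := by simp [dbar, px_const, py_const]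

theorem px_of_differentiableAt {v : ℂ → ℂ} {p : ℂ} (hv : DifferentiableAt ℂ v p) :
    px v p = deriv v p := by
  rw [px, (hv.hasDerivAt.hasFDerivAt.restrictScalars ℝ).fderiv]; simp

theorem py_of_differentiableAt {v : ℂ → ℂ} {p : ℂ} (hv : DifferentiableAt ℂ v p) :
    py v p = I * deriv v p := by
  rw [py, (hv.hasDerivAt.hasFDerivAt.restrictScalars ℝ).fderiv]; simp

theorem dbar_of_differentiableAt {v : ℂ → ℂ} {p : ℂ} (hv : DifferentiableAt ℂ v p) :
    dbar v p = 0 := by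
  rw [dbar, px_of_differentiableAt hv, py_of_differentiableAt hv, ← mul_assoc, Complex.I_mul_I]
  ring

theorem differentiableAt_conj {v : ℂ → ℂ} {p : ℂ} (hv : DifferentiableAt ℝ v p) :
    DifferentiableAt ℝ (fun q => starRingEnd ℂ (v q)) p :=
  Complex.conjCLE.toContinuousLinearMap.differentiableAt.comp p hv

theorem dbar_conj_of_differentiableAt {v : ℂ → ℂ} {p : ℂ} (hv : DifferentiableAt ℂ v p) :
    dbar (fun q => starRingEnd ℂ (v q)) p = 2 * starRingEnd ℂ (deriv v p) := by
  have h1 := px_clm (Complex.conjCLE : ℂ →L[ℝ] ℂ) (hv.restrictScalars ℝ)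
  have h2 := py_clm (Complex.conjCLE : ℂ →L[ℝ] ℂ) (hv.restrictScalars ℝ)
  simp only [ContinuousLinearEquiv.coe_coe, Complex.conjCLE_apply] at h1 h2
  rw [dbar, h1, h2, px_of_differentiableAt hv, py_of_differentiableAt hv, map_mul, Complex.conj_I]
  linear_combination (-starRingEnd ℂ (deriv v p)) * Complex.I_mul_I

theorem one_sub_mul_conj (v : ℂ) : 1 - v * starRingEnd ℂ v = ((1 - ‖v‖ ^ 2 : ℝ) : ℂ) := by
  rw [Complex.mul_conj, Complex.normSq_eq_norm_sq]; push_cast; ring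

theorem one_sub_mul_conj_ne_zero {v : ℂ} (hv : ‖v‖ < 1) : 1 - v * starRingEnd ℂ v ≠ 0 := by
  rw [one_sub_mul_conj, Complex.ofReal_ne_zero]
  nlinarith [norm_nonneg v]

/-- The Hopf differentials `A (1 - v̄) / (1 - |v|²)`, with `A` and `v` holomorphic. -/
theorem dbar_cayley {A v : ℂ → ℂ} {p : ℂ} (hA : DifferentiableAt ℂ A p)
    (hv : DifferentiableAt ℂ v p) (h1 : ‖v p‖ < 1) :
    dbar (fun q => A q * ((1 - starRingEnd ℂ (v q)) / (1 - v q * starRingEnd ℂ (v q)))) p =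
      2 * A p * starRingEnd ℂ (deriv v p) * (v p - 1) / (1 - v p * starRingEnd ℂ (v p)) ^ 2 := by
  have h0 := one_sub_mul_conj_ne_zero h1
  have dA := hA.restrictScalars ℝ
  have dv := hv.restrictScalars ℝ
  have dc := differentiableAt_conj dv
  have c1 : ∀ c : ℂ, DifferentiableAt ℝ (fun _ : ℂ => c) p := fun c => differentiableAt_const c
  set R : ℂ → ℂ := fun q => (1 - starRingEnd ℂ (v q)) / (1 - v q * starRingEnd ℂ (v q)) with hR
  have dD : DifferentiableAt ℝ (fun q => 1 - v q * starRingEnd ℂ (v q)) p :=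
    (c1 1).fun_sub (dv.fun_mul dc)
  have dR : DifferentiableAt ℝ R p := by
    simp only [hR, div_eq_mul_inv]
    exact ((c1 1).fun_sub dc).fun_mul (dD.fun_inv h0)
  -- The quotient is differentiated through the product rule for R (1 - |v|²) = 1 - v̄.
  have key : dbar (fun q => R q * (1 - v q * starRingEnd ℂ (v q))) p =
      dbar (fun q => 1 - starRingEnd ℂ (v q)) p := by
    refine dbar_congr ?_
    filter_upwards [dD.continuousAt.eventually_ne h0] with q hq
    exact div_mul_cancel₀ _ hq
  rw [dbar_mul dR dD, dbar_sub (c1 1) dc, dbar_sub (c1 1) (dv.fun_mul dc), dbar_mul dv dc,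
    dbar_const, dbar_of_differentiableAt hv, dbar_conj_of_differentiableAt hv] at key
  rw [dbar_mul dA dR, dbar_of_differentiableAt hA]
  have hRp : R p = (1 - starRingEnd ℂ (v p)) / (1 - v p * starRingEnd ℂ (v p)) := rfl
  have : dbar R p = (-(2 * starRingEnd ℂ (deriv v p)) + R p * (v p * (2 * starRingEnd ℂ (deriv v p))))
      / (1 - v p * starRingEnd ℂ (v p)) := by
    rw [eq_div_iff h0]; linear_combination key
  rw [this, hRp]
  generalize hD : 1 - v p * starRingEnd ℂ (v p) = D at h0 ⊢
  field_simp
  linear_combination 2 * A p * starRingEnd ℂ (deriv v p) * hD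

/-! ### Radial functions -/

theorem hasFDerivAt_norm_sq (p : ℂ) :
    HasFDerivAt (fun q : ℂ => ‖q‖ ^ 2) (2 • innerSL ℝ p) p :=
  (hasStrictFDerivAt_norm_sq p).hasFDerivAt

theorem norm_sq_eq_re_im (p : ℂ) : ‖p‖ ^ 2 = p.re ^ 2 + p.im ^ 2 := by
  rw [← Complex.normSq_eq_norm_sq, Complex.normSq_apply]; ring

/-- A derivative within [0, S) suffices because |q|² is never negative. This covers the centre,
where ψ is controlled only from the right. -/
theorem hasFDerivAt_radial {ψ : ℝ → ℝ} {d S : ℝ} {p : ℂ}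
    (hψ : HasDerivWithinAt ψ d (Ico 0 S) (‖p‖ ^ 2)) (hp : ‖p‖ ^ 2 < S) :
    HasFDerivAt (fun q : ℂ => ψ (‖q‖ ^ 2)) (d • (2 • innerSL ℝ p)) p := by
  have hnb : {q : ℂ | ‖q‖ ^ 2 < S} ∈ 𝓝 p :=
    (isOpen_lt (by fun_prop) continuous_const).mem_nhds hp
  have := HasFDerivWithinAt.comp (g := ψ) (t := Ico 0 S) p hψ.hasFDerivWithinAt
    (hasFDerivAt_norm_sq p).hasFDerivWithinAt (s := {q : ℂ | ‖q‖ ^ 2 < S})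
    fun q hq => ⟨by positivity, hq⟩
  refine (this.hasFDerivAt hnb).congr_fderiv ?_
  ext x
  simp
  ring

theorem px_radial {ψ : ℝ → ℝ} {d S : ℝ} {p : ℂ}
    (hψ : HasDerivWithinAt ψ d (Ico 0 S) (‖p‖ ^ 2)) (hp : ‖p‖ ^ 2 < S) :
    px (fun q : ℂ => ψ (‖q‖ ^ 2)) p = 2 * p.re * d := by
  rw [px, (hasFDerivAt_radial hψ hp).fderiv]
  simp [Complex.inner]; ring

theorem py_radial {ψ : ℝ → ℝ} {d S : ℝ} {p : ℂ}
    (hψ : HasDerivWithinAt ψ d (Ico 0 S) (‖p‖ ^ 2)) (hp : ‖p‖ ^ 2 < S) :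
    py (fun q : ℂ => ψ (‖q‖ ^ 2)) p = 2 * p.im * d := by
  rw [py, (hasFDerivAt_radial hψ hp).fderiv]
  simp [Complex.inner]; ring

theorem contDiffOn_radial {ψ : ℝ → ℝ} {r : ℝ} (hψ : ContDiffOn ℝ ∞ ψ (Ico 0 (r ^ 2))) :
    ContDiffOn ℝ ∞ (fun q : ℂ => ψ (‖q‖ ^ 2)) (Metric.ball 0 r) := by
  refine hψ.comp (contDiff_norm_sq ℝ).contDiffOn fun q hq => ⟨by positivity, ?_⟩
  have := mem_ball_zero_iff.1 hq
  gcongr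

theorem px_re (p : ℂ) : px (fun q => q.re) p = 1 := by
  have := (Complex.reCLM.hasFDerivAt (x := p)).fderiv
  change fderiv ℝ Complex.reCLM p 1 = 1
  simp [this]

theorem py_im (p : ℂ) : py (fun q => q.im) p = 1 := by
  have := (Complex.imCLM.hasFDerivAt (x := p)).fderiv
  change fderiv ℝ Complex.imCLM p I = 1
  simp [this]

theorem px_radial_of_hasDerivAt {ψ : ℝ → ℝ} {d : ℝ} {p : ℂ} (hψ : HasDerivAt ψ d (‖p‖ ^ 2)) :
    px (fun q : ℂ => ψ (‖q‖ ^ 2)) p = 2 * p.re * d :=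
  px_radial (S := ‖p‖ ^ 2 + 1) hψ.hasDerivWithinAt (by linarith)

theorem py_radial_of_hasDerivAt {ψ : ℝ → ℝ} {d : ℝ} {p : ℂ} (hψ : HasDerivAt ψ d (‖p‖ ^ 2)) :
    py (fun q : ℂ => ψ (‖q‖ ^ 2)) p = 2 * p.im * d :=
  py_radial (S := ‖p‖ ^ 2 + 1) hψ.hasDerivWithinAt (by linarith)

/-- For a radial function `E = e(|w|²)`, the expression `E ΔE - |∇E|² = E² Δ log E`. -/
theorem radial_gauss {e : ℝ → ℝ} {V : Set ℝ} (hV : IsOpen V) (he : ContDiffOn ℝ ∞ e V)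
    (hpos : ∀ t ∈ V, 0 < e t) {E : ℂ → ℝ} {p : ℂ} (hp : ‖p‖ ^ 2 ∈ V)
    (hE : E =ᶠ[𝓝 p] fun q => e (‖q‖ ^ 2)) :
    E p * (px (px E) p + py (py E) p) - (px E p ^ 2 + py E p ^ 2) =
      4 * e (‖p‖ ^ 2) ^ 2 * deriv (fun t => t * deriv e t / e t) (‖p‖ ^ 2) := by
  have he' := ContDiffOn.deriv_of_isOpen_infty hV he
  have h1 := fun {t : ℝ} (ht : t ∈ V) => ContDiffOn.hasDerivAt_of_isOpen hV he ht
  have h2 := fun {t : ℝ} (ht : t ∈ V) => ContDiffOn.hasDerivAt_of_isOpen hV he' ht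
  have hW : ∀ᶠ q in 𝓝 p, ‖q‖ ^ 2 ∈ V :=
    (hV.preimage (by fun_prop : Continuous fun q : ℂ => ‖q‖ ^ 2)).mem_nhds hp
  have hx : px E =ᶠ[𝓝 p] fun q => 2 * q.re * deriv e (‖q‖ ^ 2) := by
    filter_upwards [hE.eventuallyEq_nhds, hW] with q hq hqV
    rw [px_congr hq, px_radial_of_hasDerivAt (h1 hqV)]
  have hy : py E =ᶠ[𝓝 p] fun q => 2 * q.im * deriv e (‖q‖ ^ 2) := by
    filter_upwards [hE.eventuallyEq_nhds, hW] with q hq hqV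
    rw [py_congr hq, py_radial_of_hasDerivAt (h1 hqV)]
  have dre : DifferentiableAt ℝ (fun q : ℂ => 2 * q.re) p :=
    (Complex.reCLM.differentiableAt (x := p)).const_mul 2
  have dim : DifferentiableAt ℝ (fun q : ℂ => 2 * q.im) p :=
    (Complex.imCLM.differentiableAt (x := p)).const_mul 2
  have de' : DifferentiableAt ℝ (fun q : ℂ => deriv e (‖q‖ ^ 2)) p := by
    have := (h2 hp).comp_hasFDerivAt p (hasFDerivAt_norm_sq p)
    exact this.differentiableAt
  have e0 := (hpos _ hp).ne'
  have r1 : px (fun q : ℂ => 2 * q.re) p = 2 * 1 :=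
    (px_const_mul 2 Complex.reCLM.differentiableAt).trans (congrArg (2 * ·) (px_re p))
  have r2 : py (fun q : ℂ => 2 * q.im) p = 2 * 1 :=
    (py_const_mul 2 Complex.imCLM.differentiableAt).trans (congrArg (2 * ·) (py_im p))
  rw [px_congr hx, py_congr hy, px_mul dre de', py_mul dim de', px_radial_of_hasDerivAt (h2 hp),
    py_radial_of_hasDerivAt (h2 hp), r1, r2, hx.eq_of_nhds, hy.eq_of_nhds, hE.eq_of_nhds]
  have hd := (((hasDerivAt_id _).fun_mul (h2 hp)).fun_div (h1 hp) e0).deriv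
  simp only [id] at hd
  rw [hd]
  field_simp
  rw [norm_sq_eq_re_im]
  ring

/-! ### The Hazzidakis equation -/

/-- The conformal factor determined by a solution of the Hazzidakis equation. -/
def modelFactor (J : ℕ) (H : ℝ → ℝ) (t : ℝ) : ℝ :=
  -2 * ((J : ℝ) + 2) ^ 2 * (t ^ J / ((1 - t ^ (J + 2)) ^ 2 * deriv H t))

theorem one_sub_pow_pos {S t : ℝ} (hS : S ≤ 1) (ht : t ∈ Ico 0 S) (J : ℕ) :
    0 < 1 - t ^ (J + 2) := by
  have := pow_lt_one₀ ht.1 (ht.2.trans_le hS) (by omega : J + 2 ≠ 0)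
  linarith

theorem modelFactor_pos {J : ℕ} {S : ℝ} (hS : S ≤ 1) {H : ℝ → ℝ}
    (hneg : ∀ t ∈ Ioo 0 S, deriv H t < 0) {t : ℝ} (ht : t ∈ Ioo 0 S) : 0 < modelFactor J H t := by
  have h1 := one_sub_pow_pos hS ⟨ht.1.le, ht.2⟩ J
  have h2 := hneg t ht
  have h3 := pow_pos ht.1 J
  rw [modelFactor, neg_mul, neg_mul, neg_pos, mul_neg_iff]
  left
  exact ⟨by positivity, div_neg_of_pos_of_neg h3 (mul_neg_of_pos_of_neg (by positivity) h2)⟩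

theorem contDiffOn_modelFactor {J : ℕ} {S : ℝ} (hS : S ≤ 1) {H : ℝ → ℝ}
    (hH : ContDiffOn ℝ ∞ H (Ioo 0 S)) (hneg : ∀ t ∈ Ioo 0 S, deriv H t < 0) :
    ContDiffOn ℝ ∞ (modelFactor J H) (Ioo 0 S) := by
  refine contDiffOn_const.mul (ContDiffOn.div (by fun_prop) (ContDiffOn.mul (by fun_prop)
    (ContDiffOn.deriv_of_isOpen_infty isOpen_Ioo hH)) fun t ht => ?_)
  exact mul_ne_zero (pow_ne_zero _ (one_sub_pow_pos hS ⟨ht.1.le, ht.2⟩ J).ne') (hneg t ht).ne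

/-- A logarithmic derivative, so the three factors contribute separately. The contribution of H' is
the expression whose derivative opens the Hazzidakis equation. -/
theorem modelFactor_log_deriv {J : ℕ} {S : ℝ} (hS : S ≤ 1) {H : ℝ → ℝ}
    (hH : ContDiffOn ℝ ∞ H (Ioo 0 S)) (hneg : ∀ t ∈ Ioo 0 S, deriv H t < 0) {t : ℝ}
    (ht : t ∈ Ioo 0 S) :
    t * deriv (modelFactor J H) t / modelFactor J H t =
      J + 2 * ((J : ℝ) + 2) * (t ^ (J + 2) / (1 - t ^ (J + 2))) -
        t * deriv (deriv H) t / deriv H t := by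
  have hH' := ContDiffOn.deriv_of_isOpen_infty isOpen_Ioo hH
  have h1 := (one_sub_pow_pos hS ⟨ht.1.le, ht.2⟩ J).ne'
  have h2 := (hneg t ht).ne
  have h3 := ht.1.ne'
  have d1 : HasDerivAt (fun t : ℝ => (1 - t ^ (J + 2)) ^ 2)
      (2 * (1 - t ^ (J + 2)) * -(((J : ℝ) + 2) * t ^ (J + 1))) t := by
    have := (((hasDerivAt_pow (J + 2) t).const_sub 1)).fun_pow 2
    refine this.congr_deriv ?_
    push_cast; simp
  have d2 := d1.fun_mul (ContDiffOn.hasDerivAt_of_isOpen isOpen_Ioo hH' ht)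
  have d3 := ((hasDerivAt_pow J t).fun_div d2 (mul_ne_zero (pow_ne_zero 2 h1) h2)).const_mul
    (-2 * ((J : ℝ) + 2) ^ 2)
  have d4 : deriv (modelFactor J H) t = _ := d3.deriv
  -- The truncated exponent J - 1 is harmless: for J = 0 both sides vanish.
  have hJ : (J : ℝ) * t ^ (J - 1) = J * t ^ J / t := by
    cases J with
    | zero => simp
    | succ j => rw [Nat.add_sub_cancel, pow_succ]; field_simp
  have hJ2 : ((J : ℝ) + 2) ≠ 0 := by positivity
  rw [d4, hJ, modelFactor]
  have h5 : t ^ J ≠ 0 := pow_ne_zero _ h3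
  have e1 : t ^ (J + 1) = t ^ J * t := pow_succ t J
  have e2 : t ^ (J + 2) = t ^ J * t ^ 2 := pow_add t J 2
  rw [e2] at h1
  rw [e1, e2]
  generalize t ^ J = T at *
  generalize hD : 1 - T * t ^ 2 = D at h1 ⊢
  field_simp
  ring

theorem deriv_modelFactor_log_deriv {J : ℕ} {S : ℝ} (hS : S ≤ 1) {H : ℝ → ℝ}
    (hH : ContDiffOn ℝ ∞ H (Ioo 0 S)) (hneg : ∀ t ∈ Ioo 0 S, deriv H t < 0) {s : ℝ}
    (hs : s ∈ Ioo 0 S) :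
    deriv (fun t => t * deriv (modelFactor J H) t / modelFactor J H t) s =
      2 * ((J : ℝ) + 2) ^ 2 * s ^ (J + 1) / (1 - s ^ (J + 2)) ^ 2 -
        deriv (fun t => t * deriv (deriv H) t / deriv H t) s := by
  have hH' := ContDiffOn.deriv_of_isOpen_infty isOpen_Ioo hH
  have hH'' := ContDiffOn.deriv_of_isOpen_infty isOpen_Ioo hH'
  have h1 := (one_sub_pow_pos hS ⟨hs.1.le, hs.2⟩ J).ne'
  have e : (fun t => t * deriv (modelFactor J H) t / modelFactor J H t) =ᶠ[𝓝 s] fun t =>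
      J + 2 * ((J : ℝ) + 2) * (t ^ (J + 2) / (1 - t ^ (J + 2))) -
        t * deriv (deriv H) t / deriv H t :=
    (isOpen_Ioo.eventually_mem hs).mono fun t ht => modelFactor_log_deriv hS hH hneg ht
  rw [e.deriv_eq]
  have d1 := hasDerivAt_pow (J + 2) s
  have d2 := ((d1.fun_div (d1.const_sub 1) h1).const_mul (2 * ((J : ℝ) + 2))).const_add (J : ℝ)
  have d3 := ((hasDerivAt_id s).fun_mul (ContDiffOn.hasDerivAt_of_isOpen isOpen_Ioo hH'' hs)).fun_div
    (ContDiffOn.hasDerivAt_of_isOpen isOpen_Ioo hH' hs) (hneg s hs).ne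
  have d4 := d2.fun_sub d3.differentiableAt.hasDerivAt
  simp only [id] at d4
  rw [d4.deriv]
  congr 1
  field_simp
  push_cast
  ring

/-- The Gauss equation of the normal form is equivalent to the Hazzidakis equation. -/
theorem gauss_iff_hazzidakis {J : ℕ} {S : ℝ} (hS : S ≤ 1) {H : ℝ → ℝ}
    (hH : ContDiffOn ℝ ∞ H (Ioo 0 S)) (hneg : ∀ t ∈ Ioo 0 S, deriv H t < 0) {E : ℂ → ℝ} {p : ℂ}
    (hp : ‖p‖ ^ 2 ∈ Ioo 0 S) (hE : E =ᶠ[𝓝 p] fun q => modelFactor J H (‖q‖ ^ 2)) {k : ℝ}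
    (hk : k = ((J : ℝ) + 2) ^ 2 * (‖p‖ ^ 2) ^ J / (1 - (‖p‖ ^ 2) ^ (J + 2)) ^ 2) :
    E p * (px (px E) p + py (py E) p) - (px E p ^ 2 + py E p ^ 2) =
        -2 * E p * (E p ^ 2 * H (‖p‖ ^ 2) ^ 2 - 4 * k) ↔
      deriv (fun t => t * deriv (deriv H) t / deriv H t) (‖p‖ ^ 2) - deriv H (‖p‖ ^ 2) =
        ((J : ℝ) + 2) ^ 2 * (‖p‖ ^ 2) ^ (J + 1) / (1 - (‖p‖ ^ 2) ^ (J + 2)) ^ 2 *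
          (2 - H (‖p‖ ^ 2) ^ 2 / (‖p‖ ^ 2 * deriv H (‖p‖ ^ 2))) := by
  rw [radial_gauss isOpen_Ioo (contDiffOn_modelFactor hS hH hneg)
    (fun t ht => modelFactor_pos hS hneg ht) hp hE, deriv_modelFactor_log_deriv hS hH hneg hp,
    hE.eq_of_nhds, hk]
  have h1 := (one_sub_pow_pos hS ⟨hp.1.le, hp.2⟩ J).ne'
  have h2 := (hneg _ hp).ne
  have h3 := hp.1.ne'
  have hm := (modelFactor_pos (J := J) hS hneg hp).ne'
  have hJ2 : ((J : ℝ) + 2) ≠ 0 := by positivity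
  generalize ‖p‖ ^ 2 = s at *
  generalize deriv (fun t => t * deriv (deriv H) t / deriv H t) s = D
  -- The Codazzi relation E H' = -2|Q|², here `hme`, makes the difference of the two sides of the
  -- Gauss equation equal to -4E² times the difference of the two sides of the Hazzidakis equation.
  -- Since E ≠ 0, the two equations are equivalent.
  have key : 4 * modelFactor J H s ^ 2 *
      (2 * ((J : ℝ) + 2) ^ 2 * s ^ (J + 1) / (1 - s ^ (J + 2)) ^ 2 - D) -
      -2 * modelFactor J H s * (modelFactor J H s ^ 2 * H s ^ 2 -
        4 * (((J : ℝ) + 2) ^ 2 * s ^ J / (1 - s ^ (J + 2)) ^ 2)) =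
      -4 * modelFactor J H s ^ 2 * (D - deriv H s - ((J : ℝ) + 2) ^ 2 * s ^ (J + 1) /
        (1 - s ^ (J + 2)) ^ 2 * (2 - H s ^ 2 / (s * deriv H s))) := by
    have hme : modelFactor J H s * deriv H s =
        -2 * (((J : ℝ) + 2) ^ 2 * s ^ J / (1 - s ^ (J + 2)) ^ 2) := by
      rw [modelFactor]; field_simp
    have e2 : s ^ (J + 1) = s ^ J * s := pow_succ s J
    have hq : ((J : ℝ) + 2) ^ 2 * s ^ (J + 1) / (1 - s ^ (J + 2)) ^ 2 =
        -(modelFactor J H s * deriv H s) / 2 * s := by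
      rw [hme, e2]; ring
    have hq2 : (((J : ℝ) + 2) ^ 2 * s ^ J / (1 - s ^ (J + 2)) ^ 2) =
        -(modelFactor J H s * deriv H s) / 2 := by rw [hme]; ring
    rw [hq2, show 2 * ((J : ℝ) + 2) ^ 2 * s ^ (J + 1) / (1 - s ^ (J + 2)) ^ 2 =
      2 * (((J : ℝ) + 2) ^ 2 * s ^ (J + 1) / (1 - s ^ (J + 2)) ^ 2) by ring, hq]
    field_simp
    ring
  rw [← sub_eq_zero, key, ← sub_eq_zero (b := _ * (2 - _)), mul_eq_zero]
  constructor
  · rintro (h | h)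
    · exact absurd h (mul_ne_zero (by norm_num) (pow_ne_zero 2 hm))
    · exact h
  · exact Or.inr

end BonnetSurf

namespace BonnetSurf

open Complex (I)

/-! ### The Hopf differential of the normal form -/

/-- The coefficient of the Hopf differential in the normal form. -/
def modelHopf (J : ℕ) (w : ℂ) : ℂ :=
  ((J : ℂ) + 2) * ((1 - (starRingEnd ℂ w) ^ (J + 2)) / (1 - w ^ (J + 2))) *
    (w ^ J / (1 - ((‖w‖ ^ 2 : ℝ) : ℂ) ^ (J + 2)))

/-- Exhibits the model as an instance of `dbar_cayley`, with v = w^(J+2). -/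
theorem modelHopf_eq_cayley (J : ℕ) (w : ℂ) :
    modelHopf J w = (((J : ℂ) + 2) * w ^ J / (1 - w ^ (J + 2))) *
      ((1 - starRingEnd ℂ (w ^ (J + 2))) /
        (1 - w ^ (J + 2) * starRingEnd ℂ (w ^ (J + 2)))) := by
  have : ((‖w‖ ^ 2 : ℝ) : ℂ) ^ (J + 2) = w ^ (J + 2) * starRingEnd ℂ (w ^ (J + 2)) := by
    rw [map_pow, ← mul_pow, Complex.mul_conj, Complex.normSq_eq_norm_sq]
  rw [modelHopf, this, map_pow]
  ring

theorem one_sub_pow_ne_zero {w : ℂ} (hw : ‖w‖ < 1) (J : ℕ) : 1 - w ^ (J + 2) ≠ 0 := by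
  intro h
  have h1 : ‖w ^ (J + 2)‖ = 1 := by rw [← sub_eq_zero.1 h]; simp
  rw [norm_pow] at h1
  have := pow_lt_one₀ (norm_nonneg w) hw (by omega : J + 2 ≠ 0)
  linarith

theorem norm_pow_lt_one {w : ℂ} (hw : ‖w‖ < 1) (J : ℕ) : ‖w ^ (J + 2)‖ < 1 := by
  rw [norm_pow]; exact pow_lt_one₀ (norm_nonneg w) hw (by omega)

theorem dbar_modelHopf (J : ℕ) {w : ℂ} (hw : ‖w‖ < 1) :
    dbar (modelHopf J) w = -((2 * ((J : ℝ) + 2) ^ 2 * (‖w‖ ^ 2) ^ J /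
      (1 - (‖w‖ ^ 2) ^ (J + 2)) ^ 2 : ℝ) : ℂ) * starRingEnd ℂ w := by
  have h0 := one_sub_pow_ne_zero hw J
  have hv := differentiableAt_pow (𝕜 := ℂ) (x := w) (J + 2)
  have e : modelHopf J = fun w => (((J : ℂ) + 2) * w ^ J / (1 - w ^ (J + 2))) *
      ((1 - starRingEnd ℂ (w ^ (J + 2))) /
        (1 - w ^ (J + 2) * starRingEnd ℂ (w ^ (J + 2)))) := funext (modelHopf_eq_cayley J)
  have dA : DifferentiableAt ℂ (fun w : ℂ => ((J : ℂ) + 2) * w ^ J / (1 - w ^ (J + 2))) w :=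
    DifferentiableAt.div (by fun_prop) (by fun_prop) h0
  rw [e, dbar_cayley dA hv (norm_pow_lt_one hw J)]
  have hd : deriv (fun x : ℂ => x ^ (J + 2)) w = ((J : ℂ) + 2) * w ^ (J + 1) := by
    rw [deriv_pow_field]; push_cast; rfl
  have h2 := one_sub_mul_conj_ne_zero (norm_pow_lt_one hw J)
  have e3 : ((‖w‖ ^ 2 : ℝ) : ℂ) = w * starRingEnd ℂ w := by
    rw [Complex.mul_conj, Complex.normSq_eq_norm_sq]
  rw [hd]
  push_cast at e3 ⊢
  rw [e3]
  simp only [map_mul, map_add, map_pow, Complex.conj_natCast, map_ofNat] at h2 ⊢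
  rw [mul_pow w _ (J + 2)]
  generalize hD : 1 - w ^ (J + 2) * (starRingEnd ℂ) w ^ (J + 2) = D at *
  generalize hC : 1 - w ^ (J + 2) = C at *
  have : w ^ (J + 2) - 1 = - C := by rw [← hC]; ring
  rw [this, mul_pow, pow_succ (starRingEnd ℂ w) J]
  field_simp

/-- The first quotient in the model is a number divided by its conjugate and has modulus 1. -/
theorem norm_sq_modelHopf (J : ℕ) {w : ℂ} (hw : ‖w‖ < 1) :
    ‖modelHopf J w‖ ^ 2 =
      ((J : ℝ) + 2) ^ 2 * (‖w‖ ^ 2) ^ J / (1 - (‖w‖ ^ 2) ^ (J + 2)) ^ 2 := by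
  have h0 := one_sub_pow_ne_zero hw J
  have h1 : ‖1 - starRingEnd ℂ w ^ (J + 2)‖ = ‖1 - w ^ (J + 2)‖ := by
    rw [← Complex.norm_conj (1 - w ^ (J + 2))]; simp
  have h2 : ‖1 - ((‖w‖ ^ 2 : ℝ) : ℂ) ^ (J + 2)‖ ^ 2 = (1 - (‖w‖ ^ 2) ^ (J + 2)) ^ 2 := by
    rw [show 1 - ((‖w‖ ^ 2 : ℝ) : ℂ) ^ (J + 2) = ((1 - (‖w‖ ^ 2) ^ (J + 2) : ℝ) : ℂ) by
      push_cast; ring, Complex.norm_real, Real.norm_eq_abs, sq_abs]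
  have h3 : ‖(J : ℂ) + 2‖ = (J : ℝ) + 2 := by
    have : (J : ℂ) + 2 = (((J : ℝ) + 2 : ℝ) : ℂ) := by push_cast; ring
    rw [this, Complex.norm_real, Real.norm_of_nonneg (by positivity)]
  rw [modelHopf, norm_mul, norm_mul, norm_div, norm_div, h1, div_self (norm_ne_zero_iff.2 h0),
    mul_one, mul_pow, div_pow, h2, h3, norm_pow]
  ring

theorem contDiffOn_modelHopf (J : ℕ) : ContDiffOn ℝ ∞ (modelHopf J) (Metric.ball 0 1) := by
  have hc : ContDiff ℝ ∞ (fun w : ℂ => starRingEnd ℂ w) := Complex.conjCLE.contDiff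
  have hn : ContDiff ℝ ∞ (fun w : ℂ => ((‖w‖ ^ 2 : ℝ) : ℂ)) :=
    Complex.ofRealCLM.contDiff.comp (contDiff_norm_sq ℝ)
  have e : modelHopf J = fun w => ((J : ℂ) + 2) * ((1 - (starRingEnd ℂ w) ^ (J + 2)) *
      (1 - w ^ (J + 2))⁻¹) * (w ^ J * (1 - ((‖w‖ ^ 2 : ℝ) : ℂ) ^ (J + 2))⁻¹) := by
    funext w; simp only [modelHopf, div_eq_mul_inv]
  rw [e]
  refine ContDiffOn.mul (contDiffOn_const.mul (ContDiffOn.mul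
    (contDiff_const.sub (hc.pow _)).contDiffOn (ContDiffOn.inv
    (contDiff_const.sub (contDiff_id.pow _)).contDiffOn
    fun w hw => one_sub_pow_ne_zero (mem_ball_zero_iff.1 hw) J))) (ContDiffOn.mul
    (contDiff_id.pow _).contDiffOn (ContDiffOn.inv
    (contDiff_const.sub (hn.pow _)).contDiffOn fun w hw => ?_))
  have hw := mem_ball_zero_iff.1 hw
  have : ((‖w‖ ^ 2 : ℝ) : ℂ) ^ (J + 2) = w ^ (J + 2) * starRingEnd ℂ (w ^ (J + 2)) := by
    rw [map_pow, ← mul_pow, Complex.mul_conj, Complex.normSq_eq_norm_sq]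
  rw [this]
  exact one_sub_mul_conj_ne_zero (norm_pow_lt_one hw J)

theorem norm_sq_mem_Ico {r : ℝ} {w : ℂ} (hw : w ∈ Metric.ball (0 : ℂ) r) :
    ‖w‖ ^ 2 ∈ Ico 0 (r ^ 2) :=
  ⟨by positivity, by have := mem_ball_zero_iff.1 hw; gcongr⟩

theorem norm_sq_mem_Ioo {r : ℝ} {w : ℂ} (hw : w ∈ Metric.ball (0 : ℂ) r) (h0 : w ≠ 0) :
    ‖w‖ ^ 2 ∈ Ioo 0 (r ^ 2) :=
  ⟨by have := norm_pos_iff.2 h0; positivity, (norm_sq_mem_Ico hw).2⟩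

/-- For the model, Q_z̄ is a real multiple of w̄; the Codazzi equation then says that the gradient
of H is radial, with a known factor. -/
theorem codazzi_iff_gradient {E c hx hy : ℝ} (hE : E ≠ 0) (w : ℂ) :
    -((c : ℝ) : ℂ) * starRingEnd ℂ w = ((E / 2 : ℝ) : ℂ) * (((hx : ℝ) : ℂ) - I * ((hy : ℝ) : ℂ)) ↔
      hx = -(2 * c / E) * w.re ∧ hy = -(2 * c / E) * w.im := by
  have : (E : ℝ) ≠ 0 := hE
  rw [Complex.ext_iff]
  simp only [Complex.mul_re, Complex.mul_im, Complex.neg_re, Complex.neg_im, Complex.ofReal_re,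
    Complex.ofReal_im, Complex.conj_re, Complex.conj_im, Complex.sub_re, Complex.sub_im,
    Complex.I_re, Complex.I_im]
  constructor
  · rintro ⟨h1, h2⟩
    constructor <;> field_simp <;> linarith
  · rintro ⟨rfl, rfl⟩
    constructor <;> field_simp <;> ring

/-- A function whose gradient is everywhere radial is radial. -/
theorem radial_of_gradient {h c : ℂ → ℝ} {r : ℝ} (hh : ContDiffOn ℝ ∞ h (Metric.ball 0 r))
    (hx : ∀ w ∈ Metric.ball (0 : ℂ) r, px h w = c w * w.re)
    (hy : ∀ w ∈ Metric.ball (0 : ℂ) r, py h w = c w * w.im) {w : ℂ}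
    (hw : w ∈ Metric.ball (0 : ℂ) r) : h w = h (‖w‖ : ℂ) := by
  have hmem : ∀ t : ℝ, (‖w‖ : ℂ) * Complex.exp (t * I) ∈ Metric.ball (0 : ℂ) r := fun t => by
    rw [mem_ball_zero_iff, norm_mul, Complex.norm_exp_ofReal_mul_I]
    simpa using hw
  have hd : ∀ t : ℝ, HasDerivAt (fun t : ℝ => h ((‖w‖ : ℂ) * Complex.exp (t * I))) 0 t := by
    intro t
    set q := (‖w‖ : ℂ) * Complex.exp (t * I) with hq
    have h1 : HasDerivAt (fun t : ℝ => (‖w‖ : ℂ) * Complex.exp (t * I)) (q * I) t := by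
      have := (((Complex.ofRealCLM.hasDerivAt (x := t)).mul_const I).cexp).const_mul (‖w‖ : ℂ)
      refine this.congr_deriv ?_
      simp [hq]; ring
    have h2 := (hh.differentiableAt_of_isOpen Metric.isOpen_ball (hmem t)).hasFDerivAt
    have h3 := h2.comp_hasDerivAt t h1
    refine h3.congr_deriv ?_
    rw [fderiv_eq_px_py, hx _ (hmem t), hy _ (hmem t), ← hq]
    simp; ring
  have := is_const_of_deriv_eq_zero (fun t => (hd t).differentiableAt) (fun t => (hd t).deriv)
    w.arg 0
  simpa [Complex.norm_mul_exp_arg_mul_I] using this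

/-- A conformal immersion of a disc with the Hopf differential of the normal form. -/
theorem exists_hazzidakis_of_hopf {J : ℕ} {r : ℝ} (hr : 0 < r) (hr1 : r ≤ 1) {f : ℂ → E3}
    (hf : IsConformalImmersionOn f (Metric.ball 0 r))
    (hQ : ∀ w ∈ Metric.ball (0 : ℂ) r, hopf f w = modelHopf J w) :
    ∃ H : ℝ → ℝ, IsHazzidakisSolution J (r ^ 2) H ∧ HasAsymptotics J (r ^ 2) H ∧
      HasFundamentalForms J H r f := by
  have hU : IsOpen (Metric.ball (0 : ℂ) r) := Metric.isOpen_ball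
  have hS : r ^ 2 ≤ 1 := pow_le_one₀ hr.le hr1
  have hlt : ∀ {w : ℂ}, w ∈ Metric.ball (0 : ℂ) r → ‖w‖ < 1 := fun hw =>
    (mem_ball_zero_iff.1 hw).trans_le hr1
  set E := conformalFactor f with hEdef
  set h := meanCurv f with hhdef
  have hE0 : ∀ {w : ℂ}, w ∈ Metric.ball (0 : ℂ) r → 0 < E w := fun hw => hf.cf_pos hw
  have hEc := hf.contDiffOn_cf hU
  have hhc := hf.contDiffOn_meanCurv hU
  have hJ : (0 : ℝ) < (J : ℝ) + 2 := by positivity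
  set c : ℂ → ℝ := fun w => -(2 * (2 * ((J : ℝ) + 2) ^ 2 * (‖w‖ ^ 2) ^ J /
      (1 - (‖w‖ ^ 2) ^ (J + 2)) ^ 2) / E w) with hc
  have grad : ∀ w ∈ Metric.ball (0 : ℂ) r, px h w = c w * w.re ∧ py h w = c w * w.im := by
    intro w hw
    have h1 := hf.codazzi hU hw
    have h2 : px (hopf f) w + I * py (hopf f) w = dbar (modelHopf J) w :=
      dbar_congr ((hU.eventually_mem hw).mono hQ)
    rw [h2, dbar_modelHopf J (hlt hw), codazzi_iff_gradient (hE0 hw).ne'] at h1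
    exact h1
  have hrad : ∀ w ∈ Metric.ball (0 : ℂ) r, h w = h (‖w‖ : ℂ) := fun w hw =>
    radial_of_gradient hhc (fun w hw => (grad w hw).1) (fun w hw => (grad w hw).2) hw
  -- The mean curvature is constant on circles, so its values on the nonnegative real axis, in the
  -- variable s = x², determine it.
  set H : ℝ → ℝ := fun s => h (√s : ℂ) with hH
  have hHh : ∀ w ∈ Metric.ball (0 : ℂ) r, h w = H (‖w‖ ^ 2) := fun w hw => by
    rw [hrad w hw, hH]; simp [Real.sqrt_sq (norm_nonneg w)]
  have hsq : ∀ {s : ℝ}, s < r ^ 2 → (√s : ℂ) ∈ Metric.ball (0 : ℂ) r := fun {s} hs => by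
    rw [mem_ball_zero_iff, Complex.norm_real, Real.norm_of_nonneg (Real.sqrt_nonneg s)]
    exact (Real.sqrt_lt' hr).2 hs
  have hHc : ContDiffOn ℝ ∞ H (Ioo 0 (r ^ 2)) := by
    refine hhc.comp (t := Metric.ball 0 r) (fun s hs => ?_) fun s hs => hsq hs.2
    exact (Complex.ofRealCLM.contDiff.contDiffAt.comp s
      (Real.contDiffAt_sqrt hs.1.ne')).contDiffWithinAt
  have hHc0 : ContinuousOn H (Ico 0 (r ^ 2)) :=
    hhc.continuousOn.comp (by fun_prop) fun s hs => hsq hs.2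
  have hH' : ∀ {w : ℂ}, w ∈ Metric.ball (0 : ℂ) r → w ≠ 0 → 2 * deriv H (‖w‖ ^ 2) = c w := by
    intro w hw h0
    have hs := norm_sq_mem_Ioo hw h0
    have e : h =ᶠ[𝓝 w] fun q => H (‖q‖ ^ 2) := (hU.eventually_mem hw).mono hHh
    have hd := ContDiffOn.hasDerivAt_of_isOpen isOpen_Ioo hHc hs
    have hx := (px_congr e).trans (px_radial_of_hasDerivAt hd)
    have hy := (py_congr e).trans (py_radial_of_hasDerivAt hd)
    rw [(grad w hw).1] at hx
    rw [(grad w hw).2] at hy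
    have hne : w.re ≠ 0 ∨ w.im ≠ 0 := by
      by_contra! hcon
      exact h0 (Complex.ext hcon.1 hcon.2)
    rcases hne with hne | hne
    · exact mul_right_cancel₀ hne (by linarith)
    · exact mul_right_cancel₀ hne (by linarith)
  have hD : ∀ {w : ℂ}, w ∈ Metric.ball (0 : ℂ) r → 0 < 1 - (‖w‖ ^ 2) ^ (J + 2) := fun hw =>
    one_sub_pow_pos hS (norm_sq_mem_Ico hw) J
  have hneg : ∀ s ∈ Ioo 0 (r ^ 2), deriv H s < 0 := by
    intro s hs
    have h1 := hsq hs.2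
    have h0 : (√s : ℂ) ≠ 0 := Complex.ofReal_ne_zero.2 (Real.sqrt_pos.2 hs.1).ne'
    have h2 := hH' h1 h0
    have h3 : ‖(√s : ℂ)‖ ^ 2 = s := by simp [Real.sq_sqrt hs.1.le]
    have h4 := hE0 h1
    have h5 := hD h1
    simp only [hc, h3] at h2 h5
    have : 0 < 2 * (2 * ((J : ℝ) + 2) ^ 2 * s ^ J / (1 - s ^ (J + 2)) ^ 2) / E √s := by
      have := pow_pos hs.1 J
      positivity
    linarith
  have hfac : ∀ w ∈ Metric.ball (0 : ℂ) r, w ≠ 0 → E w = modelFactor J H (‖w‖ ^ 2) := by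
    intro w hw h0
    have h1 := hH' hw h0
    have h2 := (hE0 hw).ne'
    have h3 := (hD hw).ne'
    have h4 := (hneg _ (norm_sq_mem_Ioo hw h0)).ne
    simp only [hc] at h1
    rw [modelFactor]
    generalize ‖w‖ ^ 2 = s at *
    field_simp at h1 ⊢
    linarith
  refine ⟨H, ⟨hHc, hneg, fun s hs => ?_⟩, ?_, hf, hQ, hfac, hHh⟩
  · have h1 := hsq hs.2
    have h0 : (√s : ℂ) ≠ 0 := Complex.ofReal_ne_zero.2 (Real.sqrt_pos.2 hs.1).ne'
    have h3 : ‖(√s : ℂ)‖ ^ 2 = s := by simp [Real.sq_sqrt hs.1.le]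
    have hev : E =ᶠ[𝓝 (√s : ℂ)] fun q => modelFactor J H (‖q‖ ^ 2) := by
      filter_upwards [hU.eventually_mem h1, eventually_ne_nhds h0] with q hq hq0
      exact hfac q hq hq0
    have hg := hf.gauss hU h1
    have := (gauss_iff_hazzidakis hS hHc hneg (by rwa [h3]) hev
      (norm_sq_modelHopf J (hlt h1))).1 (by
        rw [hQ _ h1] at hg
        rw [← hHh _ h1]
        exact hg)
    rwa [h3] at this
  · have hEx : ContDiffOn ℝ ∞ (fun x : ℝ => E (x : ℂ)) (Ioo (-r) r) :=
      hEc.comp Complex.ofRealCLM.contDiff.contDiffOn fun x hx => by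
        rw [mem_ball_zero_iff, Complex.norm_real]; exact abs_lt.2 hx
    have hbx : ∀ {x : ℝ}, x ∈ Ioo (-r) r → (x : ℂ) ∈ Metric.ball (0 : ℂ) r := fun {x} hx => by
      rw [mem_ball_zero_iff, Complex.norm_real]; exact abs_lt.2 hx
    have hDx : ∀ {x : ℝ}, x ∈ Ioo (-r) r → 0 < 1 - (x ^ 2) ^ (J + 2) := fun {x} hx => by
      have := hD (hbx hx); simpa using this
    -- This g is H'(s)/s^J as a function of x = √s, written through the conformal factor on the real
    -- axis. Since E is smooth and positive at the centre as well, g is smooth and negative there.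
    refine exists_asymptotic_factor hr J
      (g := fun x => -2 * ((J : ℝ) + 2) ^ 2 / ((1 - (x ^ 2) ^ (J + 2)) ^ 2 * E (x : ℂ)))
      (ContDiffOn.div contDiffOn_const (ContDiffOn.mul (by fun_prop) hEx) fun x hx =>
        mul_ne_zero (pow_ne_zero 2 (hDx hx).ne') (hE0 (hbx hx)).ne')
      (fun x hx => ?_) (fun x hx => ?_) hHc0 fun s hs => ?_
    · by_cases h0 : x = 0
      · simp [h0]
      · have e : E ((-x : ℝ) : ℂ) = E (x : ℂ) := by
          rw [hfac _ (hbx ⟨by linarith [hx.2], by linarith [hx.1]⟩) (by simpa using h0),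
            hfac _ (hbx hx) (by simpa using h0)]
          simp
        simp only [e, neg_sq]
    · have h1 := hE0 (hbx hx)
      have h2 := hDx hx
      exact div_neg_of_neg_of_pos (by nlinarith) (by positivity)
    · have h1 := hsq hs.2
      have h0 : (√s : ℂ) ≠ 0 := Complex.ofReal_ne_zero.2 (Real.sqrt_pos.2 hs.1).ne'
      have h2 := hH' h1 h0
      have h3 : ‖(√s : ℂ)‖ ^ 2 = s := by simp [Real.sq_sqrt hs.1.le]
      have h4 := (hE0 h1).ne'
      have h5 := (hD h1).ne'
      simp only [hc, h3] at h2 h5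
      refine (ContDiffOn.hasDerivAt_of_isOpen isOpen_Ioo hHc hs).congr_deriv ?_
      rw [Real.sq_sqrt hs.1.le]
      field_simp at h2 ⊢
      linarith

end BonnetSurf

namespace BonnetSurf

open Complex (I)

/-! ### Surfaces with given fundamental forms: existence and uniqueness -/

/-- Carries identities across the centre, where the formulas containing H' make sense only as
limits. -/
theorem eq_of_eq_punctured {X : Type*} [TopologicalSpace X] [T2Space X] {a b : ℂ → X} {r : ℝ}
    (ha : ContinuousOn a (Metric.ball 0 r)) (hb : ContinuousOn b (Metric.ball 0 r))
    (h : ∀ w ∈ Metric.ball (0 : ℂ) r, w ≠ 0 → a w = b w) :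
    ∀ w ∈ Metric.ball (0 : ℂ) r, a w = b w := by
  intro w hw
  by_cases h0 : w = 0
  · subst h0
    have hn := Metric.isOpen_ball.mem_nhds hw
    refine tendsto_nhds_unique (l := 𝓝[≠] (0:ℂ))
      (((ha.continuousAt hn).tendsto).mono_left nhdsWithin_le_nhds)
      ((((hb.continuousAt hn).tendsto).mono_left nhdsWithin_le_nhds).congr' ?_)
    filter_upwards [self_mem_nhdsWithin, mem_nhdsWithin_of_mem_nhds hn] with q hq hqb
    exact (h q hqb hq).symm
  · exact h w hw h0

theorem IsHazzidakisSolution.hasDerivWithinAt {J : ℕ} {r : ℝ} {H B : ℝ → ℝ}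
    (hB : ContDiffOn ℝ ∞ B (Ico 0 (r ^ 2)))
    (hHB : ∀ s ∈ Ico 0 (r ^ 2), H s = H 0 + s ^ (J + 1) * B s) {s : ℝ} (hs : s ∈ Ico 0 (r ^ 2)) :
    HasDerivWithinAt H (s ^ J * (((J : ℝ) + 1) * B s +
      s * derivWithin B (Ico 0 (r ^ 2)) s)) (Ico 0 (r ^ 2)) s := by
  have h1 := ((hB.differentiableOn (by simp)) s hs).hasDerivWithinAt
  have h2 := ((hasDerivAt_pow (J + 1) s).hasDerivWithinAt.fun_mul h1).const_add (H 0)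
  refine (h2.congr hHB (hHB s hs)).congr_deriv ?_
  rw [Nat.add_sub_cancel]; push_cast; ring

theorem exists_hasFundamentalForms {J : ℕ} {r : ℝ} (hr : 0 < r) (hr1 : r ≤ 1) {H : ℝ → ℝ}
    (hH : IsHazzidakisSolution J (r ^ 2) H) (hA : HasAsymptotics J (r ^ 2) H) :
    ∃ f : ℂ → E3, HasFundamentalForms J H r f := by
  obtain ⟨B, hB, hB0, hHB⟩ := hA
  have hS : r ^ 2 ≤ 1 := pow_le_one₀ hr.le hr1
  have hU : IsOpen (Metric.ball (0 : ℂ) r) := Metric.isOpen_ball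
  have hlt : ∀ {w : ℂ}, w ∈ Metric.ball (0 : ℂ) r → ‖w‖ < 1 := fun hw =>
    (mem_ball_zero_iff.1 hw).trans_le hr1
  have hrr : 0 < r ^ 2 := by positivity
  have hud : UniqueDiffOn ℝ (Ico 0 (r ^ 2)) := uniqueDiffOn_Ico 0 (r ^ 2)
  have hJ : (0 : ℝ) < (J : ℝ) + 2 := by positivity
  -- H' = s^J b, with b smooth up to s = 0.
  set b : ℝ → ℝ := fun s => ((J : ℝ) + 1) * B s + s * derivWithin B (Ico 0 (r ^ 2)) s with hb
  have hbc : ContDiffOn ℝ ∞ b (Ico 0 (r ^ 2)) :=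
    (contDiffOn_const.mul hB).add (contDiffOn_id.mul (hB.derivWithin hud (by simp)))
  have hHd : ∀ s ∈ Ico 0 (r ^ 2), HasDerivWithinAt H (s ^ J * b s) (Ico 0 (r ^ 2)) s :=
    fun s hs => IsHazzidakisSolution.hasDerivWithinAt hB hHB hs
  have hHd' : ∀ s ∈ Ioo 0 (r ^ 2), deriv H s = s ^ J * b s := fun s hs =>
    ((hHd s (Ioo_subset_Ico_self hs)).hasDerivAt (Ico_mem_nhds hs.1 hs.2)).deriv
  have hHc : ContDiffOn ℝ ∞ H (Ico 0 (r ^ 2)) :=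
    (contDiffOn_const.add ((contDiffOn_id.pow (J + 1)).mul hB)).congr hHB
  have hbneg' : ∀ s ∈ Ioo 0 (r ^ 2), b s < 0 := fun s hs => by
    have h1 := hH.deriv_neg s hs
    rw [hHd' s hs] at h1
    exact (mul_neg_iff.1 h1).elim (fun h => h.2) fun h => absurd h.1 (pow_pos hs.1 J).le.not_gt
  have h00 : (0:ℝ) ∈ Ico 0 (r ^ 2) := ⟨le_rfl, hrr⟩
  -- At s = 0 the limit from the right gives b ≤ 0, and b(0) = (J+1) B(0) ≠ 0 makes it strict. This
  -- is where the nonvanishing of B enters.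
  have hbneg : ∀ s ∈ Ico 0 (r ^ 2), b s < 0 := by
    intro s hs
    rcases hs.1.eq_or_lt with h | h
    · subst h
      have hne : b 0 ≠ 0 := by
        simp only [hb, zero_mul, add_zero]
        exact mul_ne_zero (by positivity) (hB0 0 h00)
      refine lt_of_le_of_ne ?_ hne
      have ht : Tendsto b (𝓝[>] 0) (𝓝 (b 0)) := (hbc.continuousOn 0 h00).tendsto.mono_left
        (nhdsWithin_le_of_mem (mem_of_superset (Ioo_mem_nhdsGT hrr) Ioo_subset_Ico_self))
      refine le_of_tendsto ht ?_
      filter_upwards [Ioo_mem_nhdsGT hrr] with s hs using (hbneg' s hs).le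
    · exact hbneg' s ⟨h, hs.2⟩
  -- The conformal factor with s^J cancelled, so that it extends smoothly and positively to s = 0.
  set e : ℝ → ℝ := fun t => -2 * ((J : ℝ) + 2) ^ 2 / ((1 - t ^ (J + 2)) ^ 2 * b t) with he
  have hec : ContDiffOn ℝ ∞ e (Ico 0 (r ^ 2)) :=
    ContDiffOn.div contDiffOn_const (ContDiffOn.mul (by fun_prop) hbc) fun t ht =>
      mul_ne_zero (pow_ne_zero 2 (one_sub_pow_pos hS ht J).ne') (hbneg t ht).ne
  have hepos : ∀ t ∈ Ico 0 (r ^ 2), 0 < e t := fun t ht => by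
    have h1 := one_sub_pow_pos hS ht J
    have h2 := hbneg t ht
    exact div_pos_of_neg_of_neg (by nlinarith) (mul_neg_of_pos_of_neg (by positivity) h2)
  have hem : ∀ t ∈ Ioo 0 (r ^ 2), e t = modelFactor J H t := fun t ht => by
    have h1 := (one_sub_pow_pos hS (Ioo_subset_Ico_self ht) J).ne'
    have h2 := (hbneg' t ht).ne
    have h3 := (pow_pos ht.1 J).ne'
    rw [modelFactor, hHd' t ht, he]
    field_simp
  set E : ℂ → ℝ := fun q => e (‖q‖ ^ 2) with hE
  have hEc : ContDiffOn ℝ ∞ E (Metric.ball 0 r) := contDiffOn_radial hec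
  have hhc : ContDiffOn ℝ ∞ (fun q : ℂ => H (‖q‖ ^ 2)) (Metric.ball 0 r) := contDiffOn_radial hHc
  have hQc : ContDiffOn ℝ ∞ (modelHopf J) (Metric.ball 0 r) :=
    (contDiffOn_modelHopf J).mono (Metric.ball_subset_ball hr1)
  have key := fun gauss codazzi => exists_immersion hr hEc hhc hQc
    (fun p hp => hepos _ (norm_sq_mem_Ico hp)) gauss codazzi
  refine Exists.imp (fun f hf => ?_) (key ?_ ?_)
  · obtain ⟨hf, hff⟩ := hf
    refine ⟨hf, fun w hw => (hff w hw).2.1, fun w hw h0 => ?_, fun w hw => (hff w hw).2.2⟩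
    rw [(hff w hw).1]
    exact hem _ (norm_sq_mem_Ioo hw h0)
  -- The Gauss equation follows from the Hazzidakis equation off the centre, and by continuity at
  -- the centre.
  · refine eq_of_eq_punctured ?_ ?_ fun w hw h0 => ?_
    · have c0 := hEc.continuousOn
      have c1 := (contDiffOn_px hU hEc).continuousOn
      have c2 := (contDiffOn_py hU hEc).continuousOn
      have c3 := (contDiffOn_px hU (contDiffOn_px hU hEc)).continuousOn
      have c4 := (contDiffOn_py hU (contDiffOn_py hU hEc)).continuousOn
      exact (c0.mul (c3.add c4)).sub ((c1.pow 2).add (c2.pow 2))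
    · have c0 := hEc.continuousOn
      exact (continuousOn_const.mul c0).mul (((c0.pow 2).mul (hhc.continuousOn.pow 2)).sub
        (continuousOn_const.mul (hQc.continuousOn.norm.pow 2)))
    · have hs := norm_sq_mem_Ioo hw h0
      refine (gauss_iff_hazzidakis hS hH.smooth hH.deriv_neg hs ?_
        (norm_sq_modelHopf J (hlt hw))).2 (hH.equation _ hs)
      filter_upwards [hU.eventually_mem hw, eventually_ne_nhds h0] with q hq hq0
      exact hem _ (norm_sq_mem_Ioo hq hq0)
  · intro w hw
    have hs := norm_sq_mem_Ico hw
    have h1 := dbar_modelHopf J (hlt hw)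
    rw [dbar] at h1
    rw [h1, codazzi_iff_gradient (hepos _ hs).ne', px_radial (hHd _ hs) hs.2,
      py_radial (hHd _ hs) hs.2]
    have h2 := (one_sub_pow_pos hS hs J).ne'
    have h3 := (hbneg _ hs).ne
    have key : -(2 * (2 * ((J : ℝ) + 2) ^ 2 * (‖w‖ ^ 2) ^ J / (1 - (‖w‖ ^ 2) ^ (J + 2)) ^ 2) /
        e (‖w‖ ^ 2)) = 2 * ((‖w‖ ^ 2) ^ J * b (‖w‖ ^ 2)) := by
      simp only [he]
      generalize ‖w‖ ^ 2 = s at *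
      field_simp
    rw [key]
    constructor <;> ring

namespace HasFundamentalForms

variable {J : ℕ} {H : ℝ → ℝ} {r : ℝ} {f g : ℂ → E3}

theorem hopf_eq_model (hf : HasFundamentalForms J H r f) {w : ℂ}
    (hw : w ∈ Metric.ball (0 : ℂ) r) : hopf f w = modelHopf J w := hf.hopf_eq w hw

theorem conformalFactor_eq (hf : HasFundamentalForms J H r f) (hg : HasFundamentalForms J H r g) :
    ∀ w ∈ Metric.ball (0 : ℂ) r, conformalFactor g w = conformalFactor f w :=
  eq_of_eq_punctured (hg.immersion.contDiffOn_cf Metric.isOpen_ball).continuousOn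
    (hf.immersion.contDiffOn_cf Metric.isOpen_ball).continuousOn fun w hw h0 => by
      rw [hf.factor_eq w hw h0, hg.factor_eq w hw h0]

theorem exists_isometry (hf : HasFundamentalForms J H r f) (hg : HasFundamentalForms J H r g) :
    ∃ A : E3 ≃ᵢ E3, ∀ w ∈ Metric.ball (0 : ℂ) r, g w = A (f w) :=
  IsConformalImmersionOn.exists_isometry Metric.isOpen_ball hf.immersion hg.immersion
    (hf.conformalFactor_eq hg)
    (fun w hw => by rw [hf.meanCurv_eq w hw, hg.meanCurv_eq w hw])
    (fun w hw => by rw [hf.hopf_eq w hw, hg.hopf_eq w hw])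
    (convex_ball (0 : ℂ) r).isPreconnected

end HasFundamentalForms

/-! ### Rotations -/

theorem mul_mem_ball_of_norm_eq_one {κ w : ℂ} {r : ℝ} (hκ : ‖κ‖ = 1)
    (hw : w ∈ Metric.ball (0 : ℂ) r) : κ * w ∈ Metric.ball (0 : ℂ) r := by
  rw [mem_ball_zero_iff] at *; rwa [norm_mul, hκ, one_mul]

theorem deriv_const_mul_id (κ q : ℂ) : deriv (fun w : ℂ => κ * w) q = κ := by
  simp

/-- A rotation enters only through κ^(J+2): as |κ| = 1, the denominator 1 - |w|^(2(J+2)) is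
unchanged, and κ^(J+2) times its conjugate is 1. Hence rotations by (J+2)-th roots of unity preserve
the model. -/
theorem rotated_modelHopf (J : ℕ) {κ w : ℂ} (hκ : ‖κ‖ = 1) (hw : ‖w‖ < 1) :
    κ ^ 2 * modelHopf J (κ * w) = ((J : ℂ) + 2) * w ^ J *
      (κ ^ (J + 2) - starRingEnd ℂ (w ^ (J + 2))) / ((1 - κ ^ (J + 2) * w ^ (J + 2)) *
        (1 - w ^ (J + 2) * starRingEnd ℂ (w ^ (J + 2)))) := by
  have h1 : ‖κ * w‖ < 1 := by rwa [norm_mul, hκ, one_mul]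
  have h2 := one_sub_pow_ne_zero h1 J
  have h3 := one_sub_mul_conj_ne_zero (norm_pow_lt_one hw J)
  have hc : κ ^ (J + 2) * starRingEnd ℂ (κ ^ (J + 2)) = 1 := by
    rw [Complex.mul_conj, Complex.normSq_eq_norm_sq, norm_pow, hκ]; simp
  rw [modelHopf_eq_cayley, mul_pow κ w J]
  rw [mul_pow κ w (J + 2)] at h2 ⊢
  have h4 : κ ^ (J + 2) * w ^ (J + 2) * starRingEnd ℂ (κ ^ (J + 2) * w ^ (J + 2)) =
      w ^ (J + 2) * starRingEnd ℂ (w ^ (J + 2)) := by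
    rw [map_mul]; linear_combination (w ^ (J + 2) * starRingEnd ℂ (w ^ (J + 2))) * hc
  rw [h4, map_mul]
  generalize hD : 1 - w ^ (J + 2) * starRingEnd ℂ (w ^ (J + 2)) = D at *
  generalize hC : 1 - κ ^ (J + 2) * w ^ (J + 2) = C at *
  field_simp
  linear_combination (((J : ℂ) + 2) * w ^ J * -starRingEnd ℂ (w ^ (J + 2))) * hc

namespace HasFundamentalForms

variable {J : ℕ} {H : ℝ → ℝ} {r : ℝ} {f : ℂ → E3} {κ : ℂ}

theorem rotate_immersion (hf : HasFundamentalForms J H r f) (hκ : ‖κ‖ = 1) :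
    IsConformalImmersionOn (fun w => f (κ * w)) (Metric.ball 0 r) :=
  isConformalImmersionOn_comp_holomorphic Metric.isOpen_ball Metric.isOpen_ball hf.immersion
    (by fun_prop) (fun _ hw => mul_mem_ball_of_norm_eq_one hκ hw) fun q _ => by
      rw [deriv_const_mul_id]; rintro rfl; simp at hκ

theorem rotate_conformalFactor (hf : HasFundamentalForms J H r f) (hκ : ‖κ‖ = 1) {w : ℂ}
    (hw : w ∈ Metric.ball (0 : ℂ) r) :
    conformalFactor (fun w => f (κ * w)) w = conformalFactor f w := by
  rw [conformalFactor_comp_holomorphic Metric.isOpen_ball Metric.isOpen_ball hf.immersion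
    (φ := fun w => κ * w) (by fun_prop) (fun _ hw => mul_mem_ball_of_norm_eq_one hκ hw) hw,
    deriv_const_mul_id, hκ, one_pow, one_mul]
  by_cases h0 : w = 0
  · rw [h0, mul_zero]
  · have hκ0 : κ ≠ 0 := by rintro rfl; simp at hκ
    rw [hf.factor_eq _ hw h0, hf.factor_eq _ (mul_mem_ball_of_norm_eq_one hκ hw)
      (mul_ne_zero hκ0 h0), norm_mul, hκ, one_mul]

theorem rotate_meanCurv (hf : HasFundamentalForms J H r f) (hκ : ‖κ‖ = 1) {w : ℂ}
    (hw : w ∈ Metric.ball (0 : ℂ) r) : meanCurv (fun w => f (κ * w)) w = meanCurv f w := by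
  rw [meanCurv_comp_holomorphic Metric.isOpen_ball Metric.isOpen_ball hf.immersion
    (φ := fun w => κ * w) (by fun_prop) (fun _ hw => mul_mem_ball_of_norm_eq_one hκ hw) hw
    (by rw [deriv_const_mul_id]; rintro rfl; simp at hκ), hf.meanCurv_eq _ hw,
    hf.meanCurv_eq _ (mul_mem_ball_of_norm_eq_one hκ hw), norm_mul, hκ, one_mul]

theorem rotate_hopf (hf : HasFundamentalForms J H r f) (hr1 : r ≤ 1) (hκ : ‖κ‖ = 1) {w : ℂ}
    (hw : w ∈ Metric.ball (0 : ℂ) r) :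
    hopf (fun w => f (κ * w)) w = ((J : ℂ) + 2) * w ^ J *
      (κ ^ (J + 2) - starRingEnd ℂ (w ^ (J + 2))) / ((1 - κ ^ (J + 2) * w ^ (J + 2)) *
        (1 - w ^ (J + 2) * starRingEnd ℂ (w ^ (J + 2)))) := by
  rw [hopf_comp_holomorphic Metric.isOpen_ball Metric.isOpen_ball hf.immersion
    (φ := fun w => κ * w) (by fun_prop) (fun _ hw => mul_mem_ball_of_norm_eq_one hκ hw) hw
    (by rw [deriv_const_mul_id]; rintro rfl; simp at hκ), deriv_const_mul_id,
    hf.hopf_eq_model (mul_mem_ball_of_norm_eq_one hκ hw),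
    rotated_modelHopf J hκ ((mem_ball_zero_iff.1 hw).trans_le hr1)]

/-- If a rotation of the normal form is congruent to it, then the rotation is one of its
symmetries. -/
theorem pow_eq_one_of_congruent (hf : HasFundamentalForms J H r f) (hr : 0 < r) (hr1 : r ≤ 1)
    (hneg : ∀ s ∈ Ioo 0 (r ^ 2), deriv H s < 0) (hκ : ‖κ‖ = 1) {A : E3 ≃ᵢ E3}
    (h : ∀ w ∈ Metric.ball (0 : ℂ) r, f (κ * w) = A (f w)) : κ ^ (J + 2) = 1 := by
  have hU : IsOpen (Metric.ball (0 : ℂ) r) := Metric.isOpen_ball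
  -- An isometry that changes the sign of Q also changes the sign of H. Since H' < 0, there is a
  -- point with H ≠ 0, and this excludes such an isometry.
  obtain ⟨w, hw, hw0, hH⟩ : ∃ w ∈ Metric.ball (0 : ℂ) r, w ≠ 0 ∧ H (‖w‖ ^ 2) ≠ 0 := by
    by_contra! hcon
    have hs : r ^ 2 / 2 ∈ Ioo 0 (r ^ 2) := ⟨by positivity, by nlinarith [sq_pos_of_pos hr]⟩
    have hz : H =ᶠ[𝓝 (r ^ 2 / 2)] fun _ => 0 := by
      filter_upwards [isOpen_Ioo.eventually_mem hs] with s hs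
      have h1 := hcon (√s : ℂ) (by
        rw [mem_ball_zero_iff, Complex.norm_real, Real.norm_of_nonneg (Real.sqrt_nonneg s)]
        exact (Real.sqrt_lt' hr).2 hs.2) (Complex.ofReal_ne_zero.2 (Real.sqrt_pos.2 hs.1).ne')
      simpa [Real.sq_sqrt hs.1.le] using h1
    have := hneg _ hs
    rw [hz.deriv_eq] at this
    simp at this
  have hw1 := (mem_ball_zero_iff.1 hw).trans_le hr1
  have e1 := hf.rotate_meanCurv hκ hw
  have e2 : hopf (fun w => f (κ * w)) w = hopf (fun w => A (f w)) w :=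
    hopf_congr ((hU.eventually_mem hw).mono h)
  have e3 : meanCurv (fun w => f (κ * w)) w = meanCurv (fun w => A (f w)) w :=
    meanCurv_congr ((hU.eventually_mem hw).mono h)
  have hm := hf.meanCurv_eq w hw
  rcases forms_isometry hU hf.immersion A hw with ⟨h1, -⟩ | ⟨-, h1⟩
  · rw [← e2, hf.rotate_hopf hr1 hκ hw, hf.hopf_eq_model hw, modelHopf_eq_cayley] at h1
    have h2 := one_sub_pow_ne_zero hw1 J
    have h3 := one_sub_mul_conj_ne_zero (norm_pow_lt_one hw1 J)
    have h4 : 1 - κ ^ (J + 2) * w ^ (J + 2) ≠ 0 := by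
      rw [← mul_pow]; exact one_sub_pow_ne_zero (by rwa [norm_mul, hκ, one_mul]) J
    have h5 : w ^ J ≠ 0 := pow_ne_zero _ hw0
    have h6 : (J : ℂ) + 2 ≠ 0 := by exact_mod_cast (by omega : J + 2 ≠ 0)
    rw [div_mul_div_comm, div_eq_div_iff (mul_ne_zero h4 h3) (mul_ne_zero h2 h3)] at h1
    have : (((J : ℂ) + 2) * w ^ J) * (1 - w ^ (J + 2) * starRingEnd ℂ (w ^ (J + 2))) ^ 2 *
        (κ ^ (J + 2) - 1) = 0 := by linear_combination h1
    rcases mul_eq_zero.1 this with h7 | h7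
    · exact absurd h7 (mul_ne_zero (mul_ne_zero h6 h5) (pow_ne_zero 2 h3))
    · exact sub_eq_zero.1 h7
  · exact absurd (by linarith : H (‖w‖ ^ 2) = 0) hH

end HasFundamentalForms

/-! ### Classification of the isometric surfaces with the same mean curvature -/

/-- For positive j the bound forces q(0) = 0, so one factor w splits off through `dslope` and the
exponent decreases. -/
theorem exists_eq_pow_mul {q : ℂ → ℂ} {r : ℝ} (hr : 0 < r)
    (hq : DifferentiableOn ℂ q (Metric.ball 0 r)) {C : ℝ} {j : ℕ}
    (hb : ∀ᶠ w in 𝓝[≠] (0 : ℂ), ‖q w‖ ≤ C * ‖w‖ ^ j) :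
    ∃ p : ℂ → ℂ, DifferentiableOn ℂ p (Metric.ball 0 r) ∧ ∀ w, q w = w ^ j * p w := by
  have hn : Metric.ball (0 : ℂ) r ∈ 𝓝 0 := Metric.ball_mem_nhds 0 hr
  induction j generalizing q with
  | zero => exact ⟨q, hq, by simp⟩
  | succ j ih =>
    have h0 : q 0 = 0 := by
      have h1 : Tendsto q (𝓝[≠] 0) (𝓝 (q 0)) :=
        (hq.differentiableAt hn).continuousAt.tendsto.mono_left nhdsWithin_le_nhds
      have h2 : Tendsto (fun w : ℂ => C * ‖w‖ ^ (j + 1)) (𝓝[≠] 0) (𝓝 0) := by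
        have : ContinuousAt (fun w : ℂ => C * ‖w‖ ^ (j + 1)) 0 := by fun_prop
        have h3 := this.tendsto.mono_left (nhdsWithin_le_nhds (s := {0}ᶜ))
        simpa using h3
      exact tendsto_nhds_unique h1 (squeeze_zero_norm' hb h2)
    obtain ⟨p, hp, hqp⟩ := ih ((Complex.differentiableOn_dslope hn).2 hq) (by
      filter_upwards [hb, self_mem_nhdsWithin] with w hw hw0
      have hw0' : 0 < ‖w‖ := norm_pos_iff.2 hw0
      rw [dslope_of_ne _ hw0, slope_def_field, h0, sub_zero, sub_zero, norm_div,
        div_le_iff₀ hw0']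
      rw [pow_succ] at hw; linarith)
    refine ⟨p, hp, fun w => ?_⟩
    have := sub_smul_dslope q 0 w
    rw [h0, sub_zero, sub_zero, smul_eq_mul, hqp] at this
    rw [← this]; ring

/-- Holomorphic functions with equal norms are proportional. -/
theorem exists_const_mul_of_norm_eq {a b : ℂ → ℂ} {r : ℝ} (hr : 0 < r)
    (ha : DifferentiableOn ℂ a (Metric.ball 0 r)) (hb : DifferentiableOn ℂ b (Metric.ball 0 r))
    (hb0 : b 0 ≠ 0) (h : ∀ w ∈ Metric.ball (0 : ℂ) r, ‖a w‖ = ‖b w‖) :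
    ∃ c : ℂ, ‖c‖ = 1 ∧ ∀ w ∈ Metric.ball (0 : ℂ) r, a w = c * b w := by
  have h0 : (0 : ℂ) ∈ Metric.ball (0 : ℂ) r := Metric.mem_ball_self hr
  have hn : Metric.ball (0 : ℂ) r ∈ 𝓝 0 := Metric.ball_mem_nhds 0 hr
  have hbne : ∀ᶠ w in 𝓝 (0 : ℂ), b w ≠ 0 :=
    (hb.differentiableAt hn).continuousAt.eventually_ne hb0
  have hnorm : ∀ᶠ w in 𝓝 (0 : ℂ), ‖a w / b w‖ = 1 := by
    filter_upwards [hbne, hn] with w hw hwb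
    rw [norm_div, h w hwb, div_self (norm_ne_zero_iff.2 hw)]
  -- The quotient a/b has modulus 1 near 0, so the maximum principle makes it constant there; the
  -- identity theorem extends the proportionality to the disc.
  have hmax : IsLocalMax (norm ∘ fun w => a w / b w) 0 := by
    filter_upwards [hnorm] with w hw
    simp only [Function.comp, hw, hnorm.self_of_nhds, le_refl]
  have hd : ∀ᶠ w in 𝓝 (0 : ℂ), DifferentiableAt ℂ (fun w => a w / b w) w := by
    filter_upwards [hbne, Metric.isOpen_ball.eventually_mem h0] with w hw hwb
    have hnw := Metric.isOpen_ball.mem_nhds hwb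
    exact (ha.differentiableAt hnw).fun_div (hb.differentiableAt hnw) hw
  have hev := Complex.eventually_eq_of_isLocalMax_norm hd hmax
  refine ⟨a 0 / b 0, hnorm.self_of_nhds, ?_⟩
  have hA : AnalyticOnNhd ℂ a (Metric.ball 0 r) := ha.analyticOnNhd Metric.isOpen_ball
  have hB : AnalyticOnNhd ℂ (fun w => a 0 / b 0 * b w) (Metric.ball 0 r) :=
    (hb.const_mul _).analyticOnNhd Metric.isOpen_ball
  refine hA.eqOn_of_preconnected_of_eventuallyEq hB (convex_ball (0 : ℂ) r).isPreconnected h0 ?_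
  filter_upwards [hev, hbne] with w hw hwb
  rw [← hw, div_mul_cancel₀ _ hwb]

/-- Q_g - Q_f is holomorphic and, since |Q_g| = |Q_f|, divisible by w^J. Written in Cayley form,
this replaces the numerator 1 - v̄ by a - v̄b with a, b holomorphic; equality of norms then forces a
= cb with |c| = 1. A (J+2)-th root κ of c gives a rotated surface with the Hopf differential of g,
and rigidity finishes. -/
theorem HasFundamentalForms.exists_rotation {J : ℕ} {H : ℝ → ℝ} {r : ℝ} {f g : ℂ → E3}
    (hf : HasFundamentalForms J H r f) (hr : 0 < r) (hr1 : r ≤ 1)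
    (hg : IsConformalImmersionOn g (Metric.ball 0 r))
    (hE : ∀ w ∈ Metric.ball (0 : ℂ) r, conformalFactor g w = conformalFactor f w)
    (hH : ∀ w ∈ Metric.ball (0 : ℂ) r, meanCurv g w = meanCurv f w) :
    ∃ α : ℝ, ∃ A : E3 ≃ᵢ E3, ∀ w ∈ Metric.ball (0 : ℂ) r,
      g w = A (f (Complex.exp (α * I) * w)) := by
  have hU : IsOpen (Metric.ball (0 : ℂ) r) := Metric.isOpen_ball
  have hlt : ∀ {w : ℂ}, w ∈ Metric.ball (0 : ℂ) r → ‖w‖ < 1 := fun hw =>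
    (mem_ball_zero_iff.1 hw).trans_le hr1
  have h6 : (J : ℂ) + 2 ≠ 0 := by exact_mod_cast (by omega : J + 2 ≠ 0)
  have hn := Metric.ball_mem_nhds (0 : ℂ) hr
  have hgc := (hg.contDiffOn_hopf hU).continuousOn
  have hfc := (hf.immersion.contDiffOn_hopf hU).continuousOn
  set q : ℂ → ℂ := fun w => hopf g w - hopf f w with hq
  have hqd : DifferentiableOn ℂ q (Metric.ball 0 r) :=
    hf.immersion.differentiableOn_hopf_sub hU hg hE hH
  have hnorm : ∀ w ∈ Metric.ball (0 : ℂ) r, ‖hopf g w‖ = ‖hopf f w‖ := fun w hw =>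
    hf.immersion.norm_hopf_eq hU hg hE hH hw
  have hbd : ∀ᶠ w in 𝓝[≠] (0 : ℂ), ‖q w‖ ≤ (2 * (‖(J : ℂ) + 2‖ * 2)) * ‖w‖ ^ J := by
    have ht : Tendsto (fun w : ℂ => ‖((1 - (starRingEnd ℂ w) ^ (J + 2)) / (1 - w ^ (J + 2))) *
        (1 - ((‖w‖ ^ 2 : ℝ) : ℂ) ^ (J + 2))⁻¹‖) (𝓝 0) (𝓝 1) := by
      have : ContinuousAt (fun w : ℂ => ‖((1 - (starRingEnd ℂ w) ^ (J + 2)) / (1 - w ^ (J + 2))) *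
        (1 - ((‖w‖ ^ 2 : ℝ) : ℂ) ^ (J + 2))⁻¹‖) 0 := by
        refine (ContinuousAt.mul (ContinuousAt.div (by fun_prop) (by fun_prop) (by simp))
          (ContinuousAt.inv₀ (by fun_prop) (by simp))).norm
      simpa [ContinuousAt] using this
    filter_upwards [nhdsWithin_le_nhds (ht.eventually_lt_const (by norm_num : (1:ℝ) < 2)),
      nhdsWithin_le_nhds hn] with w hw hwb
    have h1 : ‖hopf f w‖ ≤ (‖(J : ℂ) + 2‖ * 2) * ‖w‖ ^ J := by
      rw [hf.hopf_eq_model hwb, modelHopf, show ∀ a b c d : ℂ, a * b * (c / d) =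
        a * (b * d⁻¹) * c from fun a b c d => by ring, norm_mul, norm_mul, norm_pow]
      gcongr
    calc ‖q w‖ ≤ ‖hopf g w‖ + ‖hopf f w‖ := norm_sub_le _ _
      _ ≤ _ := by rw [hnorm w hwb]; linarith
  obtain ⟨p, hp, hqp⟩ := exists_eq_pow_mul hr hqd hbd
  -- These absorb the holomorphic difference into the numerator. They satisfy b - va = 1 - v with v
  -- = w^(J+2), which is the relation used below to compare norms.
  set a : ℂ → ℂ := fun w => 1 + (1 - w ^ (J + 2)) * p w / ((J : ℂ) + 2) with ha
  set b : ℂ → ℂ := fun w => 1 + w ^ (J + 2) * ((1 - w ^ (J + 2)) * p w / ((J : ℂ) + 2)) with hb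
  have hPd : DifferentiableOn ℂ (fun w => (1 - w ^ (J + 2)) * p w / ((J : ℂ) + 2))
      (Metric.ball 0 r) := by
    simp only [div_eq_mul_inv]
    exact (DifferentiableOn.mul (by fun_prop) hp).mul_const _
  have hQg : ∀ w ∈ Metric.ball (0 : ℂ) r, hopf g w = ((J : ℂ) + 2) * w ^ J /
      ((1 - w ^ (J + 2)) * (1 - w ^ (J + 2) * starRingEnd ℂ (w ^ (J + 2)))) *
      (a w - starRingEnd ℂ (w ^ (J + 2)) * b w) := by
    intro w hw
    have h1 : hopf g w = hopf f w + w ^ J * p w := by rw [← hqp]; simp [hq]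
    have h2 := one_sub_pow_ne_zero (hlt hw) J
    have h3 := one_sub_mul_conj_ne_zero (norm_pow_lt_one (hlt hw) J)
    rw [h1, hf.hopf_eq_model hw, modelHopf_eq_cayley]
    simp only [ha, hb]
    generalize hD : 1 - w ^ (J + 2) * starRingEnd ℂ (w ^ (J + 2)) = D at *
    generalize hC : 1 - w ^ (J + 2) = C at *
    field_simp
    rw [← hD]; ring
  have hab' : ∀ w ∈ Metric.ball (0 : ℂ) r, w ≠ 0 → ‖a w‖ = ‖b w‖ := by
    intro w hw h0
    have h2 := one_sub_pow_ne_zero (hlt hw) J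
    have h3 := one_sub_mul_conj_ne_zero (norm_pow_lt_one (hlt hw) J)
    have h1 := hnorm w hw
    rw [hQg w hw, hf.hopf_eq_model hw, modelHopf_eq_cayley, div_mul_div_comm,
      mul_div_right_comm _ (1 - starRingEnd ℂ (w ^ (J + 2))), norm_mul, norm_mul] at h1
    have h4 : ‖((J : ℂ) + 2) * w ^ J /
      ((1 - w ^ (J + 2)) * (1 - w ^ (J + 2) * starRingEnd ℂ (w ^ (J + 2))))‖ ≠ 0 :=
      norm_ne_zero_iff.2 (div_ne_zero (mul_ne_zero h6 (pow_ne_zero _ h0)) (mul_ne_zero h2 h3))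
    have h5 := mul_left_cancel₀ h4 h1
    rw [← Complex.norm_conj (1 - starRingEnd ℂ (w ^ (J + 2))), map_sub, Complex.conj_conj,
      map_one, show 1 - w ^ (J + 2) = b w - w ^ (J + 2) * a w by simp only [ha, hb]; ring] at h5
    have h7 := norm_pow_lt_one (hlt hw) J
    -- Squaring |a - v̄b| = |b - va| cancels the mixed terms and leaves exactly this product.
    have h8 : (1 - ‖w ^ (J + 2)‖ ^ 2) * (‖a w‖ ^ 2 - ‖b w‖ ^ 2) = 0 := by
      have h9 := congrArg (fun x : ℝ => x ^ 2) h5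
      simp only [← Complex.normSq_eq_norm_sq, Complex.normSq_apply, Complex.sub_re, Complex.sub_im,
        Complex.mul_re, Complex.mul_im, Complex.conj_re, Complex.conj_im] at h9 ⊢
      linear_combination h9
    have h10 : 1 - ‖w ^ (J + 2)‖ ^ 2 ≠ 0 := by nlinarith [norm_nonneg (w ^ (J + 2))]
    have h11 := (mul_eq_zero.1 h8).resolve_left h10
    exact (sq_eq_sq₀ (norm_nonneg _) (norm_nonneg _)).1 (sub_eq_zero.1 h11)
  have had : DifferentiableOn ℂ a (Metric.ball 0 r) := (differentiableOn_const 1).add hPd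
  have hbd' : DifferentiableOn ℂ b (Metric.ball 0 r) :=
    (differentiableOn_const 1).add (DifferentiableOn.mul (by fun_prop) hPd)
  have hab := eq_of_eq_punctured had.continuousOn.norm hbd'.continuousOn.norm hab'
  obtain ⟨c, hc, hac⟩ := exists_const_mul_of_norm_eq hr had hbd' (by simp [hb]) hab
  set κ : ℂ := Complex.exp (((c.arg / ((J : ℝ) + 2) : ℝ) : ℂ) * I) with hκdef
  have hκ : ‖κ‖ = 1 := Complex.norm_exp_ofReal_mul_I _
  have hκc : κ ^ (J + 2) = c := by
    rw [hκdef, ← Complex.exp_nat_mul]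
    have := Complex.norm_mul_exp_arg_mul_I c
    rw [hc, Complex.ofReal_one, one_mul] at this
    rw [← this]
    congr 1
    push_cast
    field_simp
    rw [this]
  have hhopf : ∀ w ∈ Metric.ball (0 : ℂ) r, hopf g w = hopf (fun w => f (κ * w)) w := by
    intro w hw
    rw [hQg w hw, hf.rotate_hopf hr1 hκ hw, hκc]
    have h2 := one_sub_pow_ne_zero (hlt hw) J
    have h3 := one_sub_mul_conj_ne_zero (norm_pow_lt_one (hlt hw) J)
    have h4 : 1 - c * w ^ (J + 2) ≠ 0 := by
      rw [← hκc, ← mul_pow]; exact one_sub_pow_ne_zero (by rw [norm_mul, hκ, one_mul]; exact hlt hw) J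
    have h5 : b w * (1 - c * w ^ (J + 2)) = 1 - w ^ (J + 2) := by
      have := hac w hw
      have e : b w = 1 - w ^ (J + 2) + w ^ (J + 2) * a w := by simp only [ha, hb]; ring
      linear_combination e + w ^ (J + 2) * this
    rw [hac w hw, ← h5]
    have h6' : b w ≠ 0 := by rintro h; rw [h, zero_mul] at h5; exact h2 h5.symm
    generalize hD : 1 - w ^ (J + 2) * starRingEnd ℂ (w ^ (J + 2)) = D at *
    generalize hC : 1 - c * w ^ (J + 2) = C at *
    field_simp
  obtain ⟨A, hA⟩ := IsConformalImmersionOn.exists_isometry hU (hf.rotate_immersion hκ) hg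
    (fun w hw => by rw [hE w hw, hf.rotate_conformalFactor hκ hw])
    (fun w hw => by rw [hH w hw, hf.rotate_meanCurv hκ hw]) hhopf
    (convex_ball (0 : ℂ) r).isPreconnected
  exact ⟨_, A, hA⟩

end BonnetSurf

namespace BonnetSurf

open Complex (I)

/-! ### Changes of conformal charts -/

section Transition

variable {M : Type*} [TopologicalSpace M] {z z' : OpenPartialHomeomorph M ℂ}

theorem isOpen_transition_source (z z' : OpenPartialHomeomorph M ℂ) :
    IsOpen (z.target ∩ z.symm ⁻¹' z'.source) :=
  z.isOpen_inter_preimage_symm z'.open_source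

theorem mapsTo_transition (z z' : OpenPartialHomeomorph M ℂ) :
    MapsTo (fun x => z' (z.symm x)) (z.target ∩ z.symm ⁻¹' z'.source) z'.target :=
  fun _ hx => z'.map_source hx.2

theorem inChart_eq_comp (F : M → E3) {x : ℂ} (hx : x ∈ z.target ∩ z.symm ⁻¹' z'.source) :
    inChart F z x = inChart F z' (z' (z.symm x)) := by
  simp only [inChart, z'.left_inv hx.2]

theorem inChart_eventuallyEq_comp (F : M → E3) {x : ℂ}
    (hx : x ∈ z.target ∩ z.symm ⁻¹' z'.source) :
    inChart F z =ᶠ[𝓝 x] fun x => inChart F z' (z' (z.symm x)) := by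
  filter_upwards [(isOpen_transition_source z z').mem_nhds hx] with y hy
  exact inChart_eq_comp F hy

variable [ChartedSpace ℂ M]

theorem chartAt_mem_conformalCharts [IsManifold 𝓘(ℂ) ω M] (P : M) : chartAt ℂ P ∈ conformalCharts M :=
  IsManifold.chart_mem_maximalAtlas P

theorem contDiffOn_transition (hz : z ∈ conformalCharts M) (hz' : z' ∈ conformalCharts M) :
    ContDiffOn ℂ ω (fun x => z' (z.symm x)) (z.target ∩ z.symm ⁻¹' z'.source) := by
  have h := IsManifold.compatible_of_mem_maximalAtlas (I := 𝓘(ℂ)) (n := ω) hz hz'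
  have h3 : ContDiffOn ℂ ω _ _ := (mem_groupoid_of_pregroupoid.1 h).1
  simpa [Function.comp_def] using h3

theorem differentiableOn_transition (hz : z ∈ conformalCharts M) (hz' : z' ∈ conformalCharts M) :
    DifferentiableOn ℂ (fun x => z' (z.symm x)) (z.target ∩ z.symm ⁻¹' z'.source) :=
  (contDiffOn_transition hz hz').differentiableOn (by simp)

theorem deriv_transition_ne_zero (hz : z ∈ conformalCharts M) (hz' : z' ∈ conformalCharts M)
    {x : ℂ} (hx : x ∈ z.target ∩ z.symm ⁻¹' z'.source) :
    deriv (fun x => z' (z.symm x)) x ≠ 0 := by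
  have h1 := ((differentiableOn_transition hz hz').differentiableAt
    ((isOpen_transition_source z z').mem_nhds hx)).hasDerivAt
  have hy : z' (z.symm x) ∈ z'.target ∩ z'.symm ⁻¹' z.source :=
    ⟨z'.map_source hx.2, by simp only [mem_preimage, z'.left_inv hx.2, z.map_target hx.1]⟩
  have h2 := ((differentiableOn_transition hz' hz).differentiableAt
    ((isOpen_transition_source z' z).mem_nhds hy)).hasDerivAt
  have h3 := h2.comp x h1
  have h4 : HasDerivAt (fun x : ℂ => x) 1 x := hasDerivAt_id x
  have e : ((fun y => z (z'.symm y)) ∘ fun x => z' (z.symm x)) =ᶠ[𝓝 x] fun x => x := by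
    filter_upwards [(isOpen_transition_source z z').mem_nhds hx] with y hy
    simp only [Function.comp, z'.left_inv hy.2, z.right_inv hy.1]
  have := (h4.congr_of_eventuallyEq e).unique h3
  intro h0
  rw [h0, mul_zero] at this
  exact one_ne_zero this

variable {F : M → E3} (hz : z ∈ conformalCharts M) (hz' : z' ∈ conformalCharts M)
  (hF : IsConformalImmersionOn (inChart F z') z'.target) {x : ℂ}
  (hx : x ∈ z.target ∩ z.symm ⁻¹' z'.source)

include hz hz' hF

theorem isConformalImmersionOn_transition :
    IsConformalImmersionOn (inChart F z) (z.target ∩ z.symm ⁻¹' z'.source) :=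
  IsConformalImmersionOn.congr (isOpen_transition_source z z')
    (isConformalImmersionOn_comp_holomorphic z'.open_target (isOpen_transition_source z z') hF
      (differentiableOn_transition hz hz') (mapsTo_transition z z')
      fun _ hq => deriv_transition_ne_zero hz hz' hq) fun _ hq => inChart_eq_comp F hq

include hx

theorem conformalFactor_transition : conformalFactor (inChart F z) x =
    ‖deriv (fun x => z' (z.symm x)) x‖ ^ 2 * conformalFactor (inChart F z') (z' (z.symm x)) := by
  rw [conformalFactor_congr (inChart_eventuallyEq_comp F hx)]
  exact conformalFactor_comp_holomorphic z'.open_target (isOpen_transition_source z z') hF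
    (differentiableOn_transition hz hz') (mapsTo_transition z z') hx

theorem hopf_transition : hopf (inChart F z) x =
    deriv (fun x => z' (z.symm x)) x ^ 2 * hopf (inChart F z') (z' (z.symm x)) := by
  rw [hopf_congr (inChart_eventuallyEq_comp F hx)]
  exact hopf_comp_holomorphic z'.open_target (isOpen_transition_source z z') hF
    (differentiableOn_transition hz hz') (mapsTo_transition z z') hx
    (deriv_transition_ne_zero hz hz' hx)

theorem meanCurv_transition :
    meanCurv (inChart F z) x = meanCurv (inChart F z') (z' (z.symm x)) := by
  rw [meanCurv_congr (inChart_eventuallyEq_comp F hx)]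
  exact meanCurv_comp_holomorphic z'.open_target (isOpen_transition_source z z') hF
    (differentiableOn_transition hz hz') (mapsTo_transition z z') hx
    (deriv_transition_ne_zero hz hz' hx)

omit hx hF hz' in
theorem meanCurvature_symm_apply [IsManifold 𝓘(ℂ) ω M] (hF : IsConformalImmersion F) {x : ℂ} (hx : x ∈ z.target) :
    meanCurvature F (z.symm x) = meanCurv (inChart F z) x :=
  (meanCurv_transition hz (chartAt_mem_conformalCharts (z.symm x))
    (hF _ (chartAt_mem_conformalCharts (z.symm x))) ⟨hx, mem_chart_source ℂ (z.symm x)⟩).symm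

end Transition

/-! ### The disc as a Riemann surface -/

section Disc

variable {r : ℝ}

theorem disc_chartAt_source (p : disc r) : (chartAt ℂ p).source = univ := by
  rw [TopologicalSpace.Opens.chartAt_eq, OpenPartialHomeomorph.subtypeRestr_source,
    chartAt_self_eq]
  rfl

theorem disc_chartAt_apply (p x : disc r) : chartAt ℂ p x = x := rfl

theorem disc_chartAt_target (p : disc r) : (chartAt ℂ p).target = Metric.ball 0 r := by
  rw [← (chartAt ℂ p).image_source_eq_target, disc_chartAt_source, image_univ]
  exact Subtype.range_coe

theorem disc_chartAt_symm (p : disc r) {x : ℂ} (hx : x ∈ Metric.ball (0 : ℂ) r) :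
    (((chartAt ℂ p).symm x : disc r) : ℂ) = x :=
  (chartAt ℂ p).right_inv (by rwa [disc_chartAt_target])

theorem inChart_disc (f : ℂ → E3) (p : disc r) {x : ℂ} (hx : x ∈ Metric.ball (0 : ℂ) r) :
    inChart (fun p : disc r => f p) (chartAt ℂ p) x = f x := by
  simp only [inChart, disc_chartAt_symm p hx]

theorem inChart_disc_eventuallyEq (f : ℂ → E3) (p : disc r) {x : ℂ}
    (hx : x ∈ Metric.ball (0 : ℂ) r) :
    inChart (fun p : disc r => f p) (chartAt ℂ p) =ᶠ[𝓝 x] f :=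
  (Metric.isOpen_ball.eventually_mem hx).mono fun _ h => inChart_disc f p h

theorem meanCurvature_disc (f : ℂ → E3) (p : disc r) :
    meanCurvature (fun p : disc r => f p) p = meanCurv f p :=
  meanCurv_congr (inChart_disc_eventuallyEq f p p.2)

theorem isConformalImmersionOn_inChart_disc {f : ℂ → E3}
    (hf : IsConformalImmersionOn f (Metric.ball 0 r)) (p : disc r) :
    IsConformalImmersionOn (inChart (fun p : disc r => f p) (chartAt ℂ p))
      (chartAt ℂ p).target := by
  rw [disc_chartAt_target]
  exact IsConformalImmersionOn.congr Metric.isOpen_ball hf fun _ h => inChart_disc f p h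

theorem disc_chart_mem (p : disc r) (z : OpenPartialHomeomorph (disc r) ℂ) {x : ℂ}
    (hx : x ∈ z.target) : x ∈ z.target ∩ z.symm ⁻¹' (chartAt ℂ p).source :=
  ⟨hx, by rw [disc_chartAt_source]; trivial⟩

theorem isConformalImmersion_disc {f : ℂ → E3}
    (hf : IsConformalImmersionOn f (Metric.ball 0 r)) :
    IsConformalImmersion (fun p : disc r => f p) := by
  intro z hz
  rcases z.target.eq_empty_or_nonempty with h | ⟨x, hx⟩
  · rw [h]; exact ⟨contDiffOn_empty, by simp, by simp, by simp⟩
  · exact (isConformalImmersionOn_transition hz (chartAt_mem_conformalCharts (z.symm x))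
      (isConformalImmersionOn_inChart_disc hf _)).mono fun y hy => disc_chart_mem _ z hy

theorem sameMetric_disc {f g : ℂ → E3} (hf : IsConformalImmersionOn f (Metric.ball 0 r))
    (hg : IsConformalImmersionOn g (Metric.ball 0 r))
    (h : ∀ w ∈ Metric.ball (0 : ℂ) r, conformalFactor g w = conformalFactor f w) :
    SameMetric (fun p : disc r => f p) (fun p : disc r => g p) := by
  intro z hz x hx
  have hc := chartAt_mem_conformalCharts (z.symm x)
  have hx' := disc_chart_mem (z.symm x) z hx
  rw [conformalFactor_transition hz hc (isConformalImmersionOn_inChart_disc hf _) hx',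
    conformalFactor_transition hz hc (isConformalImmersionOn_inChart_disc hg _) hx']
  rw [disc_chartAt_apply, conformalFactor_congr (inChart_disc_eventuallyEq f _ (z.symm x).2),
    conformalFactor_congr (inChart_disc_eventuallyEq g _ (z.symm x).2), h _ (z.symm x).2]

theorem contDiffOn_disc_chart_symm {z : OpenPartialHomeomorph (disc r) ℂ}
    (hz : z ∈ conformalCharts (disc r)) :
    ContDiffOn ℝ ∞ (fun x => (z.symm x : ℂ)) z.target := by
  rcases z.target.eq_empty_or_nonempty with h | ⟨x, hx⟩
  · rw [h]; exact contDiffOn_empty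
  · exact (((contDiffOn_transition hz (chartAt_mem_conformalCharts (z.symm x))).mono
      fun y hy => disc_chart_mem _ z hy).restrict_scalars ℝ).of_le (by simp)

variable {J : ℕ} {H : ℝ → ℝ} {f : ℂ → E3}

/-- Metric and mean curvature depend on |w| only, so they do not change under rotation. Congruence
with f would force κ^(J+2) = 1. -/
theorem HasFundamentalForms.isBonnetFamily (hf : HasFundamentalForms J H r f) (hr : 0 < r)
    (hr1 : r ≤ 1) (hneg : ∀ s ∈ Ioo 0 (r ^ 2), deriv H s < 0) :
    IsBonnetFamily (2 * Real.pi / ((J : ℝ) + 2))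
      (fun (α : ℝ) (p : disc r) => f (Complex.exp (α * I) * p)) := by
  have hJ : (0 : ℝ) < (J : ℝ) + 2 := by positivity
  have hκ : ∀ α : ℝ, ‖Complex.exp (α * I)‖ = 1 := Complex.norm_exp_ofReal_mul_I
  obtain ⟨Fam, hFam⟩ : ∃ Fam : ℝ → disc r → E3,
      Fam = fun (α : ℝ) (p : disc r) => f (Complex.exp (α * I) * p) := ⟨_, rfl⟩
  have hα : ∀ α, Fam α = fun p : disc r => f (Complex.exp (α * I) * p) := fun α => by rw [hFam]
  have h0 : Fam 0 = fun p : disc r => f p := by rw [hα]; simp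
  rw [← hFam]
  refine ⟨fun z hz => ?_, fun α _ => ?_, fun α _ => ?_, fun α _ P => ?_, ?_, fun α hαε hα0 => ?_⟩
  · simp only [hα]
    refine hf.immersion.smooth.comp (t := Metric.ball 0 r) ?_
      fun q hq => mul_mem_ball_of_norm_eq_one (hκ _) (z.symm q.2).2
    refine ContDiffOn.mul (ContDiff.contDiffOn ?_)
      ((contDiffOn_disc_chart_symm hz).comp contDiffOn_snd fun q hq => hq.2)
    exact ((Complex.ofRealCLM.contDiff.comp contDiff_fst).mul contDiff_const).cexp
  · rw [hα]
    exact isConformalImmersion_disc (hf.rotate_immersion (hκ α))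
  · rw [h0, hα]
    exact sameMetric_disc (g := fun w => f (Complex.exp (α * I) * w)) hf.immersion (hf.rotate_immersion (hκ α))
      fun w hw => hf.rotate_conformalFactor (hκ α) hw
  · rw [h0, hα]
    have e1 := meanCurvature_disc f P
    have e2 := meanCurvature_disc (fun w => f (Complex.exp (α * I) * w)) P
    exact e2.trans ((hf.rotate_meanCurv (hκ α) P.2).trans e1.symm)
  · rintro ⟨c, hc⟩
    rw [h0] at hc
    have hs : r ^ 2 / 2 ∈ Ioo 0 (r ^ 2) := ⟨by positivity, by nlinarith [sq_pos_of_pos hr]⟩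
    have hz : H =ᶠ[𝓝 (r ^ 2 / 2)] fun _ => c := by
      filter_upwards [isOpen_Ioo.eventually_mem hs] with s hs
      have hm : (√s : ℂ) ∈ Metric.ball (0 : ℂ) r := by
        rw [mem_ball_zero_iff, Complex.norm_real, Real.norm_of_nonneg (Real.sqrt_nonneg s)]
        exact (Real.sqrt_lt' hr).2 hs.2
      have h1 := hc ⟨_, hm⟩
      rw [meanCurvature_disc, hf.meanCurv_eq _ hm] at h1
      simpa [Real.sq_sqrt hs.1.le] using h1
    have := hneg _ hs
    rw [hz.deriv_eq] at this
    simp at this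
  · rw [h0, hα]
    rintro ⟨A, hA⟩
    -- κ^(J+2) = 1 makes (J+2)α an integral multiple of 2π, and |α| < 2π/(J+2) leaves only α = 0.
    have h1 := hf.pow_eq_one_of_congruent hr hr1 hneg (hκ α) (A := A)
      fun w hw => hA ⟨w, hw⟩
    rw [← Complex.exp_nat_mul, Complex.exp_eq_one_iff] at h1
    obtain ⟨k, hk⟩ := h1
    have h2 : ((J : ℝ) + 2) * α = k * (2 * Real.pi) := by
      have h3 : ((((J : ℝ) + 2) * α : ℝ) : ℂ) * I = ((k * (2 * Real.pi) : ℝ) : ℂ) * I := by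
        push_cast at hk ⊢; linear_combination hk
      exact_mod_cast mul_right_cancel₀ Complex.I_ne_zero h3
    have h4 : |((J : ℝ) + 2) * α| < 2 * Real.pi := by
      rw [abs_mul, abs_of_pos hJ, mul_comm]
      exact (lt_div_iff₀ hJ).1 (abs_lt.2 hαε)
    rw [h2, abs_mul, abs_of_pos Real.two_pi_pos] at h4
    have h5 : |(k : ℝ)| < 1 := by
      by_contra! hcon
      nlinarith [Real.two_pi_pos]
    have h6 : k = 0 := Int.abs_lt_one_iff.1 (by exact_mod_cast h5)
    rw [h6] at h2
    simp only [Int.cast_zero, zero_mul, mul_eq_zero] at h2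
    exact hα0 (h2.resolve_left hJ.ne')

theorem HasFundamentalForms.isBonnetSurface (hf : HasFundamentalForms J H r f) (hr : 0 < r)
    (hr1 : r ≤ 1) (hneg : ∀ s ∈ Ioo 0 (r ^ 2), deriv H s < 0) :
    IsBonnetSurface (fun p : disc r => f p) :=
  ⟨_, by have := Real.pi_pos; positivity, _, by simp, hf.isBonnetFamily hr hr1 hneg⟩

theorem HasFundamentalForms.isCriticalPointOfIndexNeg (hf : HasFundamentalForms J H r f)
    (hr : 0 < r) (hA : HasAsymptotics J (r ^ 2) H) :
    IsCriticalPointOfIndexNeg (fun p : disc r => f p) ⟨0, Metric.mem_ball_self hr⟩ J := by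
  have h0 : (0 : ℂ) ∈ Metric.ball (0 : ℂ) r := Metric.mem_ball_self hr
  set P : disc r := ⟨0, h0⟩ with hP
  refine ⟨chartAt ℂ P, chartAt_mem_conformalCharts P, mem_chart_source ℂ P, rfl, ?_,
    fun w => ((J : ℂ) + 2) * ((1 - (starRingEnd ℂ w) ^ (J + 2)) / (1 - w ^ (J + 2))) *
      (1 / (1 - ((‖w‖ ^ 2 : ℝ) : ℂ) ^ (J + 2))), ?_, ?_, ?_⟩
  · obtain ⟨B, hB, -, hHB⟩ := hA
    have e : (fun x => meanCurvature (fun p : disc r => f p) ((chartAt ℂ P).symm x)) =ᶠ[𝓝 0]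
        fun x : ℂ => H (‖x‖ ^ 2) := by
      filter_upwards [Metric.isOpen_ball.eventually_mem h0] with x hx
      rw [meanCurvature_disc, disc_chartAt_symm P hx, hf.meanCurv_eq x hx]
    have hs := norm_sq_mem_Ico h0
    -- H has a one-sided derivative at s = 0 by its asymptotics, and the differential of |x|²
    -- vanishes at 0.
    rw [e.fderiv_eq, (hasFDerivAt_radial
      (IsHazzidakisSolution.hasDerivWithinAt hB hHB hs) hs.2).fderiv]
    simp
  · exact ContinuousAt.mul (continuousAt_const.mul
      (ContinuousAt.div (by fun_prop) (by fun_prop) (by simp)))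
      (ContinuousAt.div (by fun_prop) (by fun_prop) (by simp))
  · have : (J : ℂ) + 2 ≠ 0 := by exact_mod_cast (by omega : J + 2 ≠ 0)
    simpa using this
  · filter_upwards [Metric.isOpen_ball.eventually_mem h0] with x hx
    rw [hopf_congr (inChart_disc_eventuallyEq f P hx), hf.hopf_eq x hx]
    ring

end Disc

end BonnetSurf

namespace BonnetSurf

open Complex (I)

/-! ### Germs of holomorphic functions -/

theorem AnalyticAt.exists_order {f : ℂ → ℂ} (hf : AnalyticAt ℂ f 0)
    (h : ¬ ∀ᶠ z in 𝓝 (0 : ℂ), f z = 0) :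
    ∃ (n : ℕ) (g : ℂ → ℂ), AnalyticAt ℂ g 0 ∧ g 0 ≠ 0 ∧ ∀ᶠ z in 𝓝 (0 : ℂ), f z = z ^ n * g z := by
  obtain ⟨n, g, hg, hg0, he⟩ := hf.exists_eventuallyEq_pow_smul_nonzero_iff.2 h
  exact ⟨n, g, hg, hg0, by simpa using he⟩

theorem AnalyticAt.eventually_ne_zero_of_not {f : ℂ → ℂ} (hf : AnalyticAt ℂ f 0)
    (h : ¬ ∀ᶠ z in 𝓝 (0 : ℂ), f z = 0) : ∀ᶠ z in 𝓝[≠] (0 : ℂ), f z ≠ 0 :=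
  hf.eventually_eq_zero_or_eventually_ne_zero.resolve_left h

/-- The directions of `z^j z̄^k` separate the exponents. -/
theorem eq_of_im_pow_mul_conj_pow {j k : ℕ} {φ : ℂ → ℂ} (hφ : ContinuousAt φ 0) (h0 : φ 0 ≠ 0)
    (h : ∀ᶠ z in 𝓝[≠] (0 : ℂ), (z ^ j * starRingEnd ℂ z ^ k * φ z).im = 0) : j = k := by
  by_contra hjk
  -- On the ray z = tκ the positive factor t^(j+k) can be divided out, and t → 0 leaves a condition
  -- on φ(0) for every direction κ.
  have key : ∀ κ : ℂ, ‖κ‖ = 1 → (κ ^ j * starRingEnd ℂ κ ^ k * φ 0).im = 0 := by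
    intro κ hκ
    have hκ0 : κ ≠ 0 := by rintro rfl; simp at hκ
    have hc : Tendsto (fun t : ℝ => (t : ℂ) * κ) (𝓝[>] 0) (𝓝[≠] 0) := by
      refine tendsto_nhdsWithin_iff.2 ⟨?_, ?_⟩
      · have : ContinuousAt (fun t : ℝ => (t : ℂ) * κ) 0 := by fun_prop
        have h1 := this.tendsto.mono_left (nhdsWithin_le_nhds (s := Ioi 0))
        simpa using h1
      · filter_upwards [self_mem_nhdsWithin] with t ht
        exact mul_ne_zero (Complex.ofReal_ne_zero.2 (ne_of_gt ht)) hκ0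
    have h1 : ∀ᶠ t : ℝ in 𝓝[>] 0, (κ ^ j * starRingEnd ℂ κ ^ k * φ ((t : ℂ) * κ)).im = 0 := by
      filter_upwards [hc.eventually h, self_mem_nhdsWithin] with t ht htp
      have e : ((t : ℂ) * κ) ^ j * starRingEnd ℂ ((t : ℂ) * κ) ^ k * φ ((t : ℂ) * κ) =
          ((t ^ (j + k) : ℝ) : ℂ) * (κ ^ j * starRingEnd ℂ κ ^ k * φ ((t : ℂ) * κ)) := by
        rw [map_mul, Complex.conj_ofReal]; push_cast; ring
      rw [e, Complex.im_ofReal_mul] at ht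
      exact (mul_eq_zero.1 ht).resolve_left (pow_ne_zero _ (ne_of_gt htp))
    have h2 : Tendsto (fun t : ℝ => (κ ^ j * starRingEnd ℂ κ ^ k * φ ((t : ℂ) * κ)).im)
        (𝓝[>] 0) (𝓝 (κ ^ j * starRingEnd ℂ κ ^ k * φ 0).im) :=
      (Complex.continuous_im.tendsto _).comp ((hφ.tendsto.comp
        (hc.mono_right nhdsWithin_le_nhds)).const_mul _)
    exact tendsto_nhds_unique (h2.congr' (f₂ := fun _ => (0:ℝ)) h1) tendsto_const_nhds
  have hN : ((j : ℝ) - k) ≠ 0 := sub_ne_zero.2 (by exact_mod_cast hjk)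
  have h1 := key 1 (by simp)
  -- The direction κ = 1 shows that φ(0) is real. For this θ one has κ^j κ̄^k = i, which makes the
  -- real part of φ(0) vanish too.
  set θ : ℝ := Real.pi / 2 / ((j : ℝ) - k) with hθ
  have h2 := key (Complex.exp (θ * I)) (Complex.norm_exp_ofReal_mul_I θ)
  have e : Complex.exp (θ * I) ^ j * starRingEnd ℂ (Complex.exp (θ * I)) ^ k = I := by
    rw [← Complex.exp_conj, ← Complex.exp_nat_mul, ← Complex.exp_nat_mul, ← Complex.exp_add,
      map_mul, Complex.conj_ofReal, Complex.conj_I]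
    have : (j : ℂ) * (θ * I) + k * (θ * -I) = Real.pi / 2 * I := by
      have h3 : ((j : ℝ) - k) * θ = Real.pi / 2 := by rw [hθ]; field_simp
      have h4 : ((j : ℂ) - k) * θ = Real.pi / 2 := by exact_mod_cast congrArg Complex.ofReal h3
      linear_combination h4 * I
    rw [this, Complex.exp_pi_div_two_mul_I]
  rw [e] at h2
  simp at h1 h2
  exact h0 (Complex.ext h2 h1)

/-- g/g(0) equals 1 at the origin, so the principal logarithm is analytic there. -/
theorem exists_analytic_root {g : ℂ → ℂ} (hg : AnalyticAt ℂ g 0) (h0 : g 0 ≠ 0) {n : ℕ}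
    (hn : 0 < n) :
    ∃ ψ : ℂ → ℂ, AnalyticAt ℂ ψ 0 ∧ ψ 0 ≠ 0 ∧ ∀ᶠ z in 𝓝 (0 : ℂ), ψ z ^ n = g z := by
  obtain ⟨c, hc⟩ := IsAlgClosed.exists_pow_nat_eq (g 0) hn
  have hc0 : c ≠ 0 := by rintro rfl; rw [zero_pow hn.ne'] at hc; exact h0 hc.symm
  have hq : AnalyticAt ℂ (fun z => g z / g 0) 0 := hg.fun_div analyticAt_const h0
  refine ⟨fun z => c * Complex.exp (Complex.log (g z / g 0) / n), analyticAt_const.mul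
    ((hq.clog (by simp [h0])).fun_div analyticAt_const (by exact_mod_cast hn.ne')).cexp, ?_, ?_⟩
  · exact mul_ne_zero hc0 (Complex.exp_ne_zero _)
  · filter_upwards [hg.continuousAt.eventually_ne h0] with z hz
    rw [mul_pow, hc, ← Complex.exp_nat_mul, mul_div_cancel₀ _ (by exact_mod_cast hn.ne'),
      Complex.exp_log (div_ne_zero hz h0), mul_div_cancel₀ _ h0]

/-- The inverse function theorem for holomorphic functions of one variable. -/
theorem exists_local_biholomorphism {g : ℂ → ℂ} {p : ℂ} (hg : AnalyticAt ℂ g p)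
    (h0 : deriv g p ≠ 0) {U : Set ℂ} (hU : U ∈ 𝓝 p) :
    ∃ (e : OpenPartialHomeomorph ℂ ℂ) (r : ℝ), 0 < r ∧ r ≤ 1 ∧ p ∈ e.source ∧ e.source ⊆ U ∧
      (∀ z, e z = g z) ∧ e.target = Metric.ball (g p) r ∧ DifferentiableOn ℂ e e.source ∧
      DifferentiableOn ℂ e.symm e.target ∧
      ∀ y ∈ e.target, deriv e.symm y * deriv g (e.symm y) = 1 := by
  have hs : HasStrictDerivAt g (deriv g p) p := hg.hasStrictDerivAt
  set e₀ := (hs.hasStrictFDerivAt_equiv h0).toOpenPartialHomeomorph g with he₀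
  have hp : p ∈ e₀.source := HasStrictFDerivAt.mem_toOpenPartialHomeomorph_source _
  have hcoe : ∀ z, e₀ z = g z := fun z => rfl
  have hgp : g p ∈ e₀.target := e₀.map_source hp
  have hlp : e₀.symm (g p) = p := e₀.left_inv hp
  have hV : ∀ᶠ z in 𝓝 p, z ∈ U ∧ AnalyticAt ℂ g z ∧ deriv g z ≠ 0 :=
    (eventually_mem_set.2 hU).and (hg.eventually_analyticAt.and
      (hg.deriv.continuousAt.eventually_ne h0))
  have hW : ∀ᶠ y in 𝓝 (g p), y ∈ e₀.target ∧ e₀.symm y ∈ U ∧ AnalyticAt ℂ g (e₀.symm y) ∧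
      deriv g (e₀.symm y) ≠ 0 := by
    refine (e₀.open_target.eventually_mem hgp).and ?_
    have := e₀.continuousAt_symm hgp
    rw [ContinuousAt, hlp] at this
    exact this.eventually hV
  obtain ⟨r, hr, hrW⟩ := Metric.eventually_nhds_iff_ball.1 hW
  set r' := min r 1
  have hr' : 0 < r' := lt_min hr one_pos
  have hsub : ∀ y ∈ Metric.ball (g p) r', y ∈ Metric.ball (g p) r :=
    Metric.ball_subset_ball (min_le_left _ _)
  set e := (e₀.symm.restrOpen (Metric.ball (g p) r') Metric.isOpen_ball).symm with he
  have ht : e.target = Metric.ball (g p) r' := by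
    change e₀.target ∩ Metric.ball (g p) r' = _
    exact inter_eq_right.2 fun y hy => (hrW y (hsub y hy)).1
  have hse : ∀ z ∈ e.source, z ∈ e₀.source ∧ g z ∈ Metric.ball (g p) r' := fun z hz =>
    ⟨hz.1, by have := e.map_source hz; rw [ht] at this; exact this⟩
  have hds : ∀ y ∈ e.target, HasDerivAt e.symm (deriv g (e.symm y))⁻¹ y := by
    intro y hy
    have h1 : y ∈ Metric.ball (g p) r' := by rwa [ht] at hy
    obtain ⟨-, -, h2, h3⟩ := hrW y (hsub y h1)
    exact e.hasDerivAt_symm hy h3 h2.differentiableAt.hasDerivAt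
  refine ⟨e, r', hr', min_le_right _ _, ?_, fun z hz => ?_, hcoe, ht, fun z hz => ?_,
    fun y hy => (hds y hy).differentiableAt.differentiableWithinAt, fun y hy => ?_⟩
  · have : e.symm (g p) ∈ e.source := e.map_target (by rw [ht]; exact Metric.mem_ball_self hr')
    have h2 : e.symm (g p) = p := hlp
    rwa [h2] at this
  · obtain ⟨h1, h2⟩ := hse z hz
    have := (hrW _ (hsub _ h2)).2.1
    rwa [← hcoe z, e₀.left_inv h1] at this
  · obtain ⟨h1, h2⟩ := hse z hz
    have := (hrW _ (hsub _ h2)).2.2.1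
    rw [← hcoe z, e₀.left_inv h1] at this
    exact this.differentiableAt.differentiableWithinAt
  · have h1 : y ∈ Metric.ball (g p) r' := by rwa [ht] at hy
    rw [(hds y hy).deriv]
    exact inv_mul_cancel₀ (hrW y (hsub y h1)).2.2.2

/-- The punctured disc is the image of a half plane under the exponential. -/
theorem isPreconnected_punctured_ball {δ : ℝ} (hδ : 0 < δ) :
    IsPreconnected (Metric.ball (0 : ℂ) δ \ {0}) := by
  have hc : Convex ℝ {t : ℂ | t.re < Real.log δ} := convex_halfSpace_re_lt _
  have := hc.isPreconnected.image Complex.exp Complex.continuous_exp.continuousOn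
  convert this using 1
  ext z
  simp only [Set.mem_sdiff, mem_ball_zero_iff, mem_singleton_iff, mem_image, mem_ofPred_eq]
  constructor
  · rintro ⟨h1, h2⟩
    exact ⟨Complex.log z, by
      rw [Complex.log_re]; exact Real.log_lt_log (norm_pos_iff.2 h2) h1, Complex.exp_log h2⟩
  · rintro ⟨t, ht, rfl⟩
    exact ⟨by rw [Complex.norm_exp]; exact (Real.lt_log_iff_exp_lt hδ).1 ht, Complex.exp_ne_zero t⟩

theorem im_pos_or_im_neg {k : ℂ → ℂ} (hk : ∀ᶠ z in 𝓝[≠] (0 : ℂ), ContinuousAt k z)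
    (h : ∀ᶠ z in 𝓝[≠] (0 : ℂ), (k z).im ≠ 0) :
    (∀ᶠ z in 𝓝[≠] (0 : ℂ), 0 < (k z).im) ∨ ∀ᶠ z in 𝓝[≠] (0 : ℂ), (k z).im < 0 := by
  obtain ⟨δ, hδ, hball⟩ := Metric.eventually_nhds_iff_ball.1
    (eventually_nhdsWithin_iff.1 (hk.and h))
  set S := Metric.ball (0 : ℂ) δ \ {0} with hS
  have hmem : S ∈ 𝓝[≠] (0 : ℂ) := by
    rw [hS, sdiff_eq, inter_comm]; exact inter_mem_nhdsWithin _ (Metric.ball_mem_nhds 0 hδ)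
  have hc : ContinuousOn (fun z => (k z).im) S := fun z hz =>
    (Complex.continuous_im.continuousAt.comp (hball z hz.1 hz.2).1).continuousWithinAt
  have hpre := (isPreconnected_punctured_ball hδ).image _ hc
  have h0 : (0 : ℝ) ∉ (fun z => (k z).im) '' S := by
    rintro ⟨z, hz, hz0⟩; exact (hball z hz.1 hz.2).2 hz0
  by_cases hpos : ∀ z ∈ S, 0 < (k z).im
  · exact Or.inl (mem_of_superset hmem hpos)
  · push Not at hpos
    obtain ⟨z₀, hz₀, hle⟩ := hpos
    refine Or.inr (mem_of_superset hmem fun z hz => ?_)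
    by_contra hge
    have hge : 0 ≤ (k z).im := not_lt.1 hge
    exact h0 (hpre.ordConnected.out (mem_image_of_mem _ hz₀) (mem_image_of_mem _ hz) ⟨hle, hge⟩)

/-- A holomorphic function near a puncture with values in the upper half plane extends. -/
theorem exists_analytic_extension_of_im_pos {k : ℂ → ℂ}
    (hk : ∀ᶠ z in 𝓝[≠] (0 : ℂ), DifferentiableAt ℂ k z)
    (h : ∀ᶠ z in 𝓝[≠] (0 : ℂ), 0 < (k z).im) :
    ∃ k' : ℂ → ℂ, AnalyticAt ℂ k' 0 ∧ 0 < (k' 0).im ∧ ∀ᶠ z in 𝓝[≠] (0 : ℂ), k' z = k z := by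
  obtain ⟨δ, hδ, hball⟩ := Metric.eventually_nhds_iff_ball.1
    (eventually_nhdsWithin_iff.1 (hk.and h))
  have hn := Metric.ball_mem_nhds (0 : ℂ) hδ
  have hne : ∀ {x : ℂ}, 0 < x.im → x + I ≠ 0 := fun {x} hx h0 => by
    have := congrArg Complex.im h0; simp at this; linarith
  have hlt : ∀ {x : ℂ}, 0 < x.im → ‖(x - I) / (x + I)‖ < 1 := fun {x} hx => by
    rw [norm_div, div_lt_one (norm_pos_iff.2 (hne hx)), ← sq_lt_sq₀ (norm_nonneg _) (norm_nonneg _),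
      norm_sq_eq_re_im, norm_sq_eq_re_im]
    simp; nlinarith
  -- The Cayley transform takes the upper half plane to the unit disc, so its composition with k is
  -- bounded and the singularity is removable.
  set c₀ : ℂ → ℂ := fun z => (k z - I) / (k z + I) with hc₀
  have hcd : DifferentiableOn ℂ c₀ (Metric.ball 0 δ \ {0}) := fun z hz => by
    obtain ⟨h1, h2⟩ := hball z hz.1 hz.2
    exact ((h1.sub_const _).fun_div (h1.add_const _) (hne h2)).differentiableWithinAt
  have hb : BddAbove (norm ∘ c₀ '' (Metric.ball 0 δ \ {0})) := by
    refine ⟨1, ?_⟩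
    rintro _ ⟨z, hz, rfl⟩
    exact (hlt (hball z hz.1 hz.2).2).le
  have hext := Complex.differentiableOn_update_limUnder_of_bddAbove hn hcd hb
  set c := Function.update c₀ 0 (limUnder (𝓝[≠] 0) c₀) with hc
  have hcc : ∀ᶠ z in 𝓝[≠] (0 : ℂ), c z = c₀ z := by
    filter_upwards [self_mem_nhdsWithin] with z hz
    exact Function.update_of_ne hz _ _
  have hca : AnalyticAt ℂ c 0 := hext.analyticAt hn
  have hclt : ∀ᶠ z in 𝓝[≠] (0 : ℂ), ‖c z‖ < 1 := by
    filter_upwards [hcc, h] with z hz hz2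
    rw [hz]; exact hlt hz2
  -- Modulus 1 at the puncture would be a local maximum, and the maximum principle would make c
  -- constant of modulus 1 nearby, contrary to `hclt`. Hence the extended k also has positive
  -- imaginary part at 0.
  have hc1 : ‖c 0‖ < 1 := by
    have hle : ‖c 0‖ ≤ 1 := le_of_tendsto
      (hca.continuousAt.norm.tendsto.mono_left (nhdsWithin_le_nhds (s := {0}ᶜ)))
      (hclt.mono fun z hz => hz.le)
    refine lt_of_le_of_ne hle fun h1 => ?_
    have hmax : IsLocalMax (norm ∘ c) 0 := by
      filter_upwards [eventually_nhdsWithin_iff.1 hclt] with z hz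
      by_cases hz0 : z = 0
      · rw [hz0]
      · simp only [Function.comp, h1]; exact (hz hz0).le
    have := Complex.eventually_eq_of_isLocalMax_norm
      (hca.eventually_analyticAt.mono fun z hz => hz.differentiableAt) hmax
    obtain ⟨z, hz1, hz2⟩ := (hclt.and (nhdsWithin_le_nhds this)).exists
    rw [hz2, h1] at hz1
    exact lt_irrefl _ hz1
  have h1c : ∀ {x : ℂ}, ‖x‖ < 1 → 1 - x ≠ 0 := fun {x} hx h0 => by
    rw [← sub_eq_zero.1 h0] at hx; simp at hx
  refine ⟨fun z => I * (1 + c z) / (1 - c z), ?_, ?_, ?_⟩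
  · exact (analyticAt_const.mul (analyticAt_const.add hca)).fun_div (analyticAt_const.sub hca)
      (h1c hc1)
  · have h2 : 0 < Complex.normSq (1 - c 0) := Complex.normSq_pos.2 (h1c hc1)
    have h3 : (I * (1 + c 0) / (1 - c 0)).im = (1 - ‖c 0‖ ^ 2) / Complex.normSq (1 - c 0) := by
      rw [Complex.div_im, norm_sq_eq_re_im]; simp; field_simp; ring
    rw [h3]
    exact div_pos (by nlinarith [norm_nonneg (c 0)]) h2
  · filter_upwards [hcc, h] with z hz hz2
    have h4 := hne hz2
    have h5 : (1 : ℂ) - (k z - I) / (k z + I) ≠ 0 := h1c (hlt hz2)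
    simp only [hz, hc₀]
    rw [div_eq_iff h5]
    field_simp
    ring

theorem exists_eq_pow_mul_of_continuousAt {K γ : ℂ → ℂ} {J : ℕ} (hK : AnalyticAt ℂ K 0)
    (hγ : ContinuousAt γ 0) (h : ∀ᶠ z in 𝓝[≠] (0 : ℂ), K z = z ^ J * γ z) :
    ∃ p : ℂ → ℂ, AnalyticAt ℂ p 0 ∧ (∀ z, K z = z ^ J * p z) ∧ ∀ᶠ z in 𝓝 (0 : ℂ), p z = γ z := by
  obtain ⟨δ, hδ, hball⟩ := Metric.eventually_nhds_iff_ball.1 hK.eventually_analyticAt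
  have hd : DifferentiableOn ℂ K (Metric.ball 0 δ) := fun z hz =>
    (hball z hz).differentiableAt.differentiableWithinAt
  have hb : ∀ᶠ z in 𝓝 (0 : ℂ), ‖γ z‖ < ‖γ 0‖ + 1 :=
    hγ.norm.tendsto.eventually_lt_const (by linarith)
  obtain ⟨p, hp, hKp⟩ := exists_eq_pow_mul hδ hd (C := ‖γ 0‖ + 1) (j := J) (by
    filter_upwards [h, nhdsWithin_le_nhds hb] with z hz hzb
    rw [hz, norm_mul, norm_pow, mul_comm]
    gcongr)
  have hpa : AnalyticAt ℂ p 0 := hp.analyticAt (Metric.ball_mem_nhds 0 hδ)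
  have hpγ : ∀ᶠ z in 𝓝[≠] (0 : ℂ), p z = γ z := by
    filter_upwards [h, self_mem_nhdsWithin] with z hz hz0
    rw [hKp] at hz
    exact mul_left_cancel₀ (pow_ne_zero J hz0) hz
  have h0 : p 0 = γ 0 := tendsto_nhds_unique
    (hpa.continuousAt.tendsto.mono_left (nhdsWithin_le_nhds (s := {0}ᶜ)))
    ((hγ.tendsto.mono_left nhdsWithin_le_nhds).congr' (hpγ.mono fun z hz => hz.symm))
  refine ⟨p, hpa, hKp, ?_⟩
  filter_upwards [eventually_nhdsWithin_iff.1 hpγ] with z hz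
  by_cases hz0 : z = 0
  · rw [hz0, h0]
  · exact hz hz0

/-! ### Hopf differentials of the isometric deformations -/

theorem norm_add_eq_iff (Q q : ℂ) : ‖Q + q‖ = ‖Q‖ ↔
    q * starRingEnd ℂ q + Q * starRingEnd ℂ q + starRingEnd ℂ Q * q = 0 := by
  rw [← sq_eq_sq₀ (norm_nonneg _) (norm_nonneg _), norm_sq_eq_re_im, norm_sq_eq_re_im,
    Complex.ext_iff]
  simp only [Complex.add_re, Complex.add_im, Complex.mul_re, Complex.mul_im, Complex.conj_re,
    Complex.conj_im, Complex.zero_re, Complex.zero_im]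
  constructor
  · exact fun h => ⟨by linear_combination h, by ring⟩
  · rintro ⟨h, -⟩; linear_combination h

/-- With k = q₂/(q₂ - q₁) the hypothesis reads Q(k̄ - k) = q₁k. As k maps into the upper half plane
it extends over 0, and v = (k - k₀)/(k - k̄₀), with k₀ = k(0), maps into the unit disc and vanishes
at 0. Rewriting k̄ - k through v produces the Cayley factor, and the rest of Q is holomorphic. -/
theorem exists_cayley_form_of_im_pos {Q q₁ q₂ g : ℂ → ℂ} {J : ℕ} (h1 : AnalyticAt ℂ q₁ 0)
    (h2 : AnalyticAt ℂ q₂ 0) (hg : ContinuousAt g 0) (hg0 : g 0 ≠ 0)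
    (hQ : ∀ᶠ z in 𝓝 (0 : ℂ), Q z = z ^ J * g z)
    (hk : ∀ᶠ z in 𝓝[≠] (0 : ℂ), Q z * (starRingEnd ℂ (q₂ z / (q₂ z - q₁ z)) -
      q₂ z / (q₂ z - q₁ z)) = q₁ z * (q₂ z / (q₂ z - q₁ z)))
    (hd : ∀ᶠ z in 𝓝[≠] (0 : ℂ), q₂ z - q₁ z ≠ 0)
    (hi : ¬ ∃ c : ℂ, ∀ᶠ z in 𝓝 (0 : ℂ), q₂ z = c * q₁ z)
    (him : ∀ᶠ z in 𝓝[≠] (0 : ℂ), 0 < (q₂ z / (q₂ z - q₁ z)).im) :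
    ∃ v p : ℂ → ℂ, AnalyticAt ℂ v 0 ∧ AnalyticAt ℂ p 0 ∧ v 0 = 0 ∧ p 0 ≠ 0 ∧
      (¬ ∀ᶠ z in 𝓝 (0 : ℂ), v z = 0) ∧ ∀ᶠ z in 𝓝 (0 : ℂ), ‖v z‖ < 1 ∧
        Q z = z ^ J * p z *
          ((1 - starRingEnd ℂ (v z)) / (1 - v z * starRingEnd ℂ (v z))) := by
  have hdiff : ∀ᶠ z in 𝓝[≠] (0 : ℂ), DifferentiableAt ℂ (fun z => q₂ z / (q₂ z - q₁ z)) z := by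
    filter_upwards [nhdsWithin_le_nhds h1.eventually_analyticAt,
      nhdsWithin_le_nhds h2.eventually_analyticAt, hd] with z hz1 hz2 hz
    exact hz2.differentiableAt.fun_div (hz2.differentiableAt.fun_sub hz1.differentiableAt) hz
  obtain ⟨k, hka, hk0, hkk⟩ := exists_analytic_extension_of_im_pos hdiff him
  have hkpos : ∀ᶠ z in 𝓝 (0 : ℂ), 0 < (k z).im :=
    (Complex.continuous_im.continuousAt.comp hka.continuousAt).eventually_const_lt hk0
  set k₀ := k 0 with hk₀
  have hne : ∀ {x : ℂ}, 0 < x.im → x - starRingEnd ℂ k₀ ≠ 0 := fun {x} hx h0 => by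
    have := congrArg Complex.im h0; simp at this; linarith
  set v : ℂ → ℂ := fun z => (k z - k₀) / (k z - starRingEnd ℂ k₀) with hv
  have hva : AnalyticAt ℂ v 0 :=
    (hka.fun_sub analyticAt_const).fun_div (hka.fun_sub analyticAt_const) (hne hk0)
  have hv0 : v 0 = 0 := by simp [hv, hk₀]
  have hvlt : ∀ᶠ z in 𝓝 (0 : ℂ), ‖v z‖ < 1 :=
    hva.continuousAt.norm.tendsto.eventually_lt_const (by rw [hv0]; simp)
  -- The holomorphic part of Q. The remaining factor `m` is continuous with value 1 at 0, so `K`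
  -- vanishes to the same order J as Q.
  set K : ℂ → ℂ := fun z => -(q₁ z * k z) / (k z - starRingEnd ℂ k₀) with hK
  have hKa : AnalyticAt ℂ K 0 := ((h1.fun_mul hka).fun_neg).fun_div
    (hka.fun_sub analyticAt_const) (hne hk0)
  have hvc := Complex.continuous_conj.continuousAt.comp hva.continuousAt
  set m : ℂ → ℂ := fun z => (1 - starRingEnd ℂ (v z)) / (1 - v z * starRingEnd ℂ (v z)) with hm
  have hmc : ContinuousAt m 0 := (continuousAt_const.sub hvc).div
    (continuousAt_const.sub (hva.continuousAt.mul hvc)) (by simp [hv0])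
  have hm0 : m 0 = 1 := by simp [hm, hv0]
  have hQK : ∀ᶠ z in 𝓝[≠] (0 : ℂ), Q z = K z * m z := by
    filter_upwards [hk, hkk, nhdsWithin_le_nhds hkpos] with z hz hz2 hz3
    rw [← hz2] at hz
    have e1 := hne hz3
    have e2 : starRingEnd ℂ (k z) - k₀ ≠ 0 := fun h0 => by
      have := congrArg Complex.im h0; simp at this; linarith
    have e3 : starRingEnd ℂ (k z) - k z ≠ 0 := fun h0 => by
      have := congrArg Complex.im h0; simp at this; linarith
    have e4 : starRingEnd ℂ k₀ - k₀ ≠ 0 := fun h0 => by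
      have := congrArg Complex.im h0; simp at this; linarith
    have e5 : 1 - (k z - k₀) / (k z - starRingEnd ℂ k₀) *
        ((starRingEnd ℂ (k z) - starRingEnd ℂ k₀) / (starRingEnd ℂ (k z) - k₀)) =
        (starRingEnd ℂ (k z) - k z) * (k₀ - starRingEnd ℂ k₀) /
          ((k z - starRingEnd ℂ k₀) * (starRingEnd ℂ (k z) - k₀)) := by
      field_simp; ring
    have e6 : 1 - (starRingEnd ℂ (k z) - starRingEnd ℂ k₀) / (starRingEnd ℂ (k z) - k₀) =
        (starRingEnd ℂ k₀ - k₀) / (starRingEnd ℂ (k z) - k₀) := by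
      field_simp; ring
    have e7 : k₀ - starRingEnd ℂ k₀ = -(starRingEnd ℂ k₀ - k₀) := by ring
    simp only [hK, hm, hv, map_div₀, map_sub, Complex.conj_conj]
    rw [e5, e6, e7]
    generalize starRingEnd ℂ k₀ - k₀ = A at *
    generalize starRingEnd ℂ (k z) - k₀ = B at *
    generalize k z - starRingEnd ℂ k₀ = C at *
    generalize starRingEnd ℂ (k z) - k z = D at *
    field_simp
    linear_combination hz
  have hmne : ∀ᶠ z in 𝓝 (0 : ℂ), m z ≠ 0 := hmc.eventually_ne (by rw [hm0]; exact one_ne_zero)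
  have hKγ : ∀ᶠ z in 𝓝[≠] (0 : ℂ), K z = z ^ J * (g z / m z) := by
    filter_upwards [hQK, nhdsWithin_le_nhds hQ, nhdsWithin_le_nhds hmne] with z hz1 hz2 hz3
    rw [← mul_div_assoc, ← hz2, hz1, mul_div_cancel_right₀ _ hz3]
  obtain ⟨p, hp, -, hpγ⟩ := exists_eq_pow_mul_of_continuousAt hKa
    (hg.div hmc (by rw [hm0]; exact one_ne_zero)) hKγ
  refine ⟨v, p, hva, hp, hv0, ?_, fun hcon => hi ?_, ?_⟩
  · rw [hpγ.self_of_nhds]; change g 0 / m 0 ≠ 0; rw [hm0, div_one]; exact hg0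
  -- If v vanished identically, k would be the constant k₀, and q₂ = k₀(q₂ - q₁) would make q₂
  -- proportional to q₁.
  · have hk1 : k₀ - 1 ≠ 0 := fun h0 => by
      have := congrArg Complex.im h0; simp at this; linarith
    have hp : ∀ᶠ z in 𝓝[≠] (0 : ℂ), q₂ z = k₀ / (k₀ - 1) * q₁ z := by
      filter_upwards [hkk, nhdsWithin_le_nhds hcon, hd, nhdsWithin_le_nhds hkpos]
        with z hz1 hz2 hz3 hz4
      have : k z = k₀ := by
        have := (div_eq_zero_iff.1 hz2).resolve_right (hne hz4)
        exact sub_eq_zero.1 this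
      rw [this, eq_div_iff hz3] at hz1
      field_simp
      linear_combination hz1
    have he := (h2.frequently_eq_iff_eventually_eq (analyticAt_const.mul h1)).1 hp.frequently
    exact ⟨_, he⟩
  · filter_upwards [hvlt, hpγ, hQ, hmne] with z hz1 hz2 hz3 hz4
    refine ⟨hz1, ?_⟩
    rw [hz2, hz3]
    change z ^ J * g z = z ^ J * (g z / m z) * m z
    field_simp

/-- The Hopf differential of a surface with a two-parameter set of isometric deformations of
equal mean curvature. -/
theorem exists_cayley_form {Q q₁ q₂ g : ℂ → ℂ} {J : ℕ} (h1 : AnalyticAt ℂ q₁ 0)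
    (h2 : AnalyticAt ℂ q₂ 0) (hg : ContinuousAt g 0) (hg0 : g 0 ≠ 0)
    (hQ : ∀ᶠ z in 𝓝 (0 : ℂ), Q z = z ^ J * g z)
    (hr1 : ∀ᶠ z in 𝓝 (0 : ℂ), ‖Q z + q₁ z‖ = ‖Q z‖)
    (hr2 : ∀ᶠ z in 𝓝 (0 : ℂ), ‖Q z + q₂ z‖ = ‖Q z‖)
    (hq1 : ¬ ∀ᶠ z in 𝓝 (0 : ℂ), q₁ z = 0)
    (hi : ¬ ∃ c : ℂ, ∀ᶠ z in 𝓝 (0 : ℂ), q₂ z = c * q₁ z) :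
    ∃ v p : ℂ → ℂ, AnalyticAt ℂ v 0 ∧ AnalyticAt ℂ p 0 ∧ v 0 = 0 ∧ p 0 ≠ 0 ∧
      (¬ ∀ᶠ z in 𝓝 (0 : ℂ), v z = 0) ∧ ∀ᶠ z in 𝓝 (0 : ℂ), ‖v z‖ < 1 ∧
        Q z = z ^ J * p z *
          ((1 - starRingEnd ℂ (v z)) / (1 - v z * starRingEnd ℂ (v z))) := by
  have hq2 : ¬ ∀ᶠ z in 𝓝 (0 : ℂ), q₂ z = 0 := fun h => hi ⟨0, by simpa using h⟩
  have hq12 : ¬ ∀ᶠ z in 𝓝 (0 : ℂ), q₂ z - q₁ z = 0 := fun h => hi ⟨1, by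
    filter_upwards [h] with z hz; rw [one_mul]; exact sub_eq_zero.1 hz⟩
  have n1 := AnalyticAt.eventually_ne_zero_of_not h1 hq1
  have n2 := AnalyticAt.eventually_ne_zero_of_not h2 hq2
  have n12 := AnalyticAt.eventually_ne_zero_of_not (h2.fun_sub h1) hq12
  -- Multiplying the norm relation for a by b, the one for b by a, and subtracting eliminates Q̄.
  have rel : ∀ {a b : ℂ → ℂ}, (∀ᶠ z in 𝓝 (0 : ℂ), ‖Q z + a z‖ = ‖Q z‖) →
      (∀ᶠ z in 𝓝 (0 : ℂ), ‖Q z + b z‖ = ‖Q z‖) → (∀ᶠ z in 𝓝[≠] (0 : ℂ), b z - a z ≠ 0) →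
      ∀ᶠ z in 𝓝[≠] (0 : ℂ), Q z * (starRingEnd ℂ (b z / (b z - a z)) - b z / (b z - a z)) =
        a z * (b z / (b z - a z)) := by
    intro a b ha hb hab
    filter_upwards [nhdsWithin_le_nhds ha, nhdsWithin_le_nhds hb, hab] with z hza hzb hz
    rw [norm_add_eq_iff] at hza hzb
    have hz' : starRingEnd ℂ (b z) - starRingEnd ℂ (a z) ≠ 0 := by
      rw [← map_sub]; exact (map_ne_zero _).2 hz
    rw [map_div₀, map_sub]
    field_simp
    linear_combination b z * hza - a z * hzb
  have r12 := rel hr1 hr2 n12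
  -- At a real value of k the relation would give q₁k = 0, which fails off the isolated zeros.
  have hne : ∀ᶠ z in 𝓝[≠] (0 : ℂ), (q₂ z / (q₂ z - q₁ z)).im ≠ 0 := by
    filter_upwards [r12, n1, n2, n12] with z hz hz1 hz2 hz12 h0
    rw [Complex.conj_eq_iff_im.2 h0, sub_self, mul_zero] at hz
    exact mul_ne_zero hz1 (div_ne_zero hz2 hz12) hz.symm
  have hc : ∀ᶠ z in 𝓝[≠] (0 : ℂ), ContinuousAt (fun z => q₂ z / (q₂ z - q₁ z)) z := by
    filter_upwards [nhdsWithin_le_nhds h1.eventually_analyticAt,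
      nhdsWithin_le_nhds h2.eventually_analyticAt, n12] with z hz1 hz2 hz
    exact hz2.continuousAt.div (hz2.continuousAt.sub hz1.continuousAt) hz
  rcases im_pos_or_im_neg hc hne with hpos | hneg
  · exact exists_cayley_form_of_im_pos h1 h2 hg hg0 hQ r12 n12 hi hpos
  -- Exchanging q₁ and q₂ replaces k by 1 - k and so reverses the sign of the imaginary part.
  · have n21 : ∀ᶠ z in 𝓝[≠] (0 : ℂ), q₁ z - q₂ z ≠ 0 :=
      n12.mono fun z hz h => hz (by rw [← neg_sub, h, neg_zero])
    refine exists_cayley_form_of_im_pos h2 h1 hg hg0 hQ (rel hr2 hr1 n21) n21 ?_ ?_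
    · rintro ⟨c, hc⟩
      by_cases h0 : c = 0
      · exact hq1 (by simpa [h0] using hc)
      · exact hi ⟨c⁻¹, by filter_upwards [hc] with z hz; rw [hz]; field_simp⟩
    · filter_upwards [hneg, n12, n21] with z hz hz2 hz3
      have : q₁ z / (q₁ z - q₂ z) = 1 - q₂ z / (q₂ z - q₁ z) := by
        rw [← neg_sub (q₂ z) (q₁ z)]; field_simp; ring
      rw [this]; simpa using hz

end BonnetSurf

namespace BonnetSurf

open Complex (I)

/-! ### The operator `A ΔA - |∇A|² = A² Δ log A` -/

/-- `A ΔA - |∇A|²`, which is `A² Δ log A` for positive `A`. -/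
def logLap (A : ℂ → ℝ) (p : ℂ) : ℝ :=
  A p * (px (px A) p + py (py A) p) - (px A p ^ 2 + py A p ^ 2)

theorem logLap_congr {A B : ℂ → ℝ} {p : ℂ} (h : A =ᶠ[𝓝 p] B) : logLap A p = logLap B p := by
  have h1 : px A =ᶠ[𝓝 p] px B := h.eventually_nhds.mono fun q hq => px_congr hq
  have h2 : py A =ᶠ[𝓝 p] py B := h.eventually_nhds.mono fun q hq => py_congr hq
  rw [logLap, logLap, px_congr h1, py_congr h2, px_congr h, py_congr h, h.eq_of_nhds]

section

variable {V : Set ℂ} {p : ℂ}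

/-- Additivity of Δ log, in a form without logarithms or division. -/
theorem logLap_mul (hV : IsOpen V) {A B : ℂ → ℝ} (hA : ContDiffOn ℝ ∞ A V)
    (hB : ContDiffOn ℝ ∞ B V) (hp : p ∈ V) :
    logLap (fun q => A q * B q) p = A p ^ 2 * logLap B p + B p ^ 2 * logLap A p := by
  have dA := fun {q} (hq : q ∈ V) => hA.differentiableAt_of_isOpen hV hq
  have dB := fun {q} (hq : q ∈ V) => hB.differentiableAt_of_isOpen hV hq
  have dAx := (contDiffOn_px hV hA).differentiableAt_of_isOpen hV hp
  have dAy := (contDiffOn_py hV hA).differentiableAt_of_isOpen hV hp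
  have dBx := (contDiffOn_px hV hB).differentiableAt_of_isOpen hV hp
  have dBy := (contDiffOn_py hV hB).differentiableAt_of_isOpen hV hp
  have hx : px (fun q => A q * B q) =ᶠ[𝓝 p] fun q => px A q * B q + A q * px B q :=
    (hV.eventually_mem hp).mono fun q hq => px_mul (dA hq) (dB hq)
  have hy : py (fun q => A q * B q) =ᶠ[𝓝 p] fun q => py A q * B q + A q * py B q :=
    (hV.eventually_mem hp).mono fun q hq => py_mul (dA hq) (dB hq)
  rw [logLap, px_congr hx, py_congr hy, hx.eq_of_nhds, hy.eq_of_nhds,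
    px_add (dAx.fun_mul (dB hp)) ((dA hp).fun_mul dBx),
    py_add (dAy.fun_mul (dB hp)) ((dA hp).fun_mul dBy), px_mul dAx (dB hp), px_mul (dA hp) dBx,
    py_mul dAy (dB hp), py_mul (dA hp) dBy, logLap, logLap]
  ring

variable {u : ℂ → ℂ} (hV : IsOpen V) (hu : DifferentiableOn ℂ u V) (hp : p ∈ V)

include hV hu hp

theorem hasFDerivAt_norm_sq_holomorphic : HasFDerivAt (fun q => ‖u q‖ ^ 2)
    ((2 • innerSL ℝ (u p)).comp ((ContinuousLinearMap.toSpanSingleton ℂ (deriv u p)).restrictScalars ℝ))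
    p :=
  (hasFDerivAt_norm_sq (u p)).comp p
    ((hu.differentiableAt (hV.mem_nhds hp)).hasDerivAt.hasFDerivAt.restrictScalars ℝ)

theorem px_norm_sq : px (fun q => ‖u q‖ ^ 2) p = 2 * (starRingEnd ℂ (u p) * deriv u p).re := by
  rw [px, (hasFDerivAt_norm_sq_holomorphic hV hu hp).fderiv]
  simp [Complex.inner]; ring

theorem py_norm_sq : py (fun q => ‖u q‖ ^ 2) p = -2 * (starRingEnd ℂ (u p) * deriv u p).im := by
  rw [py, (hasFDerivAt_norm_sq_holomorphic hV hu hp).fderiv]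
  simp [Complex.inner]; ring

theorem laplacian_norm_sq : px (px fun q => ‖u q‖ ^ 2) p + py (py fun q => ‖u q‖ ^ 2) p =
    4 * ‖deriv u p‖ ^ 2 := by
  have hu' : DifferentiableOn ℂ (deriv u) V := hu.deriv hV
  have du := hu.differentiableAt (hV.mem_nhds hp)
  have du' := hu'.differentiableAt (hV.mem_nhds hp)
  have dc := differentiableAt_conj (du.restrictScalars ℝ)
  have hx : px (fun q => ‖u q‖ ^ 2) =ᶠ[𝓝 p]
      fun q => 2 * Complex.reCLM (starRingEnd ℂ (u q) * deriv u q) :=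
    (hV.eventually_mem hp).mono fun q hq => px_norm_sq hV hu hq
  have hy : py (fun q => ‖u q‖ ^ 2) =ᶠ[𝓝 p]
      fun q => -2 * Complex.imCLM (starRingEnd ℂ (u q) * deriv u q) :=
    (hV.eventually_mem hp).mono fun q hq => py_norm_sq hV hu hq
  have dm := dc.fun_mul (du'.restrictScalars ℝ)
  have c1 := px_clm (Complex.conjCLE : ℂ →L[ℝ] ℂ) (du.restrictScalars ℝ)
  have c2 := py_clm (Complex.conjCLE : ℂ →L[ℝ] ℂ) (du.restrictScalars ℝ)
  simp only [ContinuousLinearEquiv.coe_coe, Complex.conjCLE_apply] at c1 c2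
  have d1 : DifferentiableAt ℝ
      (fun q => Complex.reCLM (starRingEnd ℂ (u q) * deriv u q)) p :=
    Complex.reCLM.differentiableAt.comp p dm
  have d2 : DifferentiableAt ℝ
      (fun q => Complex.imCLM (starRingEnd ℂ (u q) * deriv u q)) p :=
    Complex.imCLM.differentiableAt.comp p dm
  rw [px_congr hx, py_congr hy, px_const_mul _ d1, py_const_mul _ d2, px_clm _ dm, py_clm _ dm,
    px_mul dc (du'.restrictScalars ℝ), py_mul dc (du'.restrictScalars ℝ), c1, c2,
    px_of_differentiableAt du, py_of_differentiableAt du, px_of_differentiableAt du',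
    py_of_differentiableAt du', norm_sq_eq_re_im]
  simp
  ring

theorem gradient_norm_sq : px (fun q => ‖u q‖ ^ 2) p ^ 2 + py (fun q => ‖u q‖ ^ 2) p ^ 2 =
    4 * ‖u p‖ ^ 2 * ‖deriv u p‖ ^ 2 := by
  rw [px_norm_sq hV hu hp, py_norm_sq hV hu hp, norm_sq_eq_re_im, norm_sq_eq_re_im]
  simp only [Complex.mul_re, Complex.mul_im, Complex.conj_re, Complex.conj_im]
  ring

omit hp in
theorem contDiffOn_norm_sq_holomorphic : ContDiffOn ℝ ∞ (fun q => ‖u q‖ ^ 2) V := by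
  have : ContDiffOn ℝ ∞ u V := (hu.contDiffOn (n := ∞) hV).restrict_scalars ℝ
  exact (contDiff_norm_sq ℝ).comp_contDiffOn this

/-- Harmonicity of log|u|² for holomorphic u; in this form it holds at zeros of u as well. -/
theorem logLap_norm_sq : logLap (fun q => ‖u q‖ ^ 2) p = 0 := by
  rw [logLap, laplacian_norm_sq hV hu hp, gradient_norm_sq hV hu hp]; ring

theorem logLap_one_sub_norm_sq : logLap (fun q => 1 - ‖u q‖ ^ 2) p = -4 * ‖deriv u p‖ ^ 2 := by
  set N : ℂ → ℝ := fun q => ‖u q‖ ^ 2 with hN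
  have hNc : ContDiffOn ℝ ∞ N V := contDiffOn_norm_sq_holomorphic hV hu
  have hx : ∀ q ∈ V, px (fun q => 1 - N q) q = 0 - px N q := fun q hq => by
    rw [px_sub (differentiableAt_const 1) (hNc.differentiableAt_of_isOpen hV hq), px_const]
  have hy : ∀ q ∈ V, py (fun q => 1 - N q) q = 0 - py N q := fun q hq => by
    rw [py_sub (differentiableAt_const 1) (hNc.differentiableAt_of_isOpen hV hq), py_const]
  have h1 := laplacian_norm_sq hV hu hp
  have h2 := gradient_norm_sq hV hu hp
  rw [logLap, px_congr ((hV.eventually_mem hp).mono hx), py_congr ((hV.eventually_mem hp).mono hy),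
    hx p hp, hy p hp, px_sub (differentiableAt_const 0)
      ((contDiffOn_px hV hNc).differentiableAt_of_isOpen hV hp), py_sub (differentiableAt_const 0)
      ((contDiffOn_py hV hNc).differentiableAt_of_isOpen hV hp), px_const, py_const]
  change px (px N) p + py (py N) p = _ at h1
  change px N p ^ 2 + py N p ^ 2 = 4 * N p * _ at h2
  linear_combination (-(1 - N p)) * h1 - h2

end

/-- Surfaces with Hopf differential `v' (1 - v̄) / ((1 - v) (1 - |v|²))`. -/
theorem im_eq_zero_of_straightened {V : Set ℂ} (hV : IsOpen V) {f : ℂ → E3} {v : ℂ → ℂ} {p : ℂ}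
    (hf : IsConformalImmersionOn f V) (hv : DifferentiableOn ℂ v V)
    (h1 : ∀ q ∈ V, ‖v q‖ < 1) (h0 : ∀ q ∈ V, deriv v q ≠ 0)
    (hQ : ∀ q ∈ V, hopf f q = deriv v q / (1 - v q) *
      ((1 - starRingEnd ℂ (v q)) / (1 - v q * starRingEnd ℂ (v q)))) (hp : p ∈ V) :
    (starRingEnd ℂ (deriv v p) * deriv (deriv v) p).im * (1 - ‖v p‖ ^ 2) +
      2 * ‖deriv v p‖ ^ 2 * (starRingEnd ℂ (v p) * deriv v p).im = 0 := by
  have hv' : DifferentiableOn ℂ (deriv v) V := hv.deriv hV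
  have hne : ∀ q ∈ V, 1 - v q ≠ 0 := fun q hq h => by
    have := h1 q hq; rw [← sub_eq_zero.1 h] at this; simp at this
  set N : ℂ → ℝ := fun q => ‖deriv v q‖ ^ 2 with hN
  set D₀ : ℂ → ℝ := fun q => 1 - ‖v q‖ ^ 2 with hD₀
  have hD0pos : ∀ q ∈ V, 0 < D₀ q := fun q hq => by
    have := h1 q hq; simp only [hD₀]; nlinarith [norm_nonneg (v q)]
  have hNpos : ∀ q ∈ V, 0 < N q := fun q hq => by
    have := norm_pos_iff.2 (h0 q hq); simp only [hN]; positivity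
  have hNc : ContDiffOn ℝ ∞ N V := contDiffOn_norm_sq_holomorphic hV hv'
  have hD0c : ContDiffOn ℝ ∞ D₀ V := contDiffOn_const.sub (contDiffOn_norm_sq_holomorphic hV hv)
  -- Up to a constant this is the conformal factor of the hyperbolic metric pulled back by v, and it
  -- equals |Q|². The Codazzi equation becomes E H_x = -4D and H_y = 0.
  set D : ℂ → ℝ := fun q => N q / D₀ q ^ 2 with hD
  have hDc : ContDiffOn ℝ ∞ D V := hNc.div (hD0c.pow 2) fun q hq => pow_ne_zero 2 (hD0pos q hq).ne'
  have hDpos : ∀ q ∈ V, 0 < D q := fun q hq => div_pos (hNpos q hq) (pow_pos (hD0pos q hq) 2)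
  set E := conformalFactor f
  set h := meanCurv f
  have hEc : ContDiffOn ℝ ∞ E V := hf.contDiffOn_cf hV
  have hhc : ContDiffOn ℝ ∞ h V := hf.contDiffOn_meanCurv hV
  have hEpos : ∀ q ∈ V, 0 < E q := fun q hq => hf.cf_pos hq
  -- the Codazzi equation
  have cod : ∀ q ∈ V, E q * px h q = -4 * D q ∧ py h q = 0 := by
    intro q hq
    have c1 := hf.codazzi hV hq
    have hnq := hV.mem_nhds hq
    have c2 : px (hopf f) q + I * py (hopf f) q = _ :=
      (dbar_congr ((hV.eventually_mem hq).mono hQ)).trans (dbar_cayley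
        ((hv'.differentiableAt hnq).fun_div ((hv.differentiableAt hnq).const_sub 1) (hne q hq))
        (hv.differentiableAt hnq) (h1 q hq))
    have c3 : 2 * (deriv v q / (1 - v q)) * starRingEnd ℂ (deriv v q) * (v q - 1) /
        (1 - v q * starRingEnd ℂ (v q)) ^ 2 = ((-2 * D q : ℝ) : ℂ) := by
      have e1 : deriv v q * starRingEnd ℂ (deriv v q) = ((N q : ℝ) : ℂ) := by
        rw [Complex.mul_conj, Complex.normSq_eq_norm_sq]
      have e2 := hne q hq
      have e3 : ((D₀ q : ℝ) : ℂ) ≠ 0 := Complex.ofReal_ne_zero.2 (hD0pos q hq).ne'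
      rw [one_sub_mul_conj, show ((-2 * D q : ℝ) : ℂ) =
        -2 * (((N q : ℝ) : ℂ) / ((D₀ q : ℝ) : ℂ) ^ 2) by simp only [hD]; push_cast; ring, ← e1]
      change _ / ((D₀ q : ℝ) : ℂ) ^ 2 = _
      field_simp
      ring
    rw [c2, c3, Complex.ext_iff] at c1
    obtain ⟨c4, c5⟩ := c1
    have hE := (hEpos q hq).ne'
    simp only [Complex.mul_re, Complex.mul_im, Complex.sub_re, Complex.sub_im, Complex.ofReal_re,
      Complex.ofReal_im, Complex.I_re, Complex.I_im] at c4 c5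
    refine ⟨by linear_combination (-2) * c4, ?_⟩
    have : E q / 2 * py h q = 0 := by linear_combination c5
    exact (mul_eq_zero.1 this).resolve_left (by positivity)
  set R : ℂ → ℝ := fun q => px h q with hR
  have hRc : ContDiffOn ℝ ∞ R V := contDiffOn_px hV hhc
  have hRneg : ∀ q ∈ V, R q < 0 := fun q hq => by
    have := (cod q hq).1; have := hEpos q hq; have := hDpos q hq
    by_contra! hcon
    nlinarith [mul_nonneg (hEpos q hq).le hcon]
  have zy : ∀ {g : ℂ → ℝ}, (∀ q ∈ V, g q = 0) → ∀ q ∈ V, px g q = 0 := fun {g} hg q hq => by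
    rw [px_congr (h := fun _ => 0) ((hV.eventually_mem hq).mono hg), px_const]
  have Ry : ∀ q ∈ V, py R q = 0 := fun q hq => by
    rw [hR, ← px_py_comm hV hhc hq]
    exact zy (fun q hq => (cod q hq).2) q hq
  have Rxy : ∀ q ∈ V, py (px R) q = 0 := fun q hq => by
    rw [← px_py_comm hV hRc hq]; exact zy Ry q hq
  have Rxxy : py (px (px R)) p = 0 := by
    rw [← px_py_comm hV (contDiffOn_px hV hRc) hp]; exact zy Rxy p hp
  have Ryy : ∀ q ∈ V, py (py R) q = 0 := fun q hq => by
    rw [py_congr (h := fun _ => 0) ((hV.eventually_mem hq).mono Ry), py_const]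
  -- the Liouville equation
  have liou : ∀ q ∈ V, logLap D q = 8 * D q ^ 3 := by
    intro q hq
    have e1 : N =ᶠ[𝓝 q] fun q => D q * (D₀ q * D₀ q) := by
      filter_upwards [hV.eventually_mem hq] with x hx
      have := (hD0pos x hx).ne'
      simp only [hD]; field_simp
    have e2 : logLap N q = 0 := logLap_norm_sq hV hv' hq
    have e3 : logLap D₀ q = -4 * N q := logLap_one_sub_norm_sq hV hv hq
    rw [logLap_congr e1, logLap_mul hV hDc (hD0c.mul hD0c) hq, logLap_mul hV hD0c hD0c hq, e3,
      e1.eq_of_nhds] at e2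
    have := (hD0pos q hq).ne'
    have h4 : D₀ q ^ 4 ≠ 0 := pow_ne_zero 4 this
    have : D₀ q ^ 4 * (logLap D q - 8 * D q ^ 3) = 0 := by linear_combination e2
    exact sub_eq_zero.1 ((mul_eq_zero.1 this).resolve_left h4)
  -- the Gauss equation
  have gau : ∀ q ∈ V, D q * (8 * R q * (R q - h q * h q)) =
      R q * (px (px R) q - 2 * (R q * R q)) - px R q * px R q := by
    intro q hq
    have g1 : logLap E q = _ := hf.gauss hV hq
    have e0 : (fun q => -4 * D q) =ᶠ[𝓝 q] fun q => E q * R q := by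
      filter_upwards [hV.eventually_mem hq] with x hx using (cod x hx).1.symm
    have e1 : logLap (fun q => -4 * D q) q = 16 * logLap D q := by
      rw [logLap_mul hV contDiffOn_const hDc hq]
      have : logLap (fun _ => (-4 : ℝ)) q = 0 := by
        have hx : px (fun _ : ℂ => (-4:ℝ)) = fun _ => 0 := funext fun q => px_const _ q
        have hy : py (fun _ : ℂ => (-4:ℝ)) = fun _ => 0 := funext fun q => py_const _ q
        rw [logLap, hx, hy, px_const, py_const]; simp
      rw [this]; ring
    have e2 : logLap R q = R q * px (px R) q - px R q ^ 2 := by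
      rw [logLap, Ry q hq, Ryy q hq]; ring
    have e3 : ‖hopf f q‖ ^ 2 = D q := by
      rw [hQ q hq, norm_mul, norm_div, norm_div, one_sub_mul_conj, Complex.norm_real,
        Real.norm_of_nonneg (hD0pos q hq).le, ← Complex.norm_conj (1 - v q), map_sub, map_one]
      have : ‖1 - starRingEnd ℂ (v q)‖ ≠ 0 := by
        rw [← Complex.norm_conj]; simpa using hne q hq
      have hd := (hD0pos q hq).ne'
      simp only [hD, hN]
      change (_ / _ * (_ / D₀ q)) ^ 2 = _
      field_simp
    rw [logLap_congr e0, logLap_mul hV hEc hRc hq, g1, e2, liou q hq, e3] at e1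
    have c := (cod q hq).1
    change E q * R q = _ at c
    have hDq := hDpos q hq
    have hEq := (hEpos q hq).ne'
    have hE2 : E q ^ 2 ≠ 0 := pow_ne_zero 2 hEq
    have : E q ^ 2 * (D q * (8 * R q * (R q - h q * h q)) -
        (R q * (px (px R) q - 2 * (R q * R q)) - px R q * px R q)) = 0 := by
      linear_combination -e1 + (8 * D q * (E q * R q - 4 * D q) - 2 * E q ^ 2 * h q ^ 2 * R q +
        2 * E q * R q ^ 2) * c
    exact sub_eq_zero.1 ((mul_eq_zero.1 this).resolve_left hE2)
  -- The Gauss equation, after eliminating E = -4D/R, is an equation for D in which R = H_x, its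
  -- x-derivatives and h all have vanishing y-derivative. The coefficient of D is positive because R
  -- < 0, so D_y = 0. The claim is this equation written in terms of v.
  have Dy : py D p = 0 := by
    have dR := hRc.differentiableAt_of_isOpen hV hp
    have dh := hhc.differentiableAt_of_isOpen hV hp
    have dRx := (contDiffOn_px hV hRc).differentiableAt_of_isOpen hV hp
    have dRxx := (contDiffOn_px hV (contDiffOn_px hV hRc)).differentiableAt_of_isOpen hV hp
    have dD := hDc.differentiableAt_of_isOpen hV hp
    have e := py_congr ((hV.eventually_mem hp).mono gau)
    have d1 := dR.const_mul 8
    have d2 := dR.fun_sub (dh.fun_mul dh)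
    have d3 := dRxx.fun_sub ((dR.fun_mul dR).const_mul 2)
    rw [py_mul dD (d1.fun_mul d2), py_mul d1 d2, py_const_mul _ dR, py_sub dR (dh.fun_mul dh),
      py_mul dh dh, py_sub (dR.fun_mul d3) (dRx.fun_mul dRx), py_mul dR d3,
      py_sub dRxx ((dR.fun_mul dR).const_mul 2), py_const_mul _ (dR.fun_mul dR), py_mul dR dR,
      py_mul dRx dRx, Ry p hp, (cod p hp).2, Rxy p hp, Rxxy] at e
    have hpos : 0 < 8 * R p * (R p - h p * h p) :=
      mul_pos_of_neg_of_neg (by linarith [hRneg p hp])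
        (by linarith [hRneg p hp, mul_self_nonneg (h p)])
    have e' : py D p * (8 * R p * (R p - h p * h p)) = 0 := by linear_combination e
    exact (mul_eq_zero.1 e').resolve_right hpos.ne'
  -- evaluate the derivative of `D`
  have e1 : N =ᶠ[𝓝 p] fun q => D q * (D₀ q * D₀ q) := by
    filter_upwards [hV.eventually_mem hp] with x hx
    have := (hD0pos x hx).ne'
    simp only [hD]; field_simp
  have dD := hDc.differentiableAt_of_isOpen hV hp
  have dD0 := hD0c.differentiableAt_of_isOpen hV hp
  have e2 := py_congr e1
  have e3 : py N p = _ := py_norm_sq hV hv' hp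
  have e4 : py D₀ p = 0 - -2 * (starRingEnd ℂ (v p) * deriv v p).im := by
    rw [hD₀, py_sub (differentiableAt_const 1)
      ((contDiffOn_norm_sq_holomorphic hV hv).differentiableAt_of_isOpen hV hp), py_const,
      py_norm_sq hV hv hp]
  rw [e3, py_mul dD (dD0.fun_mul dD0), py_mul dD0 dD0, Dy, e4] at e2
  have e5 : N p = D p * (D₀ p * D₀ p) := e1.eq_of_nhds
  change _ * D₀ p + 2 * N p * _ = 0
  linear_combination (-(1:ℝ)/2 * D₀ p) * e2 + 2 * (starRingEnd ℂ (v p) * deriv v p).im * e5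

/-- In the coordinate ζ with dζ = (G/v') dz the coefficient G turns into v'²/G, which is also dv/dζ.
So `im_eq_zero_of_straightened` applies, and its identity is carried back to z. -/
theorem im_eq_zero_of_cayley {U : Set ℂ} (hU : IsOpen U) {f : ℂ → E3} {v G : ℂ → ℂ} {p : ℂ}
    (hf : IsConformalImmersionOn f U) (hv : DifferentiableOn ℂ v U) (hG : DifferentiableOn ℂ G U)
    (h1 : ∀ q ∈ U, ‖v q‖ < 1)
    (hQ : ∀ q ∈ U, hopf f q = G q / (1 - v q) *
      ((1 - starRingEnd ℂ (v q)) / (1 - v q * starRingEnd ℂ (v q)))) (hp : p ∈ U)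
    (hv0 : deriv v p ≠ 0) (hG0 : G p ≠ 0) :
    (deriv (fun z => deriv v z ^ 2 / G z) p / deriv v p).im * (1 - ‖v p‖ ^ 2) +
      2 * (starRingEnd ℂ (v p) * (deriv v p ^ 2 / G p)).im = 0 := by
  have hv' : DifferentiableOn ℂ (deriv v) U := hv.deriv hU
  have hnp := hU.mem_nhds hp
  obtain ⟨δ, hδ, hB⟩ := Metric.eventually_nhds_iff_ball.1 ((hU.eventually_mem hp).and
    (((hv'.differentiableAt hnp).continuousAt.eventually_ne hv0).and
      ((hG.differentiableAt hnp).continuousAt.eventually_ne hG0)))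
  have hBU : Metric.ball p δ ⊆ U := fun z hz => (hB z hz).1
  have hpB : p ∈ Metric.ball p δ := Metric.mem_ball_self hδ
  have hquot : DifferentiableOn ℂ (fun z => G z / deriv v z) (Metric.ball p δ) :=
    (hG.mono hBU).fun_div (hv'.mono hBU) fun z hz => (hB z hz).2.1
  obtain ⟨ζ, hζ⟩ := hquot.isExactOn_ball
  have hζa : AnalyticAt ℂ ζ p := DifferentiableOn.analyticAt (s := Metric.ball p δ)
    (fun z hz => (hζ z hz).differentiableAt.differentiableWithinAt) (Metric.ball_mem_nhds p hδ)
  obtain ⟨e, r, hr, -, hpe, heB, heζ, het, -, hes, hder⟩ := exists_local_biholomorphism hζa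
    (by rw [(hζ p hpB).deriv]; exact div_ne_zero hG0 hv0) (Metric.ball_mem_nhds p hδ)
  set φ : ℂ → ℂ := ⇑e.symm with hφ
  have hV : IsOpen e.target := e.open_target
  have hmB : ∀ y ∈ e.target, φ y ∈ Metric.ball p δ := fun y hy => heB (e.map_target hy)
  have hmU : MapsTo φ e.target U := fun y hy => hBU (hmB y hy)
  have hφ' : ∀ y ∈ e.target, deriv φ y = deriv v (φ y) / G (φ y) := by
    intro y hy
    have h2 := hder y hy
    rw [(hζ _ (hmB y hy)).deriv] at h2
    obtain ⟨-, h3, h4⟩ := hB _ (hmB y hy)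
    field_simp at h2 ⊢
    exact h2
  have hφ0 : ∀ y ∈ e.target, deriv φ y ≠ 0 := fun y hy => by
    rw [hφ' y hy]; exact div_ne_zero (hB _ (hmB y hy)).2.1 (hB _ (hmB y hy)).2.2
  have dφ : ∀ y ∈ e.target, HasDerivAt φ (deriv φ y) y := fun y hy =>
    (hes.differentiableAt (hV.mem_nhds hy)).hasDerivAt
  set W : ℂ → ℂ := fun z => deriv v z ^ 2 / G z with hW
  have hvW : ∀ y ∈ e.target, deriv (fun y => v (φ y)) y = W (φ y) := by
    intro y hy
    have h2 := ((hv.differentiableAt (hU.mem_nhds (hmU hy))).hasDerivAt.comp y (dφ y hy)).deriv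
    change deriv (fun y => v (φ y)) y = _ at h2
    rw [h2, hφ' y hy, hW]; ring
  have hy : e p ∈ e.target := e.map_source hpe
  have hφp : φ (e p) = p := e.left_inv hpe
  have hWd : HasDerivAt W (deriv W p) (φ (e p)) := by
    rw [hφp]
    exact (((hv'.differentiableAt hnp).fun_pow 2).fun_div (hG.differentiableAt hnp)
      hG0).hasDerivAt
  have hdd : deriv (deriv fun y => v (φ y)) (e p) = deriv W p * (deriv v p / G p) := by
    have h2 : deriv (fun y => v (φ y)) =ᶠ[𝓝 (e p)] fun y => W (φ y) :=
      (hV.eventually_mem hy).mono hvW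
    have h3 := (hWd.comp (e p) (dφ _ hy)).deriv
    change deriv (fun y => W (φ y)) (e p) = _ at h3
    rw [h2.deriv_eq, h3, hφ' _ hy, hφp]
  have key := im_eq_zero_of_straightened hV (f := fun y => f (φ y)) (v := fun y => v (φ y))
    (isConformalImmersionOn_comp_holomorphic hU hV hf hes hmU hφ0) (hv.comp hes hmU)
    (fun y hy => h1 _ (hmU hy))
    (fun y hy => by
      rw [hvW y hy]
      exact div_ne_zero (pow_ne_zero 2 (hB _ (hmB y hy)).2.1) (hB _ (hmB y hy)).2.2)
    (fun y hy => by
      rw [hopf_comp_holomorphic hU hV hf hes hmU hy (hφ0 y hy), hvW y hy, hQ _ (hmU hy)]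
      have h2 := hφ' y hy
      obtain ⟨-, h3, h4⟩ := hB _ (hmB y hy)
      change deriv φ y ^ 2 * _ = _
      rw [h2, hW]
      field_simp) hy
  rw [hdd, hvW _ hy, hφp] at key
  have hW0 : W p ≠ 0 := div_ne_zero (pow_ne_zero 2 hv0) hG0
  have e1 : starRingEnd ℂ (W p) * (deriv W p * (deriv v p / G p)) =
      ((‖W p‖ ^ 2 : ℝ) : ℂ) * (deriv W p / deriv v p) := by
    rw [← Complex.normSq_eq_norm_sq, ← Complex.mul_conj]
    simp only [hW]
    field_simp
  rw [e1, Complex.im_ofReal_mul] at key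
  have h5 : ‖W p‖ ^ 2 ≠ 0 := pow_ne_zero 2 (norm_ne_zero_iff.2 hW0)
  refine (mul_eq_zero.1 ?_).resolve_left h5
  linear_combination key

end BonnetSurf

namespace BonnetSurf

open Complex (I)

/-! ### The order of contact at a critical point -/

section Order

variable {U : Set ℂ} {f : ℂ → E3} {v G : ℂ → ℂ}

/-- The gradient of the mean curvature. -/
theorem gradient_of_cayley (hU : IsOpen U) (hf : IsConformalImmersionOn f U)
    (hv : DifferentiableOn ℂ v U) (hG : DifferentiableOn ℂ G U) (h1 : ∀ q ∈ U, ‖v q‖ < 1)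
    (hQ : ∀ q ∈ U, hopf f q = G q / (1 - v q) *
      ((1 - starRingEnd ℂ (v q)) / (1 - v q * starRingEnd ℂ (v q)))) {q : ℂ} (hq : q ∈ U) :
    ((px (meanCurv f) q : ℝ) : ℂ) - I * ((py (meanCurv f) q : ℝ) : ℂ) =
      ((-4 / (conformalFactor f q * (1 - ‖v q‖ ^ 2) ^ 2) : ℝ) : ℂ) *
        (G q * starRingEnd ℂ (deriv v q)) := by
  have hnq := hU.mem_nhds hq
  have hne : 1 - v q ≠ 0 := fun h => by
    have := h1 q hq; rw [← sub_eq_zero.1 h] at this; simp at this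
  have c1 := hf.codazzi hU hq
  have c2 : px (hopf f) q + I * py (hopf f) q = _ :=
    (dbar_congr ((hU.eventually_mem hq).mono hQ)).trans (dbar_cayley
      ((hG.differentiableAt hnq).fun_div ((hv.differentiableAt hnq).const_sub 1) hne)
      (hv.differentiableAt hnq) (h1 q hq))
  have hE : ((conformalFactor f q : ℝ) : ℂ) ≠ 0 := Complex.ofReal_ne_zero.2 (hf.cf_pos hq).ne'
  have hD := one_sub_mul_conj_ne_zero (h1 q hq)
  rw [c2] at c1
  rw [one_sub_mul_conj] at c1 hD
  push_cast at c1 hD ⊢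
  field_simp at c1 ⊢
  refine mul_left_cancel₀ hne ?_
  linear_combination -c1

/-- The operator ∂_x + i∂_y takes H_x - iH_y to ΔH, which is real. -/
theorem dbar_gradient_im (hU : IsOpen U) {h : ℂ → ℝ} (hh : ContDiffOn ℝ ∞ h U) {q : ℂ}
    (hq : q ∈ U) :
    (dbar (fun q => ((px h q : ℝ) : ℂ) - I * ((py h q : ℝ) : ℂ)) q).im = 0 := by
  have dx := (contDiffOn_px hU hh).differentiableAt_of_isOpen hU hq
  have dy := (contDiffOn_py hU hh).differentiableAt_of_isOpen hU hq
  have dx' : DifferentiableAt ℝ (fun q => ((px h q : ℝ) : ℂ)) q :=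
    Complex.ofRealCLM.differentiableAt.comp q dx
  have dy' : DifferentiableAt ℝ (fun q => ((py h q : ℝ) : ℂ)) q :=
    Complex.ofRealCLM.differentiableAt.comp q dy
  have e1 : px (fun q => ((px h q : ℝ) : ℂ)) q = ((px (px h) q : ℝ) : ℂ) :=
    px_clm Complex.ofRealCLM dx
  have e2 : py (fun q => ((px h q : ℝ) : ℂ)) q = ((py (px h) q : ℝ) : ℂ) :=
    py_clm Complex.ofRealCLM dx
  have e3 : px (fun q => ((py h q : ℝ) : ℂ)) q = ((px (py h) q : ℝ) : ℂ) :=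
    px_clm Complex.ofRealCLM dy
  have e4 : py (fun q => ((py h q : ℝ) : ℂ)) q = ((py (py h) q : ℝ) : ℂ) :=
    py_clm Complex.ofRealCLM dy
  have e5 := px_py_comm hU hh hq
  rw [dbar_sub dx' (dy'.const_mul I), dbar, dbar, px_const_mul _ dy', py_const_mul _ dy', e1, e2,
    e3, e4, e5]
  simp

/-- H_x - iH_y is a real factor times z^J G₁ times the conjugate of z^(l+1) u. The realness of ΔH,
to leading order, concerns z^J z̄^l times a nonzero constant, and directions separate the exponents.
The leading coefficient contains l + 1, so this argument says nothing about a simple zero of v. -/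
theorem order_eq_of_order_ge_two {δ : ℝ} (hδ : 0 < δ) {J l : ℕ} {G₁ u : ℂ → ℂ}
    (hf : IsConformalImmersionOn f (Metric.ball 0 δ)) (hv : DifferentiableOn ℂ v (Metric.ball 0 δ))
    (hG₁ : DifferentiableOn ℂ G₁ (Metric.ball 0 δ)) (h1 : ∀ q ∈ Metric.ball (0 : ℂ) δ, ‖v q‖ < 1)
    (hQ : ∀ q ∈ Metric.ball (0 : ℂ) δ, hopf f q = q ^ J * G₁ q / (1 - v q) *
      ((1 - starRingEnd ℂ (v q)) / (1 - v q * starRingEnd ℂ (v q))))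
    (hG0 : G₁ 0 ≠ 0) (hu : DifferentiableOn ℂ u (Metric.ball 0 δ)) (hu0 : u 0 ≠ 0)
    (hvu : ∀ q ∈ Metric.ball (0 : ℂ) δ, deriv v q = q ^ (l + 1) * u q) : J = l := by
  have hU : IsOpen (Metric.ball (0 : ℂ) δ) := Metric.isOpen_ball
  have hm : (0 : ℂ) ∈ Metric.ball (0 : ℂ) δ := Metric.mem_ball_self hδ
  set T : ℂ → ℝ := fun q => -4 / (conformalFactor f q * (1 - ‖v q‖ ^ 2) ^ 2) with hT
  have hD : ∀ q ∈ Metric.ball (0 : ℂ) δ, 1 - ‖v q‖ ^ 2 ≠ 0 := fun q hq => by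
    have := h1 q hq; nlinarith [norm_nonneg (v q)]
  have hTc : ContDiffOn ℝ ∞ T (Metric.ball 0 δ) :=
    contDiffOn_const.div ((hf.contDiffOn_cf hU).mul
      ((contDiffOn_const.sub (contDiffOn_norm_sq_holomorphic hU hv)).pow 2)) fun q hq =>
      mul_ne_zero (hf.cf_pos hq).ne' (pow_ne_zero 2 (hD q hq))
  have hT0 : T 0 ≠ 0 := div_ne_zero (by norm_num)
    (mul_ne_zero (hf.cf_pos hm).ne' (pow_ne_zero 2 (hD 0 hm)))
  set Tc : ℂ → ℂ := fun q => ((T q : ℝ) : ℂ) with hTc'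
  have hTcc : ContDiffOn ℝ ∞ Tc (Metric.ball 0 δ) := Complex.ofRealCLM.contDiff.comp_contDiffOn hTc
  have hG : DifferentiableOn ℂ (fun q => q ^ J * G₁ q) (Metric.ball 0 δ) :=
    DifferentiableOn.mul (by fun_prop) hG₁
  have hv' : DifferentiableOn ℂ (deriv v) (Metric.ball 0 δ) := hv.deriv hU
  have hu' : DifferentiableOn ℂ (deriv u) (Metric.ball 0 δ) := hu.deriv hU
  have hdd : ∀ q ∈ Metric.ball (0 : ℂ) δ,
      deriv (deriv v) q = q ^ l * (((l : ℂ) + 1) * u q + q * deriv u q) := by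
    intro q hq
    have e : deriv v =ᶠ[𝓝 q] fun q => q ^ (l + 1) * u q := (hU.eventually_mem hq).mono hvu
    rw [e.deriv_eq]
    have := (hasDerivAt_pow (l + 1) q).fun_mul (hu.differentiableAt (hU.mem_nhds hq)).hasDerivAt
    rw [this.deriv, Nat.add_sub_cancel]; push_cast; ring
  refine eq_of_im_pow_mul_conj_pow (φ := fun q => G₁ q * (dbar Tc q * (starRingEnd ℂ q *
    starRingEnd ℂ (u q)) + Tc q * (2 * starRingEnd ℂ (((l : ℂ) + 1) * u q + q * deriv u q))))
    ?_ ?_ ?_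
  · have cn := hU.mem_nhds hm
    have c1 := (hG₁.differentiableAt cn).continuousAt
    have c2 : ContinuousAt (dbar Tc) 0 :=
      (((contDiffOn_px hU hTcc).continuousOn.continuousAt cn)).add
        (continuousAt_const.mul ((contDiffOn_py hU hTcc).continuousOn.continuousAt cn))
    have c3 := (hu.differentiableAt cn).continuousAt
    have c4 := (hu'.differentiableAt cn).continuousAt
    have c5 := hTcc.continuousOn.continuousAt cn
    have cc : Continuous fun q : ℂ => starRingEnd ℂ q := Complex.continuous_conj
    refine c1.mul ((c2.mul (cc.continuousAt.mul (cc.continuousAt.comp c3))).add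
      (c5.mul (continuousAt_const.mul (cc.continuousAt.comp
        ((continuousAt_const.mul c3).add (continuousAt_id.mul c4))))))
  · have : ((l : ℂ) + 1) ≠ 0 := by exact_mod_cast Nat.succ_ne_zero l
    simp only [map_zero, zero_mul, mul_zero, zero_add, add_zero]
    exact mul_ne_zero hG0 (mul_ne_zero (Complex.ofReal_ne_zero.2 hT0)
      (mul_ne_zero two_ne_zero ((map_ne_zero _).2 (mul_ne_zero this hu0))))
  · filter_upwards [nhdsWithin_le_nhds (hU.mem_nhds hm)] with q hq
    have hn := hU.mem_nhds hq
    have e1 := dbar_gradient_im hU (hf.contDiffOn_meanCurv hU) hq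
    have e2 : (fun q => ((px (meanCurv f) q : ℝ) : ℂ) - I * ((py (meanCurv f) q : ℝ) : ℂ)) =ᶠ[𝓝 q]
        fun q => Tc q * ((q ^ J * G₁ q) * starRingEnd ℂ (deriv v q)) :=
      (hU.eventually_mem hq).mono fun x hx => gradient_of_cayley hU hf hv hG h1 hQ hx
    have d1 := hTcc.differentiableAt_of_isOpen hU hq
    have d2 := (hG.differentiableAt hn).restrictScalars ℝ
    have d3 := differentiableAt_conj ((hv'.differentiableAt hn).restrictScalars ℝ)
    rw [dbar_congr e2, dbar_mul d1 (d2.fun_mul d3), dbar_mul d2 d3,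
      dbar_of_differentiableAt (hG.differentiableAt hn),
      dbar_conj_of_differentiableAt (hv'.differentiableAt hn), hdd q hq, hvu q hq] at e1
    rw [← e1]
    congr 1
    simp only [map_mul, map_pow, map_add]
    ring

/-- A simple zero of v needs two other arguments. For J = 0 the gradient of H at 0 would be nonzero,
against criticality. For J > 0 the identity of `im_eq_zero_of_cayley` has leading term z̄^(J+1) with
coefficient proportional to J, which cannot be real in all directions. -/
theorem order_ne_one {δ : ℝ} (hδ : 0 < δ) {J : ℕ} {G₁ : ℂ → ℂ}
    (hf : IsConformalImmersionOn f (Metric.ball 0 δ)) (hv : DifferentiableOn ℂ v (Metric.ball 0 δ))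
    (hG₁ : DifferentiableOn ℂ G₁ (Metric.ball 0 δ)) (h1 : ∀ q ∈ Metric.ball (0 : ℂ) δ, ‖v q‖ < 1)
    (hQ : ∀ q ∈ Metric.ball (0 : ℂ) δ, hopf f q = q ^ J * G₁ q / (1 - v q) *
      ((1 - starRingEnd ℂ (v q)) / (1 - v q * starRingEnd ℂ (v q))))
    (hG0 : G₁ 0 ≠ 0) (hcrit : fderiv ℝ (meanCurv f) 0 = 0) (hv0 : v 0 = 0) : deriv v 0 = 0 := by
  by_contra hd0
  have hU : IsOpen (Metric.ball (0 : ℂ) δ) := Metric.isOpen_ball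
  have hm : (0 : ℂ) ∈ Metric.ball (0 : ℂ) δ := Metric.mem_ball_self hδ
  have cn := hU.mem_nhds hm
  have hG : DifferentiableOn ℂ (fun q => q ^ J * G₁ q) (Metric.ball 0 δ) :=
    DifferentiableOn.mul (by fun_prop) hG₁
  have hv' : DifferentiableOn ℂ (deriv v) (Metric.ball 0 δ) := hv.deriv hU
  rcases Nat.eq_zero_or_pos J with rfl | hJ
  · have e := gradient_of_cayley hU hf hv hG h1 hQ hm
    rw [px, py, hcrit] at e
    simp only [_root_.zero_apply, Complex.ofReal_zero, mul_zero, sub_zero, pow_zero, one_mul,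
      hv0, norm_zero] at e
    refine mul_ne_zero ?_ (mul_ne_zero hG0 ((map_ne_zero _).2 hd0)) e.symm
    have := (hf.cf_pos hm).ne'
    exact Complex.ofReal_ne_zero.2 (by simp [this])
  · have hw : AnalyticAt ℂ (fun z => deriv v z ^ 2 / G₁ z) 0 :=
      ((hv'.analyticAt cn).fun_pow 2).fun_div (hG₁.analyticAt cn) hG0
    set ω₁ : ℂ → ℂ := fun z => deriv v z ^ 2 / G₁ z with hω₁
    have hω0 : ω₁ 0 ≠ 0 := div_ne_zero (pow_ne_zero 2 hd0) hG0
    have hJ0 : (J : ℂ) ≠ 0 := by exact_mod_cast hJ.ne'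
    have := eq_of_im_pow_mul_conj_pow (j := 0) (k := J + 1) (φ := fun z =>
      (z * deriv ω₁ z - J * ω₁ z) / deriv v z * ((1 - ‖v z‖ ^ 2 : ℝ) : ℂ) +
        2 * (starRingEnd ℂ (v z) * z * ω₁ z)) ?_ ?_ ?_
    · omega
    · have c1 := hw.continuousAt
      have c2 := hw.deriv.continuousAt
      have c3 := (hv.differentiableAt cn).continuousAt
      have c4 := (hv'.differentiableAt cn).continuousAt
      have c5 : ContinuousAt (fun z => ((1 - ‖v z‖ ^ 2 : ℝ) : ℂ)) 0 :=
        Complex.continuous_ofReal.continuousAt.comp (continuousAt_const.sub (c3.norm.pow 2))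
      refine ((((continuousAt_id.mul c2).sub (continuousAt_const.mul c1)).div c4 hd0).mul c5).add
        (continuousAt_const.mul (((Complex.continuous_conj.continuousAt.comp c3).mul
          continuousAt_id).mul c1))
    · simp [hv0, hω0, hJ0, hd0]
    · filter_upwards [nhdsWithin_le_nhds cn, self_mem_nhdsWithin,
        nhdsWithin_le_nhds ((hv'.differentiableAt cn).continuousAt.eventually_ne hd0),
        nhdsWithin_le_nhds ((hG₁.differentiableAt cn).continuousAt.eventually_ne hG0),
        nhdsWithin_le_nhds hw.eventually_analyticAt] with z hz hz0 hz1 hz2 hz3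
      have hz0 : z ≠ 0 := hz0
      have e := im_eq_zero_of_cayley hU hf hv hG h1 hQ hz hz1 (mul_ne_zero (pow_ne_zero _ hz0) hz2)
      have e1 : (fun z => deriv v z ^ 2 / (z ^ J * G₁ z)) = fun z => ω₁ z / z ^ J := by
        funext z; simp only [hω₁]; rw [div_div, mul_comm (G₁ z)]
      have e2 : deriv (fun z => ω₁ z / z ^ J) z = (z * deriv ω₁ z - J * ω₁ z) / z ^ (J + 1) := by
        have := (hz3.differentiableAt.hasDerivAt.fun_div (hasDerivAt_pow J z)
          (pow_ne_zero J hz0)).deriv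
        rw [this]
        obtain ⟨j, rfl⟩ : ∃ j, J = j + 1 := ⟨J - 1, by omega⟩
        rw [Nat.add_sub_cancel]
        field_simp
        push_cast
        ring
      have e3 : deriv v z ^ 2 / (z ^ J * G₁ z) = ω₁ z / z ^ J := congrFun e1 z
      rw [e1, e2, e3] at e
      set nz : ℝ := (‖z‖ ^ 2) ^ (J + 1) with hnz
      have e4 : ((nz : ℝ) : ℂ) = z ^ (J + 1) * starRingEnd ℂ z ^ (J + 1) := by
        rw [hnz, ← mul_pow, Complex.mul_conj, Complex.normSq_eq_norm_sq]; push_cast; ring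
      have e5 : z ^ 0 * starRingEnd ℂ z ^ (J + 1) *
          ((z * deriv ω₁ z - J * ω₁ z) / deriv v z * ((1 - ‖v z‖ ^ 2 : ℝ) : ℂ) +
            2 * (starRingEnd ℂ (v z) * z * ω₁ z)) =
          ((nz : ℝ) : ℂ) * ((((1 - ‖v z‖ ^ 2 : ℝ) : ℂ)) *
            ((z * deriv ω₁ z - J * ω₁ z) / z ^ (J + 1) / deriv v z) +
              ((2 : ℝ) : ℂ) * (starRingEnd ℂ (v z) * (ω₁ z / z ^ J))) := by
        rw [e4]
        push_cast
        field_simp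
        ring
      rw [e5, Complex.im_ofReal_mul, Complex.add_im, Complex.im_ofReal_mul, Complex.im_ofReal_mul]
      rw [mul_comm (1 - ‖v z‖ ^ 2), e, mul_zero]

/-- Here β = v'²/(vG) is holomorphic and nonzero at 0, because v has order J + 2 and G order J. The
identity of `im_eq_zero_of_cayley` becomes a condition on Im β and Im((v/v')β'). At 0 it shows that
β(0) is real. A first nonconstant term z^j γ would have to be real in every direction, so β is
constant. -/
theorem exists_real_factor {δ : ℝ} (hδ : 0 < δ) {J : ℕ} {G₁ v₁ : ℂ → ℂ}
    (hf : IsConformalImmersionOn f (Metric.ball 0 δ)) (hv : DifferentiableOn ℂ v (Metric.ball 0 δ))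
    (hG₁ : DifferentiableOn ℂ G₁ (Metric.ball 0 δ)) (h1 : ∀ q ∈ Metric.ball (0 : ℂ) δ, ‖v q‖ < 1)
    (hQ : ∀ q ∈ Metric.ball (0 : ℂ) δ, hopf f q = q ^ J * G₁ q / (1 - v q) *
      ((1 - starRingEnd ℂ (v q)) / (1 - v q * starRingEnd ℂ (v q))))
    (hG0 : G₁ 0 ≠ 0) (hv1 : DifferentiableOn ℂ v₁ (Metric.ball 0 δ)) (hv10 : v₁ 0 ≠ 0)
    (hvv : ∀ q ∈ Metric.ball (0 : ℂ) δ, v q = q ^ (J + 2) * v₁ q) :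
    ∃ b : ℝ, b ≠ 0 ∧ ∀ᶠ z in 𝓝 (0 : ℂ), deriv v z ^ 2 = b * v z * (z ^ J * G₁ z) := by
  have hU : IsOpen (Metric.ball (0 : ℂ) δ) := Metric.isOpen_ball
  have hm : (0 : ℂ) ∈ Metric.ball (0 : ℂ) δ := Metric.mem_ball_self hδ
  have cn := hU.mem_nhds hm
  have hG : DifferentiableOn ℂ (fun q => q ^ J * G₁ q) (Metric.ball 0 δ) :=
    DifferentiableOn.mul (by fun_prop) hG₁
  have hv1' : DifferentiableOn ℂ (deriv v₁) (Metric.ball 0 δ) := hv1.deriv hU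
  have hJ2 : (J : ℂ) + 2 ≠ 0 := by exact_mod_cast (by omega : J + 2 ≠ 0)
  have hv0 : v 0 = 0 := by rw [hvv 0 hm]; simp
  set u : ℂ → ℂ := fun z => ((J : ℂ) + 2) * v₁ z + z * deriv v₁ z with hu
  have hud : DifferentiableOn ℂ u (Metric.ball 0 δ) :=
    (hv1.const_mul _).add (differentiableOn_id.mul hv1')
  have hu0 : u 0 ≠ 0 := by simpa [hu] using ⟨hJ2, hv10⟩
  have hvu : ∀ q ∈ Metric.ball (0 : ℂ) δ, deriv v q = q ^ (J + 1) * u q := by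
    intro q hq
    have e : v =ᶠ[𝓝 q] fun q => q ^ (J + 2) * v₁ q := (hU.eventually_mem hq).mono hvv
    rw [e.deriv_eq]
    have := (hasDerivAt_pow (J + 2) q).fun_mul (hv1.differentiableAt (hU.mem_nhds hq)).hasDerivAt
    rw [this.deriv, show J + 2 - 1 = J + 1 by omega]; push_cast; simp only [hu]; ring
  have av := hv.analyticAt cn
  have av1 := hv1.analyticAt cn
  have aG := hG₁.analyticAt cn
  have au := hud.analyticAt cn
  set β : ℂ → ℂ := fun z => u z ^ 2 / (G₁ z * v₁ z) with hβ
  have aβ : AnalyticAt ℂ β 0 := (au.fun_pow 2).fun_div (aG.fun_mul av1) (mul_ne_zero hG0 hv10)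
  have hβ0 : β 0 ≠ 0 := div_ne_zero (pow_ne_zero 2 hu0) (mul_ne_zero hG0 hv10)
  -- the equation for `β`
  have hnear : ∀ᶠ z in 𝓝 (0 : ℂ), z ∈ Metric.ball (0 : ℂ) δ ∧ u z ≠ 0 ∧ G₁ z ≠ 0 ∧ v₁ z ≠ 0 ∧
      AnalyticAt ℂ β z :=
    (hU.eventually_mem hm).and ((au.continuousAt.eventually_ne hu0).and
      ((aG.continuousAt.eventually_ne hG0).and ((av1.continuousAt.eventually_ne hv10).and
        aβ.eventually_analyticAt)))
  have hW : ∀ z ∈ Metric.ball (0 : ℂ) δ, z ≠ 0 → G₁ z ≠ 0 → v₁ z ≠ 0 →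
      deriv v z ^ 2 / (z ^ J * G₁ z) = v z * β z := by
    intro z hz hz0 h2 h3
    rw [hvu z hz, hvv z hz]
    simp only [hβ]
    field_simp
    ring
  have heq : ∀ᶠ z in 𝓝[≠] (0 : ℂ), (β z + z * (v₁ z / u z) * deriv β z).im * (1 - ‖v z‖ ^ 2) +
      2 * (‖v z‖ ^ 2 * (β z).im) = 0 := by
    filter_upwards [nhdsWithin_le_nhds hnear.eventually_nhds, self_mem_nhdsWithin] with z hzz hz0
    have hz0 : z ≠ 0 := hz0
    obtain ⟨hz, h2, h3, h4, h5⟩ := hzz.self_of_nhds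
    have hd0 : deriv v z ≠ 0 := by rw [hvu z hz]; exact mul_ne_zero (pow_ne_zero _ hz0) h2
    have e := im_eq_zero_of_cayley hU hf hv hG h1 hQ hz hd0 (mul_ne_zero (pow_ne_zero _ hz0) h3)
    have e1 : (fun z => deriv v z ^ 2 / (z ^ J * G₁ z)) =ᶠ[𝓝 z] fun z => v z * β z := by
      filter_upwards [hzz, eventually_ne_nhds hz0] with x hx hx0
      exact hW x hx.1 hx0 hx.2.2.1 hx.2.2.2.1
    have e2 := ((hv.differentiableAt (hU.mem_nhds hz)).hasDerivAt.fun_mul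
      h5.differentiableAt.hasDerivAt).deriv
    have e3 : (deriv v z * β z + v z * deriv β z) / deriv v z =
        β z + z * (v₁ z / u z) * deriv β z := by
      rw [hvu z hz, hvv z hz]; field_simp; ring
    have e4 : starRingEnd ℂ (v z) * (v z * β z) = ((‖v z‖ ^ 2 : ℝ) : ℂ) * β z := by
      rw [← Complex.normSq_eq_norm_sq, ← Complex.mul_conj]; ring
    rw [e1.deriv_eq, e2, e3, hW z hz hz0 h3 h4, e4, Complex.im_ofReal_mul] at e
    exact e
  have c1 := aβ.continuousAt
  have c2 := aβ.deriv.continuousAt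
  have c3 := av.continuousAt
  have c4 := au.continuousAt
  have c5 := av1.continuousAt
  have him : (β 0).im = 0 := by
    have hc : ContinuousAt (fun z => (β z + z * (v₁ z / u z) * deriv β z).im * (1 - ‖v z‖ ^ 2) +
        2 * (‖v z‖ ^ 2 * (β z).im)) 0 :=
      ((Complex.continuous_im.continuousAt.comp (c1.add ((continuousAt_id.mul
        (c5.div c4 hu0)).mul c2))).mul (continuousAt_const.sub (c3.norm.pow 2))).add
        (continuousAt_const.mul ((c3.norm.pow 2).mul (Complex.continuous_im.continuousAt.comp c1)))
    have := tendsto_nhds_unique ((hc.tendsto.mono_left nhdsWithin_le_nhds).congr' heq)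
      tendsto_const_nhds
    simpa [hv0] using this
  have hconst : ∀ᶠ z in 𝓝 (0 : ℂ), β z - β 0 = 0 := by
    by_contra hcon
    obtain ⟨j, γ, aγ, hγ0, hγ⟩ := AnalyticAt.exists_order (aβ.fun_sub analyticAt_const) hcon
    have hj : j ≠ 0 := by
      rintro rfl
      have := hγ.self_of_nhds
      rw [sub_self, pow_zero, one_mul] at this
      exact hγ0 this.symm
    have c6 := aγ.continuousAt
    have c7 := aγ.deriv.continuousAt
    refine hj (eq_of_im_pow_mul_conj_pow (j := j) (k := 0) (φ := fun z =>
      (γ z + v₁ z / u z * (j * γ z + z * deriv γ z)) * ((1 - ‖v z‖ ^ 2 : ℝ) : ℂ) +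
        ((2 * ‖v z‖ ^ 2 : ℝ) : ℂ) * γ z) ?_ ?_ ?_)
    · have c8 : ContinuousAt (fun z => ((1 - ‖v z‖ ^ 2 : ℝ) : ℂ)) 0 :=
        Complex.continuous_ofReal.continuousAt.comp (continuousAt_const.sub (c3.norm.pow 2))
      have c9 : ContinuousAt (fun z => ((2 * ‖v z‖ ^ 2 : ℝ) : ℂ)) 0 :=
        Complex.continuous_ofReal.continuousAt.comp (continuousAt_const.mul (c3.norm.pow 2))
      exact ((c6.add ((c5.div c4 hu0).mul ((continuousAt_const.mul c6).add
        (continuousAt_id.mul c7)))).mul c8).add (c9.mul c6)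
    -- The leading coefficient is γ(0)(1 + j/(J+2)), since v/v' behaves like z/(J+2).
    · have e : (γ 0 + v₁ 0 / u 0 * (j * γ 0 + 0 * deriv γ 0)) * ((1 - ‖v 0‖ ^ 2 : ℝ) : ℂ) +
          ((2 * ‖v 0‖ ^ 2 : ℝ) : ℂ) * γ 0 = γ 0 * (((J + 2 + j : ℕ) : ℂ) / ((J : ℂ) + 2)) := by
        have : u 0 = ((J : ℂ) + 2) * v₁ 0 := by simp [hu]
        rw [hv0, this]
        push_cast
        simp only [norm_zero, Complex.ofReal_zero]
        field_simp
        ring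
      rw [e]
      exact mul_ne_zero hγ0 (div_ne_zero (by exact_mod_cast (by omega : J + 2 + j ≠ 0)) hJ2)
    · filter_upwards [heq, nhdsWithin_le_nhds hγ.eventually_nhds,
        nhdsWithin_le_nhds aγ.eventually_analyticAt] with z hz hzγ hza
      have e1 : β z = β 0 + z ^ j * γ z := by rw [← hzγ.self_of_nhds]; ring
      have e2 : z * deriv β z = z ^ j * (j * γ z + z * deriv γ z) := by
        have h3 : β =ᶠ[𝓝 z] fun z => β 0 + z ^ j * γ z :=
          hzγ.mono fun x hx => by
            show β x = β 0 + x ^ j * γ x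
            rw [← hx]; ring
        rw [h3.deriv_eq, (((hasDerivAt_pow j z).fun_mul
          hza.differentiableAt.hasDerivAt).const_add (β 0)).deriv]
        obtain ⟨i, rfl⟩ : ∃ i, j = i + 1 := ⟨j - 1, by omega⟩
        rw [Nat.add_sub_cancel]; push_cast; ring
      have e3 : β z + z * (v₁ z / u z) * deriv β z =
          β 0 + z ^ j * (γ z + v₁ z / u z * (j * γ z + z * deriv γ z)) := by
        rw [show z * (v₁ z / u z) * deriv β z = v₁ z / u z * (z * deriv β z) by ring, e2, e1]; ring
      rw [e3, e1] at hz
      simp only [Complex.add_im, him, zero_add] at hz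
      have e4 : z ^ j * starRingEnd ℂ z ^ 0 * ((γ z + v₁ z / u z * (j * γ z + z * deriv γ z)) *
          ((1 - ‖v z‖ ^ 2 : ℝ) : ℂ) + ((2 * ‖v z‖ ^ 2 : ℝ) : ℂ) * γ z) =
          ((1 - ‖v z‖ ^ 2 : ℝ) : ℂ) * (z ^ j * (γ z + v₁ z / u z * (j * γ z + z * deriv γ z))) +
            ((2 * ‖v z‖ ^ 2 : ℝ) : ℂ) * (z ^ j * γ z) := by ring
      rw [e4, Complex.add_im, Complex.im_ofReal_mul, Complex.im_ofReal_mul]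
      linear_combination hz
  have hreal : ((β 0).re : ℂ) = β 0 := Complex.ext (by simp) (by simp [him])
  refine ⟨(β 0).re, fun h => hβ0 (by rw [← hreal, h]; simp), ?_⟩
  filter_upwards [hconst, hnear] with z hz hzn
  obtain ⟨hzb, h2, h3, h4, -⟩ := hzn
  rw [hreal, ← sub_eq_zero.1 hz]
  by_cases hz0 : z = 0
  · subst hz0; rw [hvu 0 hm, hv0]; simp
  · rw [mul_comm (β z), ← hW z hzb hz0 h3 h4, div_mul_cancel₀ _ (mul_ne_zero (pow_ne_zero _ hz0) h3)]

end Order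

end BonnetSurf

namespace BonnetSurf

open Complex (I)

/-! ### The normal form of the Hopf differential -/

/-- If `v = q ^ (J + 2) * v₁` and `deriv v ^ 2` is a real multiple of `v G`, then `v` becomes
a power in a suitable holomorphic coordinate, in which `G` is a multiple of a power. -/
theorem exists_power_coordinate {U : Set ℂ} (hU : U ∈ 𝓝 (0 : ℂ)) {J : ℕ} {v v₁ G : ℂ → ℂ}
    (hv : AnalyticAt ℂ v 0) (hG : AnalyticAt ℂ G 0) (hv1 : AnalyticAt ℂ v₁ 0) (hv10 : v₁ 0 ≠ 0)
    (hvv : ∀ᶠ z in 𝓝 (0 : ℂ), v z = z ^ (J + 2) * v₁ z) {b : ℝ} (hb : b ≠ 0)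
    (hbv : ∀ᶠ z in 𝓝 (0 : ℂ), deriv v z ^ 2 = b * v z * G z) :
    ∃ r : ℝ, 0 < r ∧ r ≤ 1 ∧ ∃ e : OpenPartialHomeomorph ℂ ℂ, 0 ∈ e.source ∧ e.source ⊆ U ∧
      e 0 = 0 ∧ e.target = Metric.ball 0 r ∧ DifferentiableOn ℂ e e.source ∧
      DifferentiableOn ℂ e.symm e.target ∧ (∀ y ∈ e.target, deriv e.symm y ≠ 0) ∧
      (∀ y ∈ e.target, v (e.symm y) = y ^ (J + 2)) ∧
      ∀ y ∈ e.target, deriv e.symm y ^ 2 * G (e.symm y) = ((J : ℂ) + 2) ^ 2 / b * y ^ J := by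
  obtain ⟨ψ, aψ, hψ0, hψ⟩ := exists_analytic_root hv1 hv10 (n := J + 2) (by omega)
  set g : ℂ → ℂ := fun z => z * ψ z with hg
  have ag : AnalyticAt ℂ g 0 := analyticAt_id.fun_mul aψ
  have hg' : deriv g 0 ≠ 0 := by
    have := ((hasDerivAt_id (0 : ℂ)).fun_mul aψ.differentiableAt.hasDerivAt).deriv
    rw [hg]
    simp only [id] at this
    rw [this]
    simpa using hψ0
  have hnear : ∀ᶠ z in 𝓝 (0 : ℂ), z ∈ U ∧ AnalyticAt ℂ v z ∧ AnalyticAt ℂ G z ∧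
      v z = z ^ (J + 2) * v₁ z ∧ deriv v z ^ 2 = b * v z * G z ∧ ψ z ^ (J + 2) = v₁ z ∧
      AnalyticAt ℂ g z :=
    Filter.Eventually.and hU (hv.eventually_analyticAt.and (hG.eventually_analyticAt.and
      (hvv.and (hbv.and (hψ.and ag.eventually_analyticAt)))))
  obtain ⟨e, r, hr, hr1, h0, hsub, heg, het, hed, hes, hde⟩ :=
    exists_local_biholomorphism ag hg' hnear
  have hg0 : g 0 = 0 := by simp [hg]
  rw [hg0] at het
  have hmem : ∀ y ∈ e.target, _ := fun y hy => hsub (e.map_target hy)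
  have hpow : ∀ y ∈ e.target, v (e.symm y) = y ^ (J + 2) := by
    intro y hy
    obtain ⟨-, -, -, h1, -, h2, -⟩ := hmem y hy
    have h3 : e.symm y * ψ (e.symm y) = y := by
      have := e.right_inv hy
      rwa [heg] at this
    rw [h1, ← h2, ← mul_pow, h3]
  refine ⟨r, hr, hr1, e, h0, fun z hz => (hsub hz).1, by rw [heg, hg0], het, hed, hes,
    fun y hy h => by simpa [h] using hde y hy, hpow, ?_⟩
  have hop := e.open_target
  have hb0 : (b : ℂ) ≠ 0 := Complex.ofReal_ne_zero.2 hb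
  rw [het] at hop hes hpow hmem ⊢
  -- Differentiating v = w^(J+2) and inserting it into v'² = bvG determines the coefficient after
  -- cancelling w^(J+2), which is possible off the centre; continuity adds the centre.
  refine eq_of_eq_punctured ?_ ?_ ?_
  · refine (((hes.deriv hop).pow 2).mul (?_ : DifferentiableOn ℂ _ _)).continuousOn
    intro y hy
    exact ((hmem y hy).2.2.1.differentiableAt.comp_differentiableWithinAt y (hes y hy))
  · fun_prop
  · intro y hy hy0
    obtain ⟨-, h1, -, -, h2, -, -⟩ := hmem y hy
    have d1 := (hes.differentiableAt (hop.mem_nhds hy)).hasDerivAt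
    have d2 := h1.differentiableAt.hasDerivAt.comp y d1
    have e1 : (v ∘ e.symm) =ᶠ[𝓝 y] fun y => y ^ (J + 2) :=
      (hop.eventually_mem hy).mono hpow
    have d3 := d2.deriv
    rw [e1.deriv_eq, (hasDerivAt_pow (J + 2) y).deriv, show J + 2 - 1 = J + 1 by omega] at d3
    push_cast at d3
    rw [hpow y hy] at h2
    have hyp : (y : ℂ) ^ (J + 2) ≠ 0 := pow_ne_zero _ hy0
    rw [div_mul_eq_mul_div, eq_div_iff hb0]
    refine mul_left_cancel₀ hyp ?_
    calc y ^ (J + 2) * (deriv e.symm y ^ 2 * G (e.symm y) * b)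
        = deriv e.symm y ^ 2 * (b * y ^ (J + 2) * G (e.symm y)) := by ring
      _ = (deriv v (e.symm y) * deriv e.symm y) ^ 2 := by rw [← h2]; ring
      _ = y ^ (J + 2) * (((J : ℂ) + 2) ^ 2 * y ^ J) := by rw [← d3]; ring

/-- The local core of the direct statement: the Cayley form, the order J + 2 of v, the real constant
b and the power coordinate combine to bring Q to the model. -/
theorem exists_modelHopf_coordinate {U : Set ℂ} (hU : IsOpen U) (h0 : (0 : ℂ) ∈ U) {f : ℂ → E3}
    (hf : IsConformalImmersionOn f U) (hcrit : fderiv ℝ (meanCurv f) 0 = 0)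
    {q₁ q₂ g : ℂ → ℂ} {J : ℕ} (h1 : AnalyticAt ℂ q₁ 0)
    (h2 : AnalyticAt ℂ q₂ 0) (hg : ContinuousAt g 0) (hg0 : g 0 ≠ 0)
    (hQ : ∀ᶠ z in 𝓝 (0 : ℂ), hopf f z = z ^ J * g z)
    (hr1 : ∀ᶠ z in 𝓝 (0 : ℂ), ‖hopf f z + q₁ z‖ = ‖hopf f z‖)
    (hr2 : ∀ᶠ z in 𝓝 (0 : ℂ), ‖hopf f z + q₂ z‖ = ‖hopf f z‖)
    (hq1 : ¬ ∀ᶠ z in 𝓝 (0 : ℂ), q₁ z = 0)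
    (hi : ¬ ∃ c : ℂ, ∀ᶠ z in 𝓝 (0 : ℂ), q₂ z = c * q₁ z) :
    ∃ ρ : ℝ, ρ ≠ 0 ∧ ∃ r : ℝ, 0 < r ∧ r ≤ 1 ∧ ∃ e : OpenPartialHomeomorph ℂ ℂ, 0 ∈ e.source ∧
      e.source ⊆ U ∧ e 0 = 0 ∧ e.target = Metric.ball 0 r ∧ DifferentiableOn ℂ e e.source ∧
      DifferentiableOn ℂ e.symm e.target ∧
      IsConformalImmersionOn (fun x => ρ • f (e.symm x)) (Metric.ball 0 r) ∧
      ∀ w ∈ Metric.ball (0 : ℂ) r, hopf (fun x => ρ • f (e.symm x)) w = modelHopf J w := by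
  obtain ⟨v, p, av, ap, hv0, hp0, hvne, hvp⟩ := exists_cayley_form h1 h2 hg hg0 hQ hr1 hr2 hq1 hi
  obtain ⟨m, v₁, av1, hv10, hvv⟩ := AnalyticAt.exists_order av hvne
  -- Chosen so that the coefficient p appears as G₁/(1 - v), the shape used by the lemmas on v and
  -- G.
  set G₁ : ℂ → ℂ := fun z => p z * (1 - v z) with hG₁
  have aG : AnalyticAt ℂ G₁ 0 := ap.fun_mul (analyticAt_const.fun_sub av)
  have hG0 : G₁ 0 ≠ 0 := by simpa [hG₁, hv0] using hp0
  obtain ⟨δ, hδ, hball⟩ := Metric.eventually_nhds_iff_ball.1 ((hU.eventually_mem h0).and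
    (hvp.and (hvv.and (av.eventually_analyticAt.and (aG.eventually_analyticAt.and
      av1.eventually_analyticAt)))))
  have hm := Metric.mem_ball_self hδ (x := (0 : ℂ))
  have hcn := Metric.ball_mem_nhds (0 : ℂ) hδ
  have hfb : IsConformalImmersionOn f (Metric.ball 0 δ) := hf.mono fun z hz => (hball z hz).1
  have dv : DifferentiableOn ℂ v (Metric.ball 0 δ) := fun z hz =>
    (hball z hz).2.2.2.1.differentiableAt.differentiableWithinAt
  have dG : DifferentiableOn ℂ G₁ (Metric.ball 0 δ) := fun z hz =>
    (hball z hz).2.2.2.2.1.differentiableAt.differentiableWithinAt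
  have dv1 : DifferentiableOn ℂ v₁ (Metric.ball 0 δ) := fun z hz =>
    (hball z hz).2.2.2.2.2.differentiableAt.differentiableWithinAt
  have hv1 : ∀ z ∈ Metric.ball (0 : ℂ) δ, ‖v z‖ < 1 := fun z hz => (hball z hz).2.1.1
  have hvvb : ∀ z ∈ Metric.ball (0 : ℂ) δ, v z = z ^ m * v₁ z := fun z hz => (hball z hz).2.2.1
  have hne : ∀ z ∈ Metric.ball (0 : ℂ) δ, 1 - v z ≠ 0 := fun z hz h => by
    have := hv1 z hz; rw [← sub_eq_zero.1 h] at this; simp at this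
  have hQb : ∀ z ∈ Metric.ball (0 : ℂ) δ, hopf f z = z ^ J * G₁ z / (1 - v z) *
      ((1 - starRingEnd ℂ (v z)) / (1 - v z * starRingEnd ℂ (v z))) := fun z hz => by
    rw [(hball z hz).2.1.2, hG₁, ← mul_assoc, mul_div_cancel_right₀ _ (hne z hz)]
  -- the order of `v` is `J + 2`
  obtain rfl : m = J + 2 := by
    rcases m with _ | _ | l
    · rw [hvvb 0 hm, pow_zero, one_mul] at hv0; exact absurd hv0 hv10
    · have := order_ne_one hδ hfb dv dG hv1 hQb hG0 hcrit hv0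
      have e : v =ᶠ[𝓝 0] fun z => z ^ (0 + 1) * v₁ z := hvv
      rw [e.deriv_eq, ((hasDerivAt_pow (0 + 1) (0 : ℂ)).fun_mul
        av1.differentiableAt.hasDerivAt).deriv] at this
      exact absurd (by simpa using this) hv10
    · rw [order_eq_of_order_ge_two hδ (u := fun z => ((l : ℂ) + 2) * v₁ z + z * deriv v₁ z)
        hfb dv dG hv1 hQb hG0 ((dv1.const_mul _).add
          (differentiableOn_id.mul (dv1.deriv Metric.isOpen_ball)))
        (by simpa using ⟨by exact_mod_cast (by omega : l + 2 ≠ 0), hv10⟩) fun z hz => ?_]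
      have e : v =ᶠ[𝓝 z] fun z => z ^ (l + 1 + 1) * v₁ z :=
        (Metric.isOpen_ball.eventually_mem hz).mono hvvb
      rw [e.deriv_eq, ((hasDerivAt_pow (l + 1 + 1) z).fun_mul
        (dv1.differentiableAt (Metric.isOpen_ball.mem_nhds hz)).hasDerivAt).deriv,
        Nat.add_sub_cancel]
      push_cast
      ring
  obtain ⟨b, hb, hbv⟩ := exists_real_factor hδ hfb dv dG hv1 hQb hG0 dv1 hv10 hvvb
  obtain ⟨r, hr, hr1, e, he0, hes, hee, het, hed, hesd, hde, hpow, hfac⟩ :=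
    exists_power_coordinate hcn av ((analyticAt_id.fun_pow J).fun_mul aG) av1 hv10 hvv hb hbv
  have hop := e.open_target
  have hmaps : MapsTo e.symm e.target (Metric.ball 0 δ) := fun y hy => hes (e.map_target hy)
  have hJ2 : ((J : ℝ) + 2) ≠ 0 := by positivity
  have hJ2c : ((J : ℂ) + 2) ≠ 0 := by exact_mod_cast (by omega : J + 2 ≠ 0)
  have hρ : b / ((J : ℝ) + 2) ≠ 0 := div_ne_zero hb hJ2
  have hc := isConformalImmersionOn_comp_holomorphic Metric.isOpen_ball hop hfb hesd hmaps hde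
  -- The power coordinate leaves the coefficient (J+2)²/b, and this homothety turns it into J + 2.
  -- The factor is negative when b is.
  refine ⟨b / ((J : ℝ) + 2), hρ, r, hr, hr1, e, he0, fun z hz => (hball z (hes hz)).1, hee, het,
    hed, hesd, ?_, fun y hy => ?_⟩
  · rw [← het]; exact isConformalImmersionOn_smul hc hρ
  · rw [← het] at hy
    have h3 := hfac y hy
    simp only [id] at h3
    have hb0 : (b : ℂ) ≠ 0 := Complex.ofReal_ne_zero.2 hb
    rw [hopf_smul hρ, hopf_comp_holomorphic Metric.isOpen_ball hop hfb hesd hmaps hy (hde y hy),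
      hQb _ (hmaps hy), hpow y hy, modelHopf_eq_cayley]
    generalize (1 - starRingEnd ℂ (y ^ (J + 2))) /
      (1 - y ^ (J + 2) * starRingEnd ℂ (y ^ (J + 2))) = K
    calc _ = ((b / ((J : ℝ) + 2) : ℝ) : ℂ) * (deriv e.symm y ^ 2 * (e.symm y ^ J *
          G₁ (e.symm y))) / (1 - y ^ (J + 2)) * K := by ring
      _ = _ := by
        rw [h3]
        push_cast
        congr 2
        field_simp

end BonnetSurf

namespace BonnetSurf

open Complex (I)

/-! ### Holomorphic quadratic differentials -/

section QuadraticDifferential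

variable {M : Type*} [TopologicalSpace M]

theorem exists_ball_subset_target {z : OpenPartialHomeomorph M ℂ} {p : M} (hp : p ∈ z.source) :
    ∃ δ, 0 < δ ∧ Metric.ball (z p) δ ⊆ z.target :=
  Metric.isOpen_iff.1 z.open_target _ (z.map_source hp)

theorem eventually_mem_ball_chart {z : OpenPartialHomeomorph M ℂ} {p : M} (hp : p ∈ z.source)
    {δ : ℝ} (hδ : 0 < δ) : ∀ᶠ y in 𝓝 p, y ∈ z.source ∧ z y ∈ Metric.ball (z p) δ :=
  (z.open_source.eventually_mem hp).and
    ((z.continuousAt hp).eventually (Metric.ball_mem_nhds _ hδ))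

variable [ChartedSpace ℂ M]

/-- A holomorphic quadratic differential `D z dz²`, given by its coefficients in conformal
charts. -/
structure IsQuadraticDifferential (D : OpenPartialHomeomorph M ℂ → ℂ → ℂ) : Prop where
  holomorphic : ∀ z ∈ conformalCharts M, DifferentiableOn ℂ (D z) z.target
  transition : ∀ z ∈ conformalCharts M, ∀ z' ∈ conformalCharts M,
    ∀ x ∈ z.target ∩ z.symm ⁻¹' z'.source,
      D z x = deriv (fun x => z' (z.symm x)) x ^ 2 * D z' (z' (z.symm x))

/-- A function that is constant on coordinate balls is constant. -/
theorem eq_of_eq_on_chart_balls [IsManifold 𝓘(ℂ) ω M] [ConnectedSpace M] {X : Type*} {φ : M → X}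
    (h : ∀ z ∈ conformalCharts M, ∀ c δ, Metric.ball c δ ⊆ z.target →
      ∀ x ∈ Metric.ball c δ, ∀ y ∈ Metric.ball c δ, φ (z.symm x) = φ (z.symm y)) (p q : M) :
    φ p = φ q := by
  refine IsLocallyConstant.apply_eq_of_preconnectedSpace
    ((IsLocallyConstant.iff_eventually_eq φ).2 fun p => ?_) p q
  have hp := mem_chart_source ℂ p
  obtain ⟨δ, hδ, hb⟩ := exists_ball_subset_target hp
  filter_upwards [eventually_mem_ball_chart hp hδ] with y hy
  have := h _ (chartAt_mem_conformalCharts p) _ _ hb _ hy.2 _ (Metric.mem_ball_self hδ)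
  rwa [(chartAt ℂ p).left_inv hy.1, (chartAt ℂ p).left_inv hp] at this

namespace IsQuadraticDifferential

variable {D D' : OpenPartialHomeomorph M ℂ → ℂ → ℂ}

theorem sub_const_mul (hD : IsQuadraticDifferential D) (hD' : IsQuadraticDifferential D') (c : ℂ) :
    IsQuadraticDifferential fun z x => D z x - c * D' z x :=
  ⟨fun z hz => (hD.holomorphic z hz).sub ((hD'.holomorphic z hz).const_mul c),
    fun z hz z' hz' x hx => by
      rw [hD.transition z hz z' hz' x hx, hD'.transition z hz z' hz' x hx]; ring⟩

theorem eq_zero_iff (hD : IsQuadraticDifferential D) {z z' : OpenPartialHomeomorph M ℂ}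
    (hz : z ∈ conformalCharts M) (hz' : z' ∈ conformalCharts M) {p : M} (hp : p ∈ z.source)
    (hp' : p ∈ z'.source) : D z (z p) = 0 ↔ D z' (z' p) = 0 := by
  have hx : z p ∈ z.target ∩ z.symm ⁻¹' z'.source :=
    ⟨z.map_source hp, by simp only [mem_preimage, z.left_inv hp, hp']⟩
  rw [hD.transition z hz z' hz' _ hx, z.left_inv hp]
  simp [deriv_transition_ne_zero hz hz' hx]

/-- The identity principle on coordinate balls. -/
theorem eq_zero_on_ball (hD : IsQuadraticDifferential D) {z : OpenPartialHomeomorph M ℂ}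
    (hz : z ∈ conformalCharts M) {c : ℂ} {δ : ℝ} (hb : Metric.ball c δ ⊆ z.target) {x : ℂ}
    (hx : x ∈ Metric.ball c δ) (h : ∀ᶠ y in 𝓝 x, D z y = 0) :
    ∀ y ∈ Metric.ball c δ, D z y = 0 := fun _ hy =>
  AnalyticOnNhd.eqOn_zero_of_preconnected_of_eventuallyEq_zero
    (((hD.holomorphic z hz).mono hb).analyticOnNhd Metric.isOpen_ball)
    (convex_ball c δ).isPreconnected hx h hy

/-- The identity principle. -/
theorem eq_zero [IsManifold 𝓘(ℂ) ω M] [ConnectedSpace M] (hD : IsQuadraticDifferential D)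
    {z : OpenPartialHomeomorph M ℂ} (hz : z ∈ conformalCharts M) {x : ℂ} (hx : x ∈ z.target)
    (h : ∀ᶠ y in 𝓝 x, D z y = 0) :
    ∀ z' ∈ conformalCharts M, ∀ y ∈ z'.target, D z' y = 0 := by
  set V : Set M := {p | D (chartAt ℂ p) (chartAt ℂ p p) = 0} with hV
  have hVz : ∀ z ∈ conformalCharts M, ∀ p ∈ z.source, (p ∈ V ↔ D z (z p) = 0) := fun z hz p hp =>
    hD.eq_zero_iff (chartAt_mem_conformalCharts p) hz (mem_chart_source ℂ p) hp
  -- A coordinate ball about a limit point meets the interior of the zero set, and the identity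
  -- theorem spreads the zeros over the whole ball. So that interior is open and closed.
  have hcl : closure (interior V) ⊆ interior V := by
    intro p hp
    have hz := chartAt_mem_conformalCharts p
    have hps := mem_chart_source ℂ p
    obtain ⟨δ, hδ, hb⟩ := exists_ball_subset_target hps
    have hn := eventually_mem_ball_chart hps hδ
    obtain ⟨y, hy, hyV⟩ := mem_closure_iff_nhds.1 hp _ hn
    have h0 : ∀ᶠ x in 𝓝 (chartAt ℂ p y), D (chartAt ℂ p) x = 0 := by
      have ht := (chartAt ℂ p).map_source hy.1
      have hc := (chartAt ℂ p).continuousAt_symm ht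
      rw [ContinuousAt, (chartAt ℂ p).left_inv hy.1] at hc
      filter_upwards [hc.eventually (mem_interior_iff_mem_nhds.1 hyV),
        (chartAt ℂ p).open_target.mem_nhds ht] with x hx hxt
      have := (hVz _ hz _ ((chartAt ℂ p).map_target hxt)).1 hx
      rwa [(chartAt ℂ p).right_inv hxt] at this
    have h1 := hD.eq_zero_on_ball hz hb hy.2 h0
    rw [mem_interior_iff_mem_nhds]
    filter_upwards [hn] with x hx
    exact (hVz _ hz x hx.1).2 (h1 _ hx.2)
  have hne : (interior V).Nonempty := by
    refine ⟨z.symm x, mem_interior_iff_mem_nhds.2 ?_⟩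
    have hs := z.map_target hx
    have hc := z.continuousAt hs
    rw [ContinuousAt, z.right_inv hx] at hc
    filter_upwards [hc.eventually h, z.open_source.mem_nhds hs] with p hp hps
    exact (hVz z hz p hps).2 hp
  have huniv : interior V = univ :=
    IsClopen.eq_univ ⟨isClosed_of_closure_subset hcl, isOpen_interior⟩ hne
  intro z' hz' y hy
  have h1 : z'.symm y ∈ V := interior_subset (huniv ▸ mem_univ _)
  have := (hVz z' hz' _ (z'.map_target hy)).1 h1
  rwa [z'.right_inv hy] at this

end IsQuadraticDifferential

/-! ### Isometric surfaces with the same mean curvature -/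

/-- The difference of the Hopf differentials. -/
def hopfDiff (F G : M → E3) (z : OpenPartialHomeomorph M ℂ) (x : ℂ) : ℂ :=
  hopf (inChart G z) x - hopf (inChart F z) x

section SameMetric

variable [IsManifold 𝓘(ℂ) ω M] {F G : M → E3} (hF : IsConformalImmersion F)
  (hG : IsConformalImmersion G) (hE : SameMetric F G)
  (hH : ∀ P, meanCurvature G P = meanCurvature F P)

include hF hG hH in
theorem meanCurv_inChart_eq {z : OpenPartialHomeomorph M ℂ} (hz : z ∈ conformalCharts M) {x : ℂ}
    (hx : x ∈ z.target) : meanCurv (inChart G z) x = meanCurv (inChart F z) x := by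
  rw [← meanCurvature_symm_apply hz hF hx, ← meanCurvature_symm_apply hz hG hx, hH]

include hF hG hE hH

theorem isQuadraticDifferential_hopfDiff : IsQuadraticDifferential (hopfDiff F G) :=
  ⟨fun z hz => (hF z hz).differentiableOn_hopf_sub z.open_target (hG z hz)
      (fun x hx => (hE z hz x hx).symm) fun _ hx => meanCurv_inChart_eq hF hG hH hz hx,
    fun z hz z' hz' x hx => by
      rw [hopfDiff, hopf_transition hz hz' (hF z' hz') hx, hopf_transition hz hz' (hG z' hz') hx,
        hopfDiff]
      ring⟩

theorem norm_hopf_add_hopfDiff {z : OpenPartialHomeomorph M ℂ} (hz : z ∈ conformalCharts M) {x : ℂ}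
    (hx : x ∈ z.target) :
    ‖hopf (inChart F z) x + hopfDiff F G z x‖ = ‖hopf (inChart F z) x‖ := by
  rw [hopfDiff, add_sub_cancel]
  exact (hF z hz).norm_hopf_eq z.open_target (hG z hz)
    (fun x hx => (hE z hz x hx).symm) (fun _ hx => meanCurv_inChart_eq hF hG hH hz hx) hx

/-- The change of frame between F and G does not depend on the chart and is constant on coordinate
balls, hence constant on the connected surface; then so is G - T ∘ F. -/
theorem congruent_of_hopfDiff_eq_zero [ConnectedSpace M]
    (hQ : ∀ z ∈ conformalCharts M, ∀ x ∈ z.target, hopfDiff F G z x = 0) : Congruent F G := by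
  set T : M → (E3 →ₗ[ℝ] E3) := fun p =>
    transfer (inChart F (chartAt ℂ p)) (inChart G (chartAt ℂ p)) (chartAt ℂ p p) with hT
  have hTz : ∀ z ∈ conformalCharts M, ∀ x ∈ z.target,
      T (z.symm x) = transfer (inChart F z) (inChart G z) x := by
    intro z hz x hx
    have hz' := chartAt_mem_conformalCharts (z.symm x)
    set z' := chartAt ℂ (z.symm x) with hz'd
    have hxx : x ∈ z.target ∩ z.symm ⁻¹' z'.source := ⟨hx, mem_chart_source ℂ (z.symm x)⟩
    have h1 := transfer_comp_holomorphic z'.open_target (isOpen_transition_source z z')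
      (hF z' hz') (hG z' hz') (differentiableOn_transition hz hz') (mapsTo_transition z z') hxx
      (deriv_transition_ne_zero hz hz' hxx)
    have eF := inChart_eventuallyEq_comp F hxx
    have eG := inChart_eventuallyEq_comp G hxx
    rw [hT]
    change transfer (inChart F z') (inChart G z') (z' (z.symm x)) = _
    rw [← h1]
    ext1 v
    rw [transfer_apply, transfer_apply, dX_congr eF, dX_congr eG, dY_congr eF, dY_congr eG,
      unitNormal_congr eF, unitNormal_congr eG, conformalFactor_congr eF]
  have hforms : ∀ z ∈ conformalCharts M, ∀ c δ, Metric.ball c δ ⊆ z.target →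
      IsConformalImmersionOn (inChart F z) (Metric.ball c δ) ∧
      IsConformalImmersionOn (inChart G z) (Metric.ball c δ) ∧
      (∀ q ∈ Metric.ball c δ, conformalFactor (inChart G z) q = conformalFactor (inChart F z) q) ∧
      (∀ q ∈ Metric.ball c δ, meanCurv (inChart G z) q = meanCurv (inChart F z) q) ∧
      ∀ q ∈ Metric.ball c δ, hopf (inChart G z) q = hopf (inChart F z) q :=
    fun z hz c δ hb => ⟨(hF z hz).mono hb, (hG z hz).mono hb,
      fun q hq => (hE z hz q (hb hq)).symm, fun q hq => meanCurv_inChart_eq hF hG hH hz (hb hq),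
      fun q hq => sub_eq_zero.1 (hQ z hz q (hb hq))⟩
  have hTc : ∀ p q, T p = T q := eq_of_eq_on_chart_balls fun z hz c δ hb x hx y hy => by
    obtain ⟨h1, h2, h3, h4, h5⟩ := hforms z hz c δ hb
    rw [hTz z hz x (hb hx), hTz z hz y (hb hy)]
    exact IsConformalImmersionOn.transfer_eq Metric.isOpen_ball h1 h2 h3 h4 h5
      (convex_ball c δ).isPreconnected hx hy
  obtain ⟨p₀⟩ : Nonempty M := inferInstance
  have hc : ∀ p q, G p - T p₀ (F p) = G q - T p₀ (F q) :=
    eq_of_eq_on_chart_balls (φ := fun p => G p - T p₀ (F p)) fun z hz c δ hb x hx y hy => by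
      obtain ⟨h1, h2, h3, h4, h5⟩ := hforms z hz c δ hb
      have := IsConformalImmersionOn.sub_transfer_eq Metric.isOpen_ball h1 h2 h3 h4 h5
        (convex_ball c δ).isPreconnected hy hx
      rw [← hTz z hz y (hb hy), hTc _ p₀] at this
      exact this
  have hz₀ := chartAt_mem_conformalCharts p₀
  have hn : ∀ v, ‖T p₀ v‖ = ‖v‖ := IsConformalImmersionOn.norm_transfer (hF _ hz₀) (hG _ hz₀)
    (fun x hx => (hE _ hz₀ x hx).symm) ((chartAt ℂ p₀).map_source (mem_chart_source ℂ p₀))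
  let C : E3 →ₗᵢ[ℝ] E3 := ⟨T p₀, hn⟩
  let C' : E3 ≃ₗᵢ[ℝ] E3 := C.toLinearIsometryEquiv rfl
  refine ⟨C'.toIsometryEquiv.trans (IsometryEquiv.addRight (G p₀ - T p₀ (F p₀))), fun p => ?_⟩
  change G p = T p₀ (F p) + (G p₀ - T p₀ (F p₀))
  rw [← hc p p₀]
  abel

end SameMetric

end QuadraticDifferential

end BonnetSurf

namespace BonnetSurf

open Complex (I)

/-! ### Smooth families of immersions -/

section Family

variable {V : Type*} [NormedAddCommGroup V] [NormedSpace ℝ V]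

theorem fderiv_partial {S : Set (ℝ × ℂ)} (hS : IsOpen S) {Φ : ℝ × ℂ → V} (hΦ : ContDiffOn ℝ ∞ Φ S)
    {τ : ℝ} {x : ℂ} (h : (τ, x) ∈ S) (v : ℂ) :
    fderiv ℝ (fun y => Φ (τ, y)) x v = fderiv ℝ Φ (τ, x) (0, v) := by
  have h1 : HasFDerivAt Φ (fderiv ℝ Φ (τ, x)) (τ, x) :=
    ((hΦ.differentiableOn (by simp)).differentiableAt (hS.mem_nhds h)).hasFDerivAt
  have h2 : HasFDerivAt (fun y : ℂ => (τ, y)) (ContinuousLinearMap.inr ℝ ℝ ℂ) x :=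
    hasFDerivAt_prodMk_right τ x
  have h3 : HasFDerivAt (fun y => Φ (τ, y)) _ x := h1.comp x h2
  rw [h3.fderiv]
  rfl

theorem contDiffOn_partial {S : Set (ℝ × ℂ)} (hS : IsOpen S) {Φ : ℝ × ℂ → V}
    (hΦ : ContDiffOn ℝ ∞ Φ S) (v : ℂ) :
    ContDiffOn ℝ ∞ (fun q => fderiv ℝ (fun y => Φ (q.1, y)) q.2 v) S := by
  have h : ContDiffOn ℝ ∞ (fun q => fderiv ℝ Φ q (0, v)) S :=
    (hΦ.fderiv_of_isOpen hS (by simp)).clm_apply contDiffOn_const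
  exact h.congr fun q hq => fderiv_partial hS hΦ hq v

/-- In a smooth family of immersions the Hopf differential depends continuously on the
parameter. -/
theorem continuousOn_hopf_family {S : Set (ℝ × ℂ)} (hS : IsOpen S) {Φ : ℝ × ℂ → E3}
    (hΦ : ContDiffOn ℝ ∞ Φ S)
    (hn : ∀ q ∈ S, vprod (dX (fun y => Φ (q.1, y)) q.2) (dY (fun y => Φ (q.1, y)) q.2) ≠ 0) :
    ContinuousOn (fun q => hopf (fun y => Φ (q.1, y)) q.2) S := by
  have hx : ContDiffOn ℝ ∞ (fun q : ℝ × ℂ => dX (fun y => Φ (q.1, y)) q.2) S :=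
    contDiffOn_partial hS hΦ 1
  have hy : ContDiffOn ℝ ∞ (fun q : ℝ × ℂ => dY (fun y => Φ (q.1, y)) q.2) S :=
    contDiffOn_partial hS hΦ I
  have hxx : ContDiffOn ℝ ∞ (fun q : ℝ × ℂ => dX (dX fun y => Φ (q.1, y)) q.2) S :=
    contDiffOn_partial hS hx 1
  have hxy : ContDiffOn ℝ ∞ (fun q : ℝ × ℂ => dX (dY fun y => Φ (q.1, y)) q.2) S :=
    contDiffOn_partial hS hy 1
  have hyy : ContDiffOn ℝ ∞ (fun q : ℝ × ℂ => dY (dY fun y => Φ (q.1, y)) q.2) S :=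
    contDiffOn_partial hS hy I
  have hv := (contDiffOn_vprod hx hy).continuousOn
  have hN : ContinuousOn (fun q : ℝ × ℂ => unitNormal (fun y => Φ (q.1, y)) q.2) S :=
    (hv.norm.inv₀ fun q hq => norm_ne_zero_iff.2 (hn q hq)).smul hv
  refine ContinuousOn.sub ?_ (ContinuousOn.mul ?_ continuousOn_const)
  · exact Complex.continuous_ofReal.comp_continuousOn
      (((hxx.continuousOn.sub hyy.continuousOn).inner (𝕜 := ℝ) hN).div_const 4)
  · exact Complex.continuous_ofReal.comp_continuousOn ((hxy.continuousOn.inner (𝕜 := ℝ) hN).div_const 2)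

variable {M : Type*} [TopologicalSpace M] [ChartedSpace ℂ M]

/-- All that the normal form requires of the smooth dependence on τ. -/
theorem IsBonnetFamily.continuousAt_hopf {ε : ℝ} {F : ℝ → M → E3} (hF : IsBonnetFamily ε F)
    {z : OpenPartialHomeomorph M ℂ} (hz : z ∈ conformalCharts M) {x : ℂ} (hx : x ∈ z.target)
    {τ : ℝ} (hτ : τ ∈ Ioo (-ε) ε) : ContinuousAt (fun τ => hopf (inChart (F τ) z) x) τ := by
  have hS : IsOpen (Ioo (-ε) ε ×ˢ z.target) := isOpen_Ioo.prod z.open_target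
  have h := continuousOn_hopf_family hS (hF.smooth z hz) fun q hq h0 => by
    have hi := hF.immersion q.1 hq.1 z hz
    have h2 : vprod (dX (inChart (F q.1) z) q.2) (dY (inChart (F q.1) z) q.2) = 0 := h0
    have h3 := hi.norm_vprod hq.2
    rw [h2, norm_zero] at h3
    exact (hi.cf_pos hq.2).ne h3
  have h1 : ContinuousAt (fun τ : ℝ => (τ, x)) τ := by fun_prop
  exact ContinuousAt.comp (f := fun τ : ℝ => (τ, x))
    (h.continuousAt (hS.mem_nhds (Set.mk_mem_prod hτ hx))) h1

end Family

/-! ### Proportional differences of Hopf differentials -/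

section Proportional

theorem fderiv_eq_zero_of_px_py {h : ℂ → ℝ} {p : ℂ} (hx : px h p = 0) (hy : py h p = 0) :
    fderiv ℝ h p = 0 := by
  ext1 v
  rw [fderiv_eq_px_py, hx, hy]
  simp

/-- If the Hopf differential is proportional to a holomorphic function then the mean curvature
is stationary. -/
theorem fderiv_meanCurv_eq_zero {U : Set ℂ} (hU : IsOpen U) {f : ℂ → E3}
    (hf : IsConformalImmersionOn f U) {q : ℂ → ℂ} (hq : DifferentiableOn ℂ q U) {k : ℂ}
    (hk : ∀ x ∈ U, q x ≠ 0 → hopf f x = k * q x) {p : ℂ} (hp : p ∈ U)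
    (hne : ¬ ∀ᶠ x in 𝓝 p, q x = 0) : fderiv ℝ (meanCurv f) p = 0 := by
  -- Where q does not vanish, Q = kq is holomorphic nearby, so the Codazzi equation gives zero
  -- gradient. Zeros of q are isolated, and continuity covers them.
  have hx : ∀ x ∈ U, q x ≠ 0 → px (meanCurv f) x = 0 ∧ py (meanCurv f) x = 0 := by
    intro x hx h0
    have dq := hq.differentiableAt (hU.mem_nhds hx)
    have e : hopf f =ᶠ[𝓝 x] fun x => k * q x := by
      filter_upwards [hU.mem_nhds hx, dq.continuousAt.eventually_ne h0] with y hy hy0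
      exact hk y hy hy0
    have c := hf.codazzi hU hx
    have c2 : px (hopf f) x + I * py (hopf f) x = _ :=
      (dbar_congr e).trans (dbar_of_differentiableAt (dq.const_mul k))
    rw [c2, eq_comm, mul_eq_zero] at c
    rcases c with c | c
    · exact absurd (Complex.ofReal_eq_zero.1 c) (div_pos (hf.cf_pos hx) two_pos).ne'
    · have h1 := congrArg Complex.re c
      have h2 := congrArg Complex.im c
      simp at h1 h2
      exact ⟨h1, h2⟩
  have hn : ∀ᶠ x in 𝓝[≠] p, q x ≠ 0 :=
    ((hq.analyticAt (hU.mem_nhds hp)).eventually_eq_zero_or_eventually_ne_zero).resolve_left hne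
  have hcH := hf.contDiffOn_meanCurv hU
  have cx := (contDiffOn_px hU hcH).continuousOn.continuousAt (hU.mem_nhds hp)
  have cy := (contDiffOn_py hU hcH).continuousOn.continuousAt (hU.mem_nhds hp)
  have hnU : ∀ᶠ x in 𝓝[≠] p, x ∈ U := nhdsWithin_le_nhds (hU.mem_nhds hp)
  refine fderiv_eq_zero_of_px_py ?_ ?_
  · refine tendsto_nhds_unique (l := 𝓝[≠] p) (cx.tendsto.mono_left nhdsWithin_le_nhds)
      (tendsto_const_nhds.congr' ?_)
    filter_upwards [hn, hnU] with x h1 h2 using (hx x h2 h1).1.symm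
  · refine tendsto_nhds_unique (l := 𝓝[≠] p) (cy.tendsto.mono_left nhdsWithin_le_nhds)
      (tendsto_const_nhds.congr' ?_)
    filter_upwards [hn, hnU] with x h1 h2 using (hx x h2 h1).2.symm

theorem norm_sq_add_two_re_eq_zero {Q q : ℂ} (h : ‖Q + q‖ = ‖Q‖) :
    ‖q‖ ^ 2 + 2 * (Q * starRingEnd ℂ q).re = 0 := by
  have h1 : Complex.normSq (Q + q) = Complex.normSq Q := by
    rw [Complex.normSq_eq_norm_sq, h, Complex.normSq_eq_norm_sq]
  rw [Complex.normSq_add] at h1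
  rw [← Complex.normSq_eq_norm_sq]
  linarith

/-- A real proportionality factor is `0` or `1`. -/
theorem eq_zero_or_one_of_norm_add_eq {Q q : ℂ} (hq : q ≠ 0) {a : ℝ} (h1 : ‖Q + q‖ = ‖Q‖)
    (h2 : ‖Q + a * q‖ = ‖Q‖) : a = 0 ∨ a = 1 := by
  have e1 := norm_sq_add_two_re_eq_zero h1
  have e2 := norm_sq_add_two_re_eq_zero h2
  rw [map_mul, Complex.conj_ofReal, mul_left_comm, Complex.re_ofReal_mul, norm_mul,
    Complex.norm_real, Real.norm_eq_abs, mul_pow, sq_abs] at e2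
  have hq2 : ‖q‖ ^ 2 ≠ 0 := pow_ne_zero 2 (norm_ne_zero_iff.2 hq)
  have : ‖q‖ ^ 2 * (a * (a - 1)) = 0 := by linear_combination e2 - a * e1
  rcases mul_eq_zero.1 ((mul_eq_zero.1 this).resolve_left hq2) with h | h
  · exact .inl h
  · exact .inr (by linarith)

/-- A nonreal proportionality factor determines the Hopf differential. -/
theorem eq_mul_of_norm_add_eq {Q q c : ℂ} (hq : q ≠ 0) (hc : c.im ≠ 0) (h1 : ‖Q + q‖ = ‖Q‖)
    (h2 : ‖Q + c * q‖ = ‖Q‖) :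
    Q = ((-1 / 2 : ℝ) + ((c.re - ‖c‖ ^ 2) / (2 * c.im) : ℝ) * I : ℂ) * q := by
  have e1 := norm_sq_add_two_re_eq_zero h1
  have e2 := norm_sq_add_two_re_eq_zero h2
  rw [map_mul, mul_left_comm, Complex.mul_re, Complex.conj_re, Complex.conj_im, norm_mul,
    mul_pow] at e2
  -- After multiplication by q̄ the first norm relation gives the real part of Qq̄, and the second,
  -- because Im c ≠ 0, its imaginary part.
  refine mul_right_cancel₀ ((map_ne_zero (starRingEnd ℂ)).2 hq) ?_
  rw [mul_assoc, Complex.mul_conj q, Complex.normSq_eq_norm_sq]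
  set X := Q * starRingEnd ℂ q
  refine Complex.ext ?_ ?_
  · simp only [Complex.mul_re, Complex.add_re, Complex.ofReal_re, Complex.ofReal_im, Complex.I_re,
      Complex.I_im, Complex.add_im, Complex.mul_im]
    linarith
  · simp only [Complex.mul_im, Complex.add_re, Complex.ofReal_re, Complex.ofReal_im, Complex.I_re,
      Complex.I_im, Complex.add_im, Complex.mul_re]
    field_simp
    linear_combination e2 - c.re * e1

end Proportional

end BonnetSurf

namespace BonnetSurf

open Complex (I)

/-! ### The normal form of a Bonnet surface at a critical point -/

section NormalForm

variable {M : Type*} [TopologicalSpace M] [ChartedSpace ℂ M]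

theorem trans_mem_conformalCharts {z : OpenPartialHomeomorph M ℂ} (hz : z ∈ conformalCharts M)
    {e : OpenPartialHomeomorph ℂ ℂ} (he : DifferentiableOn ℂ e e.source)
    (he' : DifferentiableOn ℂ e.symm e.target) : z.trans e ∈ conformalCharts M := by
  have hG : e ∈ contDiffGroupoid ω 𝓘(ℂ) := by
    refine mem_groupoid_of_pregroupoid.2 ⟨?_, ?_⟩
    · have := he.contDiffOn (n := ω) e.open_source
      simpa [contDiffPregroupoid] using this
    · have := he'.contDiffOn (n := ω) e.open_target
      simpa [contDiffPregroupoid] using this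
  intro e' he''
  have h := hz e' he''
  refine ⟨?_, ?_⟩
  · rw [OpenPartialHomeomorph.trans_symm_eq_symm_trans_symm, OpenPartialHomeomorph.trans_assoc]
    exact StructureGroupoid.trans _ (StructureGroupoid.symm _ hG) h.1
  · rw [← OpenPartialHomeomorph.trans_assoc]
    exact StructureGroupoid.trans _ h.2 hG

variable [IsManifold 𝓘(ℂ) ω M] [ConnectedSpace M]

theorem meanCurvature_eq_of_fderiv_eq_zero {F : M → E3} (hF : IsConformalImmersion F)
    (h : ∀ z ∈ conformalCharts M, ∀ x ∈ z.target, fderiv ℝ (meanCurv (inChart F z)) x = 0)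
    (p q : M) : meanCurvature F p = meanCurvature F q := by
  refine eq_of_eq_on_chart_balls (fun z hz c δ hb x hx y hy => ?_) p q
  rw [meanCurvature_symm_apply hz hF (hb hx), meanCurvature_symm_apply hz hF (hb hy)]
  have hH := (hF z hz).contDiffOn_meanCurv z.open_target
  exact Metric.isOpen_ball.is_const_of_fderiv_eq_zero (𝕜 := ℝ) (convex_ball c δ).isPreconnected
    (fun x hx => (hH.differentiableAt_of_isOpen z.open_target (hb hx)).differentiableWithinAt)
    (fun x hx => h z hz x (hb hx)) hx hy

namespace IsBonnetFamily

variable {ε : ℝ} {F : ℝ → M → E3} (hF : IsBonnetFamily ε F)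

include hF

omit [ConnectedSpace M] in
theorem isQuadraticDifferential {τ : ℝ} (h0 : (0 : ℝ) ∈ Ioo (-ε) ε) (hτ : τ ∈ Ioo (-ε) ε) :
    IsQuadraticDifferential (hopfDiff (F 0) (F τ)) :=
  isQuadraticDifferential_hopfDiff (hF.immersion 0 h0) (hF.immersion τ hτ) (hF.isometric τ hτ)
    (hF.meanCurvature_eq τ hτ)

omit [ConnectedSpace M] in
theorem norm_hopf_add {τ : ℝ} (h0 : (0 : ℝ) ∈ Ioo (-ε) ε) (hτ : τ ∈ Ioo (-ε) ε)
    {z : OpenPartialHomeomorph M ℂ} (hz : z ∈ conformalCharts M) {x : ℂ} (hx : x ∈ z.target) :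
    ‖hopf (inChart (F 0) z) x + hopfDiff (F 0) (F τ) z x‖ = ‖hopf (inChart (F 0) z) x‖ :=
  norm_hopf_add_hopfDiff (hF.immersion 0 h0) (hF.immersion τ hτ) (hF.isometric τ hτ)
    (hF.meanCurvature_eq τ hτ) hz hx

theorem not_eventually_hopfDiff_eq_zero {τ : ℝ} (h0 : (0 : ℝ) ∈ Ioo (-ε) ε)
    (hτ : τ ∈ Ioo (-ε) ε) (hne : τ ≠ 0) {z : OpenPartialHomeomorph M ℂ}
    (hz : z ∈ conformalCharts M) {x : ℂ} (hx : x ∈ z.target) :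
    ¬ ∀ᶠ y in 𝓝 x, hopfDiff (F 0) (F τ) z y = 0 := fun h =>
  hF.nontrivial τ hτ hne (congruent_of_hopfDiff_eq_zero (hF.immersion 0 h0) (hF.immersion τ hτ)
    (hF.isometric τ hτ) (hF.meanCurvature_eq τ hτ)
    ((hF.isQuadraticDifferential h0 hτ).eq_zero hz hx h))

/-- The differences of the Hopf differentials in a Bonnet family are not all proportional. -/
theorem exists_independent_hopfDiff (hε : 0 < ε) {z : OpenPartialHomeomorph M ℂ}
    (hz : z ∈ conformalCharts M) {x : ℂ} (hx : x ∈ z.target) :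
    ∃ τ₁ ∈ Ioo (-ε) ε, τ₁ ≠ 0 ∧ ∃ τ₂ ∈ Ioo (-ε) ε,
      ¬ ∃ c : ℂ, ∀ᶠ y in 𝓝 x, hopfDiff (F 0) (F τ₂) z y = c * hopfDiff (F 0) (F τ₁) z y := by
  have h0 : (0 : ℝ) ∈ Ioo (-ε) ε := ⟨by linarith, hε⟩
  have hτ₁ : ε / 2 ∈ Ioo (-ε) ε := ⟨by linarith, by linarith⟩
  have hne₁ : ε / 2 ≠ 0 := by positivity
  refine ⟨ε / 2, hτ₁, hne₁, ?_⟩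
  obtain ⟨δ, hδ, hb⟩ := Metric.isOpen_iff.1 z.open_target x hx
  obtain ⟨x₁, hx₁, hq₁⟩ : ∃ x₁ ∈ Metric.ball x δ, hopfDiff (F 0) (F (ε / 2)) z x₁ ≠ 0 := by
    by_contra! h
    exact hF.not_eventually_hopfDiff_eq_zero h0 hτ₁ hne₁ hz hx
      (eventually_of_mem (Metric.ball_mem_nhds x hδ) h)
  -- At `x₁` the difference tends to 0 as τ → 0, so a small nonzero τ₂ has a value there different
  -- from the nonzero one at ε/2. This rules out the factor c = 1 later.
  have hc : ContinuousAt (fun τ => hopfDiff (F 0) (F τ) z x₁) 0 :=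
    (hF.continuousAt_hopf hz (hb hx₁) h0).sub continuousAt_const
  have hev : ∀ᶠ τ in 𝓝 (0 : ℝ), hopfDiff (F 0) (F τ) z x₁ ≠ hopfDiff (F 0) (F (ε / 2)) z x₁ :=
    hc.eventually_ne (by simpa [hopfDiff] using hq₁.symm)
  have hev' : ∀ᶠ τ in 𝓝[≠] (0 : ℝ), hopfDiff (F 0) (F τ) z x₁ ≠ hopfDiff (F 0) (F (ε / 2)) z x₁ ∧
      τ ∈ Ioo (-ε) ε := nhdsWithin_le_nhds (hev.and (isOpen_Ioo.eventually_mem h0))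
  obtain ⟨τ₂, ⟨hq₂, hτ₂⟩, hne₂⟩ := (hev'.and self_mem_nhdsWithin).exists
  have hne₂ : τ₂ ≠ 0 := hne₂
  refine ⟨τ₂, hτ₂, ?_⟩
  rintro ⟨c, hcq⟩
  have hD₁ := hF.isQuadraticDifferential h0 hτ₁
  have hD₂ := hF.isQuadraticDifferential h0 hτ₂
  -- The identity principle extends proportionality from a germ to all of M, as needed to contradict
  -- the global assumption that H is not constant.
  have hprop := (hD₂.sub_const_mul hD₁ c).eq_zero hz hx (hcq.mono fun y hy => sub_eq_zero.2 hy)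
  have hprop : ∀ z ∈ conformalCharts M, ∀ y ∈ z.target,
      hopfDiff (F 0) (F τ₂) z y = c * hopfDiff (F 0) (F (ε / 2)) z y :=
    fun z hz y hy => sub_eq_zero.1 (hprop z hz y hy)
  -- A real c is 0 or 1; the first is excluded by nontriviality of the family, the second by the
  -- choice of τ₂. A nonreal c makes Q a fixed complex multiple of a holomorphic differential, so H
  -- would be constant.
  by_cases him : c.im = 0
  · have hcr : (c.re : ℂ) = c := Complex.ext rfl (by simp [him])
    have r₁ := hF.norm_hopf_add h0 hτ₁ hz (hb hx₁)
    have r₂ := hF.norm_hopf_add h0 hτ₂ hz (hb hx₁)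
    rw [hprop z hz x₁ (hb hx₁), ← hcr] at r₂
    rcases eq_zero_or_one_of_norm_add_eq hq₁ r₁ r₂ with h | h
    · refine hF.not_eventually_hopfDiff_eq_zero h0 hτ₂ hne₂ hz hx (hcq.mono fun y hy => ?_)
      rw [hy, ← hcr, h, Complex.ofReal_zero, zero_mul]
    · refine hq₂ ?_
      rw [hprop z hz x₁ (hb hx₁), ← hcr, h, Complex.ofReal_one, one_mul]
  · obtain ⟨p₀⟩ : Nonempty M := inferInstance
    refine hF.meanCurvature_nonconst ⟨meanCurvature (F 0) p₀, fun p =>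
      meanCurvature_eq_of_fderiv_eq_zero (hF.immersion 0 h0) (fun z hz y hy => ?_) p p₀⟩
    refine fderiv_meanCurv_eq_zero
      (k := (-1 / 2 : ℝ) + ((c.re - ‖c‖ ^ 2) / (2 * c.im) : ℝ) * I) z.open_target (hF.immersion 0 h0 z hz)
      (hD₁.holomorphic z hz) (fun t ht hqt => ?_) hy
      (hF.not_eventually_hopfDiff_eq_zero h0 hτ₁ hne₁ hz hy)
    have r₂ := hF.norm_hopf_add h0 hτ₂ hz ht
    rw [hprop z hz t ht] at r₂
    exact eq_mul_of_norm_add_eq hqt him (hF.norm_hopf_add h0 hτ₁ hz ht) r₂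

end IsBonnetFamily

/-- The normal form of a Bonnet surface at a critical point of index `-J`. -/
theorem IsBonnetSurface.exists_normal_form {F : M → E3} (hF : IsBonnetSurface F) {P : M} {J : ℕ}
    (hP : IsCriticalPointOfIndexNeg F P J) :
    ∃ ρ : ℝ, ρ ≠ 0 ∧ ∃ r : ℝ, 0 < r ∧ r ≤ 1 ∧ ∃ w ∈ conformalCharts M,
      P ∈ w.source ∧ w P = 0 ∧ w.target = Metric.ball 0 r ∧
      ∃ H : ℝ → ℝ, IsHazzidakisSolution J (r ^ 2) H ∧ HasAsymptotics J (r ^ 2) H ∧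
        HasFundamentalForms J H r (inChart (fun p => ρ • F p) w) := by
  obtain ⟨ε, hε, Fam, rfl, hB⟩ := hF
  obtain ⟨z, hz, hPz, hz0, hcrit, g, hgc, hg0, hgQ⟩ := hP
  have h0 : (0 : ℝ) ∈ Ioo (-ε) ε := ⟨by linarith, hε⟩
  have h0t : (0 : ℂ) ∈ z.target := hz0 ▸ z.map_source hPz
  have hzn := z.open_target.eventually_mem h0t
  obtain ⟨τ₁, hτ₁, hne₁, τ₂, hτ₂, hi⟩ := hB.exists_independent_hopfDiff hε hz h0t
  have hcrit' : fderiv ℝ (meanCurv (inChart (Fam 0) z)) 0 = 0 := by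
    have e : (fun x => meanCurvature (Fam 0) (z.symm x)) =ᶠ[𝓝 0] meanCurv (inChart (Fam 0) z) :=
      hzn.mono fun x hx => meanCurvature_symm_apply hz (hB.immersion 0 h0) hx
    rw [← e.fderiv_eq, hcrit]
  have ht := z.open_target.mem_nhds h0t
  obtain ⟨ρ, hρ, r, hr, hr1, e, he0, hes, hee, het, hed, hesd, him, hQ⟩ :=
    exists_modelHopf_coordinate z.open_target h0t (hB.immersion 0 h0 z hz) hcrit'
      (((hB.isQuadraticDifferential h0 hτ₁).holomorphic z hz).analyticAt ht)
      (((hB.isQuadraticDifferential h0 hτ₂).holomorphic z hz).analyticAt ht) hgc hg0 hgQ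
      (hzn.mono fun x hx => hB.norm_hopf_add h0 hτ₁ hz hx)
      (hzn.mono fun x hx => hB.norm_hopf_add h0 hτ₂ hz hx)
      (hB.not_eventually_hopfDiff_eq_zero h0 hτ₁ hne₁ hz h0t) hi
  obtain ⟨H, h1, h2, h3⟩ := exists_hazzidakis_of_hopf hr hr1 him hQ
  refine ⟨ρ, hρ, r, hr, hr1, z.trans e, trans_mem_conformalCharts hz hed hesd, ?_, ?_, ?_, H, h1,
    h2, h3⟩
  · rw [OpenPartialHomeomorph.trans_source]
    exact ⟨hPz, by rw [mem_preimage, hz0]; exact he0⟩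
  · change e (z P) = 0
    rw [hz0, hee]
  · rw [OpenPartialHomeomorph.trans_target, ← het]
    exact inter_eq_left.2 fun y hy => hes (e.map_target hy)

end NormalForm

end BonnetSurf

end

theorem mainTheorem9 (J : ℕ) :
    -- normal form of a Bonnet surface at a critical point of index `-J`
    (∀ (M : Type*) [TopologicalSpace M] [T2Space M] [ConnectedSpace M] [ChartedSpace ℂ M]
        [IsManifold 𝓘(ℂ) ω M] (F : M → E3) (P : M),
      BonnetSurf.IsBonnetSurface F → BonnetSurf.IsCriticalPointOfIndexNeg F P J →
      ∃ ρ : ℝ, ρ ≠ 0 ∧ ∃ r : ℝ, 0 < r ∧ r ≤ 1 ∧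
        ∃ w ∈ BonnetSurf.conformalCharts M,
          P ∈ w.source ∧ w P = 0 ∧ w.target = Metric.ball 0 r ∧
          ∃ H : ℝ → ℝ, BonnetSurf.IsHazzidakisSolution J (r ^ 2) H ∧
            BonnetSurf.HasAsymptotics J (r ^ 2) H ∧
            BonnetSurf.HasFundamentalForms J H r
              (BonnetSurf.inChart (fun p => ρ • F p) w)) ∧
    -- conversely, every solution determines such a surface, and its Bonnet family
    (∀ (r : ℝ) (hr : 0 < r), r ≤ 1 → ∀ H : ℝ → ℝ,
      BonnetSurf.IsHazzidakisSolution J (r ^ 2) H → BonnetSurf.HasAsymptotics J (r ^ 2) H →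
      -- existence
      (∃ f : ℂ → E3, BonnetSurf.HasFundamentalForms J H r f) ∧
      -- uniqueness up to Euclidean motions
      (∀ f g : ℂ → E3, BonnetSurf.HasFundamentalForms J H r f →
        BonnetSurf.HasFundamentalForms J H r g →
        ∃ A : E3 ≃ᵢ E3, ∀ w ∈ Metric.ball (0 : ℂ) r, g w = A (f w)) ∧
      (∀ f : ℂ → E3, BonnetSurf.HasFundamentalForms J H r f →
        BonnetSurf.IsBonnetSurface (fun p : BonnetSurf.disc r => f p) ∧
        BonnetSurf.IsCriticalPointOfIndexNeg (fun p : BonnetSurf.disc r => f p)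
          ⟨0, Metric.mem_ball_self hr⟩ J ∧
        -- the rotations form a Bonnet family
        BonnetSurf.IsBonnetFamily (2 * Real.pi / ((J : ℝ) + 2))
          (fun (α : ℝ) (p : BonnetSurf.disc r) => f (Complex.exp (α * Complex.I) * p)) ∧
        -- it contains every isometric immersion with the same mean curvature function
        (∀ g : ℂ → E3, BonnetSurf.IsConformalImmersionOn g (Metric.ball 0 r) →
          (∀ w ∈ Metric.ball (0 : ℂ) r,
            BonnetSurf.conformalFactor g w = BonnetSurf.conformalFactor f w) →
          (∀ w ∈ Metric.ball (0 : ℂ) r, BonnetSurf.meanCurv g w = BonnetSurf.meanCurv f w) →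
          ∃ α : ℝ, ∃ A : E3 ≃ᵢ E3, ∀ w ∈ Metric.ball (0 : ℂ) r,
            g w = A (f (Complex.exp (α * Complex.I) * w))))) := by
  refine ⟨fun M _ _ _ _ _ F P hF hP => hF.exists_normal_form hP, fun r hr hr1 H hH hA =>
    ⟨BonnetSurf.exists_hasFundamentalForms hr hr1 hH hA,
      fun f g hf hg => hf.exists_isometry hg,
      fun f hf => ⟨hf.isBonnetSurface hr hr1 hH.deriv_neg,
        hf.isCriticalPointOfIndexNeg hr hA, hf.isBonnetFamily hr hr1 hH.deriv_neg,
        fun g hg hE hm => hf.exists_rotation hr hr1 hg hE hm⟩⟩⟩
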